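/- **Setting.** Let $d\ge 2$, $L\ge 1$, $\mathbb T_L=(\mathbb Z/(2L+1)\mathbb Z)^d$, let $E(\mathbb T_L)$ be its nearest-neighbour edges with a fixed orientation, and $\nabla f(e)=f(y)-f(x)$ for $e=(x,y)$. For $g:E(\mathbb T_L)\to\mathbb R$ put $\nabla\cdot g(x)=\sum_{e=(x,y)}g(e)-\sum_{e=(y,x)}g(e)$. For $x\in\mathbb T_L$, $|x|$ is the Euclidean norm of its representative in $\{-L,\dots,L\}^d$, $|x|_*=|x|+1$, and $\Lambda_r\subseteq\mathbb T_L$ is the image of $\{-r,\dots,r\}^d$ ($0\le r\le L$). For $U\subseteq\mathbb T_L$, $E(U)$ is the set of edges with both endpoints in $U$, and $\|u\|_{\underline L^q(U)}^q=\frac1{|U|}\sum_{e\in E(U)}|u(e)|^q$. Let $V:\mathbb R\to\mathbb R$ be $C^2$ and convex, with $0<c_-\le\liminf_{|x|\to\infty}\frac{V''(x)}{|x|^{r-2}}\le\limsup_{|x|\to\infty}\frac{V''(x)}{|x|^{r-2}}\le c_+<\infty$ for some $r>2$ and constants $c_\pm$. Let $\mu$ be the probability measure on $\{\phi:\mathbb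 T_L\to\mathbb R:\sum_x\phi(x)=0\}$ with density proportional to $\exp(-\sum_e V(\nabla\phi(e)))$ with respect to Lebesgue measure. Let $\phi_L$ be the Langevin dynamic $$d\phi_L(t,x)=\nabla\cdot V'(\nabla\phi_L)(t,x)\,dt+\sqrt2\,dB_t(x),\qquad \phi_L(0,\cdot)=\phi,$$ where $(B(x))_{x\in\mathbb T_L}$ are independent Brownian motions and $\phi\sim\mu$ is independent of them. Put $\mathbf a(t,e)=V''(\nabla\phi_L(t,e))$, and let $P_{\mathbf a}$ be the solution of $\partial_tP_{\mathbf a}=\nabla\cdot(\mathbf a\nabla P_{\mathbf a})$ for $t>0$ with $P_{\mathbf a}(0,x)=\mathbf 1_{x=0}-1/|\mathbb T_L|$. **Exponents and kernels.** Let $\lambda_d=\frac{2d+2}{d+2}$, $\kappa_d=\frac{d\lambda_d}{d-\lambda_d}$, $\sigma_d=\frac{2\kappa_d}{\kappa_d-2}$, $\tau_d=\frac{2\lambda_d}{2-\lambda_d}$, $\lambda_d'=\frac{2d+3}{d+2}$, $\tau_d'=\frac{2\lambda_d'}{2-\lambda_d'}$, $\theta_d=\frac23\cdot\frac{2d+3}{2d+2}$.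 Fix $p,p'\in(d,\infty)$, let $\frac1{\theta_c}=1+\frac{dp+2p}{dp+2d}\left(\frac{p'}d-1\right)$ and $$\alpha=(1-\theta_c)\tfrac d{d+2}+\theta_c\tfrac p{p+2},\qquad \beta=(1-\theta_c)\tfrac2{d+2},\qquad \gamma=\theta_c\tfrac2{p+2}.$$ Let $k_t=\delta(1+t)^{-p-3}$ and $K_t=k_t+\int_t^\infty sk_s\,ds$, where $\delta>0$ is such that $\int_t^{s'}K_{s-t}K_{s'-s}\,ds\le K_{s'-t}$ for all $0<t\le s'$ and $\int_0^\infty K_s\,ds\le1$. The moderated environment $w\ge0$ is given by $$w(t,e)^2=\int_t^\infty k_{s-t}\,\frac{\mathbf a(s,e)\wedge1}{(s-t)^{-1}\sum_{e'\cap e\ne\emptyset}\int_t^s(\mathbf a(s',e')\vee1)\,ds'}\,ds .$$ **Maximal functionals** (with values in $[1,\infty]$, where $0^{-1}=\infty$, $\infty^{-1}=0$, $0\cdot\infty=0$): $$\begin{aligned} \mathcal M_{p'}(t)&=1+\Big(1+\|w(t,\cdot)\|_{\underline L^{\sigma_d}(\mathbb T_L)}\|w^{-1}(t,\cdot)\|_{\underline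 L^{\tau_d}(\mathbb T_L)}\Big)^2\sup_{1\le r\le L}\|w^{-1}(t,\cdot)\|^2_{\underline L^{p'}(\Lambda_r)},\\ \mathcal M_0(t)&=1+\sup_{0\le r\le L}\|\mathbf a(t,\cdot)^{1/2}\|^2_{\underline L^{\sigma_d}(\Lambda_r)}\Big(1+\|w^{-1}(t,\cdot)\|^2_{\underline L^{\tau'_d}(\Lambda_r)}\Big),\\ \mathcal M_1(t)&=1+\int_t^\infty K_{s-t}\,\mathcal M_0(s)^{\frac p{2(1-\theta_d)}}\,ds,\qquad \mathcal M_2(t)=1+\sup_{x\in\mathbb T_L}\frac{\sum_{e\ni x}\mathbf a(t,e)}{|x|_*^{(p-2)/(p-1)}},\\ \mathcal M_3(t)&=1+\Big(\int_t^\infty K_{s-t}\,\mathcal M_{p'}(s)^{\alpha/\beta}\,ds\Big)^\beta,\qquad \mathcal M_4(t)=1+\sup_{s\in[t,t+1]}\|w^{-1}(s,\cdot)\|^2_{\underline L^d(\mathbb T_L)}, \end{aligned}$$ $$\begin{aligned} \mathscr M_1&=\Big(\sup_{t\ge1}\tfrac1t\int_0^t\mathcal M_1(s)^{2/p}ds\Big)^{p/2},&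 \mathscr M_2&=\Big(\sup_{t\ge1}\tfrac1t\int_0^t\mathcal M_2(s)\,ds\Big)^{p-1},\\ \mathscr M_3&=\Big(\inf_{t\ge1}\tfrac1t\int_0^t\mathcal M_3(s)^{-1/\alpha}ds\Big)^{-\alpha/\gamma},& \mathscr M_4&=\Big(\inf_{t\ge1}\tfrac1t\int_0^t\mathcal M_4(s)^{-1}ds\Big)^{-1}, \end{aligned}$$ $$\mathscr M=\big((\mathscr M_1+\mathscr M_2)\mathscr M_3\big)^{\frac\gamma{1-\alpha-\gamma}},\qquad \mathscr M'=\mathscr M_3^{\frac{2\gamma}{d\beta+p\gamma}+\frac\gamma\alpha}\,\mathscr M_4 .$$ **Theorem (energy upper bound for the dynamic environment).** There is a constant $C\in[1,\infty)$ depending only on $d,p,p',\delta$ (hence only on $d$ once $p,p',\delta$ are chosen as functions of $d$; in particular not on $L$ or $V$) such that, almost surely, for every $t\ge1$, $$\sum_{x\in\mathbb T_L}P_{\mathbf a}(t,x)^2\le\frac{C\,\mathscr M}{(1+t)^{d/2}}\exp\Big(-\frac t{C\,\mathscr M'L^2}\Big),$$ where the exponential is $1$ if $\mathscr M'=\infty$.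 -/

import Mathlib

open MeasureTheory ProbabilityTheory Filter Set
open scoped NNReal ENNReal

noncomputable section

namespace GradPhi

/-! ### The torus, its edges, and discrete calculus -/

/-- The discrete torus `(ℤ / (2L+1)ℤ)^d`. -/
abbrev Torus (d L : ℕ) : Type := Fin d → ZMod (2 * L + 1)

/-- The nearest-neighbour edges of the torus: `(x, i)` stands for the edge between `x` and
`x + e_i`.  For `L ≥ 1` every edge is listed exactly once. -/
abbrev Edge (d L : ℕ) : Type := Torus d L × Fin d

/-- A choice of orientation: `true` orients `(x, i)` from `x` to `x + e_i`, `false` the other way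
round. -/
abbrev Orientation (d L : ℕ) : Type := Edge d L → Bool

variable {d L : ℕ}

/-- The neighbour `x + e_i` of `x`. -/
def shift (e : Edge d L) : Torus d L := e.1 + Pi.single e.2 1

/-- The two endpoints of an edge. -/
def ends (e : Edge d L) : Finset (Torus d L) := {e.1, shift e}

/-- The starting point of the positively oriented edge `e`. -/
def src (o : Orientation d L) (e : Edge d L) : Torus d L := if o e then e.1 else shift e

/-- The final point of the positively oriented edge `e`. -/
def tgt (o : Orientation d L) (e : Edge d L) : Torus d L := if o e then shift e else e.1

/-- The discrete gradient `∇f(e) = f(y) - f(x)` for `e = (x, y)` positively oriented. -/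
def grad (o : Orientation d L) (f : Torus d L → ℝ) (e : Edge d L) : ℝ :=
  f (tgt o e) - f (src o e)

/-- The discrete divergence of a function `g` on positively oriented edges:
the sum of `g e` over `e = (x, y)` minus the sum over `e = (y, x)`. -/
def dvg (o : Orientation d L) (g : Edge d L → ℝ) (x : Torus d L) : ℝ :=
  (∑ e : Edge d L with src o e = x, g e) - ∑ e : Edge d L with tgt o e = x, g e

/-- The Euclidean norm of the representative of `x` in `{-L, …, L}^d`. -/
def euclNorm (x : Torus d L) : ℝ := √(∑ i, ((x i).valMinAbs : ℝ) ^ 2)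

/-- `|x|_* = |x| + 1`. -/
def starNorm (x : Torus d L) : ℝ := euclNorm x + 1

/-- The image in the torus of the box `{-r, …, r}^d`, for `r ≤ L`. -/
def box (d L r : ℕ) : Finset (Torus d L) :=
  Finset.univ.filter fun x => ∀ i, (x i).valMinAbs.natAbs ≤ r

/-- The edges of `U`: those with both endpoints in `U`. -/
def edgesIn (U : Finset (Torus d L)) : Finset (Edge d L) :=
  Finset.univ.filter fun e => ends e ⊆ U

/-- The normalized `L^q` norm over the edges of `U`, normalized by the number of *vertices* of `U`,
for functions with values in `[0, ∞]`. -/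
def avgNorm (q : ℝ) (U : Finset (Torus d L)) (u : Edge d L → ℝ≥0∞) : ℝ≥0∞ :=
  ((∑ e ∈ edgesIn U, u e ^ q) / (U.card : ℝ≥0∞)) ^ (1 / q)

/-! ### The potential, the Gibbs measure and the Langevin dynamic -/

/-- `V` is `C²` and convex, and `V''` grows like `|x|^{r-2}` for some `r > 2`. -/
def IsAdmissiblePotential (V : ℝ → ℝ) : Prop :=
  ContDiff ℝ 2 V ∧ ConvexOn ℝ univ V ∧
    ∃ r cm cp : ℝ, 2 < r ∧ 0 < cm ∧ 0 < cp ∧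
      (cm : EReal) ≤ liminf (fun x : ℝ => ((deriv (deriv V) x / |x| ^ (r - 2) : ℝ) : EReal))
        (cocompact ℝ) ∧
      limsup (fun x : ℝ => ((deriv (deriv V) x / |x| ^ (r - 2) : ℝ) : EReal))
        (cocompact ℝ) ≤ (cp : EReal)

/-- The space of functions on the torus with zero sum, with the `L²` scalar product. -/
def meanZero (d L : ℕ) : Submodule ℝ (EuclideanSpace ℝ (Torus d L)) where
  carrier := {φ | ∑ x, φ x = 0}
  zero_mem' := by simp
  add_mem' := by
    intro a b ha hb
    simp only [mem_ofPred_eq] at ha hb ⊢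
    simp [Finset.sum_add_distrib, ha, hb]
  smul_mem' := by
    intro c a ha
    simp only [mem_ofPred_eq] at ha ⊢
    simp [← Finset.mul_sum, ha]

/-- The unnormalized Gibbs measure `exp (-∑ₑ V(∇φ(e))) dφ` on the functions with zero sum. -/
def gibbsWeight (o : Orientation d L) (V : ℝ → ℝ) : Measure (meanZero d L) :=
  (volume : Measure (meanZero d L)).withDensity fun φ =>
    ENNReal.ofReal (Real.exp (-∑ e, V (grad o (fun x => φ.1 x) e)))

/-- The Gibbs measure: `gibbsWeight` divided by its total mass. -/
def gibbs (o : Orientation d L) (V : ℝ → ℝ) : Measure (meanZero d L) :=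
  (gibbsWeight o V univ)⁻¹ • gibbsWeight o V

/-- `φ` is the Langevin dynamic driven by the independent Brownian motions `B x` and started from
the random surface `φ₀`, which has the Gibbs measure as its law and is independent of `B`: it
solves `dφ(t,x) = ∇·V'(∇φ)(t,x) dt + √2 dB_t(x)`, `φ(0,·) = φ₀`.  Only times `t ≥ 0` matter.
Since the noise is additive, the equation is written pathwise in integrated form. -/
structure IsLangevinDynamic {Ω : Type*} [MeasurableSpace Ω] (μ : Measure Ω)
    (o : Orientation d L) (V : ℝ → ℝ) (B : Torus d L → ℝ≥0 → Ω → ℝ) (φ₀ : Ω → meanZero d L)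
    (φ : ℝ → Ω → Torus d L → ℝ) : Prop where
  brownian : ∀ x, IsBrownianReal (B x) μ
  brownian_indep : iIndepFun (fun x ω t => B x t ω) μ
  init_law : HasLaw φ₀ (gibbs o V) μ
  init_indep : IndepFun φ₀ (fun ω x t => B x t ω) μ
  aemeasurable : ∀ t, 0 ≤ t → AEMeasurable (φ t) μ
  continuous : ∀ᵐ ω ∂μ, ContinuousOn (fun t => φ t ω) (Ici 0)
  equation : ∀ᵐ ω ∂μ, ∀ t, 0 ≤ t → ∀ x,
    φ t ω x = (φ₀ ω).1 x
      + (∫ s in (0 : ℝ)..t, dvg o (fun e => deriv V (grad o (φ s ω) e)) x)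
      + √2 * B x t.toNNReal ω

/-- The environment `a(t, e) = V''(∇φ(t, e))` along a trajectory `φ`. -/
def environment (o : Orientation d L) (V : ℝ → ℝ) (φ : ℝ → Torus d L → ℝ) (t : ℝ) (e : Edge d L) :
    ℝ :=
  deriv (deriv V) (grad o (φ t) e)

/-- `P = P_a(·, · ; s, y)` is the heat kernel of the environment `a`: it is continuous on `[s, ∞)`,
solves `∂ₜ P = ∇·a∇P` for `t > s`, and `P(s, ·) = δ_y - 1/|𝕋_L|`. -/
structure IsHeatKernel (o : Orientation d L) (a : ℝ → Edge d L → ℝ) (s : ℝ) (y : Torus d L)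
    (P : ℝ → Torus d L → ℝ) : Prop where
  continuousOn : ∀ x, ContinuousOn (fun t => P t x) (Ici s)
  equation : ∀ t, s < t → ∀ x,
    HasDerivAt (fun τ => P τ x) (dvg o (fun e => a t e * grad o (P t) e) x) t
  init : ∀ x, P s x = (if x = y then 1 else 0) - 1 / (Fintype.card (Torus d L) : ℝ)

/-! ### Exponents -/

def lamExp (d : ℕ) : ℝ := (2 * d + 2) / (d + 2)
def kapExp (d : ℕ) : ℝ := d * lamExp d / (d - lamExp d)
def sigExp (d : ℕ) : ℝ := 2 * kapExp d / (kapExp d - 2)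
def tauExp (d : ℕ) : ℝ := 2 * lamExp d / (2 - lamExp d)
def lamExp' (d : ℕ) : ℝ := (2 * d + 3) / (d + 2)
def tauExp' (d : ℕ) : ℝ := 2 * lamExp' d / (2 - lamExp' d)
def thetaExp (d : ℕ) : ℝ := 2 / 3 * ((2 * d + 3) / (2 * d + 2))

/-- `θ_c`, given by `1/θ_c = 1 + (dp + 2p)/(dp + 2d) · (p'/d - 1)`. -/
def thetaCrit (d : ℕ) (p p' : ℝ) : ℝ :=
  (1 + (d * p + 2 * p) / (d * p + 2 * d) * (p' / d - 1))⁻¹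

def alphaExp (d : ℕ) (p p' : ℝ) : ℝ :=
  (1 - thetaCrit d p p') * (d / (d + 2)) + thetaCrit d p p' * (p / (p + 2))
def betaExp (d : ℕ) (p p' : ℝ) : ℝ := (1 - thetaCrit d p p') * (2 / (d + 2))
def gammaExp (d : ℕ) (p p' : ℝ) : ℝ := thetaCrit d p p' * (2 / (p + 2))

/-! ### The kernels and the moderated environment -/

/-- `k_t = δ / (1+t)^{p+3}`. -/
def kKer (p δ t : ℝ) : ℝ := δ / (1 + t) ^ (p + 3)

/-- `K_t = k_t + ∫_t^∞ s k_s ds`. -/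
def KKer (p δ t : ℝ) : ℝ := kKer p δ t + ∫ s in Ioi t, s * kKer p δ s

/-- The requirement on the small parameter `δ > 0`: `K * K ≤ K` and `∫₀^∞ K ≤ 1`. -/
def IsAdmissibleDelta (p δ : ℝ) : Prop :=
  0 < δ ∧
  (∀ t s' : ℝ, 0 < t → t ≤ s' →
    ∫ s in t..s', KKer p δ (s - t) * KKer p δ (s' - s) ≤ KKer p δ (s' - t)) ∧
  ∫ s in Ioi (0 : ℝ), KKer p δ s ≤ 1

/-- The moderated environment `w(t, e)`, the square root of
`∫_t^∞ k_{s-t} (a(s,e) ∧ 1) / ((s-t)⁻¹ ∑_{e' ∩ e ≠ ∅} ∫_t^s (a(s',e') ∨ 1) ds') ds`. -/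
def moderated (p δ : ℝ) (a : ℝ → Edge d L → ℝ) (t : ℝ) (e : Edge d L) : ℝ :=
  √(∫ s in Ioi t, kKer p δ (s - t) * (min (a s e) 1 /
    ((s - t)⁻¹ * ∑ e' : Edge d L with (ends e' ∩ ends e).Nonempty,
      ∫ s' in t..s, max (a s' e') 1)))

/-! ### The maximal functionals, with values in `[0, ∞]` -/

/-- `w(t, ·)` with values in `[0, ∞]`. -/
def wE (p δ : ℝ) (a : ℝ → Edge d L → ℝ) (t : ℝ) (e : Edge d L) : ℝ≥0∞ :=
  ENNReal.ofReal (moderated p δ a t e)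

/-- `w⁻¹(t, ·)` with values in `[0, ∞]`, equal to `∞` where `w = 0`. -/
def wInv (p δ : ℝ) (a : ℝ → Edge d L → ℝ) (t : ℝ) (e : Edge d L) : ℝ≥0∞ := (wE p δ a t e)⁻¹

/-- `𝓜_{p'}(t)` -/
def calMp' (p p' δ : ℝ) (a : ℝ → Edge d L → ℝ) (t : ℝ) : ℝ≥0∞ :=
  1 + (1 + avgNorm (sigExp d) Finset.univ (wE p δ a t)
        * avgNorm (tauExp d) Finset.univ (wInv p δ a t)) ^ 2
      * ⨆ r ∈ Finset.Icc 1 L, avgNorm p' (box d L r) (wInv p δ a t) ^ 2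

/-- `𝓜₀(t)` -/
def calM0 (p δ : ℝ) (a : ℝ → Edge d L → ℝ) (t : ℝ) : ℝ≥0∞ :=
  1 + ⨆ r ∈ Finset.Icc 0 L,
    avgNorm (sigExp d) (box d L r) (fun e => ENNReal.ofReal √(a t e)) ^ 2
      * (1 + avgNorm (tauExp' d) (box d L r) (wInv p δ a t) ^ 2)

/-- `𝓜₁(t)` -/
def calM1 (p δ : ℝ) (a : ℝ → Edge d L → ℝ) (t : ℝ) : ℝ≥0∞ :=
  1 + ∫⁻ s in Ioi t,
    ENNReal.ofReal (KKer p δ (s - t)) * calM0 p δ a s ^ (p / (2 * (1 - thetaExp d)))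

/-- `𝓜₂(t)` -/
def calM2 (p : ℝ) (a : ℝ → Edge d L → ℝ) (t : ℝ) : ℝ≥0∞ :=
  1 + ⨆ x : Torus d L, ENNReal.ofReal
    ((∑ e : Edge d L with x ∈ ends e, a t e) / starNorm x ^ ((p - 2) / (p - 1)))

/-- `𝓜₃(t)` -/
def calM3 (p p' δ : ℝ) (a : ℝ → Edge d L → ℝ) (t : ℝ) : ℝ≥0∞ :=
  1 + (∫⁻ s in Ioi t, ENNReal.ofReal (KKer p δ (s - t))
    * calMp' p p' δ a s ^ (alphaExp d p p' / betaExp d p p')) ^ betaExp d p p'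

/-- `𝓜₄(t)` -/
def calM4 (p δ : ℝ) (a : ℝ → Edge d L → ℝ) (t : ℝ) : ℝ≥0∞ :=
  1 + ⨆ s ∈ Icc t (t + 1), avgNorm (d : ℝ) Finset.univ (wInv p δ a s) ^ 2

/-- The time average `(1/t) ∫₀ᵗ f(s) ds`. -/
def timeAvg (f : ℝ → ℝ≥0∞) (t : ℝ) : ℝ≥0∞ := (∫⁻ s in Ioc 0 t, f s) / ENNReal.ofReal t

def scrM1 (p δ : ℝ) (a : ℝ → Edge d L → ℝ) : ℝ≥0∞ :=
  (⨆ t ∈ Ici (1 : ℝ), timeAvg (fun s => calM1 p δ a s ^ (2 / p)) t) ^ (p / 2)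

def scrM2 (p : ℝ) (a : ℝ → Edge d L → ℝ) : ℝ≥0∞ :=
  (⨆ t ∈ Ici (1 : ℝ), timeAvg (calM2 p a) t) ^ (p - 1)

def scrM3 (p p' δ : ℝ) (a : ℝ → Edge d L → ℝ) : ℝ≥0∞ :=
  (⨅ t ∈ Ici (1 : ℝ), timeAvg (fun s => calM3 p p' δ a s ^ (-(1 / alphaExp d p p'))) t)
    ^ (-(alphaExp d p p' / gammaExp d p p'))

def scrM4 (p δ : ℝ) (a : ℝ → Edge d L → ℝ) : ℝ≥0∞ :=
  (⨅ t ∈ Ici (1 : ℝ), timeAvg (fun s => (calM4 p δ a s)⁻¹) t)⁻¹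

/-- `𝓜 = ((𝓜₁ + 𝓜₂) 𝓜₃)^{γ/(1-α-γ)}` -/
def scrM (p p' δ : ℝ) (a : ℝ → Edge d L → ℝ) : ℝ≥0∞ :=
  ((scrM1 p δ a + scrM2 p a) * scrM3 p p' δ a)
    ^ (gammaExp d p p' / (1 - alphaExp d p p' - gammaExp d p p'))

/-- `𝓜' = 𝓜₃^{2γ/(dβ+pγ) + γ/α} 𝓜₄` -/
def scrM' (p p' δ : ℝ) (a : ℝ → Edge d L → ℝ) : ℝ≥0∞ :=
  scrM3 p p' δ a ^ (2 * gammaExp d p p' / (d * betaExp d p p' + p * gammaExp d p p')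
      + gammaExp d p p' / alphaExp d p p')
    * scrM4 p δ a

end GradPhi

end

namespace GradPhi

section Calculus

variable {d L : ℕ}

/-- The gradient in the canonical orientation. -/
def gr (f : Torus d L → ℝ) (e : Edge d L) : ℝ := f (shift e) - f e.1

/-- The operator `∇·a∇`. -/
def lap (a : Edge d L → ℝ) (f : Torus d L → ℝ) (x : Torus d L) : ℝ :=
  (∑ e : Edge d L with e.1 = x, a e * gr f e) - ∑ e : Edge d L with shift e = x, a e * gr f e

theorem dvg_mul_grad (o : Orientation d L) (a : Edge d L → ℝ) (f : Torus d L → ℝ)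
    (x : Torus d L) : dvg o (fun e => a e * grad o f e) x = lap a f x := by
  unfold dvg lap
  rw [Finset.sum_filter, Finset.sum_filter, Finset.sum_filter, Finset.sum_filter,
    ← Finset.sum_sub_distrib, ← Finset.sum_sub_distrib]
  refine Finset.sum_congr rfl fun e _ => ?_
  unfold grad gr src tgt
  cases o e <;> simp
  split_ifs <;> ring

theorem sum_mul_lap (a : Edge d L → ℝ) (f v : Torus d L → ℝ) :
    ∑ x, v x * lap a f x = -∑ e, a e * gr f e * gr v e := by
  have key : ∀ (π : Edge d L → Torus d L),
      ∑ x, v x * ∑ e : Edge d L with π e = x, a e * gr f e = ∑ e, v (π e) * (a e * gr f e) := by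
    intro π
    rw [← Finset.sum_fiberwise (s := Finset.univ) (g := π)]
    refine Finset.sum_congr rfl fun x _ => ?_
    rw [Finset.mul_sum]
    refine Finset.sum_congr rfl fun e he => ?_
    rw [(Finset.mem_filter.1 he).2]
  unfold lap
  simp only [mul_sub, Finset.sum_sub_distrib]
  rw [key, key, ← Finset.sum_sub_distrib, ← Finset.sum_neg_distrib]
  refine Finset.sum_congr rfl fun e _ => ?_
  unfold gr
  ring

theorem gr_add_const (f : Torus d L → ℝ) (c : ℝ) : gr (fun x => f x + c) = gr f := by
  funext e
  simp [gr]

theorem lap_add_const (a : Edge d L → ℝ) (f : Torus d L → ℝ) (c : ℝ) :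
    lap a (fun x => f x + c) = lap a f := by
  funext e
  simp [lap, gr_add_const]

theorem shift_eq (x : Torus d L) (i : Fin d) : shift (x, i) = x + Pi.single i 1 := rfl

theorem sum_edge {M : Type*} [AddCommMonoid M] (f : Edge d L → M) :
    ∑ e, f e = ∑ x, ∑ i, f (x, i) := Fintype.sum_prod_type f

end Calculus

section Geometry

variable {d L : ℕ}

theorem euclNorm_eq_norm (x : Torus d L) :
    euclNorm x = ‖(WithLp.toLp 2 fun i => ((x i).valMinAbs : ℝ) : EuclideanSpace ℝ (Fin d))‖ := by
  simp [euclNorm, EuclideanSpace.norm_eq]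

theorem euclNorm_nonneg (x : Torus d L) : 0 ≤ euclNorm x := Real.sqrt_nonneg _

theorem one_le_starNorm (x : Torus d L) : 1 ≤ starNorm x := by
  have := euclNorm_nonneg x
  unfold starNorm
  linarith

theorem starNorm_pos (x : Torus d L) : 0 < starNorm x := by
  linarith [one_le_starNorm x]

theorem starNorm_zero : starNorm (0 : Torus d L) = 1 := by
  simp [starNorm, euclNorm]

theorem euclNorm_add_le (x y : Torus d L) : euclNorm (x + y) ≤ euclNorm x + euclNorm y := by
  have h : euclNorm (x + y) ≤
      ‖(WithLp.toLp 2 fun i => ((x i).valMinAbs : ℝ) : EuclideanSpace ℝ (Fin d))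
        + WithLp.toLp 2 fun i => ((y i).valMinAbs : ℝ)‖ := by
    rw [EuclideanSpace.norm_eq]
    unfold euclNorm
    refine Real.sqrt_le_sqrt (Finset.sum_le_sum fun i _ => ?_)
    have := ZMod.natAbs_valMinAbs_add_le (x i) (y i)
    simp only [PiLp.add_apply, Real.norm_eq_abs, sq_abs, Pi.add_apply]
    rw [sq_le_sq]
    have h2 : |((x i + y i).valMinAbs)| ≤ |(x i).valMinAbs + (y i).valMinAbs| := by
      rw [Int.abs_eq_natAbs, Int.abs_eq_natAbs]
      exact_mod_cast this
    exact_mod_cast h2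
  refine h.trans ((norm_add_le _ _).trans ?_)
  rw [← euclNorm_eq_norm, ← euclNorm_eq_norm]

theorem euclNorm_neg (x : Torus d L) : euclNorm (-x) = euclNorm x := by
  unfold euclNorm
  congr 1
  refine Finset.sum_congr rfl fun i _ => ?_
  have := ZMod.natAbs_valMinAbs_neg (x i)
  rw [Pi.neg_apply, sq_eq_sq_iff_abs_eq_abs]
  have h2 : |((-x i).valMinAbs)| = |(x i).valMinAbs| := by
    rw [Int.abs_eq_natAbs, Int.abs_eq_natAbs, this]
  exact_mod_cast h2

theorem euclNorm_le_sum (x : Torus d L) : euclNorm x ≤ ∑ i, ((x i).valMinAbs.natAbs : ℝ) := by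
  unfold euclNorm
  refine Real.sqrt_le_iff.2 ⟨by positivity, ?_⟩
  have : ∀ i, ((x i).valMinAbs : ℝ) ^ 2 = ((x i).valMinAbs.natAbs : ℝ) ^ 2 := by
    intro i
    rw [Nat.cast_natAbs]
    simp
  simp only [this]
  exact Finset.sum_sq_le_sq_sum_of_nonneg fun i _ => by positivity

theorem natAbs_le_euclNorm (x : Torus d L) (i : Fin d) :
    ((x i).valMinAbs.natAbs : ℝ) ≤ euclNorm x := by
  unfold euclNorm
  refine Real.le_sqrt_of_sq_le ?_
  rw [Nat.cast_natAbs]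
  push_cast
  rw [sq_abs]
  exact Finset.single_le_sum (f := fun i => ((x i).valMinAbs : ℝ) ^ 2)
    (fun i _ => by positivity) (Finset.mem_univ i)

/-- The image in the torus of a vector of natural numbers. -/
def emb {m : ℕ} (z : Fin d → Fin m) : Torus d L := fun i => ((z i : ℕ) : ZMod (2 * L + 1))

theorem natAbs_valMinAbs_natCast_le (k : ℕ) :
    ((k : ZMod (2 * L + 1)).valMinAbs).natAbs ≤ k := by
  have := ZMod.natAbs_min_of_le_div_two (2 * L + 1) ((k : ZMod (2 * L + 1)).valMinAbs) (k : ℤ)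
    (by simp) (ZMod.natAbs_valMinAbs_le _)
  simpa using this

theorem euclNorm_emb_le {m : ℕ} (z : Fin d → Fin m) :
    euclNorm (emb z : Torus d L) ≤ d * m := by
  refine (euclNorm_le_sum _).trans ?_
  calc ∑ i, (((emb z : Torus d L) i).valMinAbs.natAbs : ℝ) ≤ ∑ _i : Fin d, (m : ℝ) := by
        refine Finset.sum_le_sum fun i _ => ?_
        have h1 : ((emb z : Torus d L) i).valMinAbs.natAbs ≤ m :=
          (natAbs_valMinAbs_natCast_le _).trans (z i).2.le
        exact_mod_cast h1
    _ = d * m := by simp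

theorem starNorm_add_emb_le {m : ℕ} (x : Torus d L) (z : Fin d → Fin m) :
    starNorm (x + emb z) ≤ starNorm x + d * m := by
  unfold starNorm
  linarith [euclNorm_add_le x (emb z), euclNorm_emb_le (L := L) z]

theorem starNorm_le_add_emb {m : ℕ} (x : Torus d L) (z : Fin d → Fin m) :
    starNorm x ≤ starNorm (x + emb z) + d * m := by
  unfold starNorm
  have := euclNorm_add_le (x + emb z) (-emb z)
  rw [add_neg_cancel_right, euclNorm_neg] at this
  linarith [euclNorm_emb_le (L := L) z]

theorem euclNorm_single_le (i : Fin d) : euclNorm (Pi.single i 1 : Torus d L) ≤ 1 := by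
  refine (euclNorm_le_sum _).trans ?_
  rw [Finset.sum_eq_single i]
  · have := natAbs_valMinAbs_natCast_le (L := L) 1
    simp only [Pi.single_eq_same]
    exact_mod_cast this
  · intro j _ hj
    simp [Pi.single_eq_of_ne hj]
  · simp

theorem starNorm_shift_le (e : Edge d L) : starNorm (shift e) ≤ starNorm e.1 + 1 := by
  unfold starNorm shift
  linarith [euclNorm_add_le e.1 (Pi.single e.2 1), euclNorm_single_le (L := L) e.2]

theorem starNorm_le_shift (e : Edge d L) : starNorm e.1 ≤ starNorm (shift e) + 1 := by
  unfold starNorm shift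
  have := euclNorm_add_le (e.1 + Pi.single e.2 1) (-(Pi.single e.2 1))
  rw [add_neg_cancel_right, euclNorm_neg] at this
  linarith [euclNorm_single_le (L := L) e.2]

theorem mem_box {r : ℕ} {x : Torus d L} :
    x ∈ box d L r ↔ ∀ i, (x i).valMinAbs.natAbs ≤ r := by
  simp [box]

theorem mem_box_of_starNorm_le {r : ℕ} {x : Torus d L} (h : starNorm x ≤ r + 1) :
    x ∈ box d L r := by
  refine mem_box.2 fun i => ?_
  have := natAbs_le_euclNorm x i
  unfold starNorm at h
  have h2 : ((x i).valMinAbs.natAbs : ℝ) ≤ r := by linarith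
  exact_mod_cast h2

theorem starNorm_le_of_mem_box {r : ℕ} {x : Torus d L} (h : x ∈ box d L r) :
    starNorm x ≤ d * r + 1 := by
  have := euclNorm_le_sum x
  have h2 : ∑ i, ((x i).valMinAbs.natAbs : ℝ) ≤ ∑ _i : Fin d, (r : ℝ) :=
    Finset.sum_le_sum fun i _ => by exact_mod_cast mem_box.1 h i
  simp only [Finset.sum_const, Finset.card_univ, Fintype.card_fin, nsmul_eq_mul] at h2
  unfold starNorm
  linarith

theorem natAbs_le_L (x : Torus d L) (i : Fin d) : (x i).valMinAbs.natAbs ≤ L := by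
  have := ZMod.natAbs_valMinAbs_le (x i)
  omega

theorem box_min (r : ℕ) : box d L (min r L) = box d L r := by
  ext x
  simp only [mem_box, le_min_iff]
  exact ⟨fun h i => (h i).1, fun h i => ⟨h i, natAbs_le_L x i⟩⟩

theorem box_eq_univ {r : ℕ} (h : L ≤ r) : box d L r = Finset.univ := by
  ext x
  simp only [mem_box, Finset.mem_univ, iff_true]
  exact fun i => (natAbs_le_L x i).trans h

theorem starNorm_le (x : Torus d L) : starNorm x ≤ d * L + 1 :=
  starNorm_le_of_mem_box (by rw [box_eq_univ le_rfl]; simp)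

theorem card_box_le (r : ℕ) : (box d L r).card ≤ (2 * r + 1) ^ d := by
  have : (box d L r).card ≤ (Fintype.piFinset fun _ : Fin d => Finset.Icc (-(r : ℤ)) r).card := by
    refine Finset.card_le_card_of_injOn (fun x i => (x i).valMinAbs) ?_ ?_
    · intro x hx
      simp only [Finset.mem_coe, mem_box] at hx
      simp only [Finset.mem_coe, Fintype.mem_piFinset, Finset.mem_Icc]
      intro i
      have := hx i
      omega
    · intro x _ y _ h
      funext i
      exact ZMod.injective_valMinAbs (congrFun h i)
  refine this.trans ?_
  rw [Fintype.card_piFinset]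
  simp only [Int.card_Icc, Finset.prod_const, Finset.card_univ, Fintype.card_fin]
  refine Nat.pow_le_pow_left ?_ d
  omega

theorem card_torus : Fintype.card (Torus d L) = (2 * L + 1) ^ d := by
  simp [Torus, ZMod.card]

theorem mem_edgesIn {U : Finset (Torus d L)} {e : Edge d L} :
    e ∈ edgesIn U ↔ e.1 ∈ U ∧ shift e ∈ U := by
  simp [edgesIn, ends, Finset.insert_subset_iff]

theorem mem_box_succ_of_shift {r : ℕ} {e : Edge d L} (h : e.1 ∈ box d L r) :
    shift e ∈ box d L (r + 1) := by
  refine mem_box.2 fun i => ?_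
  have h1 := ZMod.natAbs_valMinAbs_add_le (e.1 i) ((Pi.single e.2 1 : Torus d L) i)
  have h2 := mem_box.1 h i
  have h3 : (((Pi.single e.2 1 : Torus d L) i).valMinAbs).natAbs ≤ 1 := by
    by_cases hi : i = e.2
    · subst hi
      simpa using natAbs_valMinAbs_natCast_le (L := L) 1
    · simp [Pi.single_eq_of_ne hi]
  have h4 : ((shift e) i) = e.1 i + (Pi.single e.2 1 : Torus d L) i := rfl
  rw [h4]
  omega

theorem box_mono {r s : ℕ} (h : r ≤ s) : box d L r ⊆ box d L s :=
  fun _ hx => mem_box.2 fun i => (mem_box.1 hx i).trans h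

theorem add_emb_mem_box {r m : ℕ} {x : Torus d L} (hx : x ∈ box d L r) (z : Fin d → Fin m) :
    x + emb z ∈ box d L (r + m) := by
  refine mem_box.2 fun i => ?_
  have h1 := ZMod.natAbs_valMinAbs_add_le (x i) ((emb z : Torus d L) i)
  have h2 := mem_box.1 hx i
  have h3 : ((emb z : Torus d L) i).valMinAbs.natAbs ≤ m :=
    (natAbs_valMinAbs_natCast_le _).trans (z i).2.le
  rw [Pi.add_apply]
  omega

end Geometry

end GradPhi

namespace GradPhi

section Paths

variable {d m : ℕ}

theorem sum_piecewise_swap (s : Finset (Fin d)) (H : (Fin d → Fin m) → ℝ) :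
    ∑ q : (Fin d → Fin m) × (Fin d → Fin m), H (s.piecewise q.2 q.1) =
      (m : ℝ) ^ d * ∑ y, H y := by
  let σ : (Fin d → Fin m) × (Fin d → Fin m) → (Fin d → Fin m) × (Fin d → Fin m) :=
    fun q => (s.piecewise q.2 q.1, s.piecewise q.1 q.2)
  have hσ : Function.Involutive σ := by
    rintro ⟨a, b⟩
    refine Prod.ext ?_ ?_ <;> funext c <;> by_cases hc : c ∈ s <;> simp [σ, hc]
  have h1 : ∑ q : (Fin d → Fin m) × (Fin d → Fin m), H (s.piecewise q.2 q.1) =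
      ∑ q : (Fin d → Fin m) × (Fin d → Fin m), H q.1 :=
    Equiv.sum_comp hσ.toPerm fun q => H q.1
  rw [h1, Fintype.sum_prod_type]
  simp [Finset.mul_sum]

theorem sum_update_swap (l : Fin d) (H : (Fin d → Fin m) → ℝ) :
    ∑ y : Fin d → Fin m, ∑ k : Fin m, H (Function.update y l k) = m * ∑ y, H y := by
  let σ : (Fin d → Fin m) × Fin m → (Fin d → Fin m) × Fin m :=
    fun q => (Function.update q.1 l q.2, q.1 l)
  have hσ : Function.Involutive σ := by
    rintro ⟨a, b⟩
    simp [σ]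
  rw [← Fintype.sum_prod_type']
  have h1 : ∑ q : (Fin d → Fin m) × Fin m, H (Function.update q.1 l q.2) =
      ∑ q : (Fin d → Fin m) × Fin m, H q.1 :=
    Equiv.sum_comp hσ.toPerm fun q => H q.1
  rw [h1, Fintype.sum_prod_type]
  simp [Finset.mul_sum]

/-- Increment of a lattice function in the direction `l`. -/
def latticeIncr (f : (Fin d → ℕ) → ℝ) (l : Fin d) (z : Fin d → ℕ) : ℝ :=
  |f (z + Pi.single l 1) - f z|

theorem abs_sub_update_le (f : (Fin d → ℕ) → ℝ) (l : Fin d) (y : Fin d → Fin m) (b : Fin m) :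
    |f (fun c => y c) - f (fun c => Function.update y l b c)| ≤
      ∑ k : Fin m, latticeIncr f l (fun c => Function.update y l k c) := by
  let g : ℕ → ℝ := fun k => f (Function.update (fun c => (y c : ℕ)) l k)
  have hg : ∀ k : Fin m, f (fun c => Function.update y l k c) = g k := by
    intro k
    simp only [g]
    congr 1
    funext c
    by_cases hc : c = l
    · subst hc; simp
    · simp [hc]
  have hD : ∀ k : Fin m, latticeIncr f l (fun c => Function.update y l k c) =
      |g (k + 1) - g k| := by
    intro k
    unfold latticeIncr
    rw [hg]
    congr 2
    simp only [g]
    congr 1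
    funext c
    by_cases hc : c = l
    · subst hc; simp
    · simp [hc]
  have hy : f (fun c => y c) = g (y l) := by
    simp only [g]
    congr 1
    funext c
    by_cases hc : c = l
    · subst hc; simp
    · simp [hc]
  rw [hy, hg]
  simp only [hD]
  rw [Fin.sum_univ_eq_sum_range (fun k => |g (k + 1) - g k|)]
  have key : ∀ a b : ℕ, a ≤ b → b < m → |g a - g b| ≤ ∑ k ∈ Finset.range m, |g (k + 1) - g k| := by
    intro a b hab hb
    have h1 := dist_le_Ico_sum_dist g hab
    rw [Real.dist_eq] at h1
    refine h1.trans ?_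
    have h2 : ∀ k, dist (g k) (g (k + 1)) = |g (k + 1) - g k| := fun k => by
      rw [Real.dist_eq, abs_sub_comm]
    simp only [h2]
    refine Finset.sum_le_sum_of_subset_of_nonneg ?_ fun _ _ _ => abs_nonneg _
    intro k hk
    simp only [Finset.mem_Ico, Finset.mem_range] at hk ⊢
    omega
  rcases le_total (y l : ℕ) (b : ℕ) with h | h
  · exact key _ _ h b.2
  · rw [abs_sub_comm]
    exact key _ _ h (y l).2

theorem sum_abs_sub_piecewise_le (f : (Fin d → ℕ) → ℝ) (s : Finset (Fin d)) :
    ∑ q : (Fin d → Fin m) × (Fin d → Fin m),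
      |f (fun c => q.1 c) - f (fun c => s.piecewise q.2 q.1 c)| ≤
      ∑ l ∈ s, (m : ℝ) ^ d * (m * ∑ z : Fin d → Fin m, latticeIncr f l (fun c => z c)) := by
  induction s using Finset.induction_on with
  | empty => simp
  | insert l s hl ih =>
    rw [Finset.sum_insert hl, add_comm]
    have h2 : ∑ q : (Fin d → Fin m) × (Fin d → Fin m),
        |f (fun c => s.piecewise q.2 q.1 c) - f (fun c => (insert l s).piecewise q.2 q.1 c)| ≤
        (m : ℝ) ^ d * (m * ∑ z : Fin d → Fin m, latticeIncr f l (fun c => z c)) := by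
      rw [← sum_update_swap l (fun z => latticeIncr f l (fun c => z c)),
        ← sum_piecewise_swap s (fun y => ∑ k : Fin m,
          latticeIncr f l (fun c => Function.update y l k c))]
      refine Finset.sum_le_sum fun q _ => ?_
      rw [Finset.piecewise_insert]
      exact abs_sub_update_le f l _ _
    refine le_trans ?_ (add_le_add ih h2)
    rw [← Finset.sum_add_distrib]
    exact Finset.sum_le_sum fun q _ => abs_sub_le _ _ _

/-- `L¹` Poincaré inequality on a lattice cube. -/
theorem sum_abs_sub_le (f : (Fin d → ℕ) → ℝ) :
    ∑ i : Fin d → Fin m, ∑ j : Fin d → Fin m, |f (fun c => i c) - f (fun c => j c)| ≤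
      (m : ℝ) ^ d * (m * ∑ z : Fin d → Fin m, ∑ l, latticeIncr f l (fun c => z c)) := by
  have := sum_abs_sub_piecewise_le (m := m) f Finset.univ
  simp only [Finset.piecewise_univ] at this
  rw [← Fintype.sum_prod_type' (f := fun i j : Fin d → Fin m =>
    |f (fun c => i c) - f (fun c => j c)|)]
  refine this.trans (le_of_eq ?_)
  rw [Finset.sum_comm (s := Finset.univ) (t := Finset.univ) (f := fun (z : Fin d → Fin m) l =>
    latticeIncr f l (fun c => z c)), Finset.mul_sum, Finset.mul_sum]

end Paths

section Averages

variable {d L : ℕ}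

/-- The average of `u` over the cube of side `m` with lowest corner `x`. -/
noncomputable def cubeAvg (m : ℕ) (u : Torus d L → ℝ) (x : Torus d L) : ℝ :=
  ((m : ℝ) ^ d)⁻¹ * ∑ z : Fin d → Fin m, u (x + emb z)

theorem cubeAvg_one (u : Torus d L → ℝ) (x : Torus d L) : cubeAvg 1 u x = u x := by
  unfold cubeAvg
  rw [Fintype.sum_unique]
  have : (emb (default : Fin d → Fin 1) : Torus d L) = 0 := by
    funext i
    simp [emb]
  rw [this]
  simp

theorem abs_cubeAvg_sub_le {n m : ℕ} (hn : 0 < n) (hnm : n ≤ m) (hm : m ≤ 2 * n)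
    (u : Torus d L → ℝ) (x : Torus d L) :
    |cubeAvg n u x - cubeAvg m u x| ≤
      2 ^ d * m * (((m : ℝ) ^ d)⁻¹ * ∑ z : Fin d → Fin m, ∑ l, |gr u (x + emb z, l)|) := by
  let f : (Fin d → ℕ) → ℝ := fun z => u (x + fun c => ((z c : ℕ) : ZMod (2 * L + 1)))
  have hm0 : (0 : ℝ) < m := by exact_mod_cast hn.trans_le hnm
  have hn0 : (0 : ℝ) < n := by exact_mod_cast hn
  have hf : ∀ {k : ℕ} (z : Fin d → Fin k), u (x + emb z) = f (fun c => z c) := fun z => rfl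
  have hincr : ∀ (z : Fin d → Fin m) (l : Fin d),
      |gr u (x + emb z, l)| = latticeIncr f l (fun c => z c) := by
    intro z l
    unfold latticeIncr gr
    rw [hf z]
    congr 2
    simp only [f, shift_eq, add_assoc]
    congr 2
    funext c
    by_cases hc : c = l
    · subst hc; simp [emb]
    · simp [hc, emb]
  simp only [hincr]
  have h0 := sum_abs_sub_le (m := m) f
  set S := ∑ z : Fin d → Fin m, ∑ l, latticeIncr f l (fun c => z c) with hS
  have hS0 : 0 ≤ S := Finset.sum_nonneg fun _ _ => Finset.sum_nonneg fun _ _ => abs_nonneg _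
  have h1 : ∑ i : Fin d → Fin n, ∑ j : Fin d → Fin m,
      |f (fun c => i c) - f (fun c => j c)| ≤ (m : ℝ) ^ d * (m * S) := by
    refine le_trans ?_ h0
    have hinj : Function.Injective
        (fun (i : Fin d → Fin n) (c : Fin d) => Fin.castLE hnm (i c)) := by
      intro a b hab
      funext c
      exact Fin.castLE_injective hnm (congrFun hab c)
    let G : (Fin d → Fin m) → ℝ := fun i => ∑ j : Fin d → Fin m,
      |f (fun c => i c) - f (fun c => j c)|
    have h3 : ∑ i : Fin d → Fin n, G (fun c => Fin.castLE hnm (i c)) ≤ ∑ i, G i := by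
      rw [← Finset.sum_image (s := Finset.univ) (f := G)
        (g := fun (i : Fin d → Fin n) (c : Fin d) => Fin.castLE hnm (i c))
        (fun a _ b _ h => hinj h)]
      exact Finset.sum_le_sum_of_subset_of_nonneg (Finset.subset_univ _)
        fun i _ _ => Finset.sum_nonneg fun _ _ => abs_nonneg _
    exact h3
  have hrep : cubeAvg n u x - cubeAvg m u x = ((n : ℝ) ^ d)⁻¹ * ((m : ℝ) ^ d)⁻¹ *
      ∑ i : Fin d → Fin n, ∑ j : Fin d → Fin m, (f (fun c => i c) - f (fun c => j c)) := by
    unfold cubeAvg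
    simp only [hf, Finset.sum_sub_distrib, Finset.sum_const, Finset.card_univ, Fintype.card_pi,
      Fintype.card_fin, Finset.prod_const, nsmul_eq_mul, ← Finset.mul_sum]
    push_cast
    field_simp
  rw [hrep, abs_mul, abs_of_nonneg (by positivity : (0 : ℝ) ≤ ((n : ℝ) ^ d)⁻¹ * ((m : ℝ) ^ d)⁻¹)]
  have h2 : |∑ i : Fin d → Fin n, ∑ j : Fin d → Fin m, (f (fun c => i c) - f (fun c => j c))| ≤
      (m : ℝ) ^ d * (m * S) :=
    (Finset.abs_sum_le_sum_abs _ _).trans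
      ((Finset.sum_le_sum fun i _ => Finset.abs_sum_le_sum_abs _ _).trans h1)
  have h4 : ((n : ℝ) ^ d)⁻¹ ≤ 2 ^ d * ((m : ℝ) ^ d)⁻¹ := by
    rw [inv_le_iff_one_le_mul₀ (by positivity)]
    have : (m : ℝ) ^ d ≤ (2 * n : ℝ) ^ d :=
      pow_le_pow_left₀ hm0.le (by exact_mod_cast hm) d
    rw [mul_pow] at this
    calc (1 : ℝ) = ((m : ℝ) ^ d)⁻¹ * (m : ℝ) ^ d := by field_simp
      _ ≤ ((m : ℝ) ^ d)⁻¹ * (2 ^ d * (n : ℝ) ^ d) := by gcongr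
      _ = _ := by ring
  calc ((n : ℝ) ^ d)⁻¹ * ((m : ℝ) ^ d)⁻¹ * _
      ≤ (2 ^ d * ((m : ℝ) ^ d)⁻¹) * ((m : ℝ) ^ d)⁻¹ * ((m : ℝ) ^ d * (m * S)) := by
        gcongr
    _ = _ := by field_simp

theorem emb_injective {m : ℕ} (hm : m ≤ 2 * L + 1) :
    Function.Injective (emb : (Fin d → Fin m) → Torus d L) := by
  intro a b hab
  funext c
  have h := congrFun hab c
  simp only [emb] at h
  rw [ZMod.natCast_eq_natCast_iff'] at h
  rw [Nat.mod_eq_of_lt ((a c).2.trans_le hm), Nat.mod_eq_of_lt ((b c).2.trans_le hm)] at h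
  exact Fin.ext h

theorem cubeAvg_full (u : Torus d L → ℝ) (hu : ∑ x, u x = 0) (x : Torus d L) :
    cubeAvg (2 * L + 1) u x = 0 := by
  have hbij : Function.Bijective (emb : (Fin d → Fin (2 * L + 1)) → Torus d L) := by
    rw [Fintype.bijective_iff_injective_and_card]
    exact ⟨emb_injective le_rfl, by simp⟩
  unfold cubeAvg
  have h1 : ∑ z : Fin d → Fin (2 * L + 1), u (x + emb z) = ∑ y, u (x + y) :=
    Function.Bijective.sum_comp hbij fun y => u (x + y)
  have h2 : ∑ y, u (x + y) = ∑ y, u y := Equiv.sum_comp (Equiv.addLeft x) u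
  rw [h1, h2, hu, mul_zero]

/-- Young's inequality for averages over cubes. -/
theorem sum_cubeAvg_rpow_le {m : ℕ} (hm0 : 0 < m) (hm : m ≤ 2 * L + 1) {lam q : ℝ}
    (hlam : 1 ≤ lam) (hq : lam ≤ q) (X Y : Finset (Torus d L))
    (hXY : ∀ x ∈ X, ∀ z : Fin d → Fin m, x + emb z ∈ Y) (h : Torus d L → ℝ≥0∞) :
    (∑ x ∈ X, (((m : ℝ≥0∞) ^ d)⁻¹ * ∑ z : Fin d → Fin m, h (x + emb z)) ^ q) ^ (1 / q) ≤
      (m : ℝ≥0∞) ^ (d / q - d / lam) * (∑ y ∈ Y, h y ^ lam) ^ (1 / lam) := by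
  have hlam0 : 0 < lam := by linarith
  have hq0 : 0 < q := by linarith
  have hmE : (m : ℝ≥0∞) ≠ 0 := by exact_mod_cast hm0.ne'
  have hmT : (m : ℝ≥0∞) ≠ ∞ := ENNReal.natCast_ne_top m
  have hmd : ((m : ℝ≥0∞) ^ d) ≠ 0 := pow_ne_zero _ hmE
  have hmdT : ((m : ℝ≥0∞) ^ d) ≠ ∞ := ENNReal.pow_ne_top hmT
  set H := ∑ y ∈ Y, h y ^ lam with hH
  let S : Torus d L → ℝ≥0∞ := fun x => ∑ z : Fin d → Fin m, h (x + emb z) ^ lam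
  have hS1 : ∀ x ∈ X, S x ≤ H := by
    intro x hx
    have hinj : Function.Injective fun z : Fin d → Fin m => x + (emb z : Torus d L) :=
      fun a b hab => emb_injective hm (add_left_cancel hab)
    calc S x = ∑ y ∈ Finset.univ.image (fun z : Fin d → Fin m => x + (emb z : Torus d L)),
          h y ^ lam := by
          rw [Finset.sum_image fun a _ b _ hab => hinj hab]
      _ ≤ H := by
          refine Finset.sum_le_sum_of_subset ?_
          intro y hy
          obtain ⟨z, -, rfl⟩ := Finset.mem_image.1 hy
          exact hXY x hx z
  have hS2 : ∑ x ∈ X, S x ≤ (m : ℝ≥0∞) ^ d * H := by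
    rw [Finset.sum_comm]
    calc ∑ z : Fin d → Fin m, ∑ x ∈ X, h (x + emb z) ^ lam ≤ ∑ _z : Fin d → Fin m, H := by
          refine Finset.sum_le_sum fun z _ => ?_
          rw [← Finset.sum_image (s := X) (f := fun y => h y ^ lam)
            (g := fun x => x + (emb z : Torus d L)) (fun a _ b _ hab => add_right_cancel hab)]
          refine Finset.sum_le_sum_of_subset ?_
          intro y hy
          obtain ⟨x, hx, rfl⟩ := Finset.mem_image.1 hy
          exact hXY x hx z
      _ = (m : ℝ≥0∞) ^ d * H := by simp
  have hJ : ∀ x, (((m : ℝ≥0∞) ^ d)⁻¹ * ∑ z : Fin d → Fin m, h (x + emb z)) ^ lam ≤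
      ((m : ℝ≥0∞) ^ d)⁻¹ * S x := by
    intro x
    have := ENNReal.rpow_arith_mean_le_arith_mean_rpow Finset.univ
      (fun _ : Fin d → Fin m => ((m : ℝ≥0∞) ^ d)⁻¹) (fun z => h (x + emb z))
      (by simp [ENNReal.mul_inv_cancel hmd hmdT]) hlam
    rw [← Finset.mul_sum, ← Finset.mul_sum] at this
    exact this
  have hmain : ∑ x ∈ X, (((m : ℝ≥0∞) ^ d)⁻¹ * ∑ z : Fin d → Fin m, h (x + emb z)) ^ q ≤
      ((m : ℝ≥0∞) ^ d)⁻¹ ^ (q / lam) * ((m : ℝ≥0∞) ^ d * H ^ (q / lam)) := by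
    have hex : q / lam = (q / lam - 1) + 1 := by ring
    have hex0 : 0 ≤ q / lam - 1 := by
      rw [sub_nonneg, le_div_iff₀ hlam0]
      linarith
    calc ∑ x ∈ X, (((m : ℝ≥0∞) ^ d)⁻¹ * ∑ z : Fin d → Fin m, h (x + emb z)) ^ q
        = ∑ x ∈ X, ((((m : ℝ≥0∞) ^ d)⁻¹ * ∑ z : Fin d → Fin m, h (x + emb z)) ^ lam)
            ^ (q / lam) := by
          refine Finset.sum_congr rfl fun x _ => ?_
          rw [← ENNReal.rpow_mul]
          congr 1
          field_simp
      _ ≤ ∑ x ∈ X, (((m : ℝ≥0∞) ^ d)⁻¹ * S x) ^ (q / lam) := by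
          gcongr with x hx
          exact hJ x
      _ = ∑ x ∈ X, ((m : ℝ≥0∞) ^ d)⁻¹ ^ (q / lam) * S x ^ (q / lam) := by
          refine Finset.sum_congr rfl fun x _ => ?_
          rw [ENNReal.mul_rpow_of_nonneg _ _ (by positivity)]
      _ ≤ ∑ x ∈ X, ((m : ℝ≥0∞) ^ d)⁻¹ ^ (q / lam) * (H ^ (q / lam - 1) * S x) := by
          refine Finset.sum_le_sum fun x hx => ?_
          gcongr
          conv_lhs => rw [hex]
          rw [ENNReal.rpow_add_of_nonneg _ _ hex0 zero_le_one, ENNReal.rpow_one]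
          gcongr
          exact hS1 x hx
      _ = ((m : ℝ≥0∞) ^ d)⁻¹ ^ (q / lam) * (H ^ (q / lam - 1) * ∑ x ∈ X, S x) := by
          rw [Finset.mul_sum, Finset.mul_sum]
      _ ≤ ((m : ℝ≥0∞) ^ d)⁻¹ ^ (q / lam) * (H ^ (q / lam - 1) * ((m : ℝ≥0∞) ^ d * H)) := by
          gcongr
      _ = ((m : ℝ≥0∞) ^ d)⁻¹ ^ (q / lam) * ((m : ℝ≥0∞) ^ d * H ^ (q / lam)) := by
          conv_rhs => rw [hex]
          rw [ENNReal.rpow_add_of_nonneg (x := H) _ _ hex0 zero_le_one, ENNReal.rpow_one,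
            ← hex]
          ring
  refine (ENNReal.rpow_le_rpow hmain (by positivity : 0 ≤ 1 / q)).trans (le_of_eq ?_)
  rw [ENNReal.mul_rpow_of_nonneg _ _ (by positivity),
    ENNReal.mul_rpow_of_nonneg _ _ (by positivity), ← mul_assoc, ← ENNReal.rpow_mul,
    ← ENNReal.rpow_mul, ← ENNReal.rpow_natCast, ← ENNReal.rpow_neg, ← ENNReal.rpow_mul,
    ← ENNReal.rpow_mul, ← ENNReal.rpow_add _ _ hmE hmT]
  congr 2
  · field_simp
    ring
  · field_simp

theorem enorm_cubeAvg_le {m : ℕ} (hm : 0 < m) (u : Torus d L → ℝ) (x : Torus d L) :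
    ‖cubeAvg m u x‖ₑ ≤ ((m : ℝ≥0∞) ^ d)⁻¹ * ∑ z : Fin d → Fin m, ‖u (x + emb z)‖ₑ := by
  have hm0 : (0 : ℝ) < m := by exact_mod_cast hm
  unfold cubeAvg
  rw [enorm_mul]
  gcongr
  · rw [Real.enorm_of_nonneg (by positivity), ENNReal.ofReal_inv_of_pos (by positivity),
      ENNReal.ofReal_pow hm0.le, ENNReal.ofReal_natCast]
  · exact enorm_sum_le _ _

/-- The sum of the absolute values of the gradient over the edges `(x, i)`. -/
noncomputable def grSum (u : Torus d L → ℝ) (x : Torus d L) : ℝ≥0∞ := ∑ l, ‖gr u (x, l)‖ₑ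

theorem enorm_cubeAvg_sub_le {n m : ℕ} (hn : 0 < n) (hnm : n ≤ m) (hm : m ≤ 2 * n)
    (u : Torus d L → ℝ) (x : Torus d L) :
    ‖cubeAvg n u x - cubeAvg m u x‖ₑ ≤
      2 ^ d * m * (((m : ℝ≥0∞) ^ d)⁻¹ * ∑ z : Fin d → Fin m, grSum u (x + emb z)) := by
  have hm0 : (0 : ℝ) < m := by exact_mod_cast hn.trans_le hnm
  have := ENNReal.ofReal_le_ofReal (abs_cubeAvg_sub_le hn hnm hm u x)
  rw [← Real.enorm_eq_ofReal_abs] at this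
  refine this.trans (le_of_eq ?_)
  rw [ENNReal.ofReal_mul (by positivity), ENNReal.ofReal_mul (by positivity),
    ENNReal.ofReal_mul (by positivity), ENNReal.ofReal_pow (by positivity),
    ENNReal.ofReal_inv_of_pos (by positivity), ENNReal.ofReal_pow (by positivity),
    ENNReal.ofReal_natCast, ENNReal.ofReal_sum_of_nonneg fun _ _ =>
      Finset.sum_nonneg fun _ _ => abs_nonneg _]
  simp only [grSum, Real.enorm_eq_ofReal_abs]
  rw [ENNReal.ofReal_ofNat]
  congr 2
  refine Finset.sum_congr rfl fun z _ => ?_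
  rw [ENNReal.ofReal_sum_of_nonneg fun _ _ => abs_nonneg _]

end Averages

end GradPhi

namespace GradPhi

section Sobolev

variable {d L : ℕ}

/-- The edges `(x, i)` with `x ∈ Y`. -/
def edgesFrom (Y : Finset (Torus d L)) : Finset (Edge d L) :=
  Finset.univ.filter fun e => e.1 ∈ Y

theorem mem_edgesFrom {Y : Finset (Torus d L)} {e : Edge d L} : e ∈ edgesFrom Y ↔ e.1 ∈ Y := by
  simp [edgesFrom]

theorem sum_edgesFrom {M : Type*} [AddCommMonoid M] (Y : Finset (Torus d L)) (f : Edge d L → M) :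
    ∑ e ∈ edgesFrom Y, f e = ∑ y ∈ Y, ∑ l, f (y, l) := by
  have : edgesFrom Y = Y ×ˢ (Finset.univ : Finset (Fin d)) := by
    ext e
    simp [mem_edgesFrom]
  rw [this, Finset.sum_product]

/-- Sobolev–Poincaré inequality for the difference to averages over cubes, in the subcritical
range. -/
theorem exists_sobolev_cubeAvg (d : ℕ) {lam q : ℝ} (hlam : 1 ≤ lam) (hq : lam ≤ q)
    (hb : 0 < 1 + d / q - d / lam) :
    ∃ C : ℝ≥0, ∀ (L : ℕ) (u : Torus d L → ℝ) (m : ℕ), 0 < m → m ≤ 2 * L + 1 →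
      ∀ X Y : Finset (Torus d L), (∀ x ∈ X, ∀ z : Fin d → Fin m, x + emb z ∈ Y) →
      (∑ x ∈ X, ‖u x - cubeAvg m u x‖ₑ ^ q) ^ (1 / q) ≤
        C * (m : ℝ≥0∞) ^ (1 + d / q - d / lam) * (∑ y ∈ Y, grSum u y ^ lam) ^ (1 / lam) := by
  set b : ℝ := 1 + d / q - d / lam with hbdef
  have hq0 : 0 < q := by linarith
  have hlam0 : 0 < lam := by linarith
  set ρ : ℝ≥0 := 3 / 4 with hρ
  have hρb : ρ ^ b < 1 := NNReal.rpow_lt_one (by rw [hρ, div_lt_one] <;> norm_num) hb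
  set C : ℝ≥0 := 2 ^ d / (1 - ρ ^ b) with hC
  have hC1 : C * ρ ^ b + 2 ^ d = C := by
    have h1 : (1 - ρ ^ b) ≠ 0 := (tsub_pos_of_lt hρb).ne'
    have h2 : C * (1 - ρ ^ b) = 2 ^ d := by rw [hC]; field_simp
    rw [← h2, ← mul_add, add_tsub_cancel_of_le hρb.le, mul_one]
  refine ⟨C, fun L u m => ?_⟩
  induction m using Nat.strong_induction_on with
  | _ m ih =>
  intro hm hmL X Y hXY
  set H := (∑ y ∈ Y, grSum u y ^ lam) ^ (1 / lam) with hH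
  rcases Nat.lt_or_ge m 2 with h2 | h2
  · have : m = 1 := by omega
    subst this
    simp only [cubeAvg_one, sub_self, enorm_zero, ENNReal.zero_rpow_of_pos hq0,
      Finset.sum_const_zero]
    rw [ENNReal.zero_rpow_of_pos (by positivity)]
    exact zero_le
  · set n := (m + 1) / 2 with hn
    have hn0 : 0 < n := by omega
    have hnm : n < m := by omega
    have hm2n : m ≤ 2 * n := by omega
    have hn4 : 4 * n ≤ 3 * m := by omega
    have hXYn : ∀ x ∈ X, ∀ z : Fin d → Fin n, x + emb z ∈ Y := fun x hx z =>
      hXY x hx fun c => Fin.castLE hnm.le (z c)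
    have h1 := ih n hnm hn0 (by omega) X Y hXYn
    have hmE : (m : ℝ≥0∞) ≠ 0 := by exact_mod_cast hm.ne'
    have hmT : (m : ℝ≥0∞) ≠ ∞ := ENNReal.natCast_ne_top m
    have h3 : (∑ x ∈ X, ‖cubeAvg n u x - cubeAvg m u x‖ₑ ^ q) ^ (1 / q) ≤
        2 ^ d * (m : ℝ≥0∞) ^ b * H := by
      have hY := sum_cubeAvg_rpow_le hm hmL hlam hq X Y hXY (grSum u)
      calc (∑ x ∈ X, ‖cubeAvg n u x - cubeAvg m u x‖ₑ ^ q) ^ (1 / q)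
          ≤ (∑ x ∈ X, (2 ^ d * m * (((m : ℝ≥0∞) ^ d)⁻¹ *
              ∑ z : Fin d → Fin m, grSum u (x + emb z))) ^ q) ^ (1 / q) := by
            gcongr with x hx
            exact enorm_cubeAvg_sub_le hn0 hnm.le hm2n u x
        _ = 2 ^ d * m * (∑ x ∈ X, ((((m : ℝ≥0∞) ^ d)⁻¹ *
              ∑ z : Fin d → Fin m, grSum u (x + emb z))) ^ q) ^ (1 / q) := by
            rw [Finset.sum_congr rfl fun x _ =>
              ENNReal.mul_rpow_of_nonneg (2 ^ d * (m : ℝ≥0∞)) _ hq0.le]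
            rw [← Finset.mul_sum, ENNReal.mul_rpow_of_nonneg _ _ (by positivity : 0 ≤ 1 / q),
              ← ENNReal.rpow_mul, mul_one_div_cancel hq0.ne', ENNReal.rpow_one]
        _ ≤ 2 ^ d * m * ((m : ℝ≥0∞) ^ (d / q - d / lam) * H) := by gcongr
        _ = 2 ^ d * (m : ℝ≥0∞) ^ b * H := by
            have : b = 1 + (d / q - d / lam) := by rw [hbdef]; ring
            rw [this, ENNReal.rpow_add _ _ hmE hmT, ENNReal.rpow_one]
            ring
    have h4 : (n : ℝ≥0∞) ^ b ≤ (ρ : ℝ≥0∞) ^ b * (m : ℝ≥0∞) ^ b := by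
      rw [← ENNReal.mul_rpow_of_nonneg _ _ hb.le]
      refine ENNReal.rpow_le_rpow ?_ hb.le
      have : (n : ℝ≥0) ≤ ρ * m := by
        rw [hρ, ← NNReal.coe_le_coe]
        push_cast
        have : (4 * n : ℝ) ≤ 3 * m := by exact_mod_cast hn4
        linarith
      exact_mod_cast this
    calc (∑ x ∈ X, ‖u x - cubeAvg m u x‖ₑ ^ q) ^ (1 / q)
        ≤ (∑ x ∈ X, (‖u x - cubeAvg n u x‖ₑ + ‖cubeAvg n u x - cubeAvg m u x‖ₑ) ^ q)
            ^ (1 / q) := by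
          gcongr with x hx
          rw [← sub_add_sub_cancel (u x) (cubeAvg n u x) (cubeAvg m u x)]
          exact enorm_add_le _ _
      _ ≤ (∑ x ∈ X, ‖u x - cubeAvg n u x‖ₑ ^ q) ^ (1 / q)
          + (∑ x ∈ X, ‖cubeAvg n u x - cubeAvg m u x‖ₑ ^ q) ^ (1 / q) :=
          ENNReal.Lp_add_le X _ _ (hlam.trans hq)
      _ ≤ C * (n : ℝ≥0∞) ^ b * H + 2 ^ d * (m : ℝ≥0∞) ^ b * H := add_le_add h1 h3
      _ ≤ C * ((ρ : ℝ≥0∞) ^ b * (m : ℝ≥0∞) ^ b) * H + 2 ^ d * (m : ℝ≥0∞) ^ b * H := by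
          gcongr
      _ = ((C * ρ ^ b + 2 ^ d : ℝ≥0) : ℝ≥0∞) * (m : ℝ≥0∞) ^ b * H := by
          push_cast
          rw [ENNReal.coe_rpow_of_nonneg _ hb.le]
          ring
      _ = C * (m : ℝ≥0∞) ^ b * H := by rw [hC1]

theorem rpow_sum_le_of_weight (F : Finset (Edge d L)) (G w : Edge d L → ℝ≥0∞)
    (hw0 : ∀ e ∈ F, w e ≠ 0) (hwT : ∀ e ∈ F, w e ≠ ∞) {lam : ℝ} (h1 : 1 ≤ lam) (h2 : lam < 2) :
    (∑ e ∈ F, G e ^ lam) ^ (1 / lam) ≤ (∑ e ∈ F, w e ^ 2 * G e ^ 2) ^ (1 / 2 : ℝ)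
      * (∑ e ∈ F, (w e)⁻¹ ^ (2 * lam / (2 - lam))) ^ (1 / (2 * lam / (2 - lam))) := by
  have h0 : 0 < lam := by linarith
  have h3 : 0 < 2 - lam := by linarith
  have hc : (2 / lam).HolderConjugate (2 / (2 - lam)) := by
    rw [Real.holderConjugate_iff]
    refine ⟨by rw [lt_div_iff₀ h0]; linarith, ?_⟩
    field_simp
    ring
  have := ENNReal.inner_le_Lp_mul_Lq F (fun e => (w e * G e) ^ lam) (fun e => (w e)⁻¹ ^ lam) hc
  have hl : ∑ e ∈ F, G e ^ lam = ∑ e ∈ F, (w e * G e) ^ lam * (w e)⁻¹ ^ lam := by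
    refine Finset.sum_congr rfl fun e he => ?_
    rw [← ENNReal.mul_rpow_of_nonneg _ _ h0.le, mul_comm (w e), mul_assoc,
      ENNReal.mul_inv_cancel (hw0 e he) (hwT e he), mul_one]
  rw [hl]
  refine (ENNReal.rpow_le_rpow this (by positivity)).trans (le_of_eq ?_)
  rw [ENNReal.mul_rpow_of_nonneg _ _ (by positivity), ← ENNReal.rpow_mul, ← ENNReal.rpow_mul]
  congr 1
  · congr 1
    · refine Finset.sum_congr rfl fun e _ => ?_
      rw [← ENNReal.rpow_mul, mul_div_cancel₀ _ h0.ne', ENNReal.rpow_two, mul_pow]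
    · field_simp
  · congr 1
    · refine Finset.sum_congr rfl fun e _ => ?_
      rw [← ENNReal.rpow_mul]
      congr 1
      field_simp
    · field_simp

theorem rpow_sum_grSum_le (hd : 0 < d) (u : Torus d L → ℝ) (Y : Finset (Torus d L)) {lam : ℝ} (h1 : 1 ≤ lam) :
    (∑ y ∈ Y, grSum u y ^ lam) ^ (1 / lam) ≤
      d * (∑ e ∈ edgesFrom Y, ‖gr u e‖ₑ ^ lam) ^ (1 / lam) := by
  have h0 : 0 < lam := by linarith
  rw [sum_edgesFrom]
  calc (∑ y ∈ Y, grSum u y ^ lam) ^ (1 / lam)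
      ≤ (∑ y ∈ Y, (d : ℝ≥0∞) ^ (lam - 1) * ∑ l, ‖gr u (y, l)‖ₑ ^ lam) ^ (1 / lam) := by
        gcongr with y hy
        have := ENNReal.rpow_sum_le_const_mul_sum_rpow Finset.univ
          (fun l : Fin d => ‖gr u (y, l)‖ₑ) h1
        simpa [grSum] using this
    _ = ((d : ℝ≥0∞) ^ (lam - 1)) ^ (1 / lam)
          * (∑ y ∈ Y, ∑ l, ‖gr u (y, l)‖ₑ ^ lam) ^ (1 / lam) := by
        rw [← Finset.mul_sum, ENNReal.mul_rpow_of_nonneg _ _ (by positivity)]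
    _ ≤ d * (∑ y ∈ Y, ∑ l, ‖gr u (y, l)‖ₑ ^ lam) ^ (1 / lam) := by
        gcongr
        rw [← ENNReal.rpow_mul]
        calc (d : ℝ≥0∞) ^ ((lam - 1) * (1 / lam)) ≤ (d : ℝ≥0∞) ^ (1 : ℝ) := by
                refine ENNReal.rpow_le_rpow_of_exponent_le (by exact_mod_cast hd) ?_
                rw [mul_one_div, div_le_one h0]
                linarith
            _ = d := ENNReal.rpow_one _

theorem rpow_sum_le_avgNorm {q : ℝ} (hq : 0 < q) (U : Finset (Torus d L))
    (F : Finset (Edge d L)) (hF : F ⊆ edgesIn U) (h : Edge d L → ℝ≥0∞) :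
    (∑ e ∈ F, h e ^ q) ^ (1 / q) ≤ avgNorm q U h * (U.card : ℝ≥0∞) ^ (1 / q) := by
  rcases Finset.eq_empty_or_nonempty U with hU | hU
  · have : F = ∅ := by
      refine Finset.subset_empty.1 (hF.trans ?_)
      intro e he
      rw [mem_edgesIn, hU] at he
      simp at he
    rw [this, Finset.sum_empty, ENNReal.zero_rpow_of_pos (by positivity)]
    exact zero_le
  · have h0 : (U.card : ℝ≥0∞) ≠ 0 := by
      exact_mod_cast hU.card_pos.ne'
    unfold avgNorm
    rw [← ENNReal.mul_rpow_of_nonneg _ _ (by positivity),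
      ENNReal.div_mul_cancel h0 (ENNReal.natCast_ne_top _)]
    gcongr

theorem ne_top_of_avgNorm_ne_top {q : ℝ} (hq : 0 < q) {U : Finset (Torus d L)}
    {h : Edge d L → ℝ≥0∞} (hA : avgNorm q U h ≠ ∞) {e : Edge d L} (he : e ∈ edgesIn U) :
    h e ≠ ∞ := by
  intro hT
  have h1 := rpow_sum_le_avgNorm hq U {e} (by simpa using he) h
  rw [Finset.sum_singleton, hT, ENNReal.top_rpow_of_pos hq,
    ENNReal.top_rpow_of_pos (by positivity), top_le_iff] at h1
  exact ENNReal.mul_ne_top hA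
    (ENNReal.rpow_ne_top_of_nonneg (by positivity) (ENNReal.natCast_ne_top _)) h1

/-- Sobolev–Poincaré inequality with a degenerate weight. -/
theorem exists_weighted_sobolev (d : ℕ) (hd : 0 < d) {lam q : ℝ} (hlam : 1 ≤ lam) (hlam2 : lam < 2)
    (hq : lam ≤ q) (hb : 0 < 1 + d / q - d / lam) :
    ∃ C : ℝ≥0, ∀ (L : ℕ) (u : Torus d L → ℝ) (w : Edge d L → ℝ≥0∞) (m : ℕ), 0 < m →
      m ≤ 2 * L + 1 →
      ∀ X Y U : Finset (Torus d L), (∀ x ∈ X, ∀ z : Fin d → Fin m, x + emb z ∈ Y) →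
      edgesFrom Y ⊆ edgesIn U → (∀ e, w e ≠ ∞) →
      avgNorm (2 * lam / (2 - lam)) U (fun e => (w e)⁻¹) ≠ ∞ →
      (∑ x ∈ X, ‖u x - cubeAvg m u x‖ₑ ^ q) ^ (1 / q) ≤
        C * (m : ℝ≥0∞) ^ (1 + d / q - d / lam)
          * (∑ e ∈ edgesFrom Y, w e ^ 2 * ‖gr u e‖ₑ ^ 2) ^ (1 / 2 : ℝ)
          * (avgNorm (2 * lam / (2 - lam)) U (fun e => (w e)⁻¹)
            * (U.card : ℝ≥0∞) ^ (1 / (2 * lam / (2 - lam)))) := by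
  obtain ⟨C, hC⟩ := exists_sobolev_cubeAvg d hlam hq hb
  have htau : 0 < 2 * lam / (2 - lam) := div_pos (by linarith) (by linarith)
  refine ⟨C * d, fun L u w m hm hmL X Y U hXY hYU hwT hA => ?_⟩
  refine (hC L u m hm hmL X Y hXY).trans ?_
  have hw0 : ∀ e ∈ edgesFrom Y, w e ≠ 0 := by
    intro e he h0
    exact ne_top_of_avgNorm_ne_top htau hA (hYU he) (by simp [h0])
  calc (C : ℝ≥0∞) * (m : ℝ≥0∞) ^ (1 + d / q - d / lam) * (∑ y ∈ Y, grSum u y ^ lam) ^ (1 / lam)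
      ≤ C * (m : ℝ≥0∞) ^ (1 + d / q - d / lam) * (d * ((∑ e ∈ edgesFrom Y,
          w e ^ 2 * ‖gr u e‖ₑ ^ 2) ^ (1 / 2 : ℝ) *
          (avgNorm (2 * lam / (2 - lam)) U (fun e => (w e)⁻¹)
            * (U.card : ℝ≥0∞) ^ (1 / (2 * lam / (2 - lam)))))) := by
        gcongr
        refine (rpow_sum_grSum_le hd u Y hlam).trans ?_
        gcongr
        refine (rpow_sum_le_of_weight _ _ w hw0 (fun e _ => hwT e) hlam hlam2).trans ?_
        gcongr
        exact rpow_sum_le_avgNorm htau U _ hYU _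
    _ = _ := by
        push_cast
        ring

end Sobolev

end GradPhi

namespace GradPhi

section Exponents

variable {d : ℕ} {p p' : ℝ}

/-- The common denominator of the exponents `α`, `β`, `γ`. -/
noncomputable def expDenom (d : ℕ) (p p' : ℝ) : ℝ := d ^ 2 * (p + 2) + p * (d + 2) * (p' - d)

theorem expDenom_pos (hd : 2 ≤ d) (hp : (d : ℝ) < p) (hp' : (d : ℝ) < p') :
    0 < expDenom d p p' := by
  have h2 : (2 : ℝ) ≤ d := by exact_mod_cast hd
  have : 0 < p' - d := by linarith
  have : 0 < p := by linarith
  unfold expDenom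
  positivity

theorem thetaCrit_eq (hd : 2 ≤ d) (hp : (d : ℝ) < p) (hp' : (d : ℝ) < p') :
    thetaCrit d p p' = d ^ 2 * (p + 2) / expDenom d p p' := by
  have h2 : (2 : ℝ) ≤ d := by exact_mod_cast hd
  have hd0 : (0 : ℝ) < d := by linarith
  have hp0 : 0 < p := by linarith
  have hQ := expDenom_pos hd hp hp'
  unfold thetaCrit
  rw [inv_eq_iff_eq_inv, inv_div, eq_div_iff (by positivity)]
  have h3 : (d : ℝ) * p + 2 * d = d * (p + 2) := by ring
  rw [h3]
  unfold expDenom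
  field_simp

theorem alphaExp_eq (hd : 2 ≤ d) (hp : (d : ℝ) < p) (hp' : (d : ℝ) < p') :
    alphaExp d p p' = d * p * p' / expDenom d p p' := by
  have h2 : (2 : ℝ) ≤ d := by exact_mod_cast hd
  have hd0 : (0 : ℝ) < d := by linarith
  have hp0 : 0 < p := by linarith
  have hQ := expDenom_pos hd hp hp'
  unfold alphaExp
  rw [thetaCrit_eq hd hp hp']
  field_simp
  unfold expDenom
  ring

theorem betaExp_eq (hd : 2 ≤ d) (hp : (d : ℝ) < p) (hp' : (d : ℝ) < p') :
    betaExp d p p' = 2 * p * (p' - d) / expDenom d p p' := by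
  have h2 : (2 : ℝ) ≤ d := by exact_mod_cast hd
  have hd0 : (0 : ℝ) < d := by linarith
  have hp0 : 0 < p := by linarith
  have hQ := expDenom_pos hd hp hp'
  unfold betaExp
  rw [thetaCrit_eq hd hp hp']
  field_simp
  unfold expDenom
  ring

theorem gammaExp_eq (hd : 2 ≤ d) (hp : (d : ℝ) < p) (hp' : (d : ℝ) < p') :
    gammaExp d p p' = 2 * d ^ 2 / expDenom d p p' := by
  have h2 : (2 : ℝ) ≤ d := by exact_mod_cast hd
  have hd0 : (0 : ℝ) < d := by linarith
  have hp0 : 0 < p := by linarith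
  have hQ := expDenom_pos hd hp hp'
  unfold gammaExp
  rw [thetaCrit_eq hd hp hp']
  field_simp

theorem alphaExp_pos (hd : 2 ≤ d) (hp : (d : ℝ) < p) (hp' : (d : ℝ) < p') :
    0 < alphaExp d p p' := by
  have h2 : (2 : ℝ) ≤ d := by exact_mod_cast hd
  have hQ := expDenom_pos hd hp hp'
  rw [alphaExp_eq hd hp hp']
  have : 0 < p := by linarith
  have : 0 < p' := by linarith
  positivity

theorem betaExp_pos (hd : 2 ≤ d) (hp : (d : ℝ) < p) (hp' : (d : ℝ) < p') :
    0 < betaExp d p p' := by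
  have h2 : (2 : ℝ) ≤ d := by exact_mod_cast hd
  have hQ := expDenom_pos hd hp hp'
  rw [betaExp_eq hd hp hp']
  have : 0 < p := by linarith
  have : 0 < p' - d := by linarith
  positivity

theorem gammaExp_pos (hd : 2 ≤ d) (hp : (d : ℝ) < p) (hp' : (d : ℝ) < p') :
    0 < gammaExp d p p' := by
  have h2 : (2 : ℝ) ≤ d := by exact_mod_cast hd
  have hQ := expDenom_pos hd hp hp'
  rw [gammaExp_eq hd hp hp']
  positivity

theorem exponents_add (hd : 2 ≤ d) (hp : (d : ℝ) < p) (hp' : (d : ℝ) < p') :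
    alphaExp d p p' + betaExp d p p' + gammaExp d p p' = 1 := by
  have hQ := expDenom_pos hd hp hp'
  rw [alphaExp_eq hd hp hp', betaExp_eq hd hp hp', gammaExp_eq hd hp hp', ← add_div, ← add_div,
    div_eq_one_iff_eq hQ.ne']
  unfold expDenom
  ring

/-- Scale invariance of the anchored Nash inequality. -/
theorem exponents_scaling (hd : 2 ≤ d) (hp : (d : ℝ) < p) (hp' : (d : ℝ) < p') :
    d * betaExp d p p' + p * gammaExp d p p' = 2 * alphaExp d p p' := by
  have hQ := expDenom_pos hd hp hp'
  rw [alphaExp_eq hd hp hp', betaExp_eq hd hp hp', gammaExp_eq hd hp hp']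
  field_simp
  ring

end Exponents

section RealOptimization

theorem div_pow_le_of_ceil {A E C0 : ℝ} {d m : ℝ} (hA : 0 < A) (hE : 0 < E) (hC : 0 < C0)
    (hd : 0 < d) (hm : (4 * C0 * A / E) ^ (1 / d) ≤ m) : C0 * (A / m ^ d) ≤ E / 4 := by
  have h0 : 0 < 4 * C0 * A / E := by positivity
  have h1 : 0 < (4 * C0 * A / E) ^ (1 / d) := Real.rpow_pos_of_pos h0 _
  have h2 : 4 * C0 * A / E ≤ m ^ d := by
    calc 4 * C0 * A / E = ((4 * C0 * A / E) ^ (1 / d)) ^ d := by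
          rw [← Real.rpow_mul h0.le, one_div_mul_cancel hd.ne', Real.rpow_one]
      _ ≤ m ^ d := Real.rpow_le_rpow h1.le hm hd.le
  have h3 : 0 < m ^ d := h0.trans_le h2
  rw [div_le_iff₀ hE] at h2
  rw [← mul_div_assoc, div_le_iff₀ h3]
  nlinarith

theorem nash_optimize (d : ℕ) (hd : 2 ≤ d) {p p' : ℝ} (hp : (d : ℝ) < p) (hp' : (d : ℝ) < p')
    {C0 C1 : ℝ} (hC0 : 1 ≤ C0) (hC1 : 1 ≤ C1) :
    ∃ C : ℝ, 0 < C ∧ ∀ (N0 : ℕ) (E A N D h : ℝ), 1 ≤ N0 → 0 < E → E ≤ A → 0 ≤ N → 0 ≤ D → 0 ≤ h →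
      A ≤ C1 * (E + h) ^ (1 - d / p) * N ^ (d / p) →
      (∀ m R : ℕ, 1 ≤ m → m ≤ R → m ≤ N0 →
        E ≤ C0 * ((m : ℝ) ^ (2 * (1 - d / p')) * (R : ℝ) ^ (2 * d / p') * D
          + (if m < N0 then A / (m : ℝ) ^ (d : ℝ) else 0) + N / (R : ℝ) ^ p + h)) →
      E ≤ C * D ^ alphaExp d p p' * A ^ betaExp d p p' * N ^ gammaExp d p p' + C * h := by
  have h2 : (2 : ℝ) ≤ d := by exact_mod_cast hd
  have hd0 : (0 : ℝ) < d := by linarith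
  have hp0 : 0 < p := by linarith
  have hp0' : 0 < p' := by linarith
  have hα := alphaExp_pos hd hp hp'
  have hC00 : 0 < C0 := by linarith
  have hdp : 0 ≤ 1 - d / p := by rw [sub_nonneg, div_le_one hp0]; exact hp.le
  have hdp' : 0 ≤ 1 - d / p' := by rw [sub_nonneg, div_le_one hp0']; exact hp'.le
  set c1 : ℝ := 2 * (4 * C0) ^ (1 / (d : ℝ)) with hc1
  set c2 : ℝ := 3 * (4 * C0 * (C1 * 2)) ^ (1 / (d : ℝ)) + (4 * C0) ^ (1 / p) with hc2
  have hc1p : 0 < c1 := by positivity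
  have hc2p : 0 < c2 := by positivity
  set K : ℝ := 4 * C0 * (c1 ^ (2 * (1 - d / p')) * c2 ^ (2 * d / p')) with hK
  have hKp : 0 < K := by positivity
  refine ⟨K ^ alphaExp d p p' + 4 * C0, by positivity, ?_⟩
  intro N0 E A N D h hN0 hE hEA hN hD hh hA hmain
  have hA0 : 0 < A := hE.trans_le hEA
  have hprod : 0 ≤ D ^ alphaExp d p p' * A ^ betaExp d p p' * N ^ gammaExp d p p' := by positivity
  by_cases hcase : E ≤ 4 * C0 * h
  · have h3 : 0 ≤ K ^ alphaExp d p p' := by positivity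
    have h4 : 0 ≤ (K ^ alphaExp d p p' + 4 * C0) *
        (D ^ alphaExp d p p' * A ^ betaExp d p p' * N ^ gammaExp d p p') :=
      mul_nonneg (by positivity) hprod
    have h5 : 0 ≤ K ^ alphaExp d p p' * h := mul_nonneg h3 hh
    linarith
  push Not at hcase
  have hhE : h ≤ E := by nlinarith
  have hNp : 0 < N := by
    rcases hN.eq_or_lt with h0 | h0
    · rw [← h0, Real.zero_rpow (by positivity), mul_zero] at hA
      linarith
    · exact h0
  -- comparison of the two length scales
  set r : ℝ := (A / E) ^ (1 / (d : ℝ)) with hr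
  set s : ℝ := (N / E) ^ (1 / p) with hs
  have hrp : 0 < r := by positivity
  have hsp : 0 < s := by positivity
  have hr1 : 1 ≤ r := Real.one_le_rpow ((one_le_div hE).2 hEA) (by positivity)
  have hAE : A / E ≤ C1 * 2 * (N / E) ^ (d / p) := by
    have h3 : (E + h) ^ (1 - d / p) ≤ 2 * E ^ (1 - d / p) := by
      calc (E + h) ^ (1 - d / p) ≤ (2 * E) ^ (1 - d / p) := by
            apply Real.rpow_le_rpow (by positivity) (by linarith) hdp
        _ = 2 ^ (1 - d / p) * E ^ (1 - d / p) := Real.mul_rpow (by norm_num) hE.le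
        _ ≤ 2 ^ (1 : ℝ) * E ^ (1 - d / p) := by
            gcongr
            · norm_num
            · have : 0 ≤ d / p := by positivity
              linarith
        _ = _ := by rw [Real.rpow_one]
    rw [div_le_iff₀ hE]
    calc A ≤ C1 * (2 * E ^ (1 - d / p)) * N ^ (d / p) := hA.trans (by gcongr)
      _ = C1 * 2 * (N / E) ^ (d / p) * E := by
          rw [Real.div_rpow hN hE.le, Real.rpow_sub hE, Real.rpow_one]
          field_simp
  have hrs : (4 * C0 * A / E) ^ (1 / (d : ℝ)) ≤ (4 * C0 * (C1 * 2)) ^ (1 / (d : ℝ)) * s := by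
    calc (4 * C0 * A / E) ^ (1 / (d : ℝ)) ≤ (4 * C0 * (C1 * 2) * (N / E) ^ (d / p)) ^ (1 / (d : ℝ)) := by
          apply Real.rpow_le_rpow (by positivity) _ (by positivity)
          calc 4 * C0 * A / E = 4 * C0 * (A / E) := by ring
            _ ≤ 4 * C0 * (C1 * 2 * (N / E) ^ (d / p)) := by gcongr
            _ = _ := by ring
      _ = _ := by
          rw [Real.mul_rpow (by positivity) (by positivity), ← Real.rpow_mul (by positivity), hs]
          congr 2
          field_simp
  have hr0 : (4 * C0 * A / E) ^ (1 / (d : ℝ)) = (4 * C0) ^ (1 / (d : ℝ)) * r := by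
    rw [mul_div_assoc, Real.mul_rpow (by positivity) (by positivity)]
  have hs0 : (4 * C0 * N / E) ^ (1 / p) = (4 * C0) ^ (1 / p) * s := by
    rw [mul_div_assoc, Real.mul_rpow (by positivity) (by positivity)]
  set r0 := (4 * C0 * A / E) ^ (1 / (d : ℝ)) with hr0def
  set s0 := (4 * C0 * N / E) ^ (1 / p) with hs0def
  have hr01 : 1 ≤ r0 := by
    rw [hr0]
    have : 1 ≤ (4 * C0) ^ (1 / (d : ℝ)) := Real.one_le_rpow (by linarith) (by positivity)
    nlinarith
  have hs0p : 0 < s0 := by positivity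
  set m : ℕ := min ⌈r0⌉₊ N0 with hm
  set R : ℕ := max m ⌈s0⌉₊ with hR
  have hm1 : 1 ≤ m := le_min (Nat.one_le_ceil_iff.2 (by linarith)) hN0
  have hR1 : 1 ≤ R := hm1.trans (le_max_left _ _)
  have hmle : (m : ℝ) ≤ 2 * r0 := by
    have h4 : (m : ℝ) ≤ ⌈r0⌉₊ := by exact_mod_cast min_le_left _ _
    have := Nat.ceil_lt_add_one (by linarith : 0 ≤ r0)
    linarith
  have hRle : (R : ℝ) ≤ 3 * r0 + s0 := by
    rw [hR, Nat.cast_max]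
    refine max_le (by linarith) ?_
    have := Nat.ceil_lt_add_one hs0p.le
    linarith
  have hb1 := hmain m R hm1 (le_max_left _ _) (min_le_right _ _)
  have hterm1 : C0 * (if m < N0 then A / (m : ℝ) ^ (d : ℝ) else 0) ≤ E / 4 := by
    split_ifs with hlt
    · refine div_pow_le_of_ceil hA0 hE hC00 hd0 ?_
      have : m = ⌈r0⌉₊ := by omega
      rw [this]
      exact Nat.le_ceil _
    · rw [mul_zero]; positivity
  have hterm2 : C0 * (N / (R : ℝ) ^ p) ≤ E / 4 := by
    refine div_pow_le_of_ceil hNp hE hC00 hp0 ?_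
    exact (Nat.le_ceil _).trans (by exact_mod_cast le_max_right _ _)
  have hmc : (m : ℝ) ≤ c1 * r := by rw [hc1]; linarith
  have hRc : (R : ℝ) ≤ c2 * s := by
    rw [hc2]
    rw [hs0] at hRle
    have : 3 * r0 ≤ 3 * (4 * C0 * (C1 * 2)) ^ (1 / (d : ℝ)) * s := by linarith
    linarith
  have hE4 : E ≤ 4 * C0 * ((m : ℝ) ^ (2 * (1 - d / p')) * (R : ℝ) ^ (2 * d / p') * D) := by
    rw [mul_add, mul_add, mul_add] at hb1
    linarith
  have hE5 : E ≤ K * (A / E) ^ (2 * (1 - d / p') / d) * (N / E) ^ (2 * d / p' / p) * D := by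
    calc E ≤ 4 * C0 * ((c1 * r) ^ (2 * (1 - d / p')) * (c2 * s) ^ (2 * d / p') * D) := by
          refine hE4.trans ?_
          gcongr
      _ = _ := by
          rw [Real.mul_rpow hc1p.le hrp.le, Real.mul_rpow hc2p.le hsp.le, hK, hr, hs,
            ← Real.rpow_mul (by positivity), ← Real.rpow_mul (by positivity)]
          have e1 : 1 / (d : ℝ) * (2 * (1 - d / p')) = 2 * (1 - d / p') / d := by ring
          have e2 : 1 / p * (2 * d / p') = 2 * d / p' / p := by ring
          rw [e1, e2]
          ring
  have hQ := expDenom_pos hd hp hp'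
  have eβ : 2 * (1 - d / p') / d * alphaExp d p p' = betaExp d p p' := by
    rw [alphaExp_eq hd hp hp', betaExp_eq hd hp hp']
    field_simp
  have eγ : 2 * d / p' / p * alphaExp d p p' = gammaExp d p p' := by
    rw [alphaExp_eq hd hp hp', gammaExp_eq hd hp hp']
    field_simp
  have hsum := exponents_add hd hp hp'
  have hE6 : E ≤ K ^ alphaExp d p p' * D ^ alphaExp d p p' * A ^ betaExp d p p'
      * N ^ gammaExp d p p' := by
    have h7 := Real.rpow_le_rpow hE.le hE5 hα.le
    rw [Real.mul_rpow (by positivity) hD, Real.mul_rpow (by positivity) (by positivity),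
      Real.mul_rpow (by positivity) (by positivity), ← Real.rpow_mul (by positivity),
      ← Real.rpow_mul (by positivity), eβ, eγ, Real.div_rpow hA0.le hE.le,
      Real.div_rpow hN hE.le] at h7
    have h8 : E = E ^ alphaExp d p p' * E ^ betaExp d p p' * E ^ gammaExp d p p' := by
      rw [← Real.rpow_add hE, ← Real.rpow_add hE, hsum, Real.rpow_one]
    have hEβ : 0 < E ^ betaExp d p p' := by positivity
    have hEγ : 0 < E ^ gammaExp d p p' := by positivity
    calc E = E ^ alphaExp d p p' * E ^ betaExp d p p' * E ^ gammaExp d p p' := h8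
      _ ≤ (K ^ alphaExp d p p' * (A ^ betaExp d p p' / E ^ betaExp d p p') *
          (N ^ gammaExp d p p' / E ^ gammaExp d p p') * D ^ alphaExp d p p')
            * E ^ betaExp d p p' * E ^ gammaExp d p p' := by gcongr
      _ = _ := by field_simp
  have h9 : 0 ≤ 4 * C0 * (D ^ alphaExp d p p' * A ^ betaExp d p p' * N ^ gammaExp d p p') :=
    mul_nonneg (by positivity) hprod
  have h10 : 0 ≤ (K ^ alphaExp d p p' + 4 * C0) * h := by positivity
  linarith

end RealOptimization

section Lattice

variable {d L : ℕ}

theorem card_starNorm_le {y : ℝ} (hy : 1 ≤ y) :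
    ((Finset.univ.filter fun x : Torus d L => starNorm x ≤ y).card : ℝ) ≤ (3 * y) ^ d := by
  have h0 : 0 ≤ y := by linarith
  have h1 : (Finset.univ.filter fun x : Torus d L => starNorm x ≤ y) ⊆ box d L ⌊y⌋₊ := by
    intro x hx
    rw [Finset.mem_filter] at hx
    exact mem_box_of_starNorm_le (hx.2.trans (Nat.lt_floor_add_one y).le)
  have h2 := (Finset.card_le_card h1).trans (card_box_le _)
  calc ((Finset.univ.filter fun x : Torus d L => starNorm x ≤ y).card : ℝ)
      ≤ ((2 * ⌊y⌋₊ + 1 : ℕ) : ℝ) ^ d := by exact_mod_cast h2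
    _ ≤ (3 * y) ^ d := by
        gcongr
        push_cast
        linarith [Nat.floor_le h0]

theorem sum_inv_one_add_le (d : ℕ) {p : ℝ} (hp : (d : ℝ) < p) :
    ∃ C : ℝ, 0 < C ∧ ∀ (L : ℕ) (ρ : ℝ), 1 ≤ ρ →
      ∑ x : Torus d L, (1 + (starNorm x / ρ) ^ p)⁻¹ ≤ C * ρ ^ d := by
  have hp0 : 0 < p := lt_of_le_of_lt (Nat.cast_nonneg d) hp
  set θ : ℝ := (2 : ℝ) ^ (-(p - d)) with hθ
  have hθ0 : 0 < θ := by positivity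
  have hθ1 : θ < 1 := Real.rpow_lt_one_of_one_lt_of_neg (by norm_num) (by linarith)
  refine ⟨2 ^ p * 3 ^ d * (1 - θ)⁻¹, ?_, fun L ρ hρ => ?_⟩
  · have : 0 < 1 - θ := by linarith
    positivity
  have hρ0 : 0 < ρ := by linarith
  obtain ⟨J, hJ⟩ := pow_unbounded_of_one_lt ((d : ℝ) * L + 1) (by norm_num : (1 : ℝ) < 2)
  have hpt : ∀ x : Torus d L, (1 + (starNorm x / ρ) ^ p)⁻¹ ≤
      ∑ j ∈ Finset.range (J + 1), 2 ^ p * (2 : ℝ) ^ (-(j * p)) *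
        (if starNorm x ≤ 2 ^ j * ρ then 1 else 0) := by
    intro x
    have hx := starNorm_pos x
    have hex : ∃ j, starNorm x ≤ 2 ^ j * ρ := ⟨J, by
      have : (2 : ℝ) ^ J * 1 ≤ 2 ^ J * ρ := by gcongr
      linarith [starNorm_le x]⟩
    classical
    set j := Nat.find hex with hj
    have hjs := Nat.find_spec hex
    rw [← hj] at hjs
    have hjJ : j ≤ J := Nat.find_le (by
      have : (2 : ℝ) ^ J * 1 ≤ 2 ^ J * ρ := by gcongr
      linarith [starNorm_le x])
    refine le_trans ?_ (Finset.single_le_sum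
      (f := fun j : ℕ => 2 ^ p * (2 : ℝ) ^ (-(j * p)) *
        (if starNorm x ≤ 2 ^ j * ρ then (1 : ℝ) else 0))
      (fun i _ => by split_ifs <;> positivity)
      (Finset.mem_range.2 (Nat.lt_succ_of_le hjJ)))
    simp only [hjs, if_true, mul_one]
    have hq0 : 0 ≤ (starNorm x / ρ) ^ p := by positivity
    rcases Nat.eq_zero_or_pos j with h0 | h0
    · rw [h0]
      simp only [Nat.cast_zero, zero_mul, neg_zero, Real.rpow_zero, mul_one]
      calc (1 + (starNorm x / ρ) ^ p)⁻¹ ≤ 1 := inv_le_one_of_one_le₀ (by linarith)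
        _ ≤ 2 ^ p := Real.one_le_rpow (by norm_num) hp0.le
    · have h1 : ¬ starNorm x ≤ 2 ^ (j - 1) * ρ := Nat.find_min hex (by omega)
      push Not at h1
      have h2 : (2 : ℝ) ^ (j - 1) ≤ starNorm x / ρ := by
        rw [le_div_iff₀ hρ0]; exact h1.le
      have h3 : ((2 : ℝ) ^ (j - 1)) ^ p ≤ (starNorm x / ρ) ^ p :=
        Real.rpow_le_rpow (by positivity) h2 hp0.le
      calc (1 + (starNorm x / ρ) ^ p)⁻¹ ≤ (((2 : ℝ) ^ (j - 1)) ^ p)⁻¹ := by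
            apply inv_anti₀ (by positivity)
            linarith
        _ = 2 ^ p * (2 : ℝ) ^ (-(j * p)) := by
            rw [← Real.rpow_natCast, ← Real.rpow_mul (by norm_num), ← Real.rpow_neg (by norm_num),
              ← Real.rpow_add (by norm_num)]
            congr 1
            rw [Nat.cast_sub h0]
            push_cast
            ring
  calc ∑ x : Torus d L, (1 + (starNorm x / ρ) ^ p)⁻¹
      ≤ ∑ x : Torus d L, ∑ j ∈ Finset.range (J + 1), 2 ^ p * (2 : ℝ) ^ (-(j * p)) *
        (if starNorm x ≤ 2 ^ j * ρ then 1 else 0) := Finset.sum_le_sum fun x _ => hpt x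
    _ = ∑ j ∈ Finset.range (J + 1), 2 ^ p * (2 : ℝ) ^ (-(j * p)) *
        ((Finset.univ.filter fun x : Torus d L => starNorm x ≤ 2 ^ j * ρ).card : ℝ) := by
        rw [Finset.sum_comm]
        refine Finset.sum_congr rfl fun j _ => ?_
        rw [← Finset.mul_sum, Finset.sum_boole]
    _ ≤ ∑ j ∈ Finset.range (J + 1), (2 ^ p * 3 ^ d * ρ ^ d) * θ ^ j := by
        refine Finset.sum_le_sum fun j _ => ?_
        have h1 : 1 ≤ (2 : ℝ) ^ j * ρ := by
          have : (1 : ℝ) ≤ 2 ^ j := one_le_pow₀ (by norm_num)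
          nlinarith
        calc 2 ^ p * (2 : ℝ) ^ (-(j * p)) *
            ((Finset.univ.filter fun x : Torus d L => starNorm x ≤ 2 ^ j * ρ).card : ℝ)
            ≤ 2 ^ p * (2 : ℝ) ^ (-(j * p)) * (3 * (2 ^ j * ρ)) ^ d := by
              gcongr
              exact card_starNorm_le h1
          _ = (2 ^ p * 3 ^ d * ρ ^ d) * θ ^ j := by
              rw [hθ, mul_pow, mul_pow, ← pow_mul, ← Real.rpow_natCast (2 : ℝ) (j * d),
                ← Real.rpow_natCast ((2 : ℝ) ^ (-(p - d))) j, ← Real.rpow_mul (by norm_num)]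
              have : (2 : ℝ) ^ (-(p - d) * (j : ℝ)) = (2 : ℝ) ^ (-(j * p)) * 2 ^ (((j * d : ℕ) : ℝ)) := by
                rw [← Real.rpow_add (by norm_num)]
                congr 1
                push_cast
                ring
              rw [this]
              ring
    _ ≤ (2 ^ p * 3 ^ d * ρ ^ d) * (1 - θ)⁻¹ := by
        rw [← Finset.mul_sum]
        gcongr
        rw [← tsum_geometric_of_lt_one hθ0.le hθ1]
        exact (summable_geometric_of_lt_one hθ0.le hθ1).sum_le_tsum _ fun _ _ => by positivity
    _ = _ := by ring

end Lattice

end GradPhi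

namespace GradPhi

section Nash

variable {d L : ℕ}

/-- The weighted Dirichlet energy. -/
noncomputable def gradEnergy (w : Edge d L → ℝ≥0∞) (u : Torus d L → ℝ) : ℝ≥0∞ :=
  ∑ e, w e ^ 2 * ‖gr u e‖ₑ ^ 2

theorem gradEnergy_ne_top {w : Edge d L → ℝ≥0∞} (hw : ∀ e, w e ≠ ∞) (u : Torus d L → ℝ) :
    gradEnergy w u ≠ ∞ := by
  refine ENNReal.sum_ne_top.2 fun e _ => ?_
  exact ENNReal.mul_ne_top (ENNReal.pow_ne_top (hw e)) (ENNReal.pow_ne_top enorm_ne_top)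

theorem sq_rpow_half (a : ℝ≥0∞) : (a ^ (1 / 2 : ℝ)) ^ 2 = a := by
  rw [← ENNReal.rpow_two, ← ENNReal.rpow_mul]
  norm_num

theorem sq_add_le (a b : ℝ≥0∞) : (a + b) ^ 2 ≤ 2 * (a ^ 2 + b ^ 2) := by
  have := ENNReal.rpow_add_le_mul_rpow_add_rpow a b (p := 2) (by norm_num)
  norm_num at this
  simpa using this

theorem sum_sq_le_of_rpow {ι : Type*} (X : Finset ι) (f : ι → ℝ) {B : ℝ≥0∞}
    (h : (∑ x ∈ X, ‖f x‖ₑ ^ (2 : ℝ)) ^ (1 / (2 : ℝ)) ≤ B) : ∑ x ∈ X, ‖f x‖ₑ ^ 2 ≤ B ^ 2 := by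
  have h2 : (∑ x ∈ X, ‖f x‖ₑ ^ 2) ^ (1 / 2 : ℝ) ≤ B := by simpa using h
  calc ∑ x ∈ X, ‖f x‖ₑ ^ 2 = ((∑ x ∈ X, ‖f x‖ₑ ^ 2) ^ (1 / 2 : ℝ)) ^ 2 := (sq_rpow_half _).symm
    _ ≤ B ^ 2 := by gcongr

theorem exists_nash_box (d : ℕ) (hd : 2 ≤ d) {p' : ℝ} (hp' : (d : ℝ) < p') :
    ∃ C : ℝ≥0, 1 ≤ C ∧ ∀ (L : ℕ), 1 ≤ L → ∀ (u : Torus d L → ℝ), ∑ x, u x = 0 →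
      ∀ (w : Edge d L → ℝ≥0∞), (∀ e, w e ≠ ∞) → ∀ W : ℝ≥0∞, W ≠ ∞ →
      (∀ r ∈ Finset.Icc 1 L, avgNorm p' (box d L r) (fun e => (w e)⁻¹) ^ 2 ≤ W) →
      ∀ m R : ℕ, 1 ≤ m → m ≤ R → m ≤ 2 * L + 1 →
      ∑ x ∈ box d L R, ‖u x‖ₑ ^ 2 ≤
        C * ((m : ℝ≥0∞) ^ (2 * (1 - d / p')) * (R : ℝ≥0∞) ^ (2 * d / p') * (W * gradEnergy w u)
          + if m < 2 * L + 1 then ((m : ℝ≥0∞) ^ (d : ℝ))⁻¹ * (∑ x, ‖u x‖ₑ) ^ 2 else 0) := by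
  have h2 : (2 : ℝ) ≤ d := by exact_mod_cast hd
  have hd0 : (0 : ℝ) < d := by linarith
  have hp0 : 0 < p' := by linarith
  set lam : ℝ := 2 * p' / (p' + 2) with hlam
  have hlam1 : 1 ≤ lam := by rw [hlam, le_div_iff₀ (by linarith)]; linarith
  have hlam2 : lam < 2 := by rw [hlam, div_lt_iff₀ (by linarith)]; linarith
  have htau : 2 * lam / (2 - lam) = p' := by
    rw [div_eq_iff (by linarith), hlam]
    field_simp
    ring
  have hbeq : 1 + (d : ℝ) / 2 - d / lam = 1 - d / p' := by
    rw [hlam]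
    field_simp
    ring
  have hb : 0 < 1 + (d : ℝ) / 2 - d / lam := by
    rw [hbeq, sub_pos, div_lt_one hp0]
    exact hp'
  obtain ⟨C, hC⟩ := exists_weighted_sobolev d (by omega) hlam1 hlam2 hlam2.le hb
  rw [hbeq, htau] at hC
  refine ⟨2 * (C ^ 2 * 7 ^ (2 * d / p')) + 2, le_add_of_nonneg_of_le (by positivity) (by norm_num),
    ?_⟩
  intro L hL u hu w hw W hW hWr m R hm hmR hmL
  have hR1 : 1 ≤ R := hm.trans hmR
  set U := box d L (R + m + 1) with hU
  have hUmin : U = box d L (min (R + m + 1) L) := (box_min _).symm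
  have hAW : avgNorm p' U (fun e => (w e)⁻¹) ^ 2 ≤ W := by
    rw [hUmin]
    exact hWr _ (Finset.mem_Icc.2 ⟨le_min (by omega) hL, min_le_right _ _⟩)
  have hA : avgNorm p' U (fun e => (w e)⁻¹) ≠ ∞ := by
    intro hT
    rw [hT, ENNReal.top_pow (by norm_num), top_le_iff] at hAW
    exact hW hAW
  have hXY : ∀ x ∈ box d L R, ∀ z : Fin d → Fin m, x + emb z ∈ box d L (R + m) :=
    fun x hx z => add_emb_mem_box hx z
  have hYU : edgesFrom (box d L (R + m)) ⊆ edgesIn U := by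
    intro e he
    rw [mem_edgesFrom] at he
    exact mem_edgesIn.2 ⟨box_mono (Nat.le_succ _) he, mem_box_succ_of_shift he⟩
  have hS := hC L u w m hm hmL _ _ U hXY hYU hw hA
  have hmE : (m : ℝ≥0∞) ≠ 0 := by exact_mod_cast (by omega : m ≠ 0)
  have hmT : (m : ℝ≥0∞) ≠ ∞ := ENNReal.natCast_ne_top m
  have hcard : ((U.card : ℝ≥0∞) ^ (1 / p')) ^ 2 ≤ ((7 : ℝ≥0) ^ (2 * d / p') : ℝ≥0) *
      (R : ℝ≥0∞) ^ (2 * d / p') := by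
    have h1 : U.card ≤ (7 * R) ^ d :=
      (card_box_le _).trans (Nat.pow_le_pow_left (by omega) d)
    have h3 : (U.card : ℝ≥0∞) ≤ ((7 : ℝ≥0) * (R : ℝ≥0∞)) ^ (d : ℝ) := by
      rw [ENNReal.rpow_natCast]
      exact_mod_cast h1
    calc ((U.card : ℝ≥0∞) ^ (1 / p')) ^ 2 = (U.card : ℝ≥0∞) ^ (2 / p') := by
          rw [← ENNReal.rpow_two, ← ENNReal.rpow_mul]
          congr 1
          ring
      _ ≤ (((7 : ℝ≥0) * (R : ℝ≥0∞)) ^ (d : ℝ)) ^ (2 / p') := by gcongr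
      _ = _ := by
          rw [← ENNReal.rpow_mul, ENNReal.mul_rpow_of_nonneg _ _ (by positivity),
            ENNReal.coe_rpow_of_nonneg _ (by positivity)]
          have e : (d : ℝ) * (2 / p') = 2 * d / p' := by ring
          rw [e]
  have hS2 : ∑ x ∈ box d L R, ‖u x - cubeAvg m u x‖ₑ ^ 2 ≤
      (C ^ 2 * 7 ^ (2 * d / p') : ℝ≥0) * ((m : ℝ≥0∞) ^ (2 * (1 - d / p')) *
        (R : ℝ≥0∞) ^ (2 * d / p') * (W * gradEnergy w u)) := by
    refine (sum_sq_le_of_rpow _ _ hS).trans ?_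
    have h4 : ∑ e ∈ edgesFrom (box d L (R + m)), w e ^ 2 * ‖gr u e‖ₑ ^ 2 ≤ gradEnergy w u :=
      Finset.sum_le_sum_of_subset (Finset.subset_univ _)
    have h5 : ((m : ℝ≥0∞) ^ (1 - d / p')) ^ 2 = (m : ℝ≥0∞) ^ (2 * (1 - d / p')) := by
      rw [← ENNReal.rpow_two, ← ENNReal.rpow_mul]
      congr 1
      ring
    rw [mul_pow, mul_pow, mul_pow, mul_pow, sq_rpow_half, h5]
    calc (C : ℝ≥0∞) ^ 2 * (m : ℝ≥0∞) ^ (2 * (1 - d / p')) *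
          (∑ e ∈ edgesFrom (box d L (R + m)), w e ^ 2 * ‖gr u e‖ₑ ^ 2) *
          (avgNorm p' U (fun e => (w e)⁻¹) ^ 2 * ((U.card : ℝ≥0∞) ^ (1 / p')) ^ 2)
        ≤ (C : ℝ≥0∞) ^ 2 * (m : ℝ≥0∞) ^ (2 * (1 - d / p')) * gradEnergy w u *
          (W * (((7 : ℝ≥0) ^ (2 * d / p') : ℝ≥0) * (R : ℝ≥0∞) ^ (2 * d / p'))) := by
          gcongr
      _ = _ := by
          push_cast
          ring
  have hAv : ∑ x ∈ box d L R, ‖cubeAvg m u x‖ₑ ^ 2 ≤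
      if m < 2 * L + 1 then ((m : ℝ≥0∞) ^ (d : ℝ))⁻¹ * (∑ x, ‖u x‖ₑ) ^ 2 else 0 := by
    split_ifs with hlt
    · have h6 := sum_cubeAvg_rpow_le hm hmL le_rfl (by norm_num : (1 : ℝ) ≤ 2) _ _ hXY
        (fun x => ‖u x‖ₑ)
      have h7 : (∑ x ∈ box d L R, ‖cubeAvg m u x‖ₑ ^ (2 : ℝ)) ^ (1 / (2 : ℝ)) ≤ _ :=
        le_trans (by gcongr with x hx; exact enorm_cubeAvg_le hm u x) h6
      refine (sum_sq_le_of_rpow _ _ h7).trans ?_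
      have h8 : ((m : ℝ≥0∞) ^ ((d : ℝ) / 2 - d / 1)) ^ 2 = ((m : ℝ≥0∞) ^ (d : ℝ))⁻¹ := by
        rw [← ENNReal.rpow_two, ← ENNReal.rpow_mul, ← ENNReal.rpow_neg]
        congr 1
        ring
      rw [mul_pow, h8]
      simp only [ENNReal.rpow_one, div_one]
      gcongr
      exact Finset.subset_univ _
    · have : m = 2 * L + 1 := by omega
      subst this
      simp [cubeAvg_full u hu]
  have hC7 : (2 : ℝ≥0∞) * (C ^ 2 * 7 ^ (2 * d / p') : ℝ≥0) ≤
      (2 * (C ^ 2 * 7 ^ (2 * d / p')) + 2 : ℝ≥0) := by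
    push_cast
    exact le_self_add
  have hC8 : (2 : ℝ≥0∞) ≤ (2 * (C ^ 2 * 7 ^ (2 * d / p')) + 2 : ℝ≥0) := by
    push_cast
    exact le_add_self
  calc ∑ x ∈ box d L R, ‖u x‖ₑ ^ 2
      ≤ ∑ x ∈ box d L R, 2 * (‖u x - cubeAvg m u x‖ₑ ^ 2 + ‖cubeAvg m u x‖ₑ ^ 2) := by
        refine Finset.sum_le_sum fun x _ => ?_
        refine le_trans ?_ (sq_add_le _ _)
        gcongr
        conv_lhs => rw [← sub_add_cancel (u x) (cubeAvg m u x)]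
        exact enorm_add_le _ _
    _ = 2 * ∑ x ∈ box d L R, ‖u x - cubeAvg m u x‖ₑ ^ 2
          + 2 * ∑ x ∈ box d L R, ‖cubeAvg m u x‖ₑ ^ 2 := by
        rw [← Finset.mul_sum, Finset.sum_add_distrib, mul_add]
    _ ≤ 2 * ((C ^ 2 * 7 ^ (2 * d / p') : ℝ≥0) * ((m : ℝ≥0∞) ^ (2 * (1 - d / p')) *
          (R : ℝ≥0∞) ^ (2 * d / p') * (W * gradEnergy w u)))
          + 2 * (if m < 2 * L + 1 then ((m : ℝ≥0∞) ^ (d : ℝ))⁻¹ * (∑ x, ‖u x‖ₑ) ^ 2 else 0) := by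
        gcongr
    _ ≤ _ := by
        rw [mul_add, ← mul_assoc]
        gcongr

theorem ofReal_sum_sq (u : Torus d L → ℝ) (s : Finset (Torus d L)) :
    ENNReal.ofReal (∑ x ∈ s, u x ^ 2) = ∑ x ∈ s, ‖u x‖ₑ ^ 2 := by
  rw [ENNReal.ofReal_sum_of_nonneg fun _ _ => sq_nonneg _]
  refine Finset.sum_congr rfl fun x _ => ?_
  rw [← sq_abs, ENNReal.ofReal_pow (abs_nonneg _), Real.enorm_eq_ofReal_abs]

/-- Poincaré inequality on the torus with a degenerate weight. -/
theorem exists_poincare (d : ℕ) (hd : 2 ≤ d) {p' : ℝ} (hp' : (d : ℝ) < p') :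
    ∃ C : ℝ≥0, 1 ≤ C ∧ ∀ (L : ℕ), 1 ≤ L → ∀ (u : Torus d L → ℝ), ∑ x, u x = 0 →
      ∀ (w : Edge d L → ℝ≥0∞), (∀ e, w e ≠ ∞) → ∀ W : ℝ≥0∞, W ≠ ∞ →
      (∀ r ∈ Finset.Icc 1 L, avgNorm p' (box d L r) (fun e => (w e)⁻¹) ^ 2 ≤ W) →
      ENNReal.ofReal (∑ x, u x ^ 2) ≤ C * (L : ℝ≥0∞) ^ 2 * (W * gradEnergy w u) := by
  obtain ⟨C, hC1, hC⟩ := exists_nash_box d hd hp'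
  have hd0 : (0 : ℝ) < d := by exact_mod_cast (by omega : 0 < d)
  have hp0 : 0 < p' := by linarith
  refine ⟨C * 9, hC1.trans (le_mul_of_one_le_right (by positivity) (by norm_num)), ?_⟩
  intro L hL u hu w hw W hW hWr
  have h := hC L hL u hu w hw W hW hWr (2 * L + 1) (2 * L + 1) (by omega) le_rfl le_rfl
  rw [box_eq_univ (by omega), if_neg (lt_irrefl _), add_zero] at h
  rw [ofReal_sum_sq]
  refine h.trans ?_
  have h1 : (((2 * L + 1 : ℕ) : ℝ≥0∞)) ^ (2 * (1 - d / p')) * ((2 * L + 1 : ℕ) : ℝ≥0∞) ^ (2 * d / p')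
      = ((2 * L + 1 : ℕ) : ℝ≥0∞) ^ 2 := by
    rw [← ENNReal.rpow_add _ _ (by simp) (ENNReal.natCast_ne_top _),
      ← ENNReal.rpow_two]
    congr 1
    ring
  rw [h1]
  have h2 : ((2 * L + 1 : ℕ) : ℝ≥0∞) ^ 2 ≤ 9 * (L : ℝ≥0∞) ^ 2 := by
    have : (2 * L + 1) ^ 2 ≤ 9 * L ^ 2 := by nlinarith
    exact_mod_cast this
  calc (C : ℝ≥0∞) * (((2 * L + 1 : ℕ) : ℝ≥0∞) ^ 2 * (W * gradEnergy w u))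
      ≤ C * (9 * (L : ℝ≥0∞) ^ 2 * (W * gradEnergy w u)) := by gcongr
    _ = _ := by push_cast; ring

theorem sq_sum_abs_le (d : ℕ) {p : ℝ} (hp : (d : ℝ) < p) :
    ∃ C : ℝ, 1 ≤ C ∧ ∀ (L : ℕ) (U : Torus d L → ℝ),
      (∑ x, |U x|) ^ 2 ≤ C * (∑ x, U x ^ 2) ^ (1 - d / p)
        * (∑ x, starNorm x ^ p * U x ^ 2) ^ (d / p) := by
  obtain ⟨C, hC0, hC⟩ := sum_inv_one_add_le d hp
  have hp0 : 0 < p := lt_of_le_of_lt (Nat.cast_nonneg d) hp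
  refine ⟨2 * C + 1, by linarith, fun L U => ?_⟩
  set E := ∑ x, U x ^ 2 with hE
  set N := ∑ x, starNorm x ^ p * U x ^ 2 with hN
  have hEN : E ≤ N := Finset.sum_le_sum fun x _ =>
    le_mul_of_one_le_left (sq_nonneg _) (Real.one_le_rpow (one_le_starNorm x) hp0.le)
  have hE0 : 0 ≤ E := Finset.sum_nonneg fun _ _ => sq_nonneg _
  rcases hE0.eq_or_lt with h0 | h0
  · have hz : ∀ x, U x = 0 := by
      intro x
      have := (Finset.sum_eq_zero_iff_of_nonneg (fun x _ => sq_nonneg (U x))).1 h0.symm x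
        (Finset.mem_univ x)
      simpa using this
    have hl : ∑ x, |U x| = 0 := Finset.sum_eq_zero fun x _ => by rw [hz x, abs_zero]
    rw [hl, zero_pow two_ne_zero]
    have : 0 ≤ N := hE0.trans hEN
    positivity
  have hN0 : 0 < N := h0.trans_le hEN
  clear_value E N
  set ρ : ℝ := (N / E) ^ (1 / p) with hρ
  have hρ0 : 0 < ρ := by positivity
  have hρ1 : 1 ≤ ρ := Real.one_le_rpow ((one_le_div h0).2 hEN) (by positivity)
  have hρp : ρ ^ p = N / E := by
    rw [hρ, ← Real.rpow_mul (by positivity), one_div_mul_cancel hp0.ne', Real.rpow_one]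
  have hρd : ρ ^ d = (N / E) ^ (d / p) := by
    rw [hρ, ← Real.rpow_natCast, ← Real.rpow_mul (by positivity)]
    congr 1
    ring
  have hpos : ∀ x : Torus d L, 0 < 1 + (starNorm x / ρ) ^ p := fun x => by
    have := starNorm_pos x
    positivity
  have hCS : (∑ x, |U x|) ^ 2 ≤ (∑ x, U x ^ 2 * (1 + (starNorm x / ρ) ^ p))
      * ∑ x : Torus d L, (1 + (starNorm x / ρ) ^ p)⁻¹ := by
    refine Finset.sum_sq_le_sum_mul_sum_of_sq_le_mul _ ?_ ?_ ?_
    · intro x _; have := hpos x; positivity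
    · intro x _; have := hpos x; positivity
    · intro x _
      have := hpos x
      rw [sq_abs, mul_assoc, mul_inv_cancel₀ this.ne', mul_one]
  have h1 : ∑ x, U x ^ 2 * (1 + (starNorm x / ρ) ^ p) = 2 * E := by
    have : ∀ x, U x ^ 2 * (1 + (starNorm x / ρ) ^ p) =
        U x ^ 2 + (E / N) * (starNorm x ^ p * U x ^ 2) := by
      intro x
      rw [Real.div_rpow (starNorm_pos x).le hρ0.le, hρp]
      field_simp
    simp only [this, Finset.sum_add_distrib, ← Finset.mul_sum]
    rw [← hE, ← hN]
    field_simp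
    ring
  calc (∑ x, |U x|) ^ 2 ≤ (2 * E) * (C * ρ ^ d) := by
        rw [← h1]
        refine hCS.trans ?_
        gcongr
        · rw [h1]; positivity
        · exact hC L ρ hρ1
    _ = 2 * C * E ^ (1 - d / p) * N ^ (d / p) := by
        rw [hρd, Real.div_rpow hN0.le h0.le, Real.rpow_sub h0, Real.rpow_one]
        field_simp
    _ ≤ (2 * C + 1) * E ^ (1 - d / p) * N ^ (d / p) := by
        gcongr
        linarith

set_option maxHeartbeats 1000000 in
/-- The anchored Nash inequality on the torus with a degenerate weight.  The weight
`|x|_*^p` may be tested against a shift of `u` by a constant. -/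
theorem exists_anchored_nash (d : ℕ) (hd : 2 ≤ d) {p p' : ℝ} (hp : (d : ℝ) < p)
    (hp' : (d : ℝ) < p') :
    ∃ C : ℝ≥0, 1 ≤ C ∧ ∀ (L : ℕ), 1 ≤ L → ∀ (u : Torus d L → ℝ), ∑ x, u x = 0 → ∀ η : ℝ,
      ∀ (w : Edge d L → ℝ≥0∞), (∀ e, w e ≠ ∞) → ∀ W : ℝ≥0∞, W ≠ ∞ →
      (∀ r ∈ Finset.Icc 1 L, avgNorm p' (box d L r) (fun e => (w e)⁻¹) ^ 2 ≤ W) →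
      ENNReal.ofReal (∑ x, u x ^ 2) ≤
        C * (W * gradEnergy w u) ^ alphaExp d p p'
          * ENNReal.ofReal ((∑ x, |u x|) ^ 2) ^ betaExp d p p'
          * ENNReal.ofReal (∑ x, starNorm x ^ p * (u x + η) ^ 2) ^ gammaExp d p p'
        + C * ENNReal.ofReal (Fintype.card (Torus d L) * η ^ 2) := by
  obtain ⟨C0, hC01, hC0⟩ := exists_nash_box d hd hp'
  obtain ⟨C1, hC11, hC1⟩ := sq_sum_abs_le d hp
  have hC0r : (1 : ℝ) ≤ 2 * C0 := by
    have : (1 : ℝ) ≤ C0 := by exact_mod_cast hC01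
    linarith
  have hC2 : (2 : ℝ) ≤ 2 * C0 := by
    have : (1 : ℝ) ≤ C0 := by exact_mod_cast hC01
    linarith
  obtain ⟨C, hCpos, hC⟩ := nash_optimize d hd hp hp' hC0r (by linarith : 1 ≤ 4 * C1)
  refine ⟨⟨C, hCpos.le⟩ + 1, le_add_self, ?_⟩
  intro L hL u hu η w hw W hW hWr
  have hp0 : 0 < p := lt_of_le_of_lt (Nat.cast_nonneg d) hp
  have hα := alphaExp_pos hd hp hp'
  have hβ := betaExp_pos hd hp hp'
  have hγ := gammaExp_pos hd hp hp'
  set E := ∑ x, u x ^ 2 with hE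
  set A := (∑ x, |u x|) ^ 2 with hA
  set N := ∑ x, starNorm x ^ p * (u x + η) ^ 2 with hN
  set h := Fintype.card (Torus d L) * η ^ 2 with hh
  have hDtop : W * gradEnergy w u ≠ ∞ := ENNReal.mul_ne_top hW (gradEnergy_ne_top hw u)
  set D := (W * gradEnergy w u).toReal with hD
  have hN0 : 0 ≤ N := Finset.sum_nonneg fun x _ =>
    mul_nonneg (Real.rpow_nonneg (starNorm_pos x).le _) (sq_nonneg _)
  have hh0 : 0 ≤ h := by positivity
  have hA0 : 0 ≤ A := sq_nonneg _
  have hreal : E ≤ C * D ^ alphaExp d p p' * A ^ betaExp d p p' * N ^ gammaExp d p p' + C * h := by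
    rcases (Finset.sum_nonneg fun x _ => sq_nonneg (u x) : 0 ≤ E).eq_or_lt with hE0 | hE0
    · have hE00 : E = 0 := hE0.symm
      rw [hE00]
      have : 0 ≤ D := ENNReal.toReal_nonneg
      positivity
    have hEU : ∑ x, (u x + η) ^ 2 = E + h := by
      have : ∀ x, (u x + η) ^ 2 = u x ^ 2 + (2 * η) * u x + η ^ 2 := fun x => by ring
      simp only [this, Finset.sum_add_distrib, ← Finset.mul_sum, hu, Finset.sum_const,
        Finset.card_univ, nsmul_eq_mul]
      rw [hE, hh]
      ring
    refine hC (2 * L + 1) E A N D h (by omega) hE0 ?_ hN0 ENNReal.toReal_nonneg hh0 ?_ ?_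
    · have h1 := Finset.sum_sq_le_sq_sum_of_nonneg (s := Finset.univ) (f := fun x => |u x|)
        fun _ _ => abs_nonneg _
      simpa [hE, hA] using h1
    · have h1 := hC1 L fun x => u x + η
      rw [hEU] at h1
      have h2 : ∑ x, |u x| ≤ 2 * ∑ x, |u x + η| := by
        have h3 : ∑ x, (u x + η) = Fintype.card (Torus d L) * η := by
          rw [Finset.sum_add_distrib, hu]
          simp
        have h4 : Fintype.card (Torus d L) * |η| ≤ ∑ x, |u x + η| := by
          calc Fintype.card (Torus d L) * |η| = |∑ x, (u x + η)| := by
                rw [h3, abs_mul, Nat.abs_cast]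
            _ ≤ _ := Finset.abs_sum_le_sum_abs _ _
        have h5 : ∑ x, |u x| ≤ ∑ x, (|u x + η| + |η|) := by
          refine Finset.sum_le_sum fun x _ => ?_
          have := abs_sub (u x + η) η
          rwa [add_sub_cancel_right] at this
        rw [Finset.sum_add_distrib] at h5
        simp only [Finset.sum_const, Finset.card_univ, nsmul_eq_mul] at h5
        linarith
      calc A ≤ (2 * ∑ x, |u x + η|) ^ 2 := by
            rw [hA]
            exact pow_le_pow_left₀ (Finset.sum_nonneg fun _ _ => abs_nonneg _) h2 2
        _ = 4 * (∑ x, |u x + η|) ^ 2 := by ring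
        _ ≤ 4 * (C1 * (E + h) ^ (1 - d / p) * N ^ (d / p)) := by gcongr
        _ = _ := by ring
    · intro m R hm hmR hmL
      have h1 := hC0 L hL u hu w hw W hW hWr m R hm hmR hmL
      have hm0 : (0 : ℝ) < m := by exact_mod_cast hm
      have hR0 : (0 : ℝ) < R := by exact_mod_cast hm.trans hmR
      have h2 : ∑ x ∈ box d L R, u x ^ 2 ≤ C0 * ((m : ℝ) ^ (2 * (1 - d / p')) *
          (R : ℝ) ^ (2 * d / p') * D
          + (if m < 2 * L + 1 then A / (m : ℝ) ^ (d : ℝ) else 0)) := by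
        rw [← ofReal_sum_sq] at h1
        have hifnn : 0 ≤ if m < 2 * L + 1 then A / (m : ℝ) ^ (d : ℝ) else 0 := by
          split_ifs <;> positivity
        have hDnn : 0 ≤ D := ENNReal.toReal_nonneg
        rw [← ENNReal.ofReal_le_ofReal_iff (by positivity)]
        refine h1.trans (le_of_eq ?_)
        rw [ENNReal.ofReal_mul (by positivity), ENNReal.ofReal_add (by positivity) hifnn,
          ENNReal.ofReal_mul (by positivity), ENNReal.ofReal_mul (by positivity),
          ENNReal.ofReal_toReal hDtop, ENNReal.ofReal_coe_nnreal,
          ← ENNReal.ofReal_rpow_of_pos hm0, ← ENNReal.ofReal_rpow_of_pos hR0,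
          ENNReal.ofReal_natCast, ENNReal.ofReal_natCast]
        congr 2
        split_ifs
        · rw [ENNReal.ofReal_div_of_pos (by positivity), ← ENNReal.ofReal_rpow_of_pos hm0,
            ENNReal.ofReal_natCast, ENNReal.div_eq_inv_mul, hA,
            ENNReal.ofReal_pow (Finset.sum_nonneg fun _ _ => abs_nonneg _),
            ENNReal.ofReal_sum_of_nonneg fun _ _ => abs_nonneg _]
          simp only [Real.enorm_eq_ofReal_abs]
        · simp
      have h3 : ∑ x ∈ (box d L R)ᶜ, u x ^ 2 ≤ 2 * (N / (R : ℝ) ^ p) + 2 * h := by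
        calc ∑ x ∈ (box d L R)ᶜ, u x ^ 2
            ≤ ∑ x ∈ (box d L R)ᶜ, (2 * (starNorm x ^ p * (u x + η) ^ 2 / (R : ℝ) ^ p)
                + 2 * η ^ 2) := by
              refine Finset.sum_le_sum fun x hx => ?_
              have h5 : (R : ℝ) ≤ starNorm x := by
                by_contra hcon
                push Not at hcon
                rw [Finset.mem_compl] at hx
                exact hx (mem_box_of_starNorm_le (by linarith))
              have h6 : (R : ℝ) ^ p ≤ starNorm x ^ p := Real.rpow_le_rpow hR0.le h5 hp0.le
              have h7 : (u x + η) ^ 2 ≤ starNorm x ^ p * (u x + η) ^ 2 / (R : ℝ) ^ p := by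
                rw [le_div_iff₀ (by positivity), mul_comm]
                gcongr
              nlinarith [sq_nonneg (u x + 2 * η)]
          _ ≤ ∑ x, (2 * (starNorm x ^ p * (u x + η) ^ 2 / (R : ℝ) ^ p) + 2 * η ^ 2) := by
              refine Finset.sum_le_sum_of_subset_of_nonneg (Finset.subset_univ _) fun x _ _ => ?_
              have := starNorm_pos x
              positivity
          _ = 2 * (N / (R : ℝ) ^ p) + 2 * h := by
              rw [Finset.sum_add_distrib, ← Finset.mul_sum, ← Finset.sum_div, hN, hh]
              simp only [Finset.sum_const, Finset.card_univ, nsmul_eq_mul]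
              ring
      have h4 : E = ∑ x ∈ box d L R, u x ^ 2 + ∑ x ∈ (box d L R)ᶜ, u x ^ 2 :=
        (Finset.sum_add_sum_compl _ _).symm
      have h5 : 0 ≤ N / (R : ℝ) ^ p := by positivity
      have h6 : 2 * (N / (R : ℝ) ^ p) ≤ 2 * C0 * (N / (R : ℝ) ^ p) :=
        mul_le_mul_of_nonneg_right hC2 h5
      have h7 : 2 * h ≤ 2 * C0 * h := mul_le_mul_of_nonneg_right hC2 hh0
      have h8 : ∀ X Y : ℝ, 0 ≤ X + Y → C0 * (X + Y) + 2 * C0 * (N / (R : ℝ) ^ p) + 2 * C0 * h ≤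
          2 * C0 * (X + Y + N / (R : ℝ) ^ p + h) := by
        intro X Y hXY
        have : 0 ≤ C0 * (X + Y) := mul_nonneg C0.2 hXY
        linarith
      refine le_trans ?_ (h8 _ _ ?_)
      · linarith
      · have hDnn : 0 ≤ D := ENNReal.toReal_nonneg
        have hifnn : 0 ≤ if m < 2 * L + 1 then A / (m : ℝ) ^ (d : ℝ) else 0 := by
          split_ifs <;> positivity
        positivity
  have hD0 : 0 ≤ D := ENNReal.toReal_nonneg
  calc ENNReal.ofReal E ≤ ENNReal.ofReal (C * D ^ alphaExp d p p' * A ^ betaExp d p p'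
        * N ^ gammaExp d p p' + C * h) := ENNReal.ofReal_le_ofReal hreal
    _ = ENNReal.ofReal C * (W * gradEnergy w u) ^ alphaExp d p p'
          * ENNReal.ofReal A ^ betaExp d p p' * ENNReal.ofReal N ^ gammaExp d p p'
          + ENNReal.ofReal C * ENNReal.ofReal h := by
        rw [ENNReal.ofReal_add (by positivity) (by positivity), ENNReal.ofReal_mul (by positivity),
          ENNReal.ofReal_mul (by positivity), ENNReal.ofReal_mul (by positivity),
          ENNReal.ofReal_mul hCpos.le, ← ENNReal.ofReal_rpow_of_nonneg hD0 hα.le,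
          ← ENNReal.ofReal_rpow_of_nonneg hA0 hβ.le, ← ENNReal.ofReal_rpow_of_nonneg hN0 hγ.le,
          ENNReal.ofReal_toReal hDtop]
    _ ≤ _ := by
        have : ENNReal.ofReal C ≤ ((⟨C, hCpos.le⟩ + 1 : ℝ≥0) : ℝ≥0∞) := by
          rw [ENNReal.ofReal_eq_coe_nnreal hCpos.le]
          exact_mod_cast le_self_add
        gcongr

end Nash

end GradPhi

namespace GradPhi

section InterpolationExponents

variable {d : ℕ}

theorem kapExp_eq (hd : 2 ≤ d) : kapExp d = d * (2 * d + 2) / (d ^ 2 - 2) := by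
  have h2 : (2 : ℝ) ≤ d := by exact_mod_cast hd
  have h3 : (0 : ℝ) < d ^ 2 - 2 := by nlinarith
  have h4 : (d : ℝ) - (2 * d + 2) / (d + 2) = (d ^ 2 - 2) / (d + 2) := by
    field_simp
    ring
  unfold kapExp lamExp
  rw [h4]
  field_simp

theorem two_lt_kapExp (hd : 2 ≤ d) : 2 < kapExp d := by
  have h2 : (2 : ℝ) ≤ d := by exact_mod_cast hd
  have h3 : (0 : ℝ) < d ^ 2 - 2 := by nlinarith
  rw [kapExp_eq hd, lt_div_iff₀ h3]
  nlinarith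

theorem lamExp'_bounds (d : ℕ) : 1 ≤ lamExp' d ∧ lamExp' d < 2 := by
  have h0 : (0 : ℝ) ≤ d := Nat.cast_nonneg d
  unfold lamExp'
  constructor
  · rw [le_div_iff₀ (by linarith)]; linarith
  · rw [div_lt_iff₀ (by linarith)]; linarith

/-- The gain of the Sobolev inequality at exponents `λ'` and `κ`. -/
noncomputable def sobGain (d : ℕ) : ℝ := d * (d + 2) / ((2 * d + 2) * (2 * d + 3))

/-- The loss of integrability from `2` to `κ`. -/
noncomputable def intLoss (d : ℕ) : ℝ := (d + 2) / (2 * d + 2)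

theorem sobGain_pos (hd : 2 ≤ d) : 0 < sobGain d := by
  have h2 : (2 : ℝ) ≤ d := by exact_mod_cast hd
  unfold sobGain
  positivity

theorem intLoss_pos (d : ℕ) : 0 < intLoss d := by
  unfold intLoss
  positivity

theorem sobGain_eq (hd : 2 ≤ d) : 1 + d / kapExp d - d / lamExp' d = sobGain d := by
  have h2 : (2 : ℝ) ≤ d := by exact_mod_cast hd
  have h3 : (0 : ℝ) < d ^ 2 - 2 := by nlinarith
  rw [kapExp_eq hd]
  unfold lamExp' sobGain
  field_simp
  ring

theorem intLoss_eq (hd : 2 ≤ d) : d / kapExp d - d / 2 = -intLoss d := by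
  have h2 : (2 : ℝ) ≤ d := by exact_mod_cast hd
  have h3 : (0 : ℝ) < d ^ 2 - 2 := by nlinarith
  rw [kapExp_eq hd]
  unfold intLoss
  field_simp
  ring

theorem sigExp_pos (hd : 2 ≤ d) : 0 < sigExp d := by
  have := two_lt_kapExp hd
  unfold sigExp
  exact div_pos (by linarith) (by linarith)

theorem d_div_sigExp (hd : 2 ≤ d) : d * (1 / sigExp d) = intLoss d := by
  have h1 := two_lt_kapExp hd
  have h3 : d / kapExp d - d / 2 = -intLoss d := intLoss_eq hd
  have h4 : kapExp d ≠ 0 := by linarith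
  unfold sigExp
  rw [one_div_div, ← neg_eq_iff_eq_neg.2 h3]
  field_simp
  ring

theorem tauExp'_pos (d : ℕ) : 0 < tauExp' d := by
  have := lamExp'_bounds d
  unfold tauExp'
  exact div_pos (by linarith) (by linarith)

theorem d_div_tauExp' (hd : 2 ≤ d) :
    intLoss d + d * (1 / tauExp' d) = 1 - sobGain d := by
  have h1 := lamExp'_bounds d
  rw [← sobGain_eq hd, ← neg_eq_iff_eq_neg.2 (intLoss_eq hd)]
  have h5 : lamExp' d ≠ 0 := by linarith
  unfold tauExp'
  rw [one_div_div]
  field_simp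
  ring

theorem one_add_loss_div_gain (hd : 2 ≤ d) :
    1 + intLoss d / sobGain d = 1 / (1 - thetaExp d) := by
  have h2 : (2 : ℝ) ≤ d := by exact_mod_cast hd
  have h3 : 1 - thetaExp d = d / (3 * d + 3) := by
    unfold thetaExp
    field_simp
    ring
  rw [h3]
  unfold intLoss sobGain
  field_simp
  ring

end InterpolationExponents

section Annulus

variable {d L : ℕ}

theorem sum_weight_mul_sq_le (hd : 2 ≤ d) (F : Finset (Edge d L)) (U : Finset (Torus d L))
    (hF : F ⊆ edgesIn U) (a : Edge d L → ℝ) (ha : ∀ e, 0 ≤ a e) (v : Edge d L → ℝ≥0∞) :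
    ∑ e ∈ F, ENNReal.ofReal (a e) * v e ^ 2 ≤
      (avgNorm (sigExp d) U (fun e => ENNReal.ofReal √(a e)) * (U.card : ℝ≥0∞) ^ (1 / sigExp d)) ^ 2
        * ((∑ e ∈ F, v e ^ kapExp d) ^ (1 / kapExp d)) ^ 2 := by
  have h1 := two_lt_kapExp hd
  have h0 : 0 < kapExp d := by linarith
  have hs := sigExp_pos hd
  have hc : (sigExp d / 2).HolderConjugate (kapExp d / 2) := by
    rw [Real.holderConjugate_iff]
    have e1 : sigExp d / 2 = kapExp d / (kapExp d - 2) := by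
      unfold sigExp
      field_simp
    rw [e1]
    have h3 : 0 < kapExp d - 2 := by linarith
    refine ⟨by rw [lt_div_iff₀ h3]; linarith, ?_⟩
    field_simp
    ring
  have := ENNReal.inner_le_Lp_mul_Lq F (fun e => ENNReal.ofReal √(a e) ^ (2 : ℝ))
    (fun e => v e ^ (2 : ℝ)) hc
  have hl : ∑ e ∈ F, ENNReal.ofReal (a e) * v e ^ 2 =
      ∑ e ∈ F, ENNReal.ofReal √(a e) ^ (2 : ℝ) * v e ^ (2 : ℝ) := by
    refine Finset.sum_congr rfl fun e _ => ?_
    rw [ENNReal.rpow_two, ENNReal.rpow_two, ← ENNReal.ofReal_pow (Real.sqrt_nonneg _),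
      Real.sq_sqrt (ha e)]
  rw [hl]
  refine this.trans ?_
  have e2 : ∀ (f : Edge d L → ℝ≥0∞) (q : ℝ), 0 < q →
      (∑ e ∈ F, (f e ^ (2 : ℝ)) ^ (q / 2)) ^ (1 / (q / 2)) = ((∑ e ∈ F, f e ^ q) ^ (1 / q)) ^ 2 := by
    intro f q hq
    rw [← ENNReal.rpow_two, ← ENNReal.rpow_mul]
    congr 1
    · refine Finset.sum_congr rfl fun e _ => ?_
      rw [← ENNReal.rpow_mul]
      congr 1
      ring
    · field_simp
  rw [e2 _ _ hs, e2 _ _ h0]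
  gcongr
  exact rpow_sum_le_avgNorm hs U F hF _

/-- Interpolated Sobolev inequality at the scale `2 ^ j`: `q` is the ratio between the scale of the
averaging cubes and `2 ^ j`. -/
theorem exists_annulus_interp (d : ℕ) (hd : 2 ≤ d) :
    ∃ C : ℝ≥0, ∀ (L : ℕ) (u : Torus d L → ℝ) (w : Edge d L → ℝ≥0∞), (∀ e, w e ≠ ∞) →
      ∀ (j : ℕ) (q : ℝ), 0 < q → 4 * d * q ≤ 1 → (2 : ℝ) ^ j ≤ d * L + 1 →
      ∀ X Y U : Finset (Torus d L), X ⊆ Y →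
      (∀ m : ℕ, 4 * d * (m : ℝ) ≤ 2 ^ j → ∀ x ∈ X, ∀ z : Fin d → Fin m, x + emb z ∈ Y) →
      edgesFrom Y ⊆ edgesIn U → U.card ≤ (19 * 2 ^ j) ^ d →
      avgNorm (tauExp' d) U (fun e => (w e)⁻¹) ≠ ∞ →
      (((U.card : ℝ≥0∞) ^ (1 / sigExp d)) * (∑ x ∈ X, ‖u x‖ₑ ^ kapExp d) ^ (1 / kapExp d)) ^ 2 ≤
        C * ((ENNReal.ofReal q) ^ (2 * sobGain d) * (2 ^ j) ^ 2 *
              (avgNorm (tauExp' d) U (fun e => (w e)⁻¹) ^ 2 *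
                ∑ e ∈ edgesFrom Y, w e ^ 2 * ‖gr u e‖ₑ ^ 2)
            + (ENNReal.ofReal q) ^ (-(2 * intLoss d)) * ∑ x ∈ Y, ‖u x‖ₑ ^ 2) := by
  have h2d : (2 : ℝ) ≤ d := by exact_mod_cast hd
  have hκ := two_lt_kapExp hd
  have hκ0 : 0 < kapExp d := by linarith
  obtain ⟨hl1, hl2⟩ := lamExp'_bounds d
  have hb1 := sobGain_pos hd
  have hb2 := intLoss_pos d
  obtain ⟨C, hC⟩ := exists_weighted_sobolev d (by omega) hl1 hl2 (by linarith : lamExp' d ≤ kapExp d)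
    (by rw [sobGain_eq hd]; exact hb1)
  rw [sobGain_eq hd, ← tauExp'] at hC
  set b1 := sobGain d with hb1def
  set b2 := intLoss d with hb2def
  set K1 : ℝ≥0 := C * 19 ^ (1 - b1) with hK1
  set K2 : ℝ≥0 := 38 ^ b2 with hK2
  refine ⟨2 * (K1 ^ 2 + K2 ^ 2), ?_⟩
  intro L u w hw j q hq hdq hjL X Y U hXY hwin hYU hUcard hA
  set r : ℝ≥0∞ := 2 ^ j with hr
  set Q := ENNReal.ofReal q with hQ
  set Ws := avgNorm (tauExp' d) U (fun e => (w e)⁻¹) with hWs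
  set Dw := ∑ e ∈ edgesFrom Y, w e ^ 2 * ‖gr u e‖ₑ ^ 2 with hDw
  set S := ∑ x ∈ Y, ‖u x‖ₑ ^ 2 with hS
  set V := (∑ x ∈ X, ‖u x‖ₑ ^ kapExp d) ^ (1 / kapExp d) with hV
  have hr0 : r ≠ 0 := by simp [hr]
  have hrT : r ≠ ∞ := by simp [hr]
  have hQ0 : Q ≠ 0 := by simpa [hQ] using hq
  have hQT : Q ≠ ∞ := ENNReal.ofReal_ne_top
  have hσ := sigExp_pos hd
  have hτ := tauExp'_pos d
  have hcard : ∀ s : ℝ, 0 ≤ s → (U.card : ℝ≥0∞) ^ s ≤ ((19 : ℝ≥0∞) * r) ^ (d * s) := by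
    intro s hs
    rw [ENNReal.rpow_mul, ENNReal.rpow_natCast]
    gcongr
    rw [hr]
    exact_mod_cast hUcard
  have hcσ : (U.card : ℝ≥0∞) ^ (1 / sigExp d) ≤ (19 * r) ^ b2 := by
    have := hcard (1 / sigExp d) (by positivity)
    rwa [d_div_sigExp hd] at this
  have hcτ : (U.card : ℝ≥0∞) ^ (1 / tauExp' d) ≤ (19 * r) ^ (1 - b1 - b2) := by
    have := hcard (1 / tauExp' d) (by positivity)
    have e : d * (1 / tauExp' d) = 1 - b1 - b2 := by
      have := d_div_tauExp' hd
      linarith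
    rwa [e] at this
  have hexp0 : 0 ≤ 1 - b1 - b2 := by
    have := d_div_tauExp' hd
    have h3 : 0 ≤ d * (1 / tauExp' d) := by positivity
    linarith
  have h19r0 : (19 : ℝ≥0∞) * r ≠ 0 := mul_ne_zero (by norm_num) hr0
  have h19rT : (19 : ℝ≥0∞) * r ≠ ∞ := ENNReal.mul_ne_top (by norm_num) hrT
  have hclaim : (U.card : ℝ≥0∞) ^ (1 / sigExp d) * V ≤
      K1 * (Q ^ b1 * r * (Ws * Dw ^ (1 / 2 : ℝ))) + K2 * (Q ^ (-b2) * S ^ (1 / 2 : ℝ)) := by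
    rcases lt_or_ge (q * 2 ^ j) 1 with hcase | hcase
    · have hVS : V ≤ S ^ (1 / 2 : ℝ) := by
        have h3 := sum_cubeAvg_rpow_le (m := 1) one_pos (by omega) (by norm_num : (1 : ℝ) ≤ 2)
          hκ.le X Y ?_ (fun x : Torus d L => ‖u x‖ₑ)
        · simp only [Nat.cast_one, one_pow, inv_one, one_mul, ENNReal.one_rpow,
            ENNReal.rpow_two] at h3
          refine le_trans (le_of_eq ?_) h3
          rw [hV]
          congr 1
          refine Finset.sum_congr rfl fun x _ => ?_
          rw [Fintype.sum_unique]
          have : (emb (default : Fin d → Fin 1) : Torus d L) = 0 := by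
            funext i
            simp [emb]
          rw [this, add_zero]
        · intro x hx z
          have : (emb z : Torus d L) = 0 := by
            funext i
            simp [emb]
          rw [this, add_zero]
          exact hXY hx
      have hrQ : r ≤ Q⁻¹ := by
        rw [ENNReal.le_inv_iff_mul_le, mul_comm, hQ, hr]
        have h3 : (2 : ℝ≥0∞) ^ j = ENNReal.ofReal (2 ^ j) := by
          rw [ENNReal.ofReal_pow (by norm_num), ENNReal.ofReal_ofNat]
        rw [h3, ← ENNReal.ofReal_mul hq.le]
        exact ENNReal.ofReal_le_one.2 hcase.le
      calc (U.card : ℝ≥0∞) ^ (1 / sigExp d) * V ≤ (19 * r) ^ b2 * S ^ (1 / 2 : ℝ) := by gcongr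
        _ ≤ ((38 : ℝ≥0) * Q⁻¹) ^ b2 * S ^ (1 / 2 : ℝ) := by
            gcongr
            norm_num
        _ = K2 * (Q ^ (-b2) * S ^ (1 / 2 : ℝ)) := by
            rw [ENNReal.mul_rpow_of_nonneg _ _ hb2.le, ENNReal.inv_rpow, ← ENNReal.rpow_neg, hK2,
              ENNReal.coe_rpow_of_nonneg _ hb2.le]
            ring
        _ ≤ _ := le_add_self
    · set m := ⌊q * 2 ^ j⌋₊ with hm
      have hqj : 0 < q * 2 ^ j := by positivity
      have hm1 : 1 ≤ m := (Nat.one_le_floor_iff _).2 hcase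
      have hmle : (m : ℝ) ≤ q * 2 ^ j := Nat.floor_le hqj.le
      have hmge : q * 2 ^ j ≤ 2 * m := by
        have := Nat.lt_floor_add_one (q * 2 ^ j)
        have h4 : (1 : ℝ) ≤ m := by exact_mod_cast hm1
        linarith
      have h4dm : 4 * d * (m : ℝ) ≤ 2 ^ j := by
        calc 4 * d * (m : ℝ) ≤ 4 * d * (q * 2 ^ j) := by gcongr
          _ = (4 * d * q) * 2 ^ j := by ring
          _ ≤ 1 * 2 ^ j := by gcongr
          _ = _ := one_mul _
      have hmL : m ≤ 2 * L + 1 := by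
        have h5 : (4 * d * (m : ℝ)) ≤ d * L + 1 := h4dm.trans hjL
        have h6 : d * (4 * m) ≤ d * (L + 1) := by
          have : 4 * d * m ≤ d * L + 1 := by exact_mod_cast h5
          nlinarith
        have := Nat.le_of_mul_le_mul_left h6 (by omega)
        omega
      have hwinm := hwin m h4dm
      have hSob := hC L u w m hm1 hmL X Y U hwinm hYU hw hA
      have hYg := sum_cubeAvg_rpow_le hm1 hmL (by norm_num : (1 : ℝ) ≤ 2) hκ.le X Y hwinm
        (fun x : Torus d L => ‖u x‖ₑ)
      rw [intLoss_eq hd] at hYg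
      simp only [ENNReal.rpow_two] at hYg
      have hVle : V ≤ C * (m : ℝ≥0∞) ^ b1 * Dw ^ (1 / 2 : ℝ) *
          (Ws * (U.card : ℝ≥0∞) ^ (1 / tauExp' d)) + (m : ℝ≥0∞) ^ (-b2) * S ^ (1 / 2 : ℝ) := by
        calc V ≤ (∑ x ∈ X, (‖u x - cubeAvg m u x‖ₑ + ‖cubeAvg m u x‖ₑ) ^ kapExp d)
              ^ (1 / kapExp d) := by
              rw [hV]
              gcongr with x hx
              conv_lhs => rw [← sub_add_cancel (u x) (cubeAvg m u x)]
              exact enorm_add_le _ _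
          _ ≤ (∑ x ∈ X, ‖u x - cubeAvg m u x‖ₑ ^ kapExp d) ^ (1 / kapExp d)
              + (∑ x ∈ X, ‖cubeAvg m u x‖ₑ ^ kapExp d) ^ (1 / kapExp d) :=
              ENNReal.Lp_add_le X _ _ (by linarith)
          _ ≤ _ := by
              refine add_le_add hSob (le_trans ?_ hYg)
              gcongr with x hx
              exact enorm_cubeAvg_le hm1 u x
      have h2j : ENNReal.ofReal (2 ^ j) = r := by
        rw [ENNReal.ofReal_pow (by norm_num), ENNReal.ofReal_ofNat]
      have hmE : (m : ℝ≥0∞) ≤ Q * r := by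
        rw [hQ, ← h2j, ← ENNReal.ofReal_mul hq.le, ← ENNReal.ofReal_natCast]
        exact ENNReal.ofReal_le_ofReal hmle
      have hmE2 : Q * r ≤ 2 * (m : ℝ≥0∞) := by
        rw [hQ, ← h2j, ← ENNReal.ofReal_mul hq.le, ← ENNReal.ofReal_natCast,
          ← ENNReal.ofReal_ofNat 2, ← ENNReal.ofReal_mul (by norm_num)]
        exact ENNReal.ofReal_le_ofReal hmge
      have hm2 : (m : ℝ≥0∞) ^ (-b2) ≤ 2 ^ b2 * (Q ^ (-b2) * r ^ (-b2)) := by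
        have e1 : (2 : ℝ≥0∞) ^ b2 * 2 ^ (-b2) = 1 := by
          rw [← ENNReal.rpow_add _ _ (by norm_num) (by norm_num)]
          simp
        calc (m : ℝ≥0∞) ^ (-b2) = 2 ^ b2 * (2 * (m : ℝ≥0∞)) ^ (-b2) := by
              rw [ENNReal.mul_rpow_of_ne_top (by norm_num) (ENNReal.natCast_ne_top m), ← mul_assoc,
                e1, one_mul]
          _ ≤ 2 ^ b2 * (Q * r) ^ (-b2) := by
              rw [ENNReal.rpow_neg, ENNReal.rpow_neg]
              gcongr
          _ = _ := by rw [ENNReal.mul_rpow_of_ne_top hQT hrT]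
      have hA1 : (19 * r) ^ b2 * (C * (Q * r) ^ b1 * Dw ^ (1 / 2 : ℝ) *
          (Ws * (19 * r) ^ (1 - b1 - b2))) = K1 * (Q ^ b1 * r * (Ws * Dw ^ (1 / 2 : ℝ))) := by
        have e1 : (19 * r) ^ b2 * (19 * r) ^ (1 - b1 - b2) = 19 ^ (1 - b1) * r ^ (1 - b1) := by
          rw [← ENNReal.rpow_add _ _ h19r0 h19rT, ← ENNReal.mul_rpow_of_ne_top (by norm_num) hrT]
          congr 1
          ring
        have e2 : r ^ b1 * r ^ (1 - b1) = r := by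
          rw [← ENNReal.rpow_add _ _ hr0 hrT]
          simp
        calc (19 * r) ^ b2 * (C * (Q * r) ^ b1 * Dw ^ (1 / 2 : ℝ) *
              (Ws * (19 * r) ^ (1 - b1 - b2)))
            = C * (Q * r) ^ b1 * Dw ^ (1 / 2 : ℝ) * Ws *
              ((19 * r) ^ b2 * (19 * r) ^ (1 - b1 - b2)) := by ring
          _ = C * 19 ^ (1 - b1) * (Q ^ b1 * (r ^ b1 * r ^ (1 - b1)) * (Ws * Dw ^ (1 / 2 : ℝ))) := by
              rw [e1, ENNReal.mul_rpow_of_ne_top hQT hrT]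
              ring
          _ = _ := by
              rw [e2, hK1]
              push_cast
              rw [ENNReal.coe_rpow_of_nonneg _ (by linarith)]
              norm_num
      have hA2 : (19 * r) ^ b2 * ((2 ^ b2 * (Q ^ (-b2) * r ^ (-b2))) * S ^ (1 / 2 : ℝ)) =
          K2 * (Q ^ (-b2) * S ^ (1 / 2 : ℝ)) := by
        have e2 : r ^ b2 * r ^ (-b2) = 1 := by
          rw [← ENNReal.rpow_add _ _ hr0 hrT]
          simp
        have e3 : (19 : ℝ≥0∞) ^ b2 * 2 ^ b2 = K2 := by
          rw [hK2, ← ENNReal.mul_rpow_of_nonneg _ _ hb2.le, ENNReal.coe_rpow_of_nonneg _ hb2.le]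
          norm_num
        rw [ENNReal.mul_rpow_of_nonneg _ _ hb2.le]
        calc 19 ^ b2 * r ^ b2 * ((2 ^ b2 * (Q ^ (-b2) * r ^ (-b2))) * S ^ (1 / 2 : ℝ))
            = (19 ^ b2 * 2 ^ b2) * (r ^ b2 * r ^ (-b2)) * (Q ^ (-b2) * S ^ (1 / 2 : ℝ)) := by ring
          _ = _ := by rw [e2, e3, mul_one]
      calc (U.card : ℝ≥0∞) ^ (1 / sigExp d) * V
          ≤ (19 * r) ^ b2 * (C * (Q * r) ^ b1 * Dw ^ (1 / 2 : ℝ) *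
              (Ws * (19 * r) ^ (1 - b1 - b2)) + (2 ^ b2 * (Q ^ (-b2) * r ^ (-b2))) *
                S ^ (1 / 2 : ℝ)) := by
            refine mul_le_mul' hcσ (hVle.trans ?_)
            gcongr
        _ = _ := by rw [mul_add, hA1, hA2]
  calc ((U.card : ℝ≥0∞) ^ (1 / sigExp d) * V) ^ 2
      ≤ (K1 * (Q ^ b1 * r * (Ws * Dw ^ (1 / 2 : ℝ))) + K2 * (Q ^ (-b2) * S ^ (1 / 2 : ℝ))) ^ 2 := by
        gcongr
    _ ≤ 2 * ((K1 * (Q ^ b1 * r * (Ws * Dw ^ (1 / 2 : ℝ)))) ^ 2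
          + (K2 * (Q ^ (-b2) * S ^ (1 / 2 : ℝ))) ^ 2) := sq_add_le _ _
    _ = 2 * ((K1 : ℝ≥0∞) ^ 2 * (Q ^ (2 * b1) * r ^ 2 * (Ws ^ 2 * Dw))
          + (K2 : ℝ≥0∞) ^ 2 * (Q ^ (-(2 * b2)) * S)) := by
        have e1 : ∀ s : ℝ, (Q ^ s) ^ 2 = Q ^ (2 * s) := by
          intro s
          rw [← ENNReal.rpow_two, ← ENNReal.rpow_mul]
          congr 1
          ring
        simp only [mul_pow, sq_rpow_half, e1]
        rw [mul_neg]
    _ ≤ 2 * (((K1 : ℝ≥0∞) ^ 2 + (K2 : ℝ≥0∞) ^ 2) * (Q ^ (2 * b1) * r ^ 2 * (Ws ^ 2 * Dw))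
          + ((K1 : ℝ≥0∞) ^ 2 + (K2 : ℝ≥0∞) ^ 2) * (Q ^ (-(2 * b2)) * S)) := by
        gcongr
        · exact le_self_add
        · exact le_add_self
    _ = _ := by
        push_cast
        ring

end Annulus

end GradPhi

namespace GradPhi

section WeightedInterpolation

variable {d L : ℕ}

/-- The dyadic annulus `2 ^ j ≤ |x|_* < 2 ^ (j + 1)`. -/
noncomputable def annulus (d L j : ℕ) : Finset (Torus d L) :=
  Finset.univ.filter fun x => (2 : ℝ) ^ j ≤ starNorm x ∧ starNorm x < 2 ^ (j + 1)

/-- A neighbourhood of the dyadic annulus. -/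
noncomputable def fatAnnulus (d L j : ℕ) : Finset (Torus d L) :=
  Finset.univ.filter fun x => (2 : ℝ) ^ j ≤ 4 * starNorm x ∧ starNorm x ≤ 8 * 2 ^ j

theorem mem_annulus {j : ℕ} {x : Torus d L} :
    x ∈ annulus d L j ↔ (2 : ℝ) ^ j ≤ starNorm x ∧ starNorm x < 2 ^ (j + 1) := by
  simp [annulus]

theorem mem_fatAnnulus {j : ℕ} {x : Torus d L} :
    x ∈ fatAnnulus d L j ↔ (2 : ℝ) ^ j ≤ 4 * starNorm x ∧ starNorm x ≤ 8 * 2 ^ j := by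
  simp [fatAnnulus]

theorem exists_mem_annulus (x : Torus d L) :
    ∃ j ∈ Finset.range (d * L + 1), x ∈ annulus d L j := by
  have h1 := one_le_starNorm x
  obtain ⟨j, hj1, hj2⟩ := exists_nat_pow_near h1 (by norm_num : (1 : ℝ) < 2)
  refine ⟨j, ?_, mem_annulus.2 ⟨hj1, hj2⟩⟩
  have h2 : (2 : ℝ) ^ j ≤ d * L + 1 := hj1.trans (starNorm_le x)
  have h3 : 2 ^ j ≤ d * L + 1 := by exact_mod_cast h2
  have h4 := Nat.lt_two_pow_self (n := j)
  exact Finset.mem_range.2 (by omega)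

theorem card_fatAnnulus_le (s : Finset ℕ) (x : Torus d L) :
    (s.filter fun j => x ∈ fatAnnulus d L j).card ≤ 6 := by
  have h1 := one_le_starNorm x
  obtain ⟨l, hl1, hl2⟩ := exists_nat_pow_near h1 (by norm_num : (1 : ℝ) < 2)
  have h2 : (s.filter fun j => x ∈ fatAnnulus d L j) ⊆ Finset.Icc (l - 3) (l + 2) := by
    intro j hj
    obtain ⟨h3, h4⟩ := mem_fatAnnulus.1 (Finset.mem_filter.1 hj).2
    have h5 : (2 : ℝ) ^ j < 2 ^ (l + 3) := by
      calc (2 : ℝ) ^ j ≤ 4 * starNorm x := h3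
        _ < 4 * 2 ^ (l + 1) := by linarith
        _ = 2 ^ (l + 3) := by ring
    have h6 : (2 : ℝ) ^ l ≤ 2 ^ (j + 3) := by
      calc (2 : ℝ) ^ l ≤ 8 * 2 ^ j := hl1.trans h4
        _ = 2 ^ (j + 3) := by ring
    have h7 : j < l + 3 := (pow_lt_pow_iff_right₀ (by norm_num : (1 : ℝ) < 2)).1 h5
    have h8 : l ≤ j + 3 := (pow_le_pow_iff_right₀ (by norm_num : (1 : ℝ) < 2)).1 h6
    exact Finset.mem_Icc.2 ⟨by omega, by omega⟩
  refine (Finset.card_le_card h2).trans ?_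
  rw [Nat.card_Icc]
  omega

theorem sum_fatAnnulus_le (s : Finset ℕ) (g : Torus d L → ℝ≥0∞) :
    ∑ j ∈ s, ∑ x ∈ fatAnnulus d L j, g x ≤ 6 * ∑ x, g x := by
  have h1 : ∀ j, ∑ x ∈ fatAnnulus d L j, g x = ∑ x, if x ∈ fatAnnulus d L j then g x else 0 := by
    intro j
    rw [Finset.sum_ite_mem, Finset.univ_inter]
  simp only [h1]
  rw [Finset.sum_comm, Finset.mul_sum]
  refine Finset.sum_le_sum fun x _ => ?_
  rw [← Finset.sum_filter, Finset.sum_const, nsmul_eq_mul]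
  gcongr
  exact_mod_cast card_fatAnnulus_le s x

theorem sum_le_sum_annulus (g : Torus d L → ℝ≥0∞) :
    ∑ x, g x ≤ ∑ j ∈ Finset.range (d * L + 1), ∑ x ∈ annulus d L j, g x := by
  have h1 : ∀ j, ∑ x ∈ annulus d L j, g x = ∑ x, if x ∈ annulus d L j then g x else 0 := by
    intro j
    rw [Finset.sum_ite_mem, Finset.univ_inter]
  simp only [h1]
  rw [Finset.sum_comm]
  refine Finset.sum_le_sum fun x _ => ?_
  obtain ⟨j, hj, hx⟩ := exists_mem_annulus x
  calc g x = if x ∈ annulus d L j then g x else 0 := by rw [if_pos hx]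
    _ ≤ _ := Finset.single_le_sum (f := fun j => if x ∈ annulus d L j then g x else 0)
      (fun _ _ => zero_le) hj

theorem exists_annulus_energy (d : ℕ) (hd : 2 ≤ d) :
    ∃ C : ℝ≥0, ∀ (L : ℕ) (u : Torus d L → ℝ) (a : Edge d L → ℝ), (∀ e, 0 ≤ a e) →
      ∀ (w : Edge d L → ℝ≥0∞), (∀ e, w e ≠ ∞) → ∀ M : ℝ≥0∞, M ≠ ∞ →
      (∀ r ∈ Finset.Icc 0 L, avgNorm (sigExp d) (box d L r) (fun e => ENNReal.ofReal √(a e)) ^ 2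
        * (1 + avgNorm (tauExp' d) (box d L r) (fun e => (w e)⁻¹) ^ 2) ≤ M) →
      ∀ (j : ℕ) (q : ℝ), 0 < q → 4 * d * q ≤ 1 →
      ∑ e ∈ edgesFrom (annulus d L j), ENNReal.ofReal (a e) * (‖u e.1‖ₑ ^ 2 + ‖u (shift e)‖ₑ ^ 2) ≤
        C * M * ((ENNReal.ofReal q) ^ (2 * sobGain d) * (2 ^ j) ^ 2 *
                ∑ e ∈ edgesFrom (fatAnnulus d L j), w e ^ 2 * ‖gr u e‖ₑ ^ 2
            + (ENNReal.ofReal q) ^ (-(2 * intLoss d)) * ∑ x ∈ fatAnnulus d L j, ‖u x‖ₑ ^ 2) := by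
  obtain ⟨C, hC⟩ := exists_annulus_interp d hd
  have h2d : (2 : ℝ) ≤ d := by exact_mod_cast hd
  have hκ := two_lt_kapExp hd
  have hκ0 : 0 < kapExp d := by linarith
  refine ⟨2 * d ^ 2 * C, ?_⟩
  intro L u a ha w hw M hM hMr j q hq hdq
  rcases (annulus d L j).eq_empty_or_nonempty with hemp | ⟨x0, hx0⟩
  · have : edgesFrom (annulus d L j) = ∅ := by
      rw [hemp]
      simp [edgesFrom]
    rw [this, Finset.sum_empty]
    exact zero_le
  have hjL : (2 : ℝ) ^ j ≤ d * L + 1 := (mem_annulus.1 hx0).1.trans (starNorm_le x0)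
  have h1j : (1 : ℝ) ≤ 2 ^ j := one_le_pow₀ (by norm_num)
  set F := edgesFrom (annulus d L j) with hF
  set U := box d L (8 * 2 ^ j + 1) with hU
  set Y := fatAnnulus d L j with hY
  set X : Finset (Torus d L) := Finset.univ.filter fun x =>
    (2 : ℝ) ^ j ≤ 2 * starNorm x ∧ starNorm x ≤ 4 * 2 ^ j with hX
  have hXmem : ∀ x, x ∈ X ↔ (2 : ℝ) ^ j ≤ 2 * starNorm x ∧ starNorm x ≤ 4 * 2 ^ j := by
    intro x; simp [hX]
  have hXY : X ⊆ Y := by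
    intro x hx
    obtain ⟨h1, h2⟩ := (hXmem x).1 hx
    have := starNorm_pos x
    exact mem_fatAnnulus.2 ⟨by linarith, by linarith⟩
  have hwin : ∀ m : ℕ, 4 * d * (m : ℝ) ≤ 2 ^ j → ∀ x ∈ X, ∀ z : Fin d → Fin m,
      x + emb z ∈ Y := by
    intro m hm x hx z
    obtain ⟨h1, h2⟩ := (hXmem x).1 hx
    have h3 := starNorm_add_emb_le x z
    have h4 := starNorm_le_add_emb x z
    exact mem_fatAnnulus.2 ⟨by linarith, by linarith⟩
  have hYU : edgesFrom Y ⊆ edgesIn U := by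
    intro e he
    rw [mem_edgesFrom] at he
    have h1 : e.1 ∈ box d L (8 * 2 ^ j) := by
      refine mem_box_of_starNorm_le ?_
      push_cast
      linarith [(mem_fatAnnulus.1 he).2]
    exact mem_edgesIn.2 ⟨box_mono (Nat.le_succ _) h1, mem_box_succ_of_shift h1⟩
  have hUcard : U.card ≤ (19 * 2 ^ j) ^ d := by
    refine (card_box_le _).trans (Nat.pow_le_pow_left ?_ d)
    have : 1 ≤ 2 ^ j := Nat.one_le_two_pow
    omega
  have hAX : ∀ y ∈ annulus d L j, y ∈ X := by
    intro y hy
    obtain ⟨h1, h2⟩ := mem_annulus.1 hy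
    rw [pow_succ] at h2
    exact (hXmem y).2 ⟨by linarith, by linarith⟩
  have hAXs : ∀ y ∈ annulus d L j, ∀ l, shift (y, l) ∈ X := by
    intro y hy l
    obtain ⟨h1, h2⟩ := mem_annulus.1 hy
    rw [pow_succ] at h2
    have h3 := starNorm_shift_le (y, l)
    have h4 := starNorm_le_shift (y, l)
    have h5 := one_le_starNorm (shift (y, l))
    simp only at h3 h4
    refine (hXmem _).2 ⟨?_, by linarith⟩
    linarith
  have hFU : F ⊆ edgesIn U := by
    refine subset_trans ?_ hYU
    intro e he
    rw [mem_edgesFrom] at he ⊢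
    exact hXY (hAX _ he)
  set As := avgNorm (sigExp d) U (fun e => ENNReal.ofReal √(a e)) with hAs
  set Ws := avgNorm (tauExp' d) U (fun e => (w e)⁻¹) with hWs
  have hAWM : As ^ 2 * (1 + Ws ^ 2) ≤ M := by
    have := hMr (min (8 * 2 ^ j + 1) L) (Finset.mem_Icc.2 ⟨Nat.zero_le _, min_le_right _ _⟩)
    rwa [box_min] at this
  set V := (∑ x ∈ X, ‖u x‖ₑ ^ kapExp d) ^ (1 / kapExp d) with hV
  have hone : ∀ v : Edge d L → ℝ≥0∞, ∑ e ∈ F, v e ^ kapExp d ≤ d * ∑ x ∈ X, ‖u x‖ₑ ^ kapExp d →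
      ∑ e ∈ F, ENNReal.ofReal (a e) * v e ^ 2 ≤
        d ^ 2 * (As ^ 2 * ((U.card : ℝ≥0∞) ^ (1 / sigExp d) * V) ^ 2) := by
    intro v hv
    have hd1 : (d : ℝ≥0∞) ^ (1 / kapExp d) ≤ d := by
      conv_rhs => rw [← ENNReal.rpow_one (d : ℝ≥0∞)]
      refine ENNReal.rpow_le_rpow_of_exponent_le (by exact_mod_cast (by omega : 1 ≤ d)) ?_
      rw [div_le_one hκ0]
      linarith
    calc ∑ e ∈ F, ENNReal.ofReal (a e) * v e ^ 2
        ≤ (As * (U.card : ℝ≥0∞) ^ (1 / sigExp d)) ^ 2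
            * ((∑ e ∈ F, v e ^ kapExp d) ^ (1 / kapExp d)) ^ 2 :=
          sum_weight_mul_sq_le hd F U hFU a ha v
      _ ≤ (As * (U.card : ℝ≥0∞) ^ (1 / sigExp d)) ^ 2
            * ((d * ∑ x ∈ X, ‖u x‖ₑ ^ kapExp d) ^ (1 / kapExp d)) ^ 2 := by gcongr
      _ ≤ (As * (U.card : ℝ≥0∞) ^ (1 / sigExp d)) ^ 2 * (d * V) ^ 2 := by
          rw [ENNReal.mul_rpow_of_nonneg _ _ (by positivity)]
          gcongr
      _ = _ := by ring
  have hsum1 : ∑ e ∈ F, ‖u e.1‖ₑ ^ kapExp d ≤ d * ∑ x ∈ X, ‖u x‖ₑ ^ kapExp d := by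
    rw [hF, sum_edgesFrom, Finset.mul_sum]
    calc ∑ y ∈ annulus d L j, ∑ _l : Fin d, ‖u y‖ₑ ^ kapExp d
        = ∑ y ∈ annulus d L j, d * ‖u y‖ₑ ^ kapExp d := by simp
      _ ≤ _ := Finset.sum_le_sum_of_subset hAX
  have hsum2 : ∑ e ∈ F, ‖u (shift e)‖ₑ ^ kapExp d ≤ d * ∑ x ∈ X, ‖u x‖ₑ ^ kapExp d := by
    rw [hF, sum_edgesFrom, Finset.sum_comm]
    calc ∑ l : Fin d, ∑ y ∈ annulus d L j, ‖u (shift (y, l))‖ₑ ^ kapExp d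
        ≤ ∑ _l : Fin d, ∑ x ∈ X, ‖u x‖ₑ ^ kapExp d := by
          refine Finset.sum_le_sum fun l _ => ?_
          rw [← Finset.sum_image (s := annulus d L j) (f := fun y => ‖u y‖ₑ ^ kapExp d)
            (g := fun y => shift (y, l)) (fun a _ b _ hab => add_right_cancel hab)]
          refine Finset.sum_le_sum_of_subset ?_
          intro y hy
          obtain ⟨x, hx, rfl⟩ := Finset.mem_image.1 hy
          exact hAXs x hx l
      _ = _ := by simp
  have htot : ∑ e ∈ F, ENNReal.ofReal (a e) * (‖u e.1‖ₑ ^ 2 + ‖u (shift e)‖ₑ ^ 2) ≤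
      2 * (d ^ 2 * (As ^ 2 * ((U.card : ℝ≥0∞) ^ (1 / sigExp d) * V) ^ 2)) := by
    simp only [mul_add, Finset.sum_add_distrib]
    rw [two_mul]
    exact add_le_add (hone (fun e => ‖u e.1‖ₑ) hsum1) (hone (fun e => ‖u (shift e)‖ₑ) hsum2)
  refine htot.trans ?_
  by_cases hA0 : As = 0
  · rw [hA0]
    simp
  have hWs : Ws ≠ ∞ := by
    intro hT
    rw [hT, ENNReal.top_pow (by norm_num), add_top, ENNReal.mul_top (pow_ne_zero _ hA0),
      top_le_iff] at hAWM
    exact hM hAWM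
  have hmain := hC L u w hw j q hq hdq hjL X Y U hXY hwin hYU hUcard hWs
  set Dw := ∑ e ∈ edgesFrom Y, w e ^ 2 * ‖gr u e‖ₑ ^ 2
  set S := ∑ x ∈ Y, ‖u x‖ₑ ^ 2
  set Q1 := (ENNReal.ofReal q) ^ (2 * sobGain d) * (2 ^ j) ^ 2
  set Q2 := (ENNReal.ofReal q) ^ (-(2 * intLoss d))
  have hb1 : As ^ 2 * Ws ^ 2 ≤ M := le_trans (by gcongr; exact le_add_self) hAWM
  have hb2 : As ^ 2 ≤ M := le_trans (by rw [mul_add, mul_one]; exact le_self_add) hAWM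
  calc 2 * (d ^ 2 * (As ^ 2 * ((U.card : ℝ≥0∞) ^ (1 / sigExp d) * V) ^ 2))
      ≤ 2 * (d ^ 2 * (As ^ 2 * (C * (Q1 * (Ws ^ 2 * Dw) + Q2 * S)))) := by gcongr
    _ = 2 * d ^ 2 * C * ((As ^ 2 * Ws ^ 2) * (Q1 * Dw) + As ^ 2 * (Q2 * S)) := by ring
    _ ≤ 2 * d ^ 2 * C * (M * (Q1 * Dw) + M * (Q2 * S)) := by gcongr
    _ = _ := by
        push_cast
        ring

/-- `|x|_*` with values in `[0, ∞]`. -/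
noncomputable def sN (x : Torus d L) : ℝ≥0∞ := ENNReal.ofReal (starNorm x)

theorem sN_ne_top (x : Torus d L) : sN x ≠ ∞ := ENNReal.ofReal_ne_top

theorem sN_ne_zero (x : Torus d L) : sN x ≠ 0 := by
  simpa [sN] using starNorm_pos x

/-- The interpolation inequality which controls the growth of the weighted `L²` norm. -/
theorem exists_weighted_interp (d : ℕ) (hd : 2 ≤ d) {p : ℝ} (hp : 2 < p) (ε : ℝ≥0) (hε : 0 < ε) :
    ∃ C : ℝ≥0, ∀ (L : ℕ) (u : Torus d L → ℝ) (a : Edge d L → ℝ), (∀ e, 0 ≤ a e) →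
      ∀ (w : Edge d L → ℝ≥0∞), (∀ e, w e ≠ ∞) → ∀ M : ℝ≥0∞, 1 ≤ M → M ≠ ∞ →
      (∀ r ∈ Finset.Icc 0 L, avgNorm (sigExp d) (box d L r) (fun e => ENNReal.ofReal √(a e)) ^ 2
        * (1 + avgNorm (tauExp' d) (box d L r) (fun e => (w e)⁻¹) ^ 2) ≤ M) →
      ∑ e : Edge d L, sN e.1 ^ (p - 2) *
          (ENNReal.ofReal (a e) * (‖u e.1‖ₑ ^ 2 + ‖u (shift e)‖ₑ ^ 2)) ≤
        ε * ∑ e : Edge d L, sN e.1 ^ p * (w e ^ 2 * ‖gr u e‖ₑ ^ 2)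
          + C * M ^ (1 / (1 - thetaExp d)) * ∑ x, sN x ^ (p - 2) * ‖u x‖ₑ ^ 2 := by
  obtain ⟨C, hC⟩ := exists_annulus_energy d hd
  have h2d : (2 : ℝ) ≤ d := by exact_mod_cast hd
  have hb1 := sobGain_pos hd
  have hb2 := intLoss_pos d
  set b1 := sobGain d
  set b2 := intLoss d
  -- the small parameter
  set K : ℝ≥0 := 6 * (8 ^ p * C) + 1 with hK
  have hK0 : 0 < K := by positivity
  set ε1 : ℝ := min (ε / K) ((1 / (4 * d)) ^ (2 * b1)) with hε1
  have hε1p : 0 < ε1 := by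
    have : (0 : ℝ) < ε / K := by positivity
    exact lt_min this (by positivity)
  refine ⟨K * (ENNReal.ofReal ε1 ^ (-(b2 / b1))).toNNReal, ?_⟩
  intro L u a ha w hw M hM1 hM hMr
  have hCε : ((ENNReal.ofReal ε1 ^ (-(b2 / b1))).toNNReal : ℝ≥0∞) =
      ENNReal.ofReal ε1 ^ (-(b2 / b1)) := by
    refine ENNReal.coe_toNNReal ?_
    refine ENNReal.rpow_ne_top_of_ne_zero ?_ ENNReal.ofReal_ne_top
    simpa using hε1p
  have hM0 : M ≠ 0 := (zero_lt_one.trans_le hM1).ne'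
  have hMr1 : 1 ≤ M.toReal := by
    rw [← ENNReal.toReal_one]
    exact ENNReal.toReal_mono hM hM1
  have hMrp : 0 < M.toReal := by linarith
  set q : ℝ := (ε1 / M.toReal) ^ (1 / (2 * b1)) with hq
  have hq0 : 0 < q := by positivity
  have hdq : 4 * d * q ≤ 1 := by
    have h1 : q ≤ 1 / (4 * d) := by
      calc q ≤ ((1 / (4 * d)) ^ (2 * b1)) ^ (1 / (2 * b1)) := by
            apply Real.rpow_le_rpow (by positivity) _ (by positivity)
            exact (div_le_self hε1p.le hMr1).trans (min_le_right _ _)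
        _ = 1 / (4 * d) := by
            rw [← Real.rpow_mul (by positivity), mul_one_div_cancel (by positivity), Real.rpow_one]
    calc 4 * d * q ≤ 4 * d * (1 / (4 * d)) := by gcongr
      _ = 1 := by field_simp
  set Q := ENNReal.ofReal q with hQ
  have hQb : Q ^ (2 * b1) = ENNReal.ofReal ε1 * M⁻¹ := by
    rw [hQ, ENNReal.ofReal_rpow_of_pos hq0, hq, ← Real.rpow_mul (by positivity),
      one_div_mul_cancel (by positivity), Real.rpow_one, ENNReal.ofReal_div_of_pos hMrp,
      ENNReal.ofReal_toReal hM, div_eq_mul_inv]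
  have hMQ1 : M * Q ^ (2 * b1) = ENNReal.ofReal ε1 := by
    rw [hQb, mul_comm, mul_assoc, ENNReal.inv_mul_cancel hM0 hM, mul_one]
  have hMQ2 : M * Q ^ (-(2 * b2)) = ENNReal.ofReal ε1 ^ (-(b2 / b1)) * M ^ (1 / (1 - thetaExp d)) := by
    have e1 : -(2 * b2) = (2 * b1) * (-(b2 / b1)) := by field_simp
    rw [e1, ENNReal.rpow_mul, hQb, ENNReal.mul_rpow_of_ne_top ENNReal.ofReal_ne_top
      (ENNReal.inv_ne_top.2 hM0), ENNReal.inv_rpow, ← ENNReal.rpow_neg, neg_neg,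
      ← one_add_loss_div_gain hd, ENNReal.rpow_add _ _ hM0 hM, ENNReal.rpow_one]
    ring
  have hstep : ∀ j, ∑ x ∈ annulus d L j, ∑ l, sN x ^ (p - 2) *
      (ENNReal.ofReal (a (x, l)) * (‖u x‖ₑ ^ 2 + ‖u (shift (x, l))‖ₑ ^ 2)) ≤
      8 ^ p * C * ENNReal.ofReal ε1 *
          (∑ x ∈ fatAnnulus d L j, ∑ l, sN x ^ p * (w (x, l) ^ 2 * ‖gr u (x, l)‖ₑ ^ 2))
        + 8 ^ p * C * (ENNReal.ofReal ε1 ^ (-(b2 / b1)) * M ^ (1 / (1 - thetaExp d))) *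
          ∑ x ∈ fatAnnulus d L j, sN x ^ (p - 2) * ‖u x‖ₑ ^ 2 := by
    intro j
    have h1 := hC L u a ha w hw M hM hMr j q hq0 hdq
    set R : ℝ≥0∞ := 2 ^ (j + 1) with hR
    have hRr : R = ENNReal.ofReal (2 ^ (j + 1)) := by
      rw [ENNReal.ofReal_pow (by norm_num), ENNReal.ofReal_ofNat]
    have hR0 : R ≠ 0 := by simp [hR]
    have hRT : R ≠ ∞ := by simp [hR]
    have hup : ∀ x ∈ annulus d L j, sN x ≤ R := by
      intro x hx
      rw [hRr]
      exact ENNReal.ofReal_le_ofReal (mem_annulus.1 hx).2.le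
    have hlow : ∀ x ∈ fatAnnulus d L j, R ≤ 8 * sN x := by
      intro x hx
      have h3 := (mem_fatAnnulus.1 hx).1
      rw [hRr, sN, ← ENNReal.ofReal_ofNat 8, ← ENNReal.ofReal_mul (by norm_num)]
      refine ENNReal.ofReal_le_ofReal ?_
      rw [pow_succ]
      linarith
    have hp2 : 0 ≤ p - 2 := by linarith
    rw [sum_edgesFrom, sum_edgesFrom] at h1
    calc ∑ x ∈ annulus d L j, ∑ l, sN x ^ (p - 2) *
          (ENNReal.ofReal (a (x, l)) * (‖u x‖ₑ ^ 2 + ‖u (shift (x, l))‖ₑ ^ 2))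
        ≤ ∑ x ∈ annulus d L j, ∑ l, R ^ (p - 2) *
          (ENNReal.ofReal (a (x, l)) * (‖u x‖ₑ ^ 2 + ‖u (shift (x, l))‖ₑ ^ 2)) := by
          gcongr with x hx
          exact hup x hx
      _ = R ^ (p - 2) * ∑ x ∈ annulus d L j, ∑ l,
          (ENNReal.ofReal (a (x, l)) * (‖u x‖ₑ ^ 2 + ‖u (shift (x, l))‖ₑ ^ 2)) := by
          simp only [Finset.mul_sum]
      _ ≤ R ^ (p - 2) * (C * M * (Q ^ (2 * b1) * (2 ^ j) ^ 2 *
                (∑ x ∈ fatAnnulus d L j, ∑ l, w (x, l) ^ 2 * ‖gr u (x, l)‖ₑ ^ 2)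
            + Q ^ (-(2 * b2)) * ∑ x ∈ fatAnnulus d L j, ‖u x‖ₑ ^ 2)) := by gcongr
      _ = C * (M * Q ^ (2 * b1)) * ((R ^ (p - 2) * (2 ^ j) ^ 2) *
                (∑ x ∈ fatAnnulus d L j, ∑ l, w (x, l) ^ 2 * ‖gr u (x, l)‖ₑ ^ 2))
            + C * (M * Q ^ (-(2 * b2))) * (R ^ (p - 2) * ∑ x ∈ fatAnnulus d L j, ‖u x‖ₑ ^ 2) := by
          ring
      _ ≤ C * (M * Q ^ (2 * b1)) * (8 ^ p *
                (∑ x ∈ fatAnnulus d L j, ∑ l, sN x ^ p * (w (x, l) ^ 2 * ‖gr u (x, l)‖ₑ ^ 2)))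
            + C * (M * Q ^ (-(2 * b2))) *
              (8 ^ p * ∑ x ∈ fatAnnulus d L j, sN x ^ (p - 2) * ‖u x‖ₑ ^ 2) := by
          have hRp : R ^ (p - 2) * (2 ^ j) ^ 2 ≤ R ^ p := by
            calc R ^ (p - 2) * (2 ^ j) ^ 2 ≤ R ^ (p - 2) * R ^ (2 : ℝ) := by
                  rw [ENNReal.rpow_two]
                  gcongr
                  rw [hR, pow_succ]
                  exact le_mul_of_one_le_right zero_le (by norm_num)
              _ = R ^ p := by
                  rw [← ENNReal.rpow_add _ _ hR0 hRT]
                  congr 1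
                  ring
          refine add_le_add ?_ ?_
          · refine mul_le_mul' le_rfl ?_
            simp only [Finset.mul_sum]
            refine Finset.sum_le_sum fun x hx => Finset.sum_le_sum fun l _ => ?_
            rw [← mul_assoc (8 ^ p)]
            refine mul_le_mul' ?_ le_rfl
            refine hRp.trans ?_
            rw [← ENNReal.mul_rpow_of_nonneg _ _ (by linarith)]
            exact ENNReal.rpow_le_rpow (hlow x hx) (by linarith)
          · refine mul_le_mul' le_rfl ?_
            simp only [Finset.mul_sum]
            refine Finset.sum_le_sum fun x hx => ?_
            rw [← mul_assoc (8 ^ p)]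
            gcongr
            calc R ^ (p - 2) ≤ (8 * sN x) ^ (p - 2) := ENNReal.rpow_le_rpow (hlow x hx) hp2
              _ = 8 ^ (p - 2) * sN x ^ (p - 2) := ENNReal.mul_rpow_of_nonneg _ _ hp2
              _ ≤ 8 ^ p * sN x ^ (p - 2) := by
                  gcongr
                  · norm_num
                  · linarith
      _ = _ := by
          rw [hMQ1, hMQ2]
          ring
  have hKE : 6 * (8 ^ p * (C : ℝ≥0∞)) ≤ K := by
    rw [hK]
    push_cast
    rw [ENNReal.coe_rpow_of_nonneg _ (by linarith)]
    exact le_self_add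
  rw [sum_edge, sum_edge]
  set B2 := ENNReal.ofReal ε1 ^ (-(b2 / b1)) * M ^ (1 / (1 - thetaExp d)) with hB2
  calc ∑ x, ∑ l, sN x ^ (p - 2) *
        (ENNReal.ofReal (a (x, l)) * (‖u x‖ₑ ^ 2 + ‖u (shift (x, l))‖ₑ ^ 2))
      ≤ ∑ j ∈ Finset.range (d * L + 1), ∑ x ∈ annulus d L j, ∑ l, sN x ^ (p - 2) *
        (ENNReal.ofReal (a (x, l)) * (‖u x‖ₑ ^ 2 + ‖u (shift (x, l))‖ₑ ^ 2)) :=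
        sum_le_sum_annulus _
    _ ≤ ∑ j ∈ Finset.range (d * L + 1), (8 ^ p * C * ENNReal.ofReal ε1 *
          (∑ x ∈ fatAnnulus d L j, ∑ l, sN x ^ p * (w (x, l) ^ 2 * ‖gr u (x, l)‖ₑ ^ 2))
        + 8 ^ p * C * B2 * ∑ x ∈ fatAnnulus d L j, sN x ^ (p - 2) * ‖u x‖ₑ ^ 2) :=
        Finset.sum_le_sum fun j _ => hstep j
    _ ≤ 8 ^ p * C * ENNReal.ofReal ε1 *
          (6 * ∑ x, ∑ l, sN x ^ p * (w (x, l) ^ 2 * ‖gr u (x, l)‖ₑ ^ 2))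
        + 8 ^ p * C * B2 * (6 * ∑ x, sN x ^ (p - 2) * ‖u x‖ₑ ^ 2) := by
        rw [Finset.sum_add_distrib, ← Finset.mul_sum, ← Finset.mul_sum]
        gcongr
        · exact sum_fatAnnulus_le _ _
        · exact sum_fatAnnulus_le _ _
    _ = 6 * (8 ^ p * C) * ENNReal.ofReal ε1 *
          (∑ x, ∑ l, sN x ^ p * (w (x, l) ^ 2 * ‖gr u (x, l)‖ₑ ^ 2))
        + 6 * (8 ^ p * C) * B2 * (∑ x, sN x ^ (p - 2) * ‖u x‖ₑ ^ 2) := by ring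
    _ ≤ ε * (∑ x, ∑ l, sN x ^ p * (w (x, l) ^ 2 * ‖gr u (x, l)‖ₑ ^ 2))
        + K * B2 * (∑ x, sN x ^ (p - 2) * ‖u x‖ₑ ^ 2) := by
        gcongr
        calc 6 * (8 ^ p * (C : ℝ≥0∞)) * ENNReal.ofReal ε1 ≤ K * ENNReal.ofReal (ε / K) := by
              gcongr
              exact min_le_left _ _
          _ = ε := by
              rw [← ENNReal.ofReal_coe_nnreal (p := K), ← ENNReal.ofReal_mul (by positivity),
                mul_div_cancel₀ _ (by positivity), ENNReal.ofReal_coe_nnreal]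
    _ = _ := by
        push_cast
        rw [hCε, hB2]
        ring

end WeightedInterpolation

end GradPhi

namespace GradPhi

section Kernel

variable {p δ : ℝ}

/-- The tail `∫_t^∞ s k_s ds`, in closed form. -/
noncomputable def kTail (p δ t : ℝ) : ℝ :=
  δ * ((1 + t) ^ (-(p + 1)) / (p + 1) - (1 + t) ^ (-(p + 2)) / (p + 2))

/-- The kernel `K` in closed form. -/
noncomputable def kClosed (p δ t : ℝ) : ℝ := kKer p δ t + kTail p δ t

theorem hasDerivAt_kTail (hp : 0 < p) {t : ℝ} (ht : 0 ≤ t) :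
    HasDerivAt (fun s => -kTail p δ s) (t * kKer p δ t) t := by
  have h1 : (0 : ℝ) < 1 + t := by linarith
  have hb : HasDerivAt (fun s : ℝ => 1 + s) 1 t := (hasDerivAt_id t).const_add 1
  have h2 := (hb.rpow_const (p := -(p + 1)) (Or.inl h1.ne')).div_const (p + 1)
  have h3 := (hb.rpow_const (p := -(p + 2)) (Or.inl h1.ne')).div_const (p + 2)
  have h4 := ((h2.sub h3).const_mul δ).neg
  refine h4.congr_deriv ?_
  have e1 : (1 + t) ^ (-(p + 1) - 1) = (1 + t) ^ (-(p + 3)) * (1 + t) := by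
    conv_rhs => rw [← Real.rpow_one (1 + t), ← Real.rpow_mul h1.le, ← Real.rpow_add h1]
    congr 1
    ring
  have e2 : (1 + t) ^ (-(p + 2) - 1) = (1 + t) ^ (-(p + 3)) := by
    congr 1
    ring
  have e3 : kKer p δ t = δ * (1 + t) ^ (-(p + 3)) := by
    unfold kKer
    rw [Real.rpow_neg h1.le, div_eq_mul_inv]
  rw [e1, e2, e3]
  have h5 : p + 1 ≠ 0 := by linarith
  have h6 : p + 2 ≠ 0 := by linarith
  field_simp
  ring

theorem tendsto_kTail (hp : 0 < p) : Tendsto (fun s => -kTail p δ s) atTop (nhds 0) := by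
  have h0 : Tendsto (fun s : ℝ => 1 + s) atTop atTop := tendsto_atTop_add_const_left _ _ tendsto_id
  have h1 := ((tendsto_rpow_neg_atTop (by linarith : 0 < p + 1)).comp h0).div_const (p + 1)
  have h2 := ((tendsto_rpow_neg_atTop (by linarith : 0 < p + 2)).comp h0).div_const (p + 2)
  have := ((h1.sub h2).const_mul δ).neg
  simpa [kTail] using this

theorem kKer_nonneg (hδ : 0 ≤ δ) {t : ℝ} (ht : 0 ≤ t) : 0 ≤ kKer p δ t := by
  unfold kKer
  have : (0 : ℝ) ≤ (1 + t) ^ (p + 3) := Real.rpow_nonneg (by linarith) _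
  exact div_nonneg hδ this

theorem integrableOn_kTail (hp : 0 < p) (hδ : 0 ≤ δ) {t : ℝ} (ht : 0 ≤ t) :
    IntegrableOn (fun s => s * kKer p δ s) (Ioi t) :=
  integrableOn_Ioi_deriv_of_nonneg' (fun _ hs => hasDerivAt_kTail hp (ht.trans hs))
    (fun _ hs => mul_nonneg (ht.trans (le_of_lt hs)) (kKer_nonneg hδ (ht.trans (le_of_lt hs))))
    (tendsto_kTail hp)

theorem integral_kTail (hp : 0 < p) (hδ : 0 ≤ δ) {t : ℝ} (ht : 0 ≤ t) :
    ∫ s in Ioi t, s * kKer p δ s = kTail p δ t := by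
  rw [integral_Ioi_of_hasDerivAt_of_tendsto' (fun _ hs => hasDerivAt_kTail hp (ht.trans hs))
    (integrableOn_kTail hp hδ ht) (tendsto_kTail hp)]
  ring

theorem KKer_eq (hp : 0 < p) (hδ : 0 ≤ δ) {t : ℝ} (ht : 0 ≤ t) : KKer p δ t = kClosed p δ t := by
  unfold KKer kClosed
  rw [integral_kTail hp hδ ht]

theorem kTail_nonneg (hp : 0 < p) (hδ : 0 ≤ δ) {t : ℝ} (ht : 0 ≤ t) : 0 ≤ kTail p δ t := by
  rw [← integral_kTail hp hδ ht]
  exact setIntegral_nonneg measurableSet_Ioi fun s hs =>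
    mul_nonneg (ht.trans (le_of_lt hs)) (kKer_nonneg hδ (ht.trans (le_of_lt hs)))

theorem kClosed_nonneg (hp : 0 < p) (hδ : 0 ≤ δ) {t : ℝ} (ht : 0 ≤ t) : 0 ≤ kClosed p δ t :=
  add_nonneg (kKer_nonneg hδ ht) (kTail_nonneg hp hδ ht)

theorem measurable_kKer : Measurable (kKer p δ) := by
  unfold kKer
  fun_prop

theorem measurable_kClosed : Measurable (kClosed p δ) := by
  unfold kClosed kTail
  exact measurable_kKer.add (by fun_prop)

/-- The kernel with values in `[0, ∞]`. -/
noncomputable def kE (p δ t : ℝ) : ℝ≥0∞ := ENNReal.ofReal (kClosed p δ t)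

theorem measurable_kE : Measurable (kE p δ) := measurable_kClosed.ennreal_ofReal

theorem ofReal_kKer_add_lintegral (hp : 0 < p) (hδ : 0 ≤ δ) {t : ℝ} (ht : 0 ≤ t) :
    ENNReal.ofReal (kKer p δ t) + ∫⁻ s in Ioi t, ENNReal.ofReal (s * kKer p δ s) = kE p δ t := by
  rw [← ofReal_integral_eq_lintegral_ofReal (integrableOn_kTail hp hδ ht), integral_kTail hp hδ ht,
    ← ENNReal.ofReal_add (kKer_nonneg hδ ht) (kTail_nonneg hp hδ ht)]
  · rfl
  · refine (ae_restrict_iff' measurableSet_Ioi).2 (Eventually.of_forall fun s hs => ?_)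
    exact mul_nonneg (ht.trans (le_of_lt hs)) (kKer_nonneg hδ (ht.trans (le_of_lt hs)))

theorem kClosed_le (hp : 0 < p) (hδ : 0 ≤ δ) {t : ℝ} (ht : 0 ≤ t) :
    kClosed p δ t ≤ 2 * δ * (1 + t) ^ (-(p + 1)) := by
  have h1 : (1 : ℝ) ≤ 1 + t := by linarith
  have h2 : kKer p δ t ≤ δ * (1 + t) ^ (-(p + 1)) := by
    unfold kKer
    rw [div_eq_mul_inv, ← Real.rpow_neg (by linarith)]
    exact mul_le_mul_of_nonneg_left (Real.rpow_le_rpow_of_exponent_le h1 (by linarith)) hδ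
  have h3 : kTail p δ t ≤ δ * (1 + t) ^ (-(p + 1)) := by
    unfold kTail
    have h4 : (0 : ℝ) ≤ (1 + t) ^ (-(p + 2)) / (p + 2) := by positivity
    have h5 : (0 : ℝ) ≤ (1 + t) ^ (-(p + 1)) := by positivity
    have h6 : (1 + t) ^ (-(p + 1)) / (p + 1) ≤ (1 + t) ^ (-(p + 1)) :=
      div_le_self h5 (by linarith)
    exact mul_le_mul_of_nonneg_left (by linarith) hδ
  unfold kClosed
  linarith

theorem le_kClosed (hp : 0 < p) (hδ : 0 ≤ δ) {t : ℝ} (ht : 0 ≤ t) (ht1 : t ≤ 1) :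
    δ / 2 ^ (p + 3) ≤ kClosed p δ t := by
  have h1 : δ / 2 ^ (p + 3) ≤ kKer p δ t := by
    unfold kKer
    gcongr
    linarith
  exact h1.trans (le_add_of_nonneg_right (kTail_nonneg hp hδ ht))

theorem integrableOn_kClosed (hp : 0 < p) (hδ : 0 ≤ δ) :
    IntegrableOn (kClosed p δ) (Ioi 0) := by
  have h1 : IntegrableOn (fun t : ℝ => 2 * δ * (t + 1) ^ (-(p + 1))) (Ioi 0) :=
    (integrableOn_add_rpow_Ioi_of_lt (by linarith : -(p + 1) < -1) (by norm_num)).const_mul _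
  refine h1.mono' measurable_kClosed.aestronglyMeasurable ?_
  refine (ae_restrict_iff' measurableSet_Ioi).2 (Eventually.of_forall fun t ht => ?_)
  have ht0 : 0 ≤ t := le_of_lt ht
  rw [Real.norm_of_nonneg (kClosed_nonneg hp hδ ht0), add_comm t]
  exact kClosed_le hp hδ ht0

theorem lintegral_kE_le_one (hp : 0 < p) (hδ : IsAdmissibleDelta p δ) :
    ∫⁻ s in Ioi 0, kE p δ s ≤ 1 := by
  obtain ⟨hδ0, -, h1⟩ := hδ
  have h2 : ∫ s in Ioi (0 : ℝ), KKer p δ s = ∫ s in Ioi (0 : ℝ), kClosed p δ s :=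
    setIntegral_congr_fun measurableSet_Ioi fun _ hs => KKer_eq hp hδ0.le (le_of_lt hs)
  rw [h2] at h1
  unfold kE
  rw [← ofReal_integral_eq_lintegral_ofReal (integrableOn_kClosed hp hδ0.le)]
  · exact ENNReal.ofReal_le_one.2 h1
  · exact (ae_restrict_iff' measurableSet_Ioi).2 (Eventually.of_forall fun t ht =>
      kClosed_nonneg hp hδ0.le (le_of_lt ht))

theorem continuousOn_kClosed : ContinuousOn (kClosed p δ) (Ici 0) := by
  have h1 : ∀ q : ℝ, ContinuousOn (fun t : ℝ => (1 + t) ^ q) (Ici 0) := fun q =>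
    ContinuousOn.rpow_const (by fun_prop) fun t ht => Or.inl (by
      have : (0 : ℝ) ≤ t := ht
      linarith)
  have h2 : ContinuousOn (kKer p δ) (Ici 0) := by
    unfold kKer
    refine continuousOn_const.div (h1 _) fun t ht => ?_
    have : (0 : ℝ) ≤ t := ht
    positivity
  unfold kClosed kTail
  exact h2.add (continuousOn_const.mul (((h1 _).div_const _).sub ((h1 _).div_const _)))

theorem lintegral_kE_conv_le (hp : 0 < p) (hδ : IsAdmissibleDelta p δ) {r : ℝ} (hr : 0 ≤ r) :
    ∫⁻ s in Ioc 0 r, kE p δ s * kE p δ (r - s) ≤ kE p δ r := by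
  obtain ⟨hδ0, hconv, -⟩ := hδ
  have h1 := hconv 1 (1 + r) one_pos (by linarith)
  have h2 : ∫ s in (1 : ℝ)..(1 + r), KKer p δ (s - 1) * KKer p δ (1 + r - s) =
      ∫ s in (0 : ℝ)..r, kClosed p δ s * kClosed p δ (r - s) := by
    have h3 := intervalIntegral.integral_comp_sub_right (a := 1) (b := 1 + r)
      (fun s => KKer p δ s * KKer p δ (r - s)) 1
    rw [sub_self, add_sub_cancel_left] at h3
    have e1 : (fun s => KKer p δ (s - 1) * KKer p δ (1 + r - s)) =
        fun s => KKer p δ (s - 1) * KKer p δ (r - (s - 1)) := by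
      funext s
      congr 2
      ring
    rw [e1, h3]
    refine intervalIntegral.integral_congr fun s hs => ?_
    rw [uIcc_of_le hr] at hs
    rw [KKer_eq hp hδ0.le hs.1, KKer_eq hp hδ0.le (by linarith [hs.2] : 0 ≤ r - s)]
  rw [h2, add_sub_cancel_left, KKer_eq hp hδ0.le hr, intervalIntegral.integral_of_le hr] at h1
  have hcont : ContinuousOn (fun s => kClosed p δ s * kClosed p δ (r - s)) (Icc 0 r) := by
    refine ContinuousOn.mul (continuousOn_kClosed.mono fun s hs => hs.1) ?_
    refine continuousOn_kClosed.comp (by fun_prop) fun s hs => ?_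
    exact sub_nonneg.2 hs.2
  have hint : IntegrableOn (fun s => kClosed p δ s * kClosed p δ (r - s)) (Ioc 0 r) :=
    (hcont.integrableOn_Icc).mono_set Ioc_subset_Icc_self
  calc ∫⁻ s in Ioc 0 r, kE p δ s * kE p δ (r - s)
      = ∫⁻ s in Ioc 0 r, ENNReal.ofReal (kClosed p δ s * kClosed p δ (r - s)) := by
        refine setLIntegral_congr_fun measurableSet_Ioc fun s hs => ?_
        simp only [kE]
        rw [ENNReal.ofReal_mul (kClosed_nonneg hp hδ0.le hs.1.le)]
    _ = ENNReal.ofReal (∫ s in Ioc 0 r, kClosed p δ s * kClosed p δ (r - s)) := by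
        rw [ofReal_integral_eq_lintegral_ofReal hint]
        refine (ae_restrict_iff' measurableSet_Ioc).2 (Eventually.of_forall fun s hs => ?_)
        exact mul_nonneg (kClosed_nonneg hp hδ0.le hs.1.le)
          (kClosed_nonneg hp hδ0.le (by linarith [hs.2]))
    _ ≤ kE p δ r := ENNReal.ofReal_le_ofReal h1

/-- The measure on the positive half-line with density `K`. -/
noncomputable def kMeas (p δ : ℝ) : Measure ℝ := (volume.restrict (Ioi 0)).withDensity (kE p δ)

instance : SFinite (kMeas p δ) := by
  unfold kMeas
  infer_instance

theorem lintegral_kMeas {F : ℝ → ℝ≥0∞} (hF : Measurable F) :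
    ∫⁻ s, F s ∂(kMeas p δ) = ∫⁻ s in Ioi 0, kE p δ s * F s :=
  lintegral_withDensity_eq_lintegral_mul _ measurable_kE hF

theorem kMeas_univ_le (hp : 0 < p) (hδ : IsAdmissibleDelta p δ) : kMeas p δ univ ≤ 1 := by
  have := lintegral_kMeas (p := p) (δ := δ) (F := fun _ => 1) measurable_const
  simp only [lintegral_one, mul_one] at this
  rw [this]
  exact lintegral_kE_le_one hp hδ

theorem ae_kMeas_pos : ∀ᵐ s ∂(kMeas p δ), 0 < s :=
  (withDensity_absolutelyContinuous _ _).ae_le (ae_restrict_mem measurableSet_Ioi)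

/-- The average of `F` over the future of `t`, with respect to the kernel `K`. -/
noncomputable def bar (p δ : ℝ) (F : ℝ → ℝ≥0∞) (t : ℝ) : ℝ≥0∞ := ∫⁻ s, F (t + s) ∂(kMeas p δ)

theorem measurable_bar {F : ℝ → ℝ≥0∞} (hF : Measurable F) : Measurable (bar p δ F) := by
  unfold bar
  exact Measurable.lintegral_prod_right' (f := fun z : ℝ × ℝ => F (z.1 + z.2)) (by fun_prop)

theorem lintegral_Ioi_kKer_eq_bar (hp : 0 < p) (hδ : 0 ≤ δ) {F : ℝ → ℝ≥0∞} (hF : Measurable F)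
    (t : ℝ) : ∫⁻ s in Ioi t, ENNReal.ofReal (KKer p δ (s - t)) * F s = bar p δ F t := by
  unfold bar
  rw [lintegral_kMeas (by fun_prop)]
  have h1 : ∫⁻ s in Ioi t, ENNReal.ofReal (KKer p δ (s - t)) * F s =
      ∫⁻ s in Ioi t, kE p δ (s - t) * F (t + (s - t)) := by
    refine setLIntegral_congr_fun measurableSet_Ioi fun s hs => ?_
    simp only [kE]
    rw [KKer_eq hp hδ (sub_nonneg.2 (le_of_lt hs)), add_sub_cancel]
  rw [h1]
  have h2 : MeasurePreserving (fun s : ℝ => s - t) volume volume :=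
    measurePreserving_sub_right volume t
  have h3 := h2.setLIntegral_comp_preimage measurableSet_Ioi
    (f := fun s => kE p δ s * F (t + s)) (s := Ioi 0) (measurable_kE.mul (by fun_prop))
  rw [← h3]
  congr 2
  ext s
  simp

theorem bar_mono_of_pos {F G : ℝ → ℝ≥0∞} {t : ℝ} (h : ∀ s, t < s → F s ≤ G s) :
    bar p δ F t ≤ bar p δ G t := by
  unfold bar
  refine lintegral_mono_ae ?_
  filter_upwards [ae_kMeas_pos] with s hs
  exact h _ (by linarith)

theorem bar_const_mul {F : ℝ → ℝ≥0∞} (hF : Measurable F) (c : ℝ≥0∞) (t : ℝ) :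
    bar p δ (fun s => c * F s) t = c * bar p δ F t := by
  unfold bar
  exact lintegral_const_mul _ (by fun_prop)

theorem bar_add {F G : ℝ → ℝ≥0∞} (hF : Measurable F) (t : ℝ) :
    bar p δ (fun s => F s + G s) t = bar p δ F t + bar p δ G t := by
  unfold bar
  exact lintegral_add_left (by fun_prop) _

theorem bar_finset_sum {ι : Type*} (S : Finset ι) {F : ι → ℝ → ℝ≥0∞} (hF : ∀ i, Measurable (F i))
    (t : ℝ) : bar p δ (fun s => ∑ i ∈ S, F i s) t = ∑ i ∈ S, bar p δ (F i) t := by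
  unfold bar
  exact lintegral_finsetSum _ fun i _ => (hF i).comp (by fun_prop)

theorem bar_const_le (hp : 0 < p) (hδ : IsAdmissibleDelta p δ) (c : ℝ≥0∞) (t : ℝ) :
    bar p δ (fun _ => c) t ≤ c := by
  unfold bar
  rw [lintegral_const]
  exact mul_le_of_le_one_right zero_le (kMeas_univ_le hp hδ)

theorem bar_bar_le (hp : 0 < p) (hδ : IsAdmissibleDelta p δ) {F : ℝ → ℝ≥0∞} (hF : Measurable F)
    (t : ℝ) : bar p δ (bar p δ F) t ≤ bar p δ F t := by
  have hm : Measurable fun s => bar p δ F (t + s) := (measurable_bar hF).comp (by fun_prop)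
  have hkm := measurable_kE (p := p) (δ := δ)
  have h1 : bar p δ (bar p δ F) t = ∫⁻ s in Ioi 0, ∫⁻ r in Ioi 0,
      kE p δ s * ((Ioi s).indicator (fun _ => 1) r * (kE p δ (r - s) * F (t + r))) := by
    unfold bar at *
    rw [lintegral_kMeas hm]
    refine setLIntegral_congr_fun measurableSet_Ioi fun s hs => ?_
    rw [lintegral_kMeas (by fun_prop), lintegral_const_mul']
    · congr 1
      have h2 : MeasurePreserving (fun r : ℝ => r - s) volume volume :=
        measurePreserving_sub_right volume s
      have h3 := h2.setLIntegral_comp_preimage measurableSet_Ioi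
        (f := fun r => kE p δ r * F (t + s + r)) (s := Ioi 0) (hkm.mul (by fun_prop))
      rw [← h3]
      have h4 : (fun r : ℝ => r - s) ⁻¹' Ioi 0 = Ioi s := by
        ext r; simp
      rw [h4]
      have h5 : ∀ r, (Ioi s).indicator (fun _ => (1 : ℝ≥0∞)) r * (kE p δ (r - s) * F (t + r)) =
          (Ioi s).indicator (fun r => kE p δ (r - s) * F (t + r)) r := by
        intro r
        by_cases hr : r ∈ Ioi s <;> simp [hr]
      simp only [h5]
      rw [setLIntegral_indicator measurableSet_Ioi]
      have h6 : Ioi s ∩ Ioi 0 = Ioi s := by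
        refine inter_eq_left.2 fun r hr => ?_
        exact lt_trans (show (0 : ℝ) < s from hs) hr
      rw [h6]
      refine lintegral_congr fun r => ?_
      congr 2
      ring
    · exact ENNReal.ofReal_ne_top
  rw [h1, lintegral_lintegral_swap]
  · unfold bar
    rw [lintegral_kMeas (by fun_prop)]
    refine setLIntegral_mono' measurableSet_Ioi fun r hr => ?_
    have h7 : ∀ s, kE p δ s * ((Ioi s).indicator (fun _ => 1) r * (kE p δ (r - s) * F (t + r))) =
        (Iio r).indicator (fun s => kE p δ s * kE p δ (r - s)) s * F (t + r) := by
      intro s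
      by_cases hs : s < r
      · rw [indicator_of_mem (show r ∈ Ioi s from hs), indicator_of_mem (show s ∈ Iio r from hs)]
        ring
      · rw [indicator_of_notMem (show r ∉ Ioi s from hs),
          indicator_of_notMem (show s ∉ Iio r from hs)]
        ring
    simp only [h7]
    have hm2 : Measurable fun s => kE p δ s * kE p δ (r - s) :=
      hkm.mul (hkm.comp (measurable_const.sub measurable_id))
    rw [lintegral_mul_const _ (hm2.indicator measurableSet_Iio),
      setLIntegral_indicator measurableSet_Iio]
    gcongr
    refine le_trans (lintegral_mono_set ?_) (lintegral_kE_conv_le hp hδ (le_of_lt hr))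
    exact fun s hs => ⟨hs.2, le_of_lt hs.1⟩
  · refine Measurable.aemeasurable ?_
    have h8 : Measurable fun z : ℝ × ℝ => (Ioi z.1).indicator (fun _ => (1 : ℝ≥0∞)) z.2 := by
      have : (fun z : ℝ × ℝ => (Ioi z.1).indicator (fun _ => (1 : ℝ≥0∞)) z.2) =
          {z : ℝ × ℝ | z.1 < z.2}.indicator fun _ => 1 := by
        funext z
        rfl
      rw [this]
      exact measurable_const.indicator (measurableSet_lt measurable_fst measurable_snd)
    exact (hkm.comp measurable_fst).mul (h8.mul ((hkm.comp (by fun_prop)).mul (by fun_prop)))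

theorem bar_ge (hp : 0 < p) (hδ : 0 ≤ δ) {F : ℝ → ℝ≥0∞} (hF : Measurable F) {t : ℝ} {c : ℝ≥0∞}
    (h : ∀ s, t < s → s ≤ t + 1 → c ≤ F s) :
    ENNReal.ofReal (δ / 2 ^ (p + 3)) * c ≤ bar p δ F t := by
  unfold bar
  rw [lintegral_kMeas (by fun_prop)]
  calc ENNReal.ofReal (δ / 2 ^ (p + 3)) * c
      = ∫⁻ _s in Ioc (0 : ℝ) 1, ENNReal.ofReal (δ / 2 ^ (p + 3)) * c := by simp
    _ ≤ ∫⁻ s in Ioc (0 : ℝ) 1, kE p δ s * F (t + s) := by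
        refine setLIntegral_mono' measurableSet_Ioc fun s hs => ?_
        exact mul_le_mul' (ENNReal.ofReal_le_ofReal (le_kClosed hp hδ hs.1.le hs.2))
          (h _ (by linarith [hs.1]) (by linarith [hs.2]))
    _ ≤ _ := lintegral_mono_set Ioc_subset_Ioi_self

theorem bar_rpow_le (hp : 0 < p) (hδ : 0 ≤ δ) :
    bar p δ (fun s => ENNReal.ofReal ((1 + s) ^ (p - 1))) 0 ≤
      ENNReal.ofReal (∫ s in Ioi (0 : ℝ), 2 * δ * (s + 1) ^ (-2 : ℝ)) := by
  unfold bar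
  rw [lintegral_kMeas (by fun_prop)]
  have h1 : IntegrableOn (fun t : ℝ => 2 * δ * (t + 1) ^ (-2 : ℝ)) (Ioi 0) :=
    (integrableOn_add_rpow_Ioi_of_lt (by norm_num) (by norm_num)).const_mul _
  calc ∫⁻ s in Ioi 0, kE p δ s * ENNReal.ofReal ((1 + (0 + s)) ^ (p - 1))
      ≤ ∫⁻ s in Ioi 0, ENNReal.ofReal (2 * δ * (s + 1) ^ (-2 : ℝ)) := by
        refine setLIntegral_mono' measurableSet_Ioi fun s hs => ?_
        have hs0 : (0 : ℝ) ≤ s := le_of_lt hs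
        rw [kE, ← ENNReal.ofReal_mul (kClosed_nonneg hp hδ hs0)]
        refine ENNReal.ofReal_le_ofReal ?_
        calc kClosed p δ s * (1 + (0 + s)) ^ (p - 1)
            ≤ 2 * δ * (1 + s) ^ (-(p + 1)) * (1 + (0 + s)) ^ (p - 1) := by
              gcongr
              exact kClosed_le hp hδ hs0
          _ = 2 * δ * (s + 1) ^ (-2 : ℝ) := by
              rw [zero_add, mul_assoc, ← Real.rpow_add (by linarith), add_comm s 1]
              congr 2
              ring
    _ = ENNReal.ofReal (∫ s in Ioi (0 : ℝ), 2 * δ * (s + 1) ^ (-2 : ℝ)) := by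
        rw [ofReal_integral_eq_lintegral_ofReal h1]
        refine (ae_restrict_iff' measurableSet_Ioi).2 (Eventually.of_forall fun s hs => ?_)
        have hs0 : (0 : ℝ) ≤ s := le_of_lt hs
        simp only [Pi.zero_apply]
        positivity

end Kernel

end GradPhi

namespace GradPhi

section Flow

variable {d L : ℕ}

/-- A solution of `∂ₜ u = ∇·a∇u` for positive times, in a continuous environment. -/
structure IsFlow (a : ℝ → Edge d L → ℝ) (u : ℝ → Torus d L → ℝ) : Prop where
  env_continuous : ∀ e, Continuous fun t => a t e
  env_nonneg : ∀ t e, 0 ≤ a t e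
  continuous : ∀ x, Continuous fun t => u t x
  hasDerivAt : ∀ t, 0 < t → ∀ x, HasDerivAt (fun s => u s x) (lap (a t) (u t) x) t

variable {a : ℝ → Edge d L → ℝ} {u : ℝ → Torus d L → ℝ}

theorem IsFlow.add_const (h : IsFlow a u) (c : ℝ) : IsFlow a fun t x => u t x + c where
  env_continuous := h.env_continuous
  env_nonneg := h.env_nonneg
  continuous x := (h.continuous x).add continuous_const
  hasDerivAt t ht x := by
    rw [lap_add_const]
    exact (h.hasDerivAt t ht x).add_const c

theorem IsFlow.continuous_gr (h : IsFlow a u) (e : Edge d L) :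
    Continuous fun t => gr (u t) e := (h.continuous _).sub (h.continuous _)

theorem IsFlow.continuous_lap (h : IsFlow a u) (x : Torus d L) :
    Continuous fun t => lap (a t) (u t) x := by
  unfold lap
  exact (continuous_finsetSum _ fun e _ => (h.env_continuous e).mul (h.continuous_gr e)).sub
    (continuous_finsetSum _ fun e _ => (h.env_continuous e).mul (h.continuous_gr e))

theorem IsFlow.sub_eq_integral (h : IsFlow a u) (x : Torus d L) {t1 t2 : ℝ} (h1 : 0 ≤ t1)
    (h12 : t1 ≤ t2) : u t2 x - u t1 x = ∫ t in t1..t2, lap (a t) (u t) x :=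
  (intervalIntegral.integral_eq_sub_of_hasDerivAt_of_le h12 (h.continuous x).continuousOn
    (fun t ht => h.hasDerivAt t (h1.trans_lt ht.1) x)
    ((h.continuous_lap x).intervalIntegrable _ _)).symm

/-- The dissipation with weight `|x|_*^q`. -/
noncomputable def dissip (q : ℝ) (a : ℝ → Edge d L → ℝ) (u : ℝ → Torus d L → ℝ) (t : ℝ) : ℝ≥0∞ :=
  ∑ e : Edge d L, sN e.1 ^ q * (ENNReal.ofReal (a t e) * ‖gr (u t) e‖ₑ ^ 2)

/-- The error term in the evolution of the weighted `L²` norm. -/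
noncomputable def drift (p : ℝ) (a : ℝ → Edge d L → ℝ) (u : ℝ → Torus d L → ℝ) (t : ℝ) : ℝ≥0∞ :=
  ∑ e : Edge d L, sN e.1 ^ (p - 2) *
    (ENNReal.ofReal (a t e) * (‖u t e.1‖ₑ ^ 2 + ‖u t (shift e)‖ₑ ^ 2))

/-- The `L²` norm with weight `|x|_*^q`, squared. -/
noncomputable def moment (q : ℝ) (u : ℝ → Torus d L → ℝ) (t : ℝ) : ℝ≥0∞ :=
  ∑ x, sN x ^ q * ‖u t x‖ₑ ^ 2

theorem IsFlow.measurable_dissip_term (h : IsFlow a u) (e : Edge d L) :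
    Measurable fun t => ENNReal.ofReal (a t e) * ‖gr (u t) e‖ₑ ^ 2 :=
  (h.env_continuous e).measurable.ennreal_ofReal.mul
    ((h.continuous_gr e).measurable.enorm.pow_const 2)

theorem IsFlow.measurable_dissip (h : IsFlow a u) (q : ℝ) : Measurable (dissip q a u) := by
  unfold dissip
  exact Finset.measurable_sum _ fun e _ => (h.measurable_dissip_term e).const_mul _

theorem IsFlow.measurable_drift (h : IsFlow a u) (p : ℝ) : Measurable (drift p a u) := by
  unfold drift
  exact Finset.measurable_sum _ fun e _ => ((h.env_continuous e).measurable.ennreal_ofReal.mul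
    (((h.continuous _).measurable.enorm.pow_const 2).add
      ((h.continuous _).measurable.enorm.pow_const 2))).const_mul _

theorem IsFlow.measurable_moment (h : IsFlow a u) (q : ℝ) : Measurable (moment q u) := by
  unfold moment
  exact Finset.measurable_sum _ fun e _ =>
    ((h.continuous _).measurable.enorm.pow_const 2).const_mul _

theorem enorm_sq_eq_ofReal (r : ℝ) : ‖r‖ₑ ^ 2 = ENNReal.ofReal (r ^ 2) := by
  rw [Real.enorm_eq_ofReal_abs, ← ENNReal.ofReal_pow (abs_nonneg _), sq_abs]

theorem sN_rpow (x : Torus d L) (q : ℝ) : sN x ^ q = ENNReal.ofReal (starNorm x ^ q) :=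
  ENNReal.ofReal_rpow_of_pos (starNorm_pos x)

theorem moment_eq (q : ℝ) (u : ℝ → Torus d L → ℝ) (t : ℝ) :
    moment q u t = ENNReal.ofReal (∑ x, starNorm x ^ q * u t x ^ 2) := by
  unfold moment
  rw [ENNReal.ofReal_sum_of_nonneg fun x _ =>
    mul_nonneg (Real.rpow_nonneg (starNorm_pos x).le _) (sq_nonneg _)]
  refine Finset.sum_congr rfl fun x _ => ?_
  rw [sN_rpow, enorm_sq_eq_ofReal, ← ENNReal.ofReal_mul (Real.rpow_nonneg (starNorm_pos x).le _)]

theorem moment_zero_eq (u : ℝ → Torus d L → ℝ) (t : ℝ) :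
    moment 0 u t = ENNReal.ofReal (∑ x, u t x ^ 2) := by
  rw [moment_eq]
  simp

theorem dissip_eq (ha : ∀ t e, 0 ≤ a t e) (q : ℝ) (t : ℝ) :
    dissip q a u t = ENNReal.ofReal (∑ e : Edge d L, starNorm e.1 ^ q * (a t e * gr (u t) e ^ 2)) := by
  unfold dissip
  rw [ENNReal.ofReal_sum_of_nonneg fun e _ =>
    mul_nonneg (Real.rpow_nonneg (starNorm_pos e.1).le _) (mul_nonneg (ha t e) (sq_nonneg _))]
  refine Finset.sum_congr rfl fun e _ => ?_
  rw [sN_rpow, enorm_sq_eq_ofReal, ← ENNReal.ofReal_mul (ha t e),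
    ← ENNReal.ofReal_mul (Real.rpow_nonneg (starNorm_pos e.1).le _)]

theorem drift_eq (ha : ∀ t e, 0 ≤ a t e) (p : ℝ) (t : ℝ) :
    drift p a u t = ENNReal.ofReal (∑ e : Edge d L, starNorm e.1 ^ (p - 2) *
      (a t e * (u t e.1 ^ 2 + u t (shift e) ^ 2))) := by
  unfold drift
  rw [ENNReal.ofReal_sum_of_nonneg fun e _ => mul_nonneg (Real.rpow_nonneg (starNorm_pos e.1).le _)
    (mul_nonneg (ha t e) (by positivity))]
  refine Finset.sum_congr rfl fun e _ => ?_
  rw [sN_rpow, enorm_sq_eq_ofReal, enorm_sq_eq_ofReal, ← ENNReal.ofReal_add (sq_nonneg _)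
    (sq_nonneg _), ← ENNReal.ofReal_mul (ha t e),
    ← ENNReal.ofReal_mul (Real.rpow_nonneg (starNorm_pos e.1).le _)]

theorem IsFlow.weighted_sq_sub_eq (h : IsFlow a u) (ρ : Torus d L → ℝ) {t1 t2 : ℝ} (h1 : 0 ≤ t1)
    (h12 : t1 ≤ t2) :
    ∑ x, ρ x * u t2 x ^ 2 - ∑ x, ρ x * u t1 x ^ 2 =
      ∫ t in t1..t2, -(2 * ∑ e, a t e * gr (u t) e * gr (fun x => ρ x * u t x) e) := by
  have hcont : Continuous fun t => -(2 * ∑ e, a t e * gr (u t) e * gr (fun x => ρ x * u t x) e) := by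
    refine (continuous_const.mul (continuous_finsetSum _ fun e _ => ?_)).neg
    exact ((h.env_continuous e).mul (h.continuous_gr e)).mul
      ((continuous_const.mul (h.continuous _)).sub (continuous_const.mul (h.continuous _)))
  refine (intervalIntegral.integral_eq_sub_of_hasDerivAt_of_le (f := fun t => ∑ x, ρ x * u t x ^ 2)
    h12 ?_ ?_ (hcont.intervalIntegrable _ _)).symm
  · exact (continuous_finsetSum _ fun x _ =>
      continuous_const.mul ((h.continuous x).pow 2)).continuousOn
  · intro t ht
    have hd : HasDerivAt (fun t => ∑ x, ρ x * u t x ^ 2)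
        (∑ x, ρ x * (2 * u t x * lap (a t) (u t) x)) t := by
      refine HasDerivAt.fun_sum fun x _ => ?_
      have := ((h.hasDerivAt t (h1.trans_lt ht.1) x).pow 2).const_mul (ρ x)
      simpa using this
    refine hd.congr_deriv ?_
    have := sum_mul_lap (a t) (u t) (fun x => ρ x * u t x)
    rw [← mul_neg, ← this, Finset.mul_sum]
    refine Finset.sum_congr rfl fun x _ => ?_
    ring

theorem IsFlow.sum_eq (h : IsFlow a u) {t : ℝ} (ht : 0 ≤ t) : ∑ x, u t x = ∑ x, u 0 x := by
  rw [← sub_eq_zero, ← Finset.sum_sub_distrib]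
  have h1 : ∀ x, u t x - u 0 x = ∫ s in (0 : ℝ)..t, lap (a s) (u s) x :=
    fun x => h.sub_eq_integral x le_rfl ht
  simp only [h1]
  rw [← intervalIntegral.integral_finsetSum fun x _ =>
    (h.continuous_lap x).intervalIntegrable _ _]
  have h2 : ∀ s, ∑ x, lap (a s) (u s) x = 0 := by
    intro s
    have := sum_mul_lap (a s) (u s) (fun _ => 1)
    simpa [gr] using this
  simp [h2]

theorem IsFlow.sum_abs_le (h : IsFlow a u) {t : ℝ} (ht : 0 ≤ t) :
    ∑ x, |u t x| ≤ ∑ x, |u 0 x| := by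
  have key : ∀ ε : ℝ, 0 < ε → ∑ x, √(u t x ^ 2 + ε) ≤ ∑ x, √(u 0 x ^ 2 + ε) := by
    intro ε hε
    have hpos : ∀ s x, 0 < u s x ^ 2 + ε := fun s x => by positivity
    have hanti : AntitoneOn (fun s => ∑ x, √(u s x ^ 2 + ε)) (Ici 0) := by
      refine antitoneOn_of_deriv_nonpos (convex_Ici 0) ?_ ?_ ?_
      · refine (continuous_finsetSum _ fun x _ => ?_).continuousOn
        exact (((h.continuous x).pow 2).add continuous_const).sqrt
      · intro s hs
        rw [interior_Ici] at hs
        refine (DifferentiableAt.fun_sum fun x _ => ?_).differentiableWithinAt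
        exact (((h.hasDerivAt s hs x).pow 2).add_const ε).sqrt (hpos s x).ne' |>.differentiableAt
      · intro s hs
        rw [interior_Ici] at hs
        have hd : HasDerivAt (fun s => ∑ x, √(u s x ^ 2 + ε))
            (∑ x, u s x / √(u s x ^ 2 + ε) * lap (a s) (u s) x) s := by
          refine HasDerivAt.fun_sum fun x _ => ?_
          refine ((((h.hasDerivAt s hs x).pow 2).add_const ε).sqrt (hpos s x).ne').congr_deriv ?_
          have := Real.sqrt_pos.2 (hpos s x)
          simp only [Nat.cast_ofNat, Nat.add_one_sub_one, pow_one, Pi.pow_apply]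
          field_simp
        rw [hd.deriv, sum_mul_lap, neg_nonpos]
        refine Finset.sum_nonneg fun e _ => ?_
        rw [mul_assoc]
        refine mul_nonneg (h.env_nonneg s e) ?_
        unfold gr
        -- monotonicity of `y ↦ y / √(y² + ε)`
        have hmono : ∀ y z : ℝ, 0 ≤ (y - z) * (y / √(y ^ 2 + ε) - z / √(z ^ 2 + ε)) := by
          intro y z
          set A := √(y ^ 2 + ε) with hA
          set B := √(z ^ 2 + ε) with hB
          have hA0 : 0 < A := Real.sqrt_pos.2 (by positivity)
          have hB0 : 0 < B := Real.sqrt_pos.2 (by positivity)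
          have hA2 : A ^ 2 = y ^ 2 + ε := Real.sq_sqrt (by positivity)
          have hB2 : B ^ 2 = z ^ 2 + ε := Real.sq_sqrt (by positivity)
          have h1 : (y - z) * (y / A - z / B) = (y - z) * (y * B - z * A) / (A * B) := by
            field_simp
          rw [h1]
          refine div_nonneg ?_ (by positivity)
          have h2 : |y * z| + ε ≤ A * B := by
            have h3 : (|y * z| + ε) ^ 2 ≤ (A * B) ^ 2 := by
              rw [mul_pow, hA2, hB2, add_sq, sq_abs, abs_mul]
              nlinarith [sq_nonneg (|y| - |z|), sq_abs y, sq_abs z]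
            exact abs_le_of_sq_le_sq' h3 (by positivity) |>.2
          have h4 : (y - z) * (y * B - z * A) = (A + B) * (A * B - ε - y * z) := by
            linear_combination -B * hA2 - A * hB2
          rw [h4]
          exact mul_nonneg (by positivity) (by linarith [le_abs_self (y * z)])
        exact hmono _ _
    exact hanti (mem_Ici.2 le_rfl) (mem_Ici.2 ht) ht
  have hlim : Tendsto (fun ε : ℝ => ∑ x, √(u 0 x ^ 2 + ε)) (nhdsWithin 0 (Ioi 0))
      (nhds (∑ x, |u 0 x|)) := by
    have hc : Continuous fun ε : ℝ => ∑ x, √(u 0 x ^ 2 + ε) := by fun_prop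
    exact (hc.tendsto' 0 _ (by simp [Real.sqrt_sq_eq_abs])).mono_left nhdsWithin_le_nhds
  refine ge_of_tendsto hlim ?_
  filter_upwards [self_mem_nhdsWithin] with ε hε
  refine le_trans (Finset.sum_le_sum fun x _ => ?_) (key ε hε)
  exact Real.abs_le_sqrt (by linarith [mem_Ioi.1 hε])

theorem IsFlow.continuous_dissip_real (h : IsFlow a u) (q : ℝ) :
    Continuous fun t => ∑ e : Edge d L, starNorm e.1 ^ q * (a t e * gr (u t) e ^ 2) :=
  continuous_finsetSum _ fun e _ =>
    continuous_const.mul ((h.env_continuous e).mul ((h.continuous_gr e).pow 2))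

theorem IsFlow.continuous_drift_real (h : IsFlow a u) (p : ℝ) :
    Continuous fun t => ∑ e : Edge d L, starNorm e.1 ^ (p - 2) *
      (a t e * (u t e.1 ^ 2 + u t (shift e) ^ 2)) :=
  continuous_finsetSum _ fun e _ => continuous_const.mul ((h.env_continuous e).mul
    (((h.continuous _).pow 2).add ((h.continuous _).pow 2)))

theorem lintegral_Ioc_ofReal {f : ℝ → ℝ} (hf : Continuous f) (h0 : ∀ t, 0 ≤ f t) {t1 t2 : ℝ}
    (h12 : t1 ≤ t2) :
    ∫⁻ t in Ioc t1 t2, ENNReal.ofReal (f t) = ENNReal.ofReal (∫ t in t1..t2, f t) := by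
  rw [intervalIntegral.integral_of_le h12,
    ofReal_integral_eq_lintegral_ofReal (hf.integrableOn_Ioc) (ae_of_all _ h0)]

theorem IsFlow.energy_eq (h : IsFlow a u) {t1 t2 : ℝ} (h1 : 0 ≤ t1) (h12 : t1 ≤ t2) :
    moment 0 u t1 = moment 0 u t2 + 2 * ∫⁻ t in Ioc t1 t2, dissip 0 a u t := by
  have hd := h.weighted_sq_sub_eq (fun _ => 1) h1 h12
  have h0 : ∀ t, 0 ≤ ∑ e : Edge d L, starNorm e.1 ^ (0 : ℝ) * (a t e * gr (u t) e ^ 2) :=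
    fun t => Finset.sum_nonneg fun e _ => mul_nonneg (Real.rpow_nonneg (starNorm_pos _).le _)
      (mul_nonneg (h.env_nonneg t e) (sq_nonneg _))
  simp only [dissip_eq h.env_nonneg]
  rw [lintegral_Ioc_ofReal (h.continuous_dissip_real 0) h0 h12, moment_zero_eq, moment_zero_eq,
    ← ENNReal.ofReal_ofNat 2, ← ENNReal.ofReal_mul (by norm_num), ← ENNReal.ofReal_add
    (Finset.sum_nonneg fun x _ => sq_nonneg _)
    (mul_nonneg (by norm_num) (intervalIntegral.integral_nonneg h12 fun t _ => h0 t))]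
  congr 1
  have h2 : ∀ t, -(2 * ∑ e, a t e * gr (u t) e * gr (fun x => u t x) e) =
      -(2 * ∑ e : Edge d L, starNorm e.1 ^ (0 : ℝ) * (a t e * gr (u t) e ^ 2)) := by
    intro t
    congr 2
    refine Finset.sum_congr rfl fun e _ => ?_
    rw [Real.rpow_zero]
    ring
  simp only [one_mul] at hd
  simp only [h2] at hd
  rw [intervalIntegral.integral_neg, intervalIntegral.integral_const_mul] at hd
  linarith

theorem rpow_sub_rpow_le {p x y : ℝ} (hp : 1 ≤ p) (hx : 0 < x) (hy : 0 < y) :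
    x ^ p - y ^ p ≤ p * x ^ (p - 1) * (x - y) := by
  have hb := one_add_mul_self_le_rpow_one_add (s := (y - x) / x) (p := p)
    (by rw [le_div_iff₀ hx]; linarith) hp
  have h1 : 1 + (y - x) / x = y / x := by field_simp; ring
  rw [h1, Real.div_rpow hy.le hx.le, le_div_iff₀ (Real.rpow_pos_of_pos hx _)] at hb
  have h2 : x ^ p = x ^ (p - 1) * x := by
    rw [← Real.rpow_add_one hx.ne']; ring_nf
  have h3 : (1 + p * ((y - x) / x)) * x ^ p = x ^ p + p * x ^ (p - 1) * (y - x) := by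
    rw [h2]; field_simp
  linarith

theorem sq_rpow_sub_rpow_le {p x y : ℝ} (hp : 2 ≤ p) (hx : 1 ≤ x) (hy : 1 ≤ y)
    (hxy : |x - y| ≤ 1) : (x ^ p - y ^ p) ^ 2 ≤ p ^ 2 * 4 ^ p * (y ^ p * y ^ (p - 2)) := by
  have hx0 : 0 < x := by linarith
  have hy0 : 0 < y := by linarith
  obtain ⟨hl, hr⟩ := abs_le.1 hxy
  have hM : ∀ z : ℝ, 0 < z → z ≤ 2 * y → z ^ (p - 1) ≤ (2 * y) ^ (p - 1) := fun z hz hzy =>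
    Real.rpow_le_rpow hz.le hzy (by linarith)
  have h0 : 0 ≤ (2 * y) ^ (p - 1) := by positivity
  have habs : |x ^ p - y ^ p| ≤ p * (2 * y) ^ (p - 1) := by
    rw [abs_le]
    constructor
    · have h1 := rpow_sub_rpow_le (by linarith : 1 ≤ p) hy0 hx0
      have h2 := hM y hy0 (by linarith)
      have h3 : 0 ≤ y ^ (p - 1) := by positivity
      have h4 : p * y ^ (p - 1) * (y - x) ≤ p * y ^ (p - 1) * 1 :=
        mul_le_mul_of_nonneg_left (by linarith) (by positivity)
      nlinarith
    · have h1 := rpow_sub_rpow_le (by linarith : 1 ≤ p) hx0 hy0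
      have h2 := hM x hx0 (by linarith)
      have h3 : 0 ≤ x ^ (p - 1) := by positivity
      have h4 : p * x ^ (p - 1) * (x - y) ≤ p * x ^ (p - 1) * 1 :=
        mul_le_mul_of_nonneg_left (by linarith) (by positivity)
      nlinarith
  rw [← sq_abs]
  refine (pow_le_pow_left₀ (abs_nonneg _) habs 2).trans ?_
  have h5 : ((2 * y) ^ (p - 1)) ^ 2 = 4 ^ (p - 1) * (y ^ p * y ^ (p - 2)) := by
    rw [← Real.rpow_natCast, ← Real.rpow_mul (by positivity), mul_comm (p - 1),
      Real.rpow_mul (by positivity), Real.rpow_natCast, mul_pow, Real.mul_rpow (by norm_num)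
      (by positivity), ← Real.rpow_natCast y, ← Real.rpow_mul hy0.le, ← Real.rpow_add hy0]
    norm_num
    left
    ring_nf
  rw [mul_pow, h5, mul_assoc]
  refine mul_le_mul_of_nonneg_left (mul_le_mul_of_nonneg_right ?_ (by positivity)) (by positivity)
  exact Real.rpow_le_rpow_of_exponent_le (by norm_num) (by linarith)

theorem abs_starNorm_sub_le (e : Edge d L) : |starNorm (shift e) - starNorm e.1| ≤ 1 := by
  rw [abs_le]
  constructor <;> linarith [starNorm_shift_le e, starNorm_le_shift e]

theorem IsFlow.weighted_growth {p : ℝ} (h : IsFlow a u) (hp : 2 ≤ p) {t1 t2 : ℝ} (h1 : 0 ≤ t1)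
    (h12 : t1 ≤ t2) :
    moment p u t2 + ∫⁻ t in Ioc t1 t2, dissip p a u t ≤
      moment p u t1 + ENNReal.ofReal (p ^ 2 * 4 ^ p) * ∫⁻ t in Ioc t1 t2, drift p a u t := by
  have hd := h.weighted_sq_sub_eq (fun x => starNorm x ^ p) h1 h12
  have hpow : ∀ (x : Torus d L) (q : ℝ), 0 ≤ starNorm x ^ q :=
    fun x q => Real.rpow_nonneg (starNorm_pos x).le _
  have h0 : ∀ t, 0 ≤ ∑ e : Edge d L, starNorm e.1 ^ p * (a t e * gr (u t) e ^ 2) :=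
    fun t => Finset.sum_nonneg fun e _ => mul_nonneg (hpow _ _)
      (mul_nonneg (h.env_nonneg t e) (sq_nonneg _))
  have h0' : ∀ t, 0 ≤ ∑ e : Edge d L, starNorm e.1 ^ (p - 2) *
      (a t e * (u t e.1 ^ 2 + u t (shift e) ^ 2)) :=
    fun t => Finset.sum_nonneg fun e _ => mul_nonneg (hpow _ _)
      (mul_nonneg (h.env_nonneg t e) (by positivity))
  have hC : 0 ≤ p ^ 2 * (4 : ℝ) ^ p := by positivity
  simp only [dissip_eq h.env_nonneg, drift_eq h.env_nonneg]
  rw [lintegral_Ioc_ofReal (h.continuous_dissip_real p) h0 h12,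
    lintegral_Ioc_ofReal (h.continuous_drift_real p) h0' h12, moment_eq, moment_eq,
    ← ENNReal.ofReal_mul hC, ← ENNReal.ofReal_add
    (Finset.sum_nonneg fun x _ => mul_nonneg (hpow _ _) (sq_nonneg _))
    (intervalIntegral.integral_nonneg h12 fun t _ => h0 t), ← ENNReal.ofReal_add
    (Finset.sum_nonneg fun x _ => mul_nonneg (hpow _ _) (sq_nonneg _))
    (mul_nonneg hC (intervalIntegral.integral_nonneg h12 fun t _ => h0' t))]
  refine ENNReal.ofReal_le_ofReal ?_
  have hmono : ∫ t in t1..t2, -(2 * ∑ e, a t e * gr (u t) e *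
        gr (fun x => starNorm x ^ p * u t x) e) ≤
      ∫ t in t1..t2, (p ^ 2 * 4 ^ p * (∑ e : Edge d L, starNorm e.1 ^ (p - 2) *
      (a t e * (u t e.1 ^ 2 + u t (shift e) ^ 2))) -
        ∑ e : Edge d L, starNorm e.1 ^ p * (a t e * gr (u t) e ^ 2)) := by
    refine intervalIntegral.integral_mono_on h12 ?_ ?_ ?_
    · refine Continuous.intervalIntegrable ?_ _ _
      refine (continuous_const.mul (continuous_finsetSum _ fun e _ => ?_)).neg
      exact ((h.env_continuous e).mul (h.continuous_gr e)).mul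
        ((continuous_const.mul (h.continuous _)).sub (continuous_const.mul (h.continuous _)))
    · exact ((continuous_const.mul (h.continuous_drift_real p)).sub
        (h.continuous_dissip_real p)).intervalIntegrable _ _
    · intro t _
      rw [Finset.mul_sum, Finset.mul_sum, ← Finset.sum_neg_distrib, ← Finset.sum_sub_distrib]
      refine Finset.sum_le_sum fun e _ => ?_
      have ha := h.env_nonneg t e
      set g := gr (u t) e with hg
      set ρ1 := starNorm e.1 ^ p with hρ1
      set ρ2 := starNorm (shift e) ^ p with hρ2
      have hρ1pos : 0 < ρ1 := Real.rpow_pos_of_pos (starNorm_pos _) _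
      have hgr : gr (fun x => starNorm x ^ p * u t x) e =
          ρ1 * g + (ρ2 - ρ1) * u t (shift e) := by
        rw [hg]; unfold gr; ring
      have hs := sq_rpow_sub_rpow_le hp (one_le_starNorm (shift e)) (one_le_starNorm e.1)
        (abs_starNorm_sub_le e)
      rw [← hρ1, ← hρ2] at hs
      have hq : 0 ≤ starNorm e.1 ^ (p - 2) := hpow _ _
      set q := starNorm e.1 ^ (p - 2)
      set c := p ^ 2 * (4 : ℝ) ^ p
      set v := u t (shift e)
      rw [hgr]
      have hmain : -(2 * (g * (ρ1 * g + (ρ2 - ρ1) * v))) ≤ c * q * v ^ 2 - ρ1 * g ^ 2 := by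
        have h6 : (ρ2 - ρ1) ^ 2 / ρ1 ≤ c * q := by
          rw [div_le_iff₀ hρ1pos]; linarith
        have h7 := mul_le_mul_of_nonneg_right h6 (sq_nonneg v)
        have h8 : 0 ≤ (ρ1 * g + (ρ2 - ρ1) * v) ^ 2 / ρ1 := by positivity
        have h9 : (ρ1 * g + (ρ2 - ρ1) * v) ^ 2 / ρ1 =
            ρ1 * g ^ 2 + 2 * (g * ((ρ2 - ρ1) * v)) + (ρ2 - ρ1) ^ 2 / ρ1 * v ^ 2 := by
          field_simp
          ring
        rw [h9] at h8
        linarith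
      have h10 := mul_le_mul_of_nonneg_left hmain ha
      have h11 : 0 ≤ c * q * (a t e * u t e.1 ^ 2) := by positivity
      linarith
  have hI : IntervalIntegrable (fun t => p ^ 2 * 4 ^ p * ∑ e : Edge d L, starNorm e.1 ^ (p - 2) *
      (a t e * (u t e.1 ^ 2 + u t (shift e) ^ 2))) volume t1 t2 :=
    (continuous_const.mul (h.continuous_drift_real p)).intervalIntegrable _ _
  rw [intervalIntegral.integral_sub hI ((h.continuous_dissip_real p).intervalIntegrable _ _), intervalIntegral.integral_const_mul]
    at hmono
  linarith

theorem IsFlow.moment_zero_antitone (h : IsFlow a u) {t1 t2 : ℝ} (h1 : 0 ≤ t1) (h12 : t1 ≤ t2) :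
    moment 0 u t2 ≤ moment 0 u t1 := by
  rw [h.energy_eq h1 h12]
  exact le_self_add

end Flow

section Bar

variable {p δ : ℝ}

theorem lintegral_Ioc_add (F : ℝ → ℝ≥0∞) (t1 t2 s : ℝ) :
    ∫⁻ r in Ioc (t1 + s) (t2 + s), F r = ∫⁻ r in Ioc t1 t2, F (r + s) := by
  have h := (measurePreserving_add_right volume s).setLIntegral_comp_emb
    (MeasurableEquiv.addRight s).measurableEmbedding F (Ioc t1 t2)
  rw [h]
  congr 2
  exact (Set.image_add_const_Ioc s t1 t2).symm

theorem lintegral_kMeas_lintegral_Ioc {F : ℝ → ℝ≥0∞} (hF : Measurable F) (t1 t2 : ℝ) :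
    ∫⁻ s, (∫⁻ r in Ioc (t1 + s) (t2 + s), F r) ∂kMeas p δ =
      ∫⁻ r in Ioc t1 t2, bar p δ F r := by
  simp only [lintegral_Ioc_add]
  rw [lintegral_lintegral_swap]
  · rfl
  · exact (hF.comp (measurable_snd.add measurable_fst)).aemeasurable

variable {d L : ℕ} {a : ℝ → Edge d L → ℝ} {u : ℝ → Torus d L → ℝ}

theorem IsFlow.bar_energy_eq (h : IsFlow a u) {t1 t2 : ℝ} (h1 : 0 ≤ t1) (h12 : t1 ≤ t2) :
    bar p δ (moment 0 u) t1 =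
      bar p δ (moment 0 u) t2 + 2 * ∫⁻ t in Ioc t1 t2, bar p δ (dissip 0 a u) t := by
  rw [← lintegral_kMeas_lintegral_Ioc (h.measurable_dissip 0)]
  unfold bar
  have hm : ∀ t, Measurable fun s => moment 0 u (t + s) := fun t =>
    (h.measurable_moment 0).comp (measurable_const.add measurable_id)
  rw [← lintegral_const_mul' _ _ (by norm_num), ← lintegral_add_left (hm t2)]
  refine lintegral_congr_ae ?_
  filter_upwards [ae_kMeas_pos] with s hs
  exact h.energy_eq (by linarith) (by linarith)

theorem IsFlow.bar_weighted_growth (h : IsFlow a u) (hp : 2 ≤ p) {t1 t2 : ℝ} (h1 : 0 ≤ t1)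
    (h12 : t1 ≤ t2) :
    bar p δ (moment p u) t2 + ∫⁻ t in Ioc t1 t2, bar p δ (dissip p a u) t ≤
      bar p δ (moment p u) t1 +
        ENNReal.ofReal (p ^ 2 * 4 ^ p) * ∫⁻ t in Ioc t1 t2, bar p δ (drift p a u) t := by
  rw [← lintegral_kMeas_lintegral_Ioc (h.measurable_dissip p),
    ← lintegral_kMeas_lintegral_Ioc (h.measurable_drift p)]
  unfold bar
  have hm : ∀ t, Measurable fun s => moment p u (t + s) := fun t =>
    (h.measurable_moment p).comp (measurable_const.add measurable_id)
  rw [← lintegral_const_mul' _ _ ENNReal.ofReal_ne_top, ← lintegral_add_left (hm t2),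
    ← lintegral_add_left (hm t1)]
  refine lintegral_mono_ae ?_
  filter_upwards [ae_kMeas_pos] with s hs
  exact h.weighted_growth hp (by linarith) (by linarith)

end Bar

end GradPhi

namespace GradPhi

section Moderation

variable {d L : ℕ} {p p' δ : ℝ}

/-- The edges sharing an endpoint with `e`. -/
def nbr (e : Edge d L) : Finset (Edge d L) :=
  Finset.univ.filter fun e' => (ends e' ∩ ends e).Nonempty

theorem mem_nbr {e e' : Edge d L} : e' ∈ nbr e ↔ (ends e' ∩ ends e).Nonempty := by
  simp [nbr]

theorem mem_nbr_of_mem {e e' : Edge d L} {x : Torus d L} (h' : x ∈ ends e') (h : x ∈ ends e) :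
    e' ∈ nbr e := mem_nbr.2 ⟨x, Finset.mem_inter.2 ⟨h', h⟩⟩

theorem fst_mem_ends (e : Edge d L) : e.1 ∈ ends e := by simp [ends]

theorem shift_mem_ends (e : Edge d L) : shift e ∈ ends e := by simp [ends]

theorem self_mem_nbr (e : Edge d L) : e ∈ nbr e := mem_nbr_of_mem (fst_mem_ends e) (fst_mem_ends e)

theorem abs_lap_le {a : Edge d L → ℝ} (ha : ∀ e, 0 ≤ a e) (f : Torus d L → ℝ) {e : Edge d L}
    {x : Torus d L} (hx : x ∈ ends e) : |lap a f x| ≤ 2 * ∑ e' ∈ nbr e, a e' * |gr f e'| := by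
  have h : ∀ S : Finset (Edge d L), (∀ e' ∈ S, x ∈ ends e') →
      |∑ e' ∈ S, a e' * gr f e'| ≤ ∑ e' ∈ nbr e, a e' * |gr f e'| := by
    intro S hS
    refine (Finset.abs_sum_le_sum_abs _ _).trans ?_
    simp only [abs_mul, abs_of_nonneg (ha _)]
    exact Finset.sum_le_sum_of_subset_of_nonneg (fun e' he' => mem_nbr_of_mem (hS e' he') hx)
      fun e' _ _ => mul_nonneg (ha e') (abs_nonneg _)
  unfold lap
  refine (abs_sub _ _).trans ?_
  refine le_of_le_of_eq ?_ (two_mul _).symm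
  refine add_le_add (h _ fun e' he' => ?_) (h _ fun e' he' => ?_)
  · rw [← (Finset.mem_filter.1 he').2]
    exact fst_mem_ends _
  · rw [← (Finset.mem_filter.1 he').2]
    exact shift_mem_ends _

theorem abs_gr_lap_le {a : Edge d L → ℝ} (ha : ∀ e, 0 ≤ a e) (f : Torus d L → ℝ) (e : Edge d L) :
    |gr (lap a f) e| ≤ 4 * ∑ e' ∈ nbr e, a e' * |gr f e'| := by
  unfold gr
  have h1 := abs_lap_le ha f (shift_mem_ends e)
  have h2 := abs_lap_le ha f (fst_mem_ends e)
  refine (abs_sub _ _).trans ?_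
  unfold gr at h1 h2
  linarith

variable {a : ℝ → Edge d L → ℝ} {u : ℝ → Torus d L → ℝ}

theorem IsFlow.sq_gr_sub_le (h : IsFlow a u) {t s : ℝ} (ht : 0 ≤ t) (hts : t ≤ s) (e : Edge d L) :
    (gr (u s) e - gr (u t) e) ^ 2 ≤ 16 * ((∑ e' ∈ nbr e, ∫ r in t..s, max (a r e') 1) *
      ∫ r in t..s, ∑ e' ∈ nbr e, a r e' * gr (u r) e' ^ 2) := by
  have hmc : ∀ e', Continuous fun r => max (a r e') 1 :=
    fun e' => (h.env_continuous e').max continuous_const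
  have hHc : Continuous fun r => ∑ e' ∈ nbr e, a r e' * gr (u r) e' ^ 2 :=
    continuous_finsetSum _ fun e' _ => (h.env_continuous e').mul ((h.continuous_gr e').pow 2)
  have hGc : Continuous fun r => ∑ e' ∈ nbr e, a r e' * |gr (u r) e'| :=
    continuous_finsetSum _ fun e' _ => (h.env_continuous e').mul (h.continuous_gr e').abs
  have hAc : Continuous fun r => ∑ e' ∈ nbr e, max (a r e') 1 :=
    continuous_finsetSum _ fun e' _ => hmc e'
  rw [← intervalIntegral.integral_finsetSum fun e' _ => (hmc e').intervalIntegrable _ _]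
  set A := ∫ r in t..s, ∑ e' ∈ nbr e, max (a r e') 1 with hA
  set M := ∫ r in t..s, ∑ e' ∈ nbr e, a r e' * |gr (u r) e'| with hM
  set H := ∫ r in t..s, ∑ e' ∈ nbr e, a r e' * gr (u r) e' ^ 2 with hH
  have hquad : ∀ c : ℝ, 0 ≤ H - 2 * c * M + c ^ 2 * A := by
    intro c
    have h1 : H - 2 * c * M + c ^ 2 * A = ∫ r in t..s, ((∑ e' ∈ nbr e, a r e' * gr (u r) e' ^ 2) -
        2 * c * (∑ e' ∈ nbr e, a r e' * |gr (u r) e'|) +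
        c ^ 2 * ∑ e' ∈ nbr e, max (a r e') 1) := by
      have i1 := hHc.intervalIntegrable (μ := volume) t s
      have i2 : IntervalIntegrable (fun r => 2 * c * ∑ e' ∈ nbr e, a r e' * |gr (u r) e'|)
        volume t s := (continuous_const.mul hGc).intervalIntegrable _ _
      have i3 : IntervalIntegrable (fun r => c ^ 2 * ∑ e' ∈ nbr e, max (a r e') 1)
        volume t s := (continuous_const.mul hAc).intervalIntegrable _ _
      rw [intervalIntegral.integral_add (i1.sub i2) i3, intervalIntegral.integral_sub i1 i2,
        intervalIntegral.integral_const_mul, intervalIntegral.integral_const_mul]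
    rw [h1]
    refine intervalIntegral.integral_nonneg hts fun r _ => ?_
    rw [Finset.mul_sum, Finset.mul_sum, ← Finset.sum_sub_distrib, ← Finset.sum_add_distrib]
    refine Finset.sum_nonneg fun e' _ => ?_
    have h2 := mul_nonneg (h.env_nonneg r e') (sq_nonneg (|gr (u r) e'| - c))
    have h3 := mul_le_mul_of_nonneg_left (le_max_left (a r e') 1) (sq_nonneg c)
    rw [← sq_abs (gr (u r) e')]
    linarith
  have hA0 : 0 ≤ A := intervalIntegral.integral_nonneg hts fun r _ =>
    Finset.sum_nonneg fun e' _ => le_max_of_le_right zero_le_one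
  have hMH : M ^ 2 ≤ A * H := by
    have := discrim_le_zero (a := A) (b := -(2 * M)) (c := H) fun c => by
      have := hquad c
      linarith
    unfold discrim at this
    linarith
  have hsub : gr (u s) e - gr (u t) e = ∫ r in t..s, gr (lap (a r) (u r)) e := by
    unfold gr
    rw [intervalIntegral.integral_sub ((h.continuous_lap _).intervalIntegrable _ _)
      ((h.continuous_lap _).intervalIntegrable _ _), ← h.sub_eq_integral _ ht hts,
      ← h.sub_eq_integral _ ht hts]
    ring
  have habs : |gr (u s) e - gr (u t) e| ≤ 4 * M := by
    rw [hsub]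
    refine (intervalIntegral.abs_integral_le_integral_abs hts).trans ?_
    rw [hM, ← intervalIntegral.integral_const_mul]
    refine intervalIntegral.integral_mono_on hts ?_
      ((continuous_const.mul hGc).intervalIntegrable _ _) fun r _ =>
      abs_gr_lap_le (h.env_nonneg r) _ e
    exact ((h.continuous_lap _).sub (h.continuous_lap _)).abs.intervalIntegrable _ _
  calc (gr (u s) e - gr (u t) e) ^ 2 = |gr (u s) e - gr (u t) e| ^ 2 := (sq_abs _).symm
    _ ≤ (4 * M) ^ 2 := pow_le_pow_left₀ (abs_nonneg _) habs 2
    _ = 16 * M ^ 2 := by ring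
    _ ≤ _ := by linarith

theorem lintegral_Ioi_eq_shift (F : ℝ → ℝ≥0∞) (t : ℝ) :
    ∫⁻ s in Ioi t, F s = ∫⁻ s in Ioi 0, F (t + s) := by
  have h := (measurePreserving_add_left volume t).setLIntegral_comp_emb
    (MeasurableEquiv.addLeft t).measurableEmbedding F (Ioi 0)
  rw [h, Set.image_const_add_Ioi, add_zero]

theorem ofReal_integral_le {α : Type*} [MeasurableSpace α] {μ : Measure α} (f : α → ℝ) :
    ENNReal.ofReal (∫ x, f x ∂μ) ≤ ∫⁻ x, ENNReal.ofReal (f x) ∂μ := by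
  by_cases hf : Integrable f μ
  · rw [integral_eq_lintegral_pos_part_sub_lintegral_neg_part hf]
    exact (ENNReal.ofReal_le_ofReal (sub_le_self _ ENNReal.toReal_nonneg)).trans
      ENNReal.ofReal_toReal_le
  · simp [integral_undef hf]

theorem lintegral_kKer_add_swap (hp : 0 < p) (hδ : 0 ≤ δ) {H : ℝ → ℝ≥0∞} (hH : Measurable H)
    (t : ℝ) :
    (∫⁻ s in Ioi 0, ENNReal.ofReal (kKer p δ s) * H (t + s)) +
      ∫⁻ s in Ioi 0, ENNReal.ofReal (s * kKer p δ s) * ∫⁻ r in Ioc 0 s, H (t + r) =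
    bar p δ H t := by
  have hk := measurable_kKer (p := p) (δ := δ)
  have h1 : ∫⁻ s in Ioi 0, ENNReal.ofReal (s * kKer p δ s) * ∫⁻ r in Ioc 0 s, H (t + r) =
      ∫⁻ r in Ioi 0, (∫⁻ s in Ioi r, ENNReal.ofReal (s * kKer p δ s)) * H (t + r) := by
    have e1 : ∀ s, ENNReal.ofReal (s * kKer p δ s) * ∫⁻ r in Ioc 0 s, H (t + r) =
        ∫⁻ r in Ioi 0, ENNReal.ofReal (s * kKer p δ s) * ((Iic s).indicator (fun _ => 1) r *
          H (t + r)) := by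
      intro s
      rw [lintegral_const_mul' _ _ ENNReal.ofReal_ne_top, ← Ioi_inter_Iic,
        inter_comm, ← Measure.restrict_restrict measurableSet_Iic,
        ← lintegral_indicator measurableSet_Iic]
      congr 2
      ext r
      by_cases hr : r ∈ Iic s <;> simp [hr]
    simp only [e1]
    rw [lintegral_lintegral_swap]
    · refine setLIntegral_congr_fun measurableSet_Ioi fun r hr => ?_
      have e2 : ∀ s, ENNReal.ofReal (s * kKer p δ s) * ((Iic s).indicator (fun _ => 1) r *
          H (t + r)) = (Ici r).indicator (fun s => ENNReal.ofReal (s * kKer p δ s)) s *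
          H (t + r) := by
        intro s
        by_cases hs : r ≤ s
        · rw [indicator_of_mem (show r ∈ Iic s from hs), indicator_of_mem (show s ∈ Ici r from hs),
            one_mul]
        · rw [indicator_of_notMem (show r ∉ Iic s from hs),
            indicator_of_notMem (show s ∉ Ici r from hs), zero_mul, mul_zero]
      simp only [e2]
      have hi : Measurable ((Ici r).indicator fun s => ENNReal.ofReal (s * kKer p δ s)) :=
        (measurable_id.mul hk).ennreal_ofReal.indicator measurableSet_Ici
      rw [lintegral_mul_const _ hi, lintegral_indicator measurableSet_Ici,
        Measure.restrict_restrict measurableSet_Ici, inter_eq_left.2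
        (Ici_subset_Ioi.2 hr), setLIntegral_congr Ioi_ae_eq_Ici.symm]
    · refine Measurable.aemeasurable ?_
      refine Measurable.mul ((measurable_id.mul hk).ennreal_ofReal.comp measurable_fst)
        (Measurable.mul ?_ (hH.comp (measurable_const.add measurable_snd)))
      exact (measurable_const.indicator (measurableSet_le measurable_snd measurable_fst) :
        Measurable ({z : ℝ × ℝ | z.2 ≤ z.1}.indicator fun _ => (1 : ℝ≥0∞)))
  have hm : Measurable fun s => ENNReal.ofReal (kKer p δ s) * H (t + s) :=
    hk.ennreal_ofReal.mul (hH.comp (measurable_const.add measurable_id))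
  rw [h1, ← lintegral_add_left hm]
  unfold bar
  have hm' : Measurable fun s => H (t + s) := hH.comp (measurable_const.add measurable_id)
  rw [lintegral_kMeas hm']
  refine setLIntegral_congr_fun measurableSet_Ioi fun s hs => ?_
  rw [← ofReal_kKer_add_lintegral hp hδ (le_of_lt hs), add_mul]

theorem IsFlow.moderation (h : IsFlow a u) (hp : 0 < p) (hδ : 0 ≤ δ) {t : ℝ} (ht : 0 ≤ t)
    (e : Edge d L) :
    wE p δ a t e ^ 2 * ‖gr (u t) e‖ₑ ^ 2 ≤
      32 * bar p δ (fun s => ∑ e' ∈ nbr e, ENNReal.ofReal (a s e') * ‖gr (u s) e'‖ₑ ^ 2) t := by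
  set H : ℝ → ℝ := fun s => ∑ e' ∈ nbr e, a s e' * gr (u s) e' ^ 2 with hHdef
  have hHc : Continuous H :=
    continuous_finsetSum _ fun e' _ => (h.env_continuous e').mul ((h.continuous_gr e').pow 2)
  have hH0 : ∀ s, 0 ≤ H s := fun s => Finset.sum_nonneg fun e' _ =>
    mul_nonneg (h.env_nonneg s e') (sq_nonneg _)
  have hHE : (fun s => ∑ e' ∈ nbr e, ENNReal.ofReal (a s e') * ‖gr (u s) e'‖ₑ ^ 2) =
      fun s => ENNReal.ofReal (H s) := by
    ext s
    rw [hHdef, ENNReal.ofReal_sum_of_nonneg fun e' _ =>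
      mul_nonneg (h.env_nonneg s e') (sq_nonneg _)]
    exact Finset.sum_congr rfl fun e' _ => by
      rw [enorm_sq_eq_ofReal, ← ENNReal.ofReal_mul (h.env_nonneg s e')]
  rw [hHE]
  set f : ℝ → ℝ := fun s => kKer p δ (s - t) * (min (a s e) 1 /
    ((s - t)⁻¹ * ∑ e' ∈ nbr e, ∫ s' in t..s, max (a s' e') 1)) with hf
  have hw : wE p δ a t e ^ 2 ≤ ∫⁻ s in Ioi t, ENNReal.ofReal (f s) := by
    unfold wE moderated
    rw [← ENNReal.ofReal_pow (Real.sqrt_nonneg _)]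
    change ENNReal.ofReal (√(∫ s in Ioi t, f s) ^ 2) ≤ _
    by_cases hneg : 0 ≤ ∫ s in Ioi t, f s
    · rw [Real.sq_sqrt hneg]
      exact ofReal_integral_le _
    · rw [Real.sqrt_eq_zero_of_nonpos (not_le.1 hneg).le]
      simp
  calc wE p δ a t e ^ 2 * ‖gr (u t) e‖ₑ ^ 2
      ≤ (∫⁻ s in Ioi t, ENNReal.ofReal (f s)) * ENNReal.ofReal (gr (u t) e ^ 2) := by
        rw [enorm_sq_eq_ofReal]
        exact mul_le_mul_left hw _
    _ = ∫⁻ s in Ioi 0, ENNReal.ofReal (f (t + s)) * ENNReal.ofReal (gr (u t) e ^ 2) := by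
        rw [lintegral_Ioi_eq_shift, lintegral_mul_const' _ _ ENNReal.ofReal_ne_top]
    _ ≤ ∫⁻ s in Ioi 0, 32 * (ENNReal.ofReal (kKer p δ s) * ENNReal.ofReal (H (t + s)) +
          ENNReal.ofReal (s * kKer p δ s) * ∫⁻ r in Ioc 0 s, ENNReal.ofReal (H (t + r))) := by
        refine setLIntegral_mono' measurableSet_Ioi fun s hs => ?_
        have hs0 : 0 < s := hs
        have hint : ∫⁻ r in Ioc 0 s, ENNReal.ofReal (H (t + r)) =
            ENNReal.ofReal (∫ r in t..t + s, H r) := by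
          rw [← lintegral_Ioc_ofReal hHc hH0 (by linarith)]
          have := lintegral_Ioc_add (fun r => ENNReal.ofReal (H r)) 0 s t
          rw [zero_add, add_comm s t] at this
          rw [this]
          simp only [add_comm t]
        have hJ : 0 ≤ ∫ r in t..t + s, H r :=
          intervalIntegral.integral_nonneg (by linarith) fun r _ => hH0 r
        have hk : 0 ≤ kKer p δ s := kKer_nonneg hδ hs0.le
        rw [hint, ← ENNReal.ofReal_mul' (sq_nonneg _), ← ENNReal.ofReal_mul hk,
          ← ENNReal.ofReal_mul (mul_nonneg hs0.le hk), ← ENNReal.ofReal_add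
          (mul_nonneg hk (hH0 _)) (mul_nonneg (mul_nonneg hs0.le hk) hJ),
          ← ENNReal.ofReal_ofNat 32, ← ENNReal.ofReal_mul (by norm_num)]
        refine ENNReal.ofReal_le_ofReal ?_
        have hsq := h.sq_gr_sub_le ht (by linarith : t ≤ t + s) e
        change _ ≤ 16 * (_ * ∫ r in t..t + s, H r) at hsq
        simp only [hf, add_sub_cancel_left]
        set A := ∑ e' ∈ nbr e, ∫ s' in t..t + s, max (a s' e') 1 with hA
        have hAs : s ≤ A := by
          have h1 : ∀ e' : Edge d L, s ≤ ∫ s' in t..t + s, max (a s' e') 1 := by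
            intro e'
            have h2 : ∫ s' in t..t + s, (1 : ℝ) ≤ ∫ s' in t..t + s, max (a s' e') 1 :=
              intervalIntegral.integral_mono_on (by linarith) (by simp)
                (((h.env_continuous e').max continuous_const).intervalIntegrable _ _)
                fun r _ => le_max_right _ _
            simpa using h2
          exact (h1 e).trans (Finset.single_le_sum (f := fun e' => ∫ s' in t..t + s, max (a s' e') 1)
            (fun e' _ => hs0.le.trans (h1 e')) (self_mem_nbr e))
        have hA0 : 0 < A := hs0.trans_le hAs
        set b := min (a (t + s) e) 1 with hb
        have hb0 : 0 ≤ b := le_min (h.env_nonneg _ _) zero_le_one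
        have hb1 : b ≤ 1 := min_le_right _ _
        have hba : b * gr (u (t + s)) e ^ 2 ≤ H (t + s) := by
          refine (mul_le_mul_of_nonneg_right (min_le_left _ _) (sq_nonneg _)).trans ?_
          exact Finset.single_le_sum (f := fun e' => a (t + s) e' * gr (u (t + s)) e' ^ 2)
            (fun e' _ => mul_nonneg (h.env_nonneg _ e') (sq_nonneg _)) (self_mem_nbr e)
        have hg : gr (u t) e ^ 2 ≤ 2 * gr (u (t + s)) e ^ 2 +
            32 * (A * ∫ r in t..t + s, H r) := by
          nlinarith [sq_nonneg (2 * gr (u (t + s)) e - gr (u t) e)]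
        have hrw : b / (s⁻¹ * A) = b * (s / A) := by field_simp
        rw [hrw]
        have hsA : s / A ≤ 1 := (div_le_one hA0).2 hAs
        have hsA0 : 0 ≤ s / A := by positivity
        set J := ∫ r in t..t + s, H r
        have h3 : b * (s / A) * gr (u t) e ^ 2 ≤ 32 * (H (t + s) + s * J) := by
          calc b * (s / A) * gr (u t) e ^ 2
              ≤ b * (s / A) * (2 * gr (u (t + s)) e ^ 2 + 32 * (A * J)) :=
                mul_le_mul_of_nonneg_left hg (mul_nonneg hb0 hsA0)
            _ = 2 * ((s / A) * (b * gr (u (t + s)) e ^ 2)) + 32 * (b * (s * J)) := by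
                field_simp
            _ ≤ 2 * (1 * H (t + s)) + 32 * (1 * (s * J)) := by
                have h4 := mul_le_mul hsA hba (by positivity) zero_le_one
                have h5 := mul_le_mul_of_nonneg_right hb1 (mul_nonneg hs0.le hJ)
                linarith
            _ ≤ _ := by linarith [hH0 (t + s)]
        have h6 := mul_le_mul_of_nonneg_left h3 hk
        linarith
    _ = 32 * bar p δ (fun s => ENNReal.ofReal (H s)) t := by
        rw [lintegral_const_mul' _ _ (by norm_num), lintegral_add_left,
          lintegral_kKer_add_swap hp hδ hHc.measurable.ennreal_ofReal]
        exact measurable_kKer.ennreal_ofReal.mul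
          (hHc.measurable.ennreal_ofReal.comp (measurable_const.add measurable_id))

theorem card_nbr_le (e : Edge d L) : (nbr e).card ≤ 4 * d := by
  classical
  have h : nbr e ⊆ Finset.univ.image fun z : Bool × Bool × Fin d =>
      (((if z.1 then e.1 else shift e) - (if z.2.1 then 0 else Pi.single z.2.2 1), z.2.2) :
        Edge d L) := by
    intro e' he'
    obtain ⟨x, hx⟩ := mem_nbr.1 he'
    obtain ⟨h1, h2⟩ := Finset.mem_inter.1 hx
    simp only [ends, Finset.mem_insert, Finset.mem_singleton] at h1 h2
    rw [Finset.mem_image]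
    obtain ⟨b, hb⟩ : ∃ b : Bool, (if b then e.1 else shift e) = x := by
      rcases h2 with h2 | h2
      · exact ⟨true, by simp [h2]⟩
      · exact ⟨false, by simp [h2]⟩
    rcases h1 with h1 | h1
    · exact ⟨(b, true, e'.2), Finset.mem_univ _, by simp [hb, h1]⟩
    · exact ⟨(b, false, e'.2), Finset.mem_univ _, by
        dsimp only
        rw [hb, h1]
        simp [shift]⟩
  refine (Finset.card_le_card h).trans (Finset.card_image_le.trans ?_)
  simp [Fintype.card_prod]
  omega

theorem nbr_symm {e e' : Edge d L} (h : e' ∈ nbr e) : e ∈ nbr e' := by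
  rw [mem_nbr] at h ⊢
  rwa [Finset.inter_comm]

theorem starNorm_le_of_mem_nbr {e e' : Edge d L} (h : e' ∈ nbr e) :
    starNorm e.1 ≤ 3 * starNorm e'.1 := by
  obtain ⟨x, hx⟩ := mem_nbr.1 h
  obtain ⟨h1, h2⟩ := Finset.mem_inter.1 hx
  simp only [ends, Finset.mem_insert, Finset.mem_singleton] at h1 h2
  have h3 : starNorm e.1 ≤ starNorm x + 1 := by
    rcases h2 with h2 | h2
    · rw [h2]; linarith
    · rw [h2]; exact starNorm_le_shift e
  have h4 : starNorm x ≤ starNorm e'.1 + 1 := by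
    rcases h1 with h1 | h1
    · rw [h1]; linarith
    · rw [h1]; exact starNorm_shift_le e'
  linarith [one_le_starNorm e'.1]

theorem sum_weight_nbr_le {q : ℝ} (hq : 0 ≤ q) (f : Edge d L → ℝ≥0∞) :
    ∑ e : Edge d L, sN e.1 ^ q * ∑ e' ∈ nbr e, f e' ≤
      4 * d * 3 ^ q * ∑ e : Edge d L, sN e.1 ^ q * f e := by
  calc ∑ e : Edge d L, sN e.1 ^ q * ∑ e' ∈ nbr e, f e'
      ≤ ∑ e : Edge d L, ∑ e' ∈ nbr e, 3 ^ q * (sN e'.1 ^ q * f e') := by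
        refine Finset.sum_le_sum fun e _ => ?_
        rw [Finset.mul_sum]
        refine Finset.sum_le_sum fun e' he' => ?_
        rw [← mul_assoc, ← ENNReal.mul_rpow_of_nonneg _ _ hq]
        gcongr
        unfold sN
        rw [← ENNReal.ofReal_ofNat 3, ← ENNReal.ofReal_mul (by norm_num)]
        exact ENNReal.ofReal_le_ofReal (starNorm_le_of_mem_nbr he')
    _ = ∑ e' : Edge d L, ∑ e ∈ nbr e', 3 ^ q * (sN e'.1 ^ q * f e') := by
        refine Finset.sum_comm' fun e e' => ?_
        simp only [Finset.mem_univ, true_and, and_true]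
        exact ⟨nbr_symm, nbr_symm⟩
    _ ≤ ∑ e' : Edge d L, 4 * d * (3 ^ q * (sN e'.1 ^ q * f e')) := by
        refine Finset.sum_le_sum fun e' _ => ?_
        rw [Finset.sum_const, nsmul_eq_mul]
        gcongr
        exact_mod_cast card_nbr_le e'
    _ = _ := by
        rw [Finset.mul_sum]
        exact Finset.sum_congr rfl fun e' _ => by ring

theorem IsFlow.weighted_moderation (h : IsFlow a u) (hp : 0 < p) (hδ : 0 ≤ δ) {q : ℝ} (hq : 0 ≤ q)
    {t : ℝ} (ht : 0 ≤ t) :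
    ∑ e : Edge d L, sN e.1 ^ q * (wE p δ a t e ^ 2 * ‖gr (u t) e‖ₑ ^ 2) ≤
      32 * (4 * d * 3 ^ q) * bar p δ (dissip q a u) t := by
  have hb : ∀ F : Finset (Edge d L), ∀ c : Edge d L → ℝ≥0∞,
      bar p δ (fun s => ∑ e' ∈ F, c e' * (ENNReal.ofReal (a s e') * ‖gr (u s) e'‖ₑ ^ 2)) t =
      ∑ e' ∈ F, c e' * bar p δ (fun s => ENNReal.ofReal (a s e') * ‖gr (u s) e'‖ₑ ^ 2) t := by
    intro F c
    rw [bar_finset_sum F fun e' => (h.measurable_dissip_term e').const_mul (c e')]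
    exact Finset.sum_congr rfl fun e' _ => bar_const_mul (h.measurable_dissip_term e') _ _
  calc ∑ e : Edge d L, sN e.1 ^ q * (wE p δ a t e ^ 2 * ‖gr (u t) e‖ₑ ^ 2)
      ≤ ∑ e : Edge d L, sN e.1 ^ q * (32 * ∑ e' ∈ nbr e,
          bar p δ (fun s => ENNReal.ofReal (a s e') * ‖gr (u s) e'‖ₑ ^ 2) t) := by
        refine Finset.sum_le_sum fun e _ => ?_
        refine mul_le_mul' le_rfl ?_
        have := h.moderation hp hδ ht e
        have h1 := hb (nbr e) 1
        simp only [Pi.one_apply, one_mul] at h1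
        rwa [h1] at this
    _ = 32 * ∑ e : Edge d L, sN e.1 ^ q * ∑ e' ∈ nbr e,
          bar p δ (fun s => ENNReal.ofReal (a s e') * ‖gr (u s) e'‖ₑ ^ 2) t := by
        rw [Finset.mul_sum]
        exact Finset.sum_congr rfl fun e _ => by ring
    _ ≤ 32 * (4 * d * 3 ^ q * ∑ e : Edge d L, sN e.1 ^ q *
          bar p δ (fun s => ENNReal.ofReal (a s e) * ‖gr (u s) e‖ₑ ^ 2) t) := by
        gcongr
        exact sum_weight_nbr_le hq _
    _ = _ := by
        rw [← hb Finset.univ]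
        exact (mul_assoc (32 : ℝ≥0∞) _ _).symm

theorem measurable_wE (ha : ∀ e, Continuous fun t => a t e) (e : Edge d L) :
    Measurable fun t => wE p δ a t e := by
  unfold wE moderated
  refine Measurable.ennreal_ofReal (Real.continuous_sqrt.measurable.comp ?_)
  have hm : ∀ e', Continuous fun s => max (a s e') 1 := fun e' => (ha e').max continuous_const
  obtain ⟨G, hG, hI⟩ : ∃ G : Edge d L → ℝ → ℝ, (∀ e', Measurable (G e')) ∧
      ∀ e' t s, ∫ s' in t..s, max (a s' e') 1 = G e' s - G e' t :=
    ⟨fun e' s => ∫ s' in (0 : ℝ)..s, max (a s' e') 1, fun e' =>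
      (intervalIntegral.continuous_primitive
        (fun x y => (hm e').intervalIntegrable x y) 0).measurable, fun e' t s =>
      (intervalIntegral.integral_interval_sub_left ((hm e').intervalIntegrable _ _)
        ((hm e').intervalIntegrable _ _)).symm⟩
  have hk := measurable_kKer (p := p) (δ := δ)
  simp only [hI]
  have hF : Measurable fun z : ℝ × ℝ => kKer p δ (z.2 - z.1) * (min (a z.2 e) 1 /
      ((z.2 - z.1)⁻¹ * ∑ e' : Edge d L with (ends e' ∩ ends e).Nonempty,
        (G e' z.2 - G e' z.1))) := by
    have hsub : Measurable fun z : ℝ × ℝ => z.2 - z.1 := measurable_snd.sub measurable_fst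
    refine (hk.comp hsub).mul ((((ha e).measurable.comp measurable_snd).min measurable_const).div
      (hsub.inv.mul (Finset.measurable_sum _ fun e' _ => ?_)))
    exact ((hG e').comp measurable_snd).sub ((hG e').comp measurable_fst)
  have hset : MeasurableSet {z : ℝ × ℝ | z.1 < z.2} := measurableSet_lt measurable_fst measurable_snd
  have := (hF.indicator hset).stronglyMeasurable.integral_prod_right' (ν := volume)
  convert this.measurable using 2 with t
  rw [← integral_indicator measurableSet_Ioi]
  rfl

theorem measurable_avgNorm {q : ℝ} (U : Finset (Torus d L)) {f : ℝ → Edge d L → ℝ≥0∞}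
    (hf : ∀ e, Measurable fun t => f t e) : Measurable fun t => avgNorm q U (f t) := by
  unfold avgNorm
  exact ((Finset.measurable_sum _ fun e _ => (hf e).pow_const q).div_const _).pow_const _

theorem measurable_calMp' (ha : ∀ e, Continuous fun t => a t e) :
    Measurable (calMp' p p' δ a) := by
  unfold calMp'
  have hw : ∀ e, Measurable fun t => wE p δ a t e := measurable_wE ha
  have hi : ∀ e, Measurable fun t => wInv p δ a t e := fun e => (hw e).inv
  have h1 : Measurable fun t => (1 + avgNorm (sigExp d) Finset.univ (wE p δ a t) *
      avgNorm (tauExp d) Finset.univ (wInv p δ a t)) ^ 2 :=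
    (measurable_const.add ((measurable_avgNorm _ hw).mul (measurable_avgNorm _ hi))).pow_const 2
  refine measurable_const.add (h1.mul ?_)
  exact Measurable.iSup fun r => Measurable.iSup fun _ => (measurable_avgNorm _ hi).pow_const 2

theorem measurable_calM0 (ha : ∀ e, Continuous fun t => a t e) : Measurable (calM0 p δ a) := by
  unfold calM0
  have hi : ∀ e, Measurable fun t => wInv p δ a t e := fun e => (measurable_wE ha e).inv
  have h1 : ∀ r, Measurable fun t =>
      avgNorm (sigExp d) (box d L r) (fun e => ENNReal.ofReal √(a t e)) ^ 2 := fun r =>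
    (measurable_avgNorm _ fun e =>
      (Real.continuous_sqrt.comp (ha e)).measurable.ennreal_ofReal).pow_const 2
  have h2 : ∀ r, Measurable fun t =>
      1 + avgNorm (tauExp' d) (box d L r) (wInv p δ a t) ^ 2 := fun r =>
    measurable_const.add ((measurable_avgNorm _ hi).pow_const 2)
  exact measurable_const.add (Measurable.iSup fun r => Measurable.iSup fun _ => (h1 r).mul (h2 r))

theorem calM1_eq (hp : 0 < p) (hδ : 0 ≤ δ) (ha : ∀ e, Continuous fun t => a t e) (t : ℝ) :
    calM1 p δ a t = 1 + bar p δ (fun s => calM0 p δ a s ^ (p / (2 * (1 - thetaExp d)))) t := by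
  unfold calM1
  rw [lintegral_Ioi_kKer_eq_bar hp hδ ((measurable_calM0 ha).pow_const _)]

theorem calM3_eq (hp : 0 < p) (hδ : 0 ≤ δ) (ha : ∀ e, Continuous fun t => a t e) (t : ℝ) :
    calM3 p p' δ a t = 1 + bar p δ (fun s => calMp' p p' δ a s ^
      (alphaExp d p p' / betaExp d p p')) t ^ betaExp d p p' := by
  unfold calM3
  rw [lintegral_Ioi_kKer_eq_bar hp hδ ((measurable_calMp' ha).pow_const _)]

end Moderation

end GradPhi

namespace GradPhi

section Averaged

variable {d L : ℕ} {p p' δ : ℝ}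

theorem lintegral_mul_mul_rpow_le {α : Type*} [MeasurableSpace α] {μ : Measure α}
    {f g h : α → ℝ≥0∞} (hf : Measurable f) (hg : Measurable g) (hh : Measurable h)
    {a b c : ℝ} (ha : 0 ≤ a) (hb : 0 ≤ b) (hc : 0 ≤ c) (habc : a + b + c = 1) :
    ∫⁻ x, f x ^ a * g x ^ b * h x ^ c ∂μ ≤
      (∫⁻ x, f x ∂μ) ^ a * (∫⁻ x, g x ∂μ) ^ b * (∫⁻ x, h x ∂μ) ^ c := by
  have := ENNReal.lintegral_prod_norm_pow_le (μ := μ) (Finset.univ : Finset (Fin 3))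
    (f := ![f, g, h]) (p := ![a, b, c])
    (by intro i _; fin_cases i; exacts [hf.aemeasurable, hg.aemeasurable, hh.aemeasurable])
    (by simpa [Fin.sum_univ_three] using habc)
    (by intro i _; fin_cases i; exacts [ha, hb, hc])
  simpa [Fin.prod_univ_three] using this

theorem bar_mul_mul_rpow_le {f g h : ℝ → ℝ≥0∞} (hf : Measurable f) (hg : Measurable g)
    (hh : Measurable h) {a b c : ℝ} (ha : 0 ≤ a) (hb : 0 ≤ b) (hc : 0 ≤ c) (habc : a + b + c = 1)
    (t : ℝ) :
    bar p δ (fun s => f s ^ a * g s ^ b * h s ^ c) t ≤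
      bar p δ f t ^ a * bar p δ g t ^ b * bar p δ h t ^ c := by
  unfold bar
  exact lintegral_mul_mul_rpow_le (hf.comp (measurable_const_add t))
    (hg.comp (measurable_const_add t)) (hh.comp (measurable_const_add t)) ha hb hc habc

variable {a : ℝ → Edge d L → ℝ} {u : ℝ → Torus d L → ℝ}

theorem gradEnergy_wE_le (h : IsFlow a u) (hp : 0 < p) (hδ : 0 ≤ δ) {t : ℝ} (ht : 0 ≤ t) :
    gradEnergy (wE p δ a t) (u t) ≤ 128 * d * bar p δ (dissip 0 a u) t := by
  have := h.weighted_moderation hp hδ le_rfl ht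
  simp only [ENNReal.rpow_zero, one_mul, mul_one] at this
  refine this.trans_eq ?_
  rw [← mul_assoc]
  norm_num

theorem avgNorm_wInv_le_calMp' {t : ℝ} {r : ℕ} (hr : r ∈ Finset.Icc 1 L) :
    avgNorm p' (box d L r) (fun e => (wE p δ a t e)⁻¹) ^ 2 ≤ calMp' p p' δ a t := by
  unfold calMp'
  refine le_trans ?_ le_add_self
  refine le_trans ?_ (le_mul_of_one_le_left zero_le (one_le_pow₀ le_self_add))
  exact le_iSup₂_of_le r hr le_rfl

theorem avgNorm_le_calM0 {t : ℝ} {r : ℕ} (hr : r ∈ Finset.Icc 0 L) :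
    avgNorm (sigExp d) (box d L r) (fun e => ENNReal.ofReal √(a t e)) ^ 2
        * (1 + avgNorm (tauExp' d) (box d L r) (fun e => (wE p δ a t e)⁻¹) ^ 2) ≤
      calM0 p δ a t := by
  unfold calM0
  refine le_trans ?_ le_add_self
  exact le_iSup₂_of_le (f := fun r (_ : r ∈ Finset.Icc 0 L) =>
    avgNorm (sigExp d) (box d L r) (fun e => ENNReal.ofReal √(a t e)) ^ 2
        * (1 + avgNorm (tauExp' d) (box d L r) (wInv p δ a t) ^ 2)) r hr le_rfl

theorem ae_ne_top_of_bar_rpow {F : ℝ → ℝ≥0∞} (hF : Measurable F) {q : ℝ} (hq : 0 < q) {t : ℝ}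
    (h : bar p δ (fun s => F s ^ q) t ≠ ∞) : ∀ᵐ s ∂kMeas p δ, F (t + s) ≠ ∞ := by
  have hm : Measurable fun s => F (t + s) ^ q :=
    (hF.pow_const q).comp (measurable_const_add t)
  filter_upwards [ae_lt_top hm h] with s hs hF
  rw [hF, ENNReal.top_rpow_of_pos hq] at hs
  exact lt_irrefl _ hs

theorem calMp'_rpow_bar_le (hp : 0 < p) (hδ : 0 ≤ δ) (ha : ∀ e, Continuous fun t => a t e) (t : ℝ) :
    bar p δ (fun s => calMp' p p' δ a s ^ (alphaExp d p p' / betaExp d p p')) t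
      ^ betaExp d p p' ≤ calM3 p p' δ a t := by
  rw [calM3_eq hp hδ ha]
  exact le_add_self

theorem bar_calMp'_ne_top (hd : 2 ≤ d) (hp : (d : ℝ) < p) (hp' : (d : ℝ) < p') (hδ : 0 ≤ δ)
    (ha : ∀ e, Continuous fun t => a t e) {t : ℝ} (h : calM3 p p' δ a t ≠ ∞) :
    bar p δ (fun s => calMp' p p' δ a s ^ (alphaExp d p p' / betaExp d p p')) t ≠ ∞ := by
  have hp0 : 0 < p := lt_of_le_of_lt (Nat.cast_nonneg d) hp
  intro htop
  apply h
  have := calMp'_rpow_bar_le (p' := p') hp0 hδ ha t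
  rw [htop, ENNReal.top_rpow_of_pos (betaExp_pos hd hp hp')] at this
  exact top_le_iff.1 this

/-- The anchored Nash inequality for time averages. -/
theorem exists_bar_nash (d : ℕ) (hd : 2 ≤ d) {p p' δ : ℝ} (hp : (d : ℝ) < p) (hp' : (d : ℝ) < p')
    (hδ : IsAdmissibleDelta p δ) :
    ∃ C : ℝ≥0∞, 1 ≤ C ∧ C ≠ ∞ ∧ ∀ (L : ℕ), 1 ≤ L → ∀ (a : ℝ → Edge d L → ℝ)
      (u : ℝ → Torus d L → ℝ), IsFlow a u → ∑ x, u 0 x = 0 → ∑ x, |u 0 x| ≤ 2 → ∀ η t : ℝ, 0 ≤ t →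
      calM3 p p' δ a t ≠ ∞ →
      bar p δ (moment 0 u) t ≤ C * (calM3 p p' δ a t * bar p δ (dissip 0 a u) t ^ alphaExp d p p' *
          bar p δ (moment p fun t x => u t x + η) t ^ gammaExp d p p') +
        C * ENNReal.ofReal (Fintype.card (Torus d L) * η ^ 2) := by
  obtain ⟨C0, hC01, hC0⟩ := exists_anchored_nash d hd hp hp'
  have hp0 : 0 < p := lt_of_le_of_lt (Nat.cast_nonneg d) hp
  have hδ0 : 0 ≤ δ := hδ.1.le
  have hα := alphaExp_pos hd hp hp'
  have hβ := betaExp_pos hd hp hp'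
  have hγ := gammaExp_pos hd hp hp'
  have habc := exponents_add hd hp hp'
  set α := alphaExp d p p'
  set β := betaExp d p p'
  set γ := gammaExp d p p'
  set K : ℝ≥0∞ := (128 * d) ^ α * 4 ^ β with hK
  have hd1 : (1 : ℝ≥0∞) ≤ 128 * d := by
    have : (1 : ℝ≥0∞) ≤ (d : ℝ≥0∞) := by exact_mod_cast (by omega : 1 ≤ d)
    calc (1 : ℝ≥0∞) = 1 * 1 := (one_mul 1).symm
      _ ≤ _ := mul_le_mul' (by norm_num) this
  have hK1 : 1 ≤ K := one_le_mul (ENNReal.one_le_rpow hd1 hα)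
    (ENNReal.one_le_rpow (by norm_num) hβ)
  have hKt : K ≠ ∞ := ENNReal.mul_ne_top
    (ENNReal.rpow_ne_top_of_nonneg hα.le (ENNReal.mul_ne_top (by norm_num) (by simp)))
    (ENNReal.rpow_ne_top_of_nonneg hβ.le (by norm_num))
  have hC01' : (1 : ℝ≥0∞) ≤ C0 := by exact_mod_cast hC01
  refine ⟨C0 * K, one_le_mul hC01' hK1, ENNReal.mul_ne_top ENNReal.coe_ne_top hKt, ?_⟩
  intro L hL a u h hsum habs η t ht hM3
  have hη := h.add_const η
  set N := moment p fun t x => u t x + η with hN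
  set D := bar p δ (dissip 0 a u) with hDdef
  set R := ENNReal.ofReal (Fintype.card (Torus d L) * η ^ 2)
  set F := fun s => calMp' p p' δ a s ^ (α / β) with hF
  have hMm : Measurable (calMp' p p' δ a) := measurable_calMp' h.env_continuous
  have hFm : Measurable F := hMm.pow_const _
  have hDm : Measurable D := measurable_bar (h.measurable_dissip 0)
  have hNm : Measurable N := hη.measurable_moment p
  have hfin := ae_ne_top_of_bar_rpow hMm (div_pos hα hβ)
    (bar_calMp'_ne_top hd hp hp' hδ0 h.env_continuous hM3)
  have hpt : ∀ r, 0 ≤ r → calMp' p p' δ a r ≠ ∞ →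
      moment 0 u r ≤ C0 * K * (F r ^ β * D r ^ α * N r ^ γ) + C0 * R := by
    intro r hr hr'
    have hs : ∑ x, u r x = 0 := by rw [h.sum_eq hr, hsum]
    have h1 := hC0 L hL (u r) hs η (wE p δ a r) (fun e => ENNReal.ofReal_ne_top)
      (calMp' p p' δ a r) hr' (fun k hk => avgNorm_wInv_le_calMp' hk)
    rw [moment_zero_eq]
    refine h1.trans (add_le_add ?_ le_rfl)
    have h2 : (calMp' p p' δ a r * gradEnergy (wE p δ a r) (u r)) ^ α ≤
        (128 * d) ^ α * (F r ^ β * D r ^ α) := by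
      have h3 := ENNReal.rpow_le_rpow (mul_le_mul' (le_refl (calMp' p p' δ a r))
        (gradEnergy_wE_le h hp0 hδ0 hr)) hα.le
      refine h3.trans_eq ?_
      rw [ENNReal.mul_rpow_of_nonneg _ _ hα.le, ENNReal.mul_rpow_of_nonneg _ _ hα.le, hF]
      simp only
      rw [← ENNReal.rpow_mul, div_mul_cancel₀ _ hβ.ne']
      ring
    have h4 : ENNReal.ofReal ((∑ x, |u r x|) ^ 2) ^ β ≤ 4 ^ β := by
      refine ENNReal.rpow_le_rpow ?_ hβ.le
      rw [← ENNReal.ofReal_ofNat 4]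
      refine ENNReal.ofReal_le_ofReal ?_
      have h5 := (h.sum_abs_le hr).trans habs
      have h6 : 0 ≤ ∑ x, |u r x| := Finset.sum_nonneg fun x _ => abs_nonneg _
      nlinarith
    calc _ ≤ C0 * ((128 * d) ^ α * (F r ^ β * D r ^ α)) * 4 ^ β * N r ^ γ := by
          rw [hN, moment_eq]
          exact mul_le_mul' (mul_le_mul' (mul_le_mul' le_rfl h2) h4) le_rfl
      _ = _ := by rw [hK]; ring
  calc bar p δ (moment 0 u) t
      ≤ bar p δ (fun r => C0 * K * (F r ^ β * D r ^ α * N r ^ γ) + C0 * R) t := by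
        unfold bar
        refine lintegral_mono_ae ?_
        filter_upwards [hfin, ae_kMeas_pos] with s hs hs0
        exact hpt _ (by linarith) hs
    _ = C0 * K * bar p δ (fun r => F r ^ β * D r ^ α * N r ^ γ) t +
          bar p δ (fun _ => C0 * R) t := by
        have hm : Measurable fun r => F r ^ β * D r ^ α * N r ^ γ :=
          ((hFm.pow_const β).mul (hDm.pow_const α)).mul (hNm.pow_const γ)
        rw [bar_add (hm.const_mul _), bar_const_mul hm]
    _ ≤ C0 * K * (bar p δ F t ^ β * bar p δ D t ^ α * bar p δ N t ^ γ) + C0 * R := by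
        gcongr
        · exact bar_mul_mul_rpow_le hFm hDm hNm hβ.le hα.le hγ.le (by linarith) t
        · exact bar_const_le hp0 hδ _ t
    _ ≤ _ := by
        refine add_le_add (mul_le_mul' le_rfl (mul_le_mul' (mul_le_mul' ?_ ?_) le_rfl))
          (mul_le_mul' (le_mul_of_one_le_right zero_le hK1) le_rfl)
        · exact calMp'_rpow_bar_le hp0 hδ0 h.env_continuous t
        · exact ENNReal.rpow_le_rpow (bar_bar_le hp0 hδ (h.measurable_dissip 0) t) hα.le

/-- The Poincaré inequality for time averages. -/
theorem exists_bar_poincare (d : ℕ) (hd : 2 ≤ d) {p p' δ : ℝ} (hp : (d : ℝ) < p)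
    (hp' : (d : ℝ) < p') (hδ : IsAdmissibleDelta p δ) :
    ∃ C : ℝ≥0∞, 1 ≤ C ∧ C ≠ ∞ ∧ ∀ (L : ℕ), 1 ≤ L → ∀ (a : ℝ → Edge d L → ℝ)
      (u : ℝ → Torus d L → ℝ), IsFlow a u → ∑ x, u 0 x = 0 → ∀ t : ℝ, 0 ≤ t →
      calM3 p p' δ a t ≠ ∞ →
      bar p δ (moment 0 u) t ≤ C * (calM3 p p' δ a t *
        ((L : ℝ≥0∞) ^ 2 * bar p δ (dissip 0 a u) t) ^ alphaExp d p p' *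
        moment 0 u t ^ (1 - alphaExp d p p')) := by
  obtain ⟨C0, hC01, hC0⟩ := exists_poincare d hd hp'
  have hp0 : 0 < p := lt_of_le_of_lt (Nat.cast_nonneg d) hp
  have hδ0 : 0 ≤ δ := hδ.1.le
  have hα := alphaExp_pos hd hp hp'
  have hβ := betaExp_pos hd hp hp'
  have hγ := gammaExp_pos hd hp hp'
  have habc := exponents_add hd hp hp'
  set α := alphaExp d p p'
  set β := betaExp d p p'
  set γ := gammaExp d p p'
  have hC01' : (1 : ℝ≥0∞) ≤ C0 := by exact_mod_cast hC01
  have hd1 : (1 : ℝ≥0∞) ≤ 128 * d := by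
    have : (1 : ℝ≥0∞) ≤ (d : ℝ≥0∞) := by exact_mod_cast (by omega : 1 ≤ d)
    calc (1 : ℝ≥0∞) = 1 * 1 := (one_mul 1).symm
      _ ≤ _ := mul_le_mul' (by norm_num) this
  refine ⟨(C0 * (128 * d)) ^ α, ENNReal.one_le_rpow (one_le_mul hC01' hd1) hα,
    ENNReal.rpow_ne_top_of_nonneg hα.le (ENNReal.mul_ne_top ENNReal.coe_ne_top
      (ENNReal.mul_ne_top (by norm_num) (by simp))), ?_⟩
  intro L hL a u h hsum t ht hM3
  set D := bar p δ (dissip 0 a u) with hDdef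
  set F := fun s => calMp' p p' δ a s ^ (α / β) with hF
  have hMm : Measurable (calMp' p p' δ a) := measurable_calMp' h.env_continuous
  have hFm : Measurable F := hMm.pow_const _
  have hDm : Measurable D := measurable_bar (h.measurable_dissip 0)
  have hfin := ae_ne_top_of_bar_rpow hMm (div_pos hα hβ)
    (bar_calMp'_ne_top hd hp hp' hδ0 h.env_continuous hM3)
  set c : ℝ≥0∞ := (C0 * (128 * d)) ^ α * ((L : ℝ≥0∞) ^ 2) ^ α * moment 0 u t ^ (1 - α) with hc
  have hpt : ∀ r, t ≤ r → calMp' p p' δ a r ≠ ∞ →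
      moment 0 u r ≤ c * (F r ^ β * D r ^ α * 1 ^ γ) := by
    intro r hr hr'
    have hr0 := ht.trans hr
    have hs : ∑ x, u r x = 0 := by rw [h.sum_eq hr0, hsum]
    have h1 := hC0 L hL (u r) hs (wE p δ a r) (fun e => ENNReal.ofReal_ne_top)
      (calMp' p p' δ a r) hr' (fun k hk => avgNorm_wInv_le_calMp' hk)
    rw [← moment_zero_eq] at h1
    have h2 := h1.trans (mul_le_mul' le_rfl (mul_le_mul' (le_refl (calMp' p p' δ a r))
        (gradEnergy_wE_le h hp0 hδ0 hr0)))
    have h3 : moment 0 u r = moment 0 u r ^ α * moment 0 u r ^ (1 - α) := by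
      rw [← ENNReal.rpow_add_of_nonneg _ _ hα.le (by linarith)]
      simp
    rw [h3]
    calc moment 0 u r ^ α * moment 0 u r ^ (1 - α)
        ≤ (C0 * (L : ℝ≥0∞) ^ 2 * (calMp' p p' δ a r * (128 * d * D r))) ^ α *
            moment 0 u t ^ (1 - α) :=
          mul_le_mul' (ENNReal.rpow_le_rpow h2 hα.le)
            (ENNReal.rpow_le_rpow (h.moment_zero_antitone ht hr) (by linarith))
      _ = _ := by
          have e1 : F r ^ β = calMp' p p' δ a r ^ α := by
            rw [hF]
            simp only
            rw [← ENNReal.rpow_mul, div_mul_cancel₀ _ hβ.ne']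
          rw [e1, hc, ENNReal.one_rpow]
          simp only [ENNReal.mul_rpow_of_nonneg _ _ hα.le]
          ring
  calc bar p δ (moment 0 u) t
      ≤ bar p δ (fun r => c * (F r ^ β * D r ^ α * 1 ^ γ)) t := by
        unfold bar
        refine lintegral_mono_ae ?_
        filter_upwards [hfin, ae_kMeas_pos] with s hs hs0
        exact hpt _ (by linarith) hs
    _ = c * bar p δ (fun r => F r ^ β * D r ^ α * 1 ^ γ) t := by
        have hm : Measurable fun r => F r ^ β * D r ^ α * (1 : ℝ≥0∞) ^ γ :=
          ((hFm.pow_const β).mul (hDm.pow_const α)).mul measurable_const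
        rw [bar_const_mul hm]
    _ ≤ c * (bar p δ F t ^ β * bar p δ D t ^ α * bar p δ (fun _ => 1) t ^ γ) := by
        gcongr
        exact bar_mul_mul_rpow_le hFm hDm measurable_const hβ.le hα.le hγ.le (by linarith) t
    _ ≤ c * (calM3 p p' δ a t * D t ^ α * 1) := by
        refine mul_le_mul' le_rfl (mul_le_mul' (mul_le_mul' ?_ ?_) ?_)
        · exact calMp'_rpow_bar_le hp0 hδ0 h.env_continuous t
        · exact ENNReal.rpow_le_rpow (bar_bar_le hp0 hδ (h.measurable_dissip 0) t) hα.le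
        · exact ENNReal.rpow_le_one (bar_const_le hp0 hδ 1 t) hγ.le
    _ = _ := by
        rw [hc]
        simp only [ENNReal.mul_rpow_of_nonneg _ _ hα.le]
        ring

end Averaged

end GradPhi

namespace GradPhi

section Weighted

variable {d L : ℕ} {p p' δ : ℝ}

theorem sum_mul_rpow_le {ι : Type*} (S : Finset ι) (f g : ι → ℝ≥0∞) {a b : ℝ} (ha : 0 < a)
    (hb : 0 < b) (hab : a + b = 1) :
    ∑ i ∈ S, f i ^ a * g i ^ b ≤ (∑ i ∈ S, f i) ^ a * (∑ i ∈ S, g i) ^ b := by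
  have hc : (1 / a).HolderConjugate (1 / b) := by
    rw [Real.holderConjugate_iff]
    exact ⟨by rw [lt_div_iff₀ ha]; linarith, by simpa using hab⟩
  have := ENNReal.inner_le_Lp_mul_Lq S (fun i => f i ^ a) (fun i => g i ^ b) hc
  simp only [← ENNReal.rpow_mul, one_div_one_div] at this
  simpa [mul_one_div_cancel ha.ne', mul_one_div_cancel hb.ne', ha.ne', hb.ne'] using this

theorem le_of_le_add_mul_rpow {S A J : ℝ≥0∞} {θ : ℝ} (h0 : 0 < θ) (h1 : θ < 1) (hS : S ≠ ∞)
    (h : S ≤ A + J * S ^ θ) : S ≤ 2 * A + (2 * J) ^ (1 / (1 - θ)) := by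
  rcases le_total (J * S ^ θ) A with hA | hA
  · calc S ≤ A + A := h.trans (add_le_add le_rfl hA)
      _ = 2 * A := (two_mul A).symm
      _ ≤ _ := le_self_add
  · refine le_trans ?_ le_add_self
    rcases eq_or_ne S 0 with hS0 | hS0
    · rw [hS0]; exact zero_le
    have h2 : S ≤ 2 * J * S ^ θ := by
      calc S ≤ J * S ^ θ + J * S ^ θ := h.trans (add_le_add hA le_rfl)
        _ = _ := by ring
    have h3 : S ^ (1 - θ) * S ^ θ = S := by
      rw [← ENNReal.rpow_add_of_nonneg _ _ (by linarith) h0.le]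
      simp
    have hSθ : S ^ θ ≠ 0 := by
      intro hz
      rw [ENNReal.rpow_eq_zero_iff_of_pos h0] at hz
      exact hS0 hz
    have h4 : S ^ (1 - θ) ≤ 2 * J := by
      rw [← ENNReal.mul_le_mul_iff_left hSθ (ENNReal.rpow_ne_top_of_nonneg h0.le hS), h3]
      exact h2
    have h5 := ENNReal.rpow_le_rpow h4 (z := 1 / (1 - θ)) (by
      have : 0 < 1 - θ := by linarith
      positivity)
    rwa [← ENNReal.rpow_mul, mul_one_div_cancel (by linarith), ENNReal.rpow_one] at h5

theorem le_of_forall_le_add_mul_iSup_rpow {f : ℝ → ℝ≥0∞} {A J B : ℝ≥0∞} {θ t : ℝ} (h0 : 0 < θ)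
    (h1 : θ < 1) (hB : B ≠ ∞) (hfB : ∀ s ∈ Icc 0 t, f s ≤ B)
    (h : ∀ s ∈ Icc 0 t, f s ≤ A + J * (⨆ r ∈ Icc 0 t, f r) ^ θ) :
    ∀ s ∈ Icc 0 t, f s ≤ 2 * A + (2 * J) ^ (1 / (1 - θ)) := by
  have hS : (⨆ r ∈ Icc 0 t, f r) ≠ ∞ := ne_top_of_le_ne_top hB (iSup₂_le hfB)
  have := le_of_le_add_mul_rpow h0 h1 hS (iSup₂_le h)
  exact fun s hs => (le_iSup₂ (f := fun r (_ : r ∈ Icc 0 t) => f r) s hs).trans this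

variable {a : ℝ → Edge d L → ℝ} {u : ℝ → Torus d L → ℝ}

theorem moment_interp {p q : ℝ} (hq : 0 < q) (hqp : q < p) (u : ℝ → Torus d L → ℝ) (t : ℝ) :
    moment q u t ≤ moment p u t ^ (q / p) * moment 0 u t ^ (1 - q / p) := by
  have hp : 0 < p := hq.trans hqp
  unfold moment
  simp only [ENNReal.rpow_zero, one_mul]
  have h1 : q / p < 1 := (div_lt_one hp).2 hqp
  refine le_trans (le_of_eq ?_) (sum_mul_rpow_le Finset.univ (fun x => sN x ^ p * ‖u t x‖ₑ ^ 2)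
    (fun x => ‖u t x‖ₑ ^ 2) (a := q / p) (b := 1 - q / p) (by positivity) (by linarith) (by ring))
  refine Finset.sum_congr rfl fun x _ => ?_
  have h0 : 0 ≤ q / p := by positivity
  rw [ENNReal.mul_rpow_of_nonneg _ _ h0, ← ENNReal.rpow_mul, mul_div_cancel₀ _ hp.ne', mul_assoc,
    ← ENNReal.rpow_add_of_nonneg _ _ h0 (by linarith)]
  simp

theorem ofReal_sum_ends_le {p : ℝ} {t : ℝ} (x : Torus d L) :
    ENNReal.ofReal (∑ e : Edge d L with x ∈ ends e, a t e) ≤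
      calM2 p a t * sN x ^ ((p - 2) / (p - 1)) := by
  have hpos : 0 < starNorm x ^ ((p - 2) / (p - 1)) := Real.rpow_pos_of_pos (starNorm_pos x) _
  have h1 : ENNReal.ofReal ((∑ e : Edge d L with x ∈ ends e, a t e) /
      starNorm x ^ ((p - 2) / (p - 1))) ≤ calM2 p a t := by
    unfold calM2
    refine le_trans ?_ le_add_self
    exact le_iSup (f := fun x : Torus d L => ENNReal.ofReal
      ((∑ e : Edge d L with x ∈ ends e, a t e) / starNorm x ^ ((p - 2) / (p - 1)))) x
  rw [sN_rpow]
  calc _ = ENNReal.ofReal ((∑ e : Edge d L with x ∈ ends e, a t e) /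
      starNorm x ^ ((p - 2) / (p - 1))) * ENNReal.ofReal (starNorm x ^ ((p - 2) / (p - 1))) := by
        rw [← ENNReal.ofReal_mul' hpos.le, div_mul_cancel₀ _ hpos.ne']
    _ ≤ _ := mul_le_mul' h1 le_rfl

theorem sum_mul_fiber_le (b : Edge d L → ℝ) (hb : ∀ e, 0 ≤ b e) (f : Torus d L → ℝ≥0∞)
    (g : Edge d L → Torus d L) (hg : ∀ e, g e ∈ ends e) :
    ∑ e : Edge d L, f (g e) * ENNReal.ofReal (b e) ≤
      ∑ x, f x * ENNReal.ofReal (∑ e : Edge d L with x ∈ ends e, b e) := by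
  rw [← Finset.sum_fiberwise Finset.univ g]
  refine Finset.sum_le_sum fun x _ => ?_
  rw [ENNReal.ofReal_sum_of_nonneg fun e _ => hb e, Finset.mul_sum]
  calc ∑ e : Edge d L with g e = x, f (g e) * ENNReal.ofReal (b e)
      = ∑ e : Edge d L with g e = x, f x * ENNReal.ofReal (b e) :=
        Finset.sum_congr rfl fun e he => by rw [(Finset.mem_filter.1 he).2]
    _ ≤ _ := by
        refine Finset.sum_le_sum_of_subset fun e he => ?_
        have := (Finset.mem_filter.1 he).2
        exact Finset.mem_filter.2 ⟨Finset.mem_univ _, this ▸ hg e⟩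

theorem drift_le (ha : ∀ t e, 0 ≤ a t e) {p : ℝ} (hp : 2 < p) (u : ℝ → Torus d L → ℝ) (t : ℝ) :
    drift p a u t ≤ (1 + 2 ^ (p - 2)) * (calM2 p a t * (moment p u t ^ ((p - 2) / (p - 1)) *
      moment 0 u t ^ (1 / (p - 1)))) := by
  have hp1 : 0 < p - 1 := by linarith
  set f : Torus d L → ℝ≥0∞ := fun x => sN x ^ (p - 2) * ‖u t x‖ₑ ^ 2 with hf
  have hS : ∑ x, f x * ENNReal.ofReal (∑ e : Edge d L with x ∈ ends e, a t e) ≤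
      calM2 p a t * (moment p u t ^ ((p - 2) / (p - 1)) * moment 0 u t ^ (1 / (p - 1))) := by
    have hq : 0 < p * ((p - 2) / (p - 1)) := by
      have : 0 < p - 2 := by linarith
      positivity
    have h1 := moment_interp (p := p) hq (by
      have : (p - 2) / (p - 1) < 1 := (div_lt_one hp1).2 (by linarith)
      nlinarith) u t
    have e1 : p * ((p - 2) / (p - 1)) / p = (p - 2) / (p - 1) := by field_simp
    have e2 : 1 - (p - 2) / (p - 1) = 1 / (p - 1) := by field_simp; ring
    rw [e1, e2] at h1
    refine le_trans ?_ (mul_le_mul' le_rfl h1)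
    unfold moment
    rw [Finset.mul_sum]
    refine Finset.sum_le_sum fun x _ => ?_
    have e3 : p * ((p - 2) / (p - 1)) = (p - 2) + (p - 2) / (p - 1) := by field_simp; ring
    rw [e3, ENNReal.rpow_add _ _ (sN_ne_zero x) (sN_ne_top x)]
    calc f x * _ ≤ f x * (calM2 p a t * sN x ^ ((p - 2) / (p - 1))) :=
          mul_le_mul' le_rfl (ofReal_sum_ends_le x)
      _ = _ := by rw [hf]; ring
  calc drift p a u t
      ≤ ∑ e : Edge d L, (f e.1 * ENNReal.ofReal (a t e) +
          2 ^ (p - 2) * (f (shift e) * ENNReal.ofReal (a t e))) := by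
        unfold drift
        refine Finset.sum_le_sum fun e _ => ?_
        have h2 : sN e.1 ^ (p - 2) ≤ 2 ^ (p - 2) * sN (shift e) ^ (p - 2) := by
          rw [← ENNReal.mul_rpow_of_nonneg _ _ (by linarith)]
          refine ENNReal.rpow_le_rpow ?_ (by linarith)
          unfold sN
          rw [← ENNReal.ofReal_ofNat 2, ← ENNReal.ofReal_mul (by norm_num)]
          refine ENNReal.ofReal_le_ofReal ?_
          linarith [starNorm_le_shift e, one_le_starNorm (shift e)]
        rw [mul_add, mul_add]
        refine add_le_add (le_of_eq (by rw [hf]; ring)) ?_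
        calc _ ≤ 2 ^ (p - 2) * sN (shift e) ^ (p - 2) *
              (ENNReal.ofReal (a t e) * ‖u t (shift e)‖ₑ ^ 2) := mul_le_mul' h2 le_rfl
          _ = _ := by rw [hf]; ring
    _ = (∑ e : Edge d L, f e.1 * ENNReal.ofReal (a t e)) +
          2 ^ (p - 2) * ∑ e : Edge d L, f (shift e) * ENNReal.ofReal (a t e) := by
        rw [Finset.sum_add_distrib, Finset.mul_sum]
    _ ≤ _ := by
        rw [add_mul, one_mul]
        exact add_le_add ((sum_mul_fiber_le _ (ha t) f _ fst_mem_ends).trans hS)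
          (mul_le_mul' le_rfl ((sum_mul_fiber_le _ (ha t) f _ shift_mem_ends).trans hS))

theorem lintegral_Ioc_le_iSup_timeAvg (f : ℝ → ℝ≥0∞) {t : ℝ} (ht : 0 ≤ t) :
    ∫⁻ s in Ioc 0 t, f s ≤ ENNReal.ofReal (1 + t) * ⨆ r ∈ Ici (1 : ℝ), timeAvg f r := by
  have hm : (1 : ℝ) ≤ max t 1 := le_max_right _ _
  have h0 : ENNReal.ofReal (max t 1) ≠ 0 := by
    rw [Ne, ENNReal.ofReal_eq_zero]; linarith
  calc ∫⁻ s in Ioc 0 t, f s ≤ ∫⁻ s in Ioc 0 (max t 1), f s :=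
        lintegral_mono_set (Ioc_subset_Ioc_right (le_max_left _ _))
    _ = ENNReal.ofReal (max t 1) * timeAvg f (max t 1) := by
        unfold timeAvg
        rw [ENNReal.mul_div_cancel h0 ENNReal.ofReal_ne_top]
    _ ≤ _ := by
        refine mul_le_mul' (ENNReal.ofReal_le_ofReal ?_)
          (le_iSup₂ (f := fun r (_ : r ∈ Ici (1 : ℝ)) => timeAvg f r) _ hm)
        exact max_le (by linarith) (by linarith)

theorem moment_le (hp : 0 ≤ p) (u : ℝ → Torus d L → ℝ) (t : ℝ) :
    moment p u t ≤ ENNReal.ofReal ((d * L + 1) ^ p) * moment 0 u t := by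
  unfold moment
  rw [Finset.mul_sum]
  refine Finset.sum_le_sum fun x _ => ?_
  rw [ENNReal.rpow_zero, one_mul, sN_rpow]
  exact mul_le_mul' (ENNReal.ofReal_le_ofReal
    (Real.rpow_le_rpow (starNorm_pos x).le (starNorm_le x) hp)) le_rfl

theorem moment_ne_top (q : ℝ) (u : ℝ → Torus d L → ℝ) (t : ℝ) : moment q u t ≠ ∞ := by
  rw [moment_eq]
  exact ENNReal.ofReal_ne_top

theorem rpow_inv_scrM2 (p : ℝ) (a : ℝ → Edge d L → ℝ) :
    (⨆ t ∈ Ici (1 : ℝ), timeAvg (calM2 p a) t) ^ (p - 1) = scrM2 p a := rfl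

/-- Growth of the weighted norm, in terms of the maximal size of the environment. -/
theorem exists_weighted_apriori {p : ℝ} (hp : 2 < p) :
    ∃ C : ℝ≥0∞, 1 ≤ C ∧ C ≠ ∞ ∧ ∀ (d L : ℕ) (a : ℝ → Edge d L → ℝ) (u : ℝ → Torus d L → ℝ),
      IsFlow a u → moment 0 u 0 ≤ 1 → scrM2 p a ≠ ∞ → ∀ t : ℝ, 0 ≤ t →
      moment p u t + ∫⁻ s in Ioc 0 t, dissip p a u s ≤
        C * (moment p u 0 + ENNReal.ofReal ((1 + t) ^ (p - 1)) * scrM2 p a) := by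
  have hp1 : 0 < p - 1 := by linarith
  set θ := (p - 2) / (p - 1) with hθ
  have hθ0 : 0 < θ := div_pos (by linarith) hp1
  have hθ1 : θ < 1 := (div_lt_one hp1).2 (by linarith)
  have hθ2 : 1 / (1 - θ) = p - 1 := by rw [hθ]; field_simp; ring
  set c : ℝ≥0∞ := ENNReal.ofReal (p ^ 2 * 4 ^ p) * (1 + 2 ^ (p - 2)) with hc
  have hct : c ≠ ∞ := ENNReal.mul_ne_top ENNReal.ofReal_ne_top (ENNReal.add_ne_top.2
    ⟨ENNReal.one_ne_top, ENNReal.rpow_ne_top_of_nonneg (by linarith) (by norm_num)⟩)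
  refine ⟨2 + (2 * c) ^ (p - 1), le_add_right (by norm_num), ENNReal.add_ne_top.2
    ⟨by norm_num, ENNReal.rpow_ne_top_of_nonneg hp1.le (ENNReal.mul_ne_top (by norm_num) hct)⟩, ?_⟩
  intro d L a u h hE hM2 t ht
  set S := ⨆ t ∈ Ici (1 : ℝ), timeAvg (calM2 p a) t with hS
  have hSt : S ≠ ∞ := by
    intro htop
    apply hM2
    rw [← rpow_inv_scrM2, ← hS, htop, ENNReal.top_rpow_of_pos hp1]
  set f : ℝ → ℝ≥0∞ := fun s => moment p u s + ∫⁻ r in Ioc 0 s, dissip p a u r with hf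
  set J := ∫⁻ s in Ioc 0 t, calM2 p a s with hJ
  have hJS : J ≤ ENNReal.ofReal (1 + t) * S := lintegral_Ioc_le_iSup_timeAvg _ ht
  have hJt : J ≠ ∞ := ne_top_of_le_ne_top (ENNReal.mul_ne_top ENNReal.ofReal_ne_top hSt) hJS
  have hstep : ∀ B : ℝ≥0∞, B ≠ ∞ → (∀ s ∈ Icc 0 t, moment p u s ≤ B) → ∀ s ∈ Icc 0 t,
      f s ≤ moment p u 0 + c * J * B ^ θ := by
    intro B hB hNB s hs
    refine (h.weighted_growth hp.le le_rfl hs.1).trans (add_le_add le_rfl ?_)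
    have h1 : ∫⁻ r in Ioc 0 s, drift p a u r ≤ (1 + 2 ^ (p - 2)) * B ^ θ * J := by
      rw [hJ, ← lintegral_const_mul' _ _ (ENNReal.mul_ne_top (ENNReal.add_ne_top.2
        ⟨ENNReal.one_ne_top, ENNReal.rpow_ne_top_of_nonneg (by linarith) (by norm_num)⟩)
        (ENNReal.rpow_ne_top_of_nonneg hθ0.le hB))]
      refine (lintegral_mono_set (Ioc_subset_Ioc_right hs.2)).trans
        (setLIntegral_mono' measurableSet_Ioc fun r hr => ?_)
      refine (drift_le h.env_nonneg hp u r).trans ?_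
      have h2 : moment 0 u r ^ (1 / (p - 1)) ≤ 1 :=
        ENNReal.rpow_le_one ((h.moment_zero_antitone le_rfl hr.1.le).trans hE) (by positivity)
      have h3 : moment p u r ^ θ ≤ B ^ θ := ENNReal.rpow_le_rpow (hNB r ⟨hr.1.le, hr.2⟩) hθ0.le
      calc _ ≤ (1 + 2 ^ (p - 2)) * (calM2 p a r * (B ^ θ * 1)) := by gcongr
        _ = _ := by ring
    calc _ ≤ ENNReal.ofReal (p ^ 2 * 4 ^ p) * ((1 + 2 ^ (p - 2)) * B ^ θ * J) := by gcongr
      _ = _ := by rw [hc]; ring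
  have hN0 : ∀ s ∈ Icc 0 t, moment p u s ≤ ENNReal.ofReal ((d * L + 1) ^ p) := by
    intro s hs
    refine (moment_le (by linarith) u s).trans (mul_le_of_le_one_right zero_le ?_)
    exact (h.moment_zero_antitone le_rfl hs.1).trans hE
  have hfB := hstep _ ENNReal.ofReal_ne_top hN0
  have hBt : moment p u 0 + c * J * ENNReal.ofReal ((d * L + 1) ^ p) ^ θ ≠ ∞ :=
    ENNReal.add_ne_top.2 ⟨moment_ne_top _ _ _, ENNReal.mul_ne_top (ENNReal.mul_ne_top hct hJt)
      (ENNReal.rpow_ne_top_of_nonneg hθ0.le ENNReal.ofReal_ne_top)⟩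
  have hmain := le_of_forall_le_add_mul_iSup_rpow hθ0 hθ1 hBt hfB
    (hstep _ (ne_top_of_le_ne_top hBt (iSup₂_le hfB)) fun s hs =>
      le_trans le_self_add (le_iSup₂ (f := fun r (_ : r ∈ Icc 0 t) => f r) s hs)) t ⟨ht, le_rfl⟩
  refine hmain.trans ?_
  rw [hθ2]
  calc 2 * moment p u 0 + (2 * (c * J)) ^ (p - 1)
      ≤ 2 * moment p u 0 + (2 * (c * (ENNReal.ofReal (1 + t) * S))) ^ (p - 1) := by gcongr
    _ = 2 * moment p u 0 + (2 * c) ^ (p - 1) *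
          (ENNReal.ofReal ((1 + t) ^ (p - 1)) * scrM2 p a) := by
        rw [← rpow_inv_scrM2, ← hS,
          ← ENNReal.ofReal_rpow_of_nonneg (by linarith) hp1.le]
        simp only [ENNReal.mul_rpow_of_nonneg _ _ hp1.le]
        ring
    _ ≤ _ := by
        rw [mul_add]
        gcongr
        · exact le_self_add
        · exact le_add_self

/-- A priori bounds for the time averages of the weighted norm and of its dissipation. -/
theorem exists_bar_apriori {p δ : ℝ} (hp : 2 < p) (hδ : IsAdmissibleDelta p δ) :
    ∃ C : ℝ≥0∞, 1 ≤ C ∧ C ≠ ∞ ∧ ∀ (d L : ℕ) (a : ℝ → Edge d L → ℝ) (u : ℝ → Torus d L → ℝ),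
      IsFlow a u → moment 0 u 0 ≤ 1 → scrM2 p a ≠ ∞ → ∀ t : ℝ, 0 ≤ t →
      bar p δ (moment p u) t + ∫⁻ s in Ioc 0 t, bar p δ (dissip p a u) s ≤
        C * (moment p u 0 + ENNReal.ofReal ((1 + t) ^ (p - 1)) * scrM2 p a) := by
  obtain ⟨C, hC1, hCt, hC⟩ := exists_weighted_apriori hp
  set K := ENNReal.ofReal (∫ s in Ioi (0 : ℝ), 2 * δ * (s + 1) ^ (-2 : ℝ)) with hK
  refine ⟨C * (1 + K), one_le_mul hC1 le_self_add, ENNReal.mul_ne_top hCt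
    (ENNReal.add_ne_top.2 ⟨ENNReal.one_ne_top, ENNReal.ofReal_ne_top⟩), ?_⟩
  intro d L a u h hE hM2 t ht
  rw [← lintegral_kMeas_lintegral_Ioc (h.measurable_dissip p)]
  have hm : Measurable fun s => moment p u (t + s) :=
    (h.measurable_moment p).comp (measurable_const_add t)
  have hm2 : Measurable fun s : ℝ => ENNReal.ofReal ((1 + s) ^ (p - 1)) := by fun_prop
  unfold bar
  rw [← lintegral_add_left hm]
  calc ∫⁻ s, (moment p u (t + s) + ∫⁻ r in Ioc (0 + s) (t + s), dissip p a u r) ∂kMeas p δ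
      ≤ ∫⁻ s, C * moment p u 0 + (C * ENNReal.ofReal ((1 + t) ^ (p - 1)) * scrM2 p a) *
          ENNReal.ofReal ((1 + s) ^ (p - 1)) ∂kMeas p δ := by
        refine lintegral_mono_ae ?_
        filter_upwards [ae_kMeas_pos] with s hs
        have h1 : ∫⁻ r in Ioc (0 + s) (t + s), dissip p a u r ≤
            ∫⁻ r in Ioc 0 (t + s), dissip p a u r :=
          lintegral_mono_set (Ioc_subset_Ioc_left (by linarith))
        refine (add_le_add le_rfl h1).trans ((hC d L a u h hE hM2 (t + s) (by linarith)).trans ?_)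
        rw [mul_add]
        refine add_le_add le_rfl ?_
        have h2 : ENNReal.ofReal ((1 + (t + s)) ^ (p - 1)) ≤
            ENNReal.ofReal ((1 + t) ^ (p - 1)) * ENNReal.ofReal ((1 + s) ^ (p - 1)) := by
          rw [← ENNReal.ofReal_mul (by positivity), ← Real.mul_rpow (by linarith) (by linarith)]
          refine ENNReal.ofReal_le_ofReal (Real.rpow_le_rpow (by linarith) ?_ (by linarith))
          nlinarith
        calc _ ≤ C * (ENNReal.ofReal ((1 + t) ^ (p - 1)) * ENNReal.ofReal ((1 + s) ^ (p - 1)) *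
              scrM2 p a) := by gcongr
          _ = _ := by ring
    _ = (∫⁻ _s, C * moment p u 0 ∂kMeas p δ) + C * ENNReal.ofReal ((1 + t) ^ (p - 1)) * scrM2 p a *
          ∫⁻ s, ENNReal.ofReal ((1 + s) ^ (p - 1)) ∂kMeas p δ := by
        rw [lintegral_add_left measurable_const, lintegral_const_mul _ hm2]
    _ ≤ C * moment p u 0 + C * ENNReal.ofReal ((1 + t) ^ (p - 1)) * scrM2 p a * K := by
        refine add_le_add (bar_const_le (by linarith) hδ _ 0) (mul_le_mul' le_rfl ?_)
        have := bar_rpow_le (p := p) (δ := δ) (by linarith) hδ.1.le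
        unfold bar at this
        simpa only [zero_add] using this
    _ ≤ C * (1 + K) * moment p u 0 + C * (1 + K) * (ENNReal.ofReal ((1 + t) ^ (p - 1)) *
          scrM2 p a) := by
        refine add_le_add (mul_le_mul' (le_mul_of_one_le_right zero_le le_self_add) le_rfl) ?_
        calc _ = C * K * (ENNReal.ofReal ((1 + t) ^ (p - 1)) * scrM2 p a) := by ring
          _ ≤ _ := mul_le_mul' (mul_le_mul' le_rfl le_add_self) le_rfl
    _ = _ := by ring

end Weighted

end GradPhi

namespace GradPhi

section WeightedAverage

variable {d L : ℕ}

theorem thetaExp_lt_one (hd : 2 ≤ d) : thetaExp d < 1 := by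
  have : (2 : ℝ) ≤ d := by exact_mod_cast hd
  unfold thetaExp
  rw [← mul_div_assoc, div_lt_one (by linarith)]
  linarith

/-- The averaged drift is absorbed by the averaged dissipation. -/
theorem exists_bar_drift_le (d : ℕ) (hd : 2 ≤ d) {p δ : ℝ} (hp : 2 < p)
    (hδ : IsAdmissibleDelta p δ) (ε : ℝ≥0∞) (hε : ε ≠ 0) (hεt : ε ≠ ∞) :
    ∃ C : ℝ≥0∞, C ≠ ∞ ∧ ∀ (L : ℕ) (a : ℝ → Edge d L → ℝ) (u : ℝ → Torus d L → ℝ), IsFlow a u →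
      ∀ t : ℝ, 0 ≤ t → calM1 p δ a t ≠ ∞ →
      bar p δ (drift p a u) t ≤ ε * bar p δ (dissip p a u) t +
        C * (calM1 p δ a t ^ (2 / p) * moment 0 u t ^ (2 / p) *
          bar p δ (moment p u) t ^ (1 - 2 / p)) := by
  have hp0 : 0 < p := by linarith
  have hδ0 := hδ.1.le
  set Cm : ℝ≥0∞ := 32 * (4 * d * 3 ^ p) with hCm
  have hCmt : Cm ≠ ∞ := by
    refine ENNReal.mul_ne_top (by norm_num) (ENNReal.mul_ne_top (ENNReal.mul_ne_top (by norm_num)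
      (by simp)) (ENNReal.rpow_ne_top_of_nonneg hp0.le (by norm_num)))
  have hCm0 : Cm ≠ 0 := by
    have : (d : ℝ≥0∞) ≠ 0 := by exact_mod_cast (by omega : d ≠ 0)
    refine mul_ne_zero (by norm_num) (mul_ne_zero (mul_ne_zero (by norm_num) this) ?_)
    rw [Ne, ENNReal.rpow_eq_zero_iff_of_pos hp0]
    norm_num
  have hε' : (ε / Cm).toNNReal ≠ 0 :=
    (ENNReal.toNNReal_ne_zero).2 ⟨ENNReal.div_ne_zero.2 ⟨hε, hCmt⟩, ENNReal.div_ne_top hεt hCm0⟩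
  obtain ⟨C, hC⟩ := exists_weighted_interp d hd hp (ε / Cm).toNNReal (pos_iff_ne_zero.2 hε')
  rw [ENNReal.coe_toNNReal (ENNReal.div_ne_top hεt hCm0)] at hC
  refine ⟨C, ENNReal.coe_ne_top, ?_⟩
  intro L a u h t ht hM1
  set q := p / (2 * (1 - thetaExp d)) with hq
  have hθ : 0 < 1 - thetaExp d := by linarith [thetaExp_lt_one hd]
  have hq0 : 0 < q := by positivity
  have h2p : 0 < 2 / p := by positivity
  have h2p1 : 2 / p < 1 := (div_lt_one hp0).2 hp
  rw [calM1_eq hp0 hδ0 h.env_continuous] at hM1 ⊢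
  have hM0m := measurable_calM0 (p := p) (δ := δ) h.env_continuous
  have hbt : bar p δ (fun s => calM0 p δ a s ^ q) t ≠ ∞ :=
    ne_top_of_le_ne_top hM1 le_add_self
  have hfin := ae_ne_top_of_bar_rpow hM0m hq0 hbt
  set c : ℝ≥0∞ := C * moment 0 u t ^ (2 / p) with hc
  have hDm := measurable_bar (p := p) (δ := δ) (h.measurable_dissip p)
  have hNm := h.measurable_moment p
  have hpt : ∀ r, t ≤ r → calM0 p δ a r ≠ ∞ → drift p a u r ≤
      ε * bar p δ (dissip p a u) r +
        c * ((calM0 p δ a r ^ q) ^ (2 / p) * moment p u r ^ (1 - 2 / p)) := by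
    intro r hr hr'
    have hr0 := ht.trans hr
    have h1 := hC L (u r) (a r) (h.env_nonneg r) (wE p δ a r) (fun e => ENNReal.ofReal_ne_top)
      (calM0 p δ a r) (by unfold calM0; exact le_self_add) hr' (fun k hk => avgNorm_le_calM0 hk)
    refine h1.trans (add_le_add ?_ ?_)
    · refine (mul_le_mul' le_rfl (h.weighted_moderation hp0 hδ0 hp0.le hr0)).trans_eq ?_
      rw [← hCm, ← mul_assoc, ENNReal.div_mul_cancel hCm0 hCmt]
    · have h2 := moment_interp (p := p) (q := p - 2) (by linarith) (by linarith) u r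
      have e1 : (p - 2) / p = 1 - 2 / p := by field_simp
      rw [e1, sub_sub_cancel] at h2
      have e2 : (calM0 p δ a r ^ q) ^ (2 / p) = calM0 p δ a r ^ (1 / (1 - thetaExp d)) := by
        rw [← ENNReal.rpow_mul, hq]
        congr 1
        field_simp
      rw [e2]
      have h3 := ENNReal.rpow_le_rpow (h.moment_zero_antitone ht hr) h2p.le
      calc _ ≤ C * calM0 p δ a r ^ (1 / (1 - thetaExp d)) *
            (moment p u r ^ (1 - 2 / p) * moment 0 u t ^ (2 / p)) :=
            mul_le_mul' le_rfl (h2.trans (mul_le_mul' le_rfl h3))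
        _ = _ := by rw [hc]; ring
  have hm1 : Measurable fun r => (calM0 p δ a r ^ q) ^ (2 / p) * moment p u r ^ (1 - 2 / p) :=
    ((hM0m.pow_const q).pow_const _).mul (hNm.pow_const _)
  calc bar p δ (drift p a u) t
      ≤ bar p δ (fun r => ε * bar p δ (dissip p a u) r +
        c * ((calM0 p δ a r ^ q) ^ (2 / p) * moment p u r ^ (1 - 2 / p))) t := by
        unfold bar
        refine lintegral_mono_ae ?_
        filter_upwards [hfin, ae_kMeas_pos] with s hs hs0
        exact hpt _ (by linarith) hs
    _ = ε * bar p δ (bar p δ (dissip p a u)) t + c * bar p δ (fun r =>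
          (calM0 p δ a r ^ q) ^ (2 / p) * moment p u r ^ (1 - 2 / p)) t := by
        rw [bar_add (hDm.const_mul ε), bar_const_mul hDm, bar_const_mul hm1]
    _ ≤ ε * bar p δ (dissip p a u) t + c * ((1 + bar p δ (fun s => calM0 p δ a s ^ q) t) ^ (2 / p) *
          bar p δ (moment p u) t ^ (1 - 2 / p)) := by
        refine add_le_add (mul_le_mul' le_rfl (bar_bar_le hp0 hδ (h.measurable_dissip p) t))
          (mul_le_mul' le_rfl ?_)
        have h5 : bar p δ (fun r => (calM0 p δ a r ^ q) ^ (2 / p) * moment p u r ^ (1 - 2 / p)) t ≤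
            bar p δ (fun s => calM0 p δ a s ^ q) t ^ (2 / p) *
              bar p δ (moment p u) t ^ (1 - 2 / p) := by
          unfold bar
          exact ENNReal.lintegral_mul_norm_pow_le
            ((hM0m.pow_const q).comp (measurable_const_add t)).aemeasurable
            (hNm.comp (measurable_const_add t)).aemeasurable h2p.le (by linarith) (by ring)
        exact h5.trans (mul_le_mul' (ENNReal.rpow_le_rpow le_add_self h2p.le) le_rfl)
    _ = _ := by rw [hc]; ring

/-- Growth of the averaged weighted norm, in terms of the averages `𝓜₁`. -/
theorem exists_bar_moment_le (d : ℕ) (hd : 2 ≤ d) {p δ : ℝ} (hp : 2 < p)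
    (hδ : IsAdmissibleDelta p δ) :
    ∃ C : ℝ≥0∞, 1 ≤ C ∧ C ≠ ∞ ∧ ∀ (L : ℕ) (a : ℝ → Edge d L → ℝ) (u : ℝ → Torus d L → ℝ),
      IsFlow a u → moment 0 u 0 ≤ 1 → scrM2 p a ≠ ∞ → ∀ t : ℝ, 0 ≤ t →
      (∀ᵐ s ∂volume.restrict (Ioc 0 t), calM1 p δ a s ≠ ∞) → ∀ s ∈ Icc 0 t,
      bar p δ (moment p u) s ≤ C * (bar p δ (moment p u) 0 +
        (∫⁻ r in Ioc 0 t, calM1 p δ a r ^ (2 / p) * moment 0 u r ^ (2 / p)) ^ (p / 2)) := by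
  have hp0 : 0 < p := by linarith
  have h2p : 0 < 2 / p := by positivity
  have h2p1 : 2 / p < 1 := (div_lt_one hp0).2 hp
  set Cg := ENNReal.ofReal (p ^ 2 * 4 ^ p) with hCg
  have hCg0 : Cg ≠ 0 := by
    rw [hCg, Ne, ENNReal.ofReal_eq_zero, not_le]
    positivity
  have hCgt : Cg ≠ ∞ := ENNReal.ofReal_ne_top
  obtain ⟨C, hCt, hC⟩ := exists_bar_drift_le d hd hp hδ Cg⁻¹ (ENNReal.inv_ne_zero.2 hCgt)
    (ENNReal.inv_ne_top.2 hCg0)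
  obtain ⟨C', hC'1, hC't, hC'⟩ := exists_bar_apriori hp hδ
  refine ⟨2 + (2 * (Cg * C)) ^ (p / 2), le_add_right (by norm_num), ENNReal.add_ne_top.2
    ⟨by norm_num, ENNReal.rpow_ne_top_of_nonneg (by positivity) (ENNReal.mul_ne_top (by norm_num)
      (ENNReal.mul_ne_top hCgt hCt))⟩, ?_⟩
  intro L a u h hE hM2 t ht hM1
  set J := ∫⁻ r in Ioc 0 t, calM1 p δ a r ^ (2 / p) * moment 0 u r ^ (2 / p) with hJ
  set N := bar p δ (moment p u) with hN
  set X := bar p δ (dissip p a u) with hX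
  have hXm : Measurable X := measurable_bar (h.measurable_dissip p)
  set B := C' * (moment p u 0 + ENNReal.ofReal ((1 + t) ^ (p - 1)) * scrM2 p a) with hB
  have hBt : B ≠ ∞ := ENNReal.mul_ne_top hC't (ENNReal.add_ne_top.2 ⟨moment_ne_top _ _ _,
    ENNReal.mul_ne_top ENNReal.ofReal_ne_top hM2⟩)
  have hapr : ∀ s ∈ Icc 0 t, N s + ∫⁻ r in Ioc 0 s, X r ≤ B := by
    intro s hs
    refine (hC' d L a u h hE hM2 s hs.1).trans (mul_le_mul' le_rfl (add_le_add le_rfl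
      (mul_le_mul' (ENNReal.ofReal_le_ofReal ?_) le_rfl)))
    exact Real.rpow_le_rpow (by linarith [hs.1]) (by linarith [hs.2]) (by linarith)
  have hfB : ∀ s ∈ Icc 0 t, N s ≤ B := fun s hs => le_self_add.trans (hapr s hs)
  set S := ⨆ r ∈ Icc 0 t, N r with hS
  have hSt : S ≠ ∞ := ne_top_of_le_ne_top hBt (iSup₂_le hfB)
  have hstep : ∀ s ∈ Icc 0 t, N s ≤ N 0 + Cg * C * J * S ^ (1 - 2 / p) := by
    intro s hs
    have hg := h.bar_weighted_growth (δ := δ) hp.le le_rfl hs.1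
    have hM1s : ∀ᵐ r ∂volume.restrict (Ioc 0 s), calM1 p δ a r ≠ ∞ :=
      ae_restrict_of_ae_restrict_of_subset (Ioc_subset_Ioc_right hs.2) hM1
    have h1 : Cg * ∫⁻ r in Ioc 0 s, bar p δ (drift p a u) r ≤
        (∫⁻ r in Ioc 0 s, X r) + Cg * C * J * S ^ (1 - 2 / p) := by
      have h2 : ∫⁻ r in Ioc 0 s, bar p δ (drift p a u) r ≤ ∫⁻ r in Ioc 0 s, (Cg⁻¹ * X r +
          C * S ^ (1 - 2 / p) * (calM1 p δ a r ^ (2 / p) * moment 0 u r ^ (2 / p))) := by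
        refine lintegral_mono_ae ?_
        filter_upwards [hM1s, ae_restrict_mem measurableSet_Ioc] with r hr hr'
        refine (hC L a u h r hr'.1.le hr).trans (add_le_add le_rfl ?_)
        have h3 : N r ≤ S := le_iSup₂ (f := fun r (_ : r ∈ Icc 0 t) => N r) r
          ⟨hr'.1.le, hr'.2.trans hs.2⟩
        calc _ ≤ C * (calM1 p δ a r ^ (2 / p) * moment 0 u r ^ (2 / p) * S ^ (1 - 2 / p)) :=
              mul_le_mul' le_rfl (mul_le_mul' le_rfl (ENNReal.rpow_le_rpow h3 (by linarith)))
          _ = _ := by ring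
      rw [lintegral_add_left (hXm.const_mul _), lintegral_const_mul _ hXm,
        lintegral_const_mul' _ _ (ENNReal.mul_ne_top hCt (ENNReal.rpow_ne_top_of_nonneg
          (by linarith) hSt))] at h2
      calc _ ≤ Cg * (Cg⁻¹ * (∫⁻ r in Ioc 0 s, X r) + C * S ^ (1 - 2 / p) *
            ∫⁻ r in Ioc 0 s, calM1 p δ a r ^ (2 / p) * moment 0 u r ^ (2 / p)) :=
            mul_le_mul' le_rfl h2
        _ = (Cg * Cg⁻¹) * (∫⁻ r in Ioc 0 s, X r) + Cg * C *
            (∫⁻ r in Ioc 0 s, calM1 p δ a r ^ (2 / p) * moment 0 u r ^ (2 / p)) *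
            S ^ (1 - 2 / p) := by ring
        _ ≤ _ := by
            rw [ENNReal.mul_inv_cancel hCg0 hCgt, one_mul]
            refine add_le_add le_rfl (mul_le_mul' (mul_le_mul' le_rfl ?_) le_rfl)
            exact lintegral_mono_set (Ioc_subset_Ioc_right hs.2)
    have hXt : ∫⁻ r in Ioc 0 s, X r ≠ ∞ := ne_top_of_le_ne_top hBt (le_add_self.trans (hapr s hs))
    have h4 : N s + ∫⁻ r in Ioc 0 s, X r ≤
        (N 0 + Cg * C * J * S ^ (1 - 2 / p)) + ∫⁻ r in Ioc 0 s, X r := by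
      calc _ ≤ N 0 + Cg * ∫⁻ r in Ioc 0 s, bar p δ (drift p a u) r := hg
        _ ≤ N 0 + ((∫⁻ r in Ioc 0 s, X r) + Cg * C * J * S ^ (1 - 2 / p)) :=
            add_le_add le_rfl h1
        _ = _ := by ring
    exact (ENNReal.add_le_add_iff_right hXt).1 h4
  intro s hs
  refine (le_of_forall_le_add_mul_iSup_rpow (by linarith) (by linarith) hBt hfB hstep s hs).trans ?_
  have e1 : 1 / (1 - (1 - 2 / p)) = p / 2 := by rw [sub_sub_cancel, one_div_div]
  rw [e1, ← mul_assoc 2, ENNReal.mul_rpow_of_nonneg _ _ (by positivity), mul_add]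
  exact add_le_add (mul_le_mul' le_self_add le_rfl) (mul_le_mul' le_add_self le_rfl)

end WeightedAverage

end GradPhi

namespace GradPhi

section Recursions

theorem sum_mul_le_of_antitone {f w : ℕ → ℝ} {S : ℝ} (hw : Antitone w)
    (hw0 : ∀ n, 0 ≤ w n) (hf : ∀ n : ℕ, ∑ k ∈ Finset.range n, f k ≤ S * n) (n : ℕ) :
    ∑ k ∈ Finset.range n, f k * w k ≤ S * ∑ k ∈ Finset.range n, w k := by
  have key : ∀ n : ℕ, ∑ k ∈ Finset.range n, f k * w k +
      (S * n - ∑ k ∈ Finset.range n, f k) * w n ≤ S * ∑ k ∈ Finset.range n, w k := by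
    intro n
    induction n with
    | zero => simp
    | succ n ih =>
      have h1 := hf (n + 1)
      have h2 := mul_le_mul_of_nonneg_left (hw (Nat.le_succ n)) (sub_nonneg.2 h1)
      rw [Finset.sum_range_succ] at h2 ⊢
      rw [Finset.sum_range_succ, Finset.sum_range_succ _ n]
      push_cast at h2 ⊢
      simp only [Nat.succ_eq_add_one] at h2
      linarith
  have := mul_nonneg (sub_nonneg.2 (hf n)) (hw0 n)
  linarith [key n]

theorem sum_rpow_neg_le {q : ℝ} (h0 : 0 < q) (h1 : q < 1) (n : ℕ) :
    ∑ k ∈ Finset.range n, (1 + (k : ℝ)) ^ (-q) ≤ (1 / (1 - q)) * (n : ℝ) ^ (1 - q) := by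
  induction n with
  | zero => simp [Real.zero_rpow (by linarith : 1 - q ≠ 0)]
  | succ n ih =>
    rw [Finset.sum_range_succ]
    have hn : (0 : ℝ) < n + 1 := by positivity
    have hb := rpow_one_add_le_one_add_mul_self (s := -(1 / ((n : ℝ) + 1))) (p := 1 - q)
      (by rw [neg_le_neg_iff, div_le_one hn]; linarith [(Nat.cast_nonneg n : (0 : ℝ) ≤ n)])
      (by linarith) (by linarith)
    have e1 : 1 + -(1 / ((n : ℝ) + 1)) = n / (n + 1) := by field_simp; ring
    rw [e1, Real.div_rpow (Nat.cast_nonneg n) hn.le, div_le_iff₀ (Real.rpow_pos_of_pos hn _)] at hb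
    have e2 : ((n : ℝ) + 1) ^ (1 - q) = (n + 1) * (1 + (n : ℝ)) ^ (-q) := by
      rw [sub_eq_add_neg, Real.rpow_add hn, Real.rpow_one, add_comm 1 (n : ℝ)]
    have e3 : (1 + (1 - q) * -(1 / ((n : ℝ) + 1))) * ((n : ℝ) + 1) ^ (1 - q) =
        ((n : ℝ) + 1) ^ (1 - q) - (1 - q) * (1 + (n : ℝ)) ^ (-q) := by
      rw [e2]; field_simp; ring
    rw [e3] at hb
    have hq : 0 < 1 - q := by linarith
    have h3 : (1 + (n : ℝ)) ^ (-q) ≤ (1 / (1 - q)) * (((n : ℝ) + 1) ^ (1 - q) - (n : ℝ) ^ (1 - q)) := by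
      rw [one_div, ← div_eq_inv_mul, le_div_iff₀ hq]
      linarith
    push_cast
    linarith

theorem exp_half_le {z : ℝ} (h0 : 0 ≤ z) (h1 : z ≤ 1) : Real.exp (z / 2) ≤ 1 + z := by
  have h2 := Real.one_sub_le_exp_neg (z / 2)
  have h3 : 0 < Real.exp (z / 2) := Real.exp_pos _
  rw [Real.exp_neg] at h2
  have h4 : (1 - z / 2) * Real.exp (z / 2) ≤ 1 := by
    calc _ ≤ (Real.exp (z / 2))⁻¹ * Real.exp (z / 2) := mul_le_mul_of_nonneg_right h2 h3.le
      _ = 1 := inv_mul_cancel₀ h3.ne'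
  nlinarith [mul_nonneg h0 (sub_nonneg.2 h1)]

/-- Polynomial decay from a discrete differential inequality. -/
theorem rpow_neg_ge_of_recursion {e μ : ℕ → ℝ} {b h : ℝ} (hb : 0 < b) (hb1 : b ≤ 1) (hh : 0 < h)
    {N : ℕ} (hpos : ∀ n ≤ N, 0 < e n) (he1 : ∀ n ≤ N, e n ≤ 1) (hμ0 : ∀ n, 0 ≤ μ n)
    (hμ1 : ∀ n, μ n ≤ 1)
    (hrec : ∀ n < N, e (n + 1) + b * e (n + 1) ^ (1 + h) * μ n ≤ e n) :
    b * (h / (2 + h)) * ∑ n ∈ Finset.range N, μ n ≤ e N ^ (-h) := by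
  have key : ∀ n ≤ N, b * (h / (2 + h)) * ∑ n ∈ Finset.range n, μ n ≤ e n ^ (-h) := by
    intro n
    induction n with
    | zero =>
      intro h0
      simpa using Real.rpow_nonneg (hpos 0 h0).le _
    | succ n ih =>
      intro hn
      have hn' : n ≤ N := by omega
      refine le_trans ?_ (add_le_add_left (ih hn') (e (n + 1) ^ (-h) - e n ^ (-h)) |>.trans
        (by linarith))
      rw [Finset.sum_range_succ, mul_add]
      refine add_le_add le_rfl ?_
      have hx := hpos (n + 1) hn
      have hy := hpos n hn'
      set x := e (n + 1)
      set y := e n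
      set z := b * x ^ h * μ n with hz
      have hxh : x ^ h ≤ 1 := Real.rpow_le_one hx.le (he1 _ hn) hh.le
      have hxh0 : 0 < x ^ h := Real.rpow_pos_of_pos hx _
      have hz0 : 0 ≤ z := by have := hμ0 n; positivity
      have hz1 : z ≤ 1 := by
        calc z ≤ 1 * 1 * 1 := by
              have := hμ0 n
              exact mul_le_mul (mul_le_mul hb1 hxh hxh0.le zero_le_one) (hμ1 n) this (by norm_num)
          _ = 1 := by norm_num
      have h1 : x * (1 + z) ≤ y := by
        have := hrec n (by omega)
        rw [Real.rpow_add hx, Real.rpow_one] at this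
        linarith
      have h2 : x * Real.exp (z / 2) ≤ y :=
        (mul_le_mul_of_nonneg_left (exp_half_le hz0 hz1) hx.le).trans h1
      have h3 : y ^ (-h) ≤ (x * Real.exp (z / 2)) ^ (-h) :=
        Real.rpow_le_rpow_of_nonpos (by positivity) h2 (by linarith)
      rw [Real.mul_rpow hx.le (Real.exp_pos _).le, ← Real.exp_mul] at h3
      have h4 : Real.exp (z / 2 * -h) ≤ 1 / (1 + h * z / 2) := by
        rw [le_div_iff₀ (by positivity)]
        have := Real.add_one_le_exp (h * z / 2)
        calc _ ≤ Real.exp (z / 2 * -h) * Real.exp (h * z / 2) :=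
              mul_le_mul_of_nonneg_left (by linarith) (Real.exp_pos _).le
          _ = 1 := by rw [← Real.exp_add]; ring_nf; simp
      have hxn : 0 < x ^ (-h) := Real.rpow_pos_of_pos hx _
      have h5 : h / (2 + h) * z ≤ 1 - 1 / (1 + h * z / 2) := by
        have : 1 - 1 / (1 + h * z / 2) = h * z / (2 + h * z) := by field_simp; ring
        rw [this, div_mul_eq_mul_div]
        exact div_le_div_of_nonneg_left (by positivity) (by positivity) (by nlinarith)
      have h6 : x ^ (-h) * (h / (2 + h) * z) = b * (h / (2 + h)) * μ n := by
        rw [hz, Real.rpow_neg hx.le]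
        field_simp
      calc _ = x ^ (-h) * (h / (2 + h) * z) := h6.symm
        _ ≤ x ^ (-h) * (1 - 1 / (1 + h * z / 2)) := mul_le_mul_of_nonneg_left h5 hxn.le
        _ ≤ x ^ (-h) * (1 - Real.exp (z / 2 * -h)) :=
            mul_le_mul_of_nonneg_left (by linarith) hxn.le
        _ ≤ _ := by linarith
  exact key N le_rfl

/-- Exponential decay from a discrete differential inequality with a delay. -/
theorem le_exp_of_delayed_recursion {e x : ℕ → ℝ} {h : ℝ} (hh : 0 < h) (he : Antitone e)
    (he0 : ∀ n, 0 ≤ e n) (hx0 : ∀ n, 0 ≤ x n) (hx1 : ∀ n, x n ≤ 1)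
    (hrec : ∀ n, 0 < e (n + 2) →
      e (n + 2) * (1 + x (n + 1) * (e (n + 2) / e n) ^ h) ≤ e (n + 1)) {k N : ℕ} (hkN : k ≤ N) :
    e (N + 1) ≤ e k * Real.exp (-((2 : ℝ) ^ (-h) / 4 * ∑ n ∈ Finset.Ioc k N, x n)) := by
  set c : ℝ := (2 : ℝ) ^ (-h) / 2 with hc
  have h2h : (2 : ℝ) ^ (-h) ≤ 1 := Real.rpow_le_one_of_one_le_of_nonpos (by norm_num) (by linarith)
  have h2h0 : 0 < (2 : ℝ) ^ (-h) := by positivity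
  have hstep : ∀ n, e (n + 2) ≤ e n * Real.exp (-(c * x (n + 1))) := by
    intro n
    have hx := hx0 (n + 1)
    have hx' := hx1 (n + 1)
    rcases (he0 (n + 2)).eq_or_lt with h0 | h0
    · rw [← h0]
      exact mul_nonneg (he0 n) (Real.exp_pos _).le
    have hmono := he (by omega : n ≤ n + 1)
    have hn0 : 0 < e n := h0.trans_le (he (by omega : n ≤ n + 2))
    set ρ := e (n + 2) / e n with hρ
    have hρ0 : 0 < ρ := div_pos h0 hn0
    have he2 : e (n + 2) = ρ * e n := by rw [hρ]; field_simp
    have h1 : ρ * (1 + x (n + 1) * ρ ^ h) ≤ 1 := by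
      have := (hrec n h0).trans hmono
      rw [← hρ, he2] at this
      have h3 : e n * (ρ * (1 + x (n + 1) * ρ ^ h)) ≤ e n * 1 := by linarith
      exact le_of_mul_le_mul_left h3 hn0
    suffices hs : ρ ≤ Real.exp (-(c * x (n + 1))) by
      rw [he2, mul_comm]
      exact mul_le_mul_of_nonneg_left hs hn0.le
    rcases le_total ρ (1 / 2) with h2 | h2
    · refine h2.trans ?_
      have := Real.one_sub_le_exp_neg (c * x (n + 1))
      have h3 : c * x (n + 1) ≤ 1 / 2 * 1 :=
        mul_le_mul (by rw [hc]; linarith) hx' hx (by norm_num)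
      linarith
    · have h3 : (2 : ℝ) ^ (-h) ≤ ρ ^ h := by
        calc (2 : ℝ) ^ (-h) = (1 / 2 : ℝ) ^ h := by
              rw [one_div, Real.inv_rpow (by norm_num), Real.rpow_neg (by norm_num)]
          _ ≤ _ := Real.rpow_le_rpow (by norm_num) h2 hh.le
      have h4 := exp_half_le (z := (2 : ℝ) ^ (-h) * x (n + 1)) (by positivity)
        (mul_le_one₀ h2h hx hx')
      have h5 : ρ * Real.exp (c * x (n + 1)) ≤ 1 := by
        refine le_trans (mul_le_mul_of_nonneg_left ?_ hρ0.le) h1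
        have e1 : c * x (n + 1) = (2 : ℝ) ^ (-h) * x (n + 1) / 2 := by rw [hc]; ring
        rw [e1]
        refine h4.trans ?_
        have := mul_le_mul_of_nonneg_right h3 hx
        linarith
      rw [Real.exp_neg, ← one_div, le_div_iff₀ (Real.exp_pos _)]
      exact h5
  have hprod : e (N + 1) * e N ≤ e k * e (k + 1) *
      Real.exp (-(c * ∑ n ∈ Finset.Ioc k N, x n)) := by
    induction N, hkN using Nat.le_induction with
    | base => simp [mul_comm]
    | succ N hN ih =>
      have e1 : Finset.Ioc k (N + 1) = insert (N + 1) (Finset.Ioc k N) := by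
        ext n; simp only [Finset.mem_Ioc, Finset.mem_insert]; omega
      rw [e1, Finset.sum_insert (by simp), mul_add, neg_add, Real.exp_add]
      calc e (N + 1 + 1) * e (N + 1) ≤ e N * Real.exp (-(c * x (N + 1))) * e (N + 1) :=
            mul_le_mul_of_nonneg_right (hstep N) (he0 _)
        _ = e (N + 1) * e N * Real.exp (-(c * x (N + 1))) := by ring
        _ ≤ e k * e (k + 1) * Real.exp (-(c * ∑ n ∈ Finset.Ioc k N, x n)) *
              Real.exp (-(c * x (N + 1))) := mul_le_mul_of_nonneg_right ih (Real.exp_pos _).le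
        _ = _ := by ring
  have hsq : e (N + 1) ^ 2 ≤
      (e k * Real.exp (-((2 : ℝ) ^ (-h) / 4 * ∑ n ∈ Finset.Ioc k N, x n))) ^ 2 := by
    calc e (N + 1) ^ 2 ≤ e (N + 1) * e N := by
          rw [sq]; exact mul_le_mul_of_nonneg_left (he (Nat.le_succ N)) (he0 _)
      _ ≤ _ := hprod
      _ ≤ e k * e k * Real.exp (-(c * ∑ n ∈ Finset.Ioc k N, x n)) :=
          mul_le_mul_of_nonneg_right (mul_le_mul_of_nonneg_left (he (Nat.le_succ k)) (he0 k))
            (Real.exp_pos _).le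
      _ = _ := by
          rw [mul_pow, ← Real.exp_nat_mul, hc]
          ring_nf
  exact abs_le_of_sq_le_sq' hsq (mul_nonneg (he0 k) (Real.exp_pos _).le) |>.2

theorem le_rpow_of_le_mul_rpow {Λ K g : ℝ} (hΛ : 0 < Λ) (hg : g < 1)
    (h : Λ ≤ K * Λ ^ g) : Λ ≤ K ^ (1 / (1 - g)) := by
  have h1 : Λ ^ (1 - g) ≤ K := by
    rw [Real.rpow_sub hΛ, Real.rpow_one, div_le_iff₀ (Real.rpow_pos_of_pos hΛ _)]
    exact h
  have h2 := Real.rpow_le_rpow (Real.rpow_nonneg hΛ.le _) h1 (z := 1 / (1 - g))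
    (by have : 0 < 1 - g := by linarith
        positivity)
  rwa [← Real.rpow_mul hΛ.le, mul_one_div_cancel (by linarith), Real.rpow_one] at h2

theorem exists_rpow_le_exp {q c : ℝ} (hq : 0 < q) (hc : 0 < c) :
    ∃ C : ℝ, 1 ≤ C ∧ ∀ y : ℝ, 0 ≤ y → y ^ q ≤ C * Real.exp (c * y) := by
  refine ⟨(q / c) ^ q + 1, by have : 0 ≤ (q / c) ^ q := by positivity
                              linarith, fun y hy => ?_⟩
  have h1 : y ≤ q / c * Real.exp (c * y / q) := by
    have := Real.add_one_le_exp (c * y / q)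
    calc y = q / c * (c * y / q) := by field_simp
      _ ≤ _ := mul_le_mul_of_nonneg_left (by linarith) (by positivity)
  calc y ^ q ≤ (q / c * Real.exp (c * y / q)) ^ q := Real.rpow_le_rpow hy h1 hq.le
    _ = (q / c) ^ q * Real.exp (c * y) := by
        rw [Real.mul_rpow (by positivity) (Real.exp_pos _).le, ← Real.exp_mul]
        congr 2
        field_simp
    _ ≤ _ := mul_le_mul_of_nonneg_right (by linarith) (Real.exp_pos _).le

theorem le_of_le_mul_mul_rpow {x c M D : ℝ≥0∞} {α : ℝ} (hα : 0 < α) (hc0 : c ≠ 0) (hct : c ≠ ∞)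
    (hM0 : M ≠ 0) (h : M ≠ ∞ → x ≤ c * (M * D ^ α)) :
    (x / c) ^ (1 / α) * M ^ (-(1 / α)) ≤ D := by
  have hα' : 0 < 1 / α := by positivity
  rcases eq_or_ne M ∞ with rfl | hMt
  · rw [ENNReal.top_rpow_of_neg (by linarith), mul_zero]
    exact zero_le
  have h1 : x / c ≤ M * D ^ α := by
    rw [ENNReal.div_le_iff hc0 hct, mul_comm]
    exact h hMt
  have h2 := ENNReal.rpow_le_rpow h1 hα'.le
  rw [ENNReal.mul_rpow_of_nonneg _ _ hα'.le, ← ENNReal.rpow_mul, mul_one_div_cancel hα.ne',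
    ENNReal.rpow_one] at h2
  rw [ENNReal.rpow_neg]
  calc _ ≤ M ^ (1 / α) * D * (M ^ (1 / α))⁻¹ := mul_le_mul' h2 le_rfl
    _ = (M ^ (1 / α) * (M ^ (1 / α))⁻¹) * D := by ring
    _ = D := by
        rw [ENNReal.mul_inv_cancel, one_mul]
        · rw [Ne, ENNReal.rpow_eq_zero_iff_of_pos hα']; exact hM0
        · exact ENNReal.rpow_ne_top_of_nonneg hα'.le hMt

end Recursions

end GradPhi

namespace GradPhi

section Anchor

variable {d L : ℕ} {p p' δ : ℝ}

/-- The initial condition of the heat kernel. -/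
noncomputable def pointMass (d L : ℕ) (x : Torus d L) : ℝ :=
  (if x = 0 then 1 else 0) - 1 / (Fintype.card (Torus d L) : ℝ)

theorem card_torus_pos : (0 : ℝ) < Fintype.card (Torus d L) := by
  exact_mod_cast Fintype.card_pos

theorem sum_pointMass : ∑ x, pointMass d L x = 0 := by
  have := card_torus_pos (d := d) (L := L)
  simp only [pointMass, Finset.sum_sub_distrib, Finset.sum_const, Finset.card_univ, nsmul_eq_mul]
  rw [Finset.sum_ite_eq' Finset.univ (0 : Torus d L), if_pos (Finset.mem_univ _)]
  field_simp
  ring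

theorem sum_abs_pointMass_le : ∑ x, |pointMass d L x| ≤ 2 := by
  have := card_torus_pos (d := d) (L := L)
  calc ∑ x, |pointMass d L x|
      ≤ ∑ x : Torus d L, ((if x = 0 then 1 else 0) + 1 / (Fintype.card (Torus d L) : ℝ)) := by
        refine Finset.sum_le_sum fun x _ => (abs_sub _ _).trans (le_of_eq ?_)
        rw [abs_of_nonneg (a := 1 / _) (by positivity)]
        split_ifs <;> simp
    _ = 2 := by
        rw [Finset.sum_add_distrib, Finset.sum_ite_eq' Finset.univ (0 : Torus d L),
          if_pos (Finset.mem_univ _), Finset.sum_const, Finset.card_univ, nsmul_eq_mul]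
        field_simp
        norm_num

theorem sq_pointMass_le (x : Torus d L) :
    pointMass d L x ^ 2 ≤ (if x = 0 then 1 else 0) + 1 / (Fintype.card (Torus d L) : ℝ) ^ 2 := by
  have h0 := card_torus_pos (d := d) (L := L)
  have h1 : (1 : ℝ) ≤ Fintype.card (Torus d L) := by exact_mod_cast Fintype.card_pos
  unfold pointMass
  have h2 : 1 / (Fintype.card (Torus d L) : ℝ) ≤ 1 := by rw [div_le_one h0]; exact h1
  have h3 : 0 ≤ 1 / (Fintype.card (Torus d L) : ℝ) := by positivity
  rw [← one_div_pow]
  split_ifs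
  · nlinarith
  · nlinarith

theorem sum_sq_pointMass_le : ∑ x, pointMass d L x ^ 2 ≤ 1 := by
  have h0 := card_torus_pos (d := d) (L := L)
  have h1 : ∀ x, pointMass d L x ^ 2 = (if x = 0 then 1 else 0) * pointMass d L x -
      1 / (Fintype.card (Torus d L) : ℝ) * pointMass d L x := by
    intro x
    rw [← sub_mul, sq]
    rfl
  simp only [h1, Finset.sum_sub_distrib, ← Finset.mul_sum, sum_pointMass, ite_mul, one_mul,
    zero_mul, mul_zero, sub_zero]
  rw [Finset.sum_ite_eq' Finset.univ (0 : Torus d L), if_pos (Finset.mem_univ _)]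
  unfold pointMass
  rw [if_pos rfl]
  have : 0 ≤ 1 / (Fintype.card (Torus d L) : ℝ) := by positivity
  linarith

theorem exists_anchor (d : ℕ) {p : ℝ} (hp : (d : ℝ) < p) :
    ∃ C : ℝ, 1 ≤ C ∧ ∀ L : ℕ, 1 ≤ L → ∀ N : ℕ, ∃ η : ℝ,
      Fintype.card (Torus d L) * η ^ 2 ≤ (1 + (N : ℝ)) ^ (-(d / 2 : ℝ)) ∧
      ∑ x, starNorm x ^ p * (pointMass d L x + η) ^ 2 ≤ C * (1 + (N : ℝ)) ^ ((p - d) / 2) ∧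
      ∑ x, (pointMass d L x + η) ^ 2 ≤ 1 := by
  have hp0 : 0 < p := lt_of_le_of_lt (Nat.cast_nonneg d) hp
  have hC : (0 : ℝ) ≤ (d + 1 : ℝ) ^ p := by positivity
  refine ⟨1 + (d + 1 : ℝ) ^ p, by linarith, fun L hL N => ?_⟩
  have h0 := card_torus_pos (d := d) (L := L)
  have hN : (1 : ℝ) ≤ 1 + N := by linarith [(Nat.cast_nonneg N : (0 : ℝ) ≤ N)]
  have hL1 : (1 : ℝ) ≤ L := by exact_mod_cast hL
  have hcard : (Fintype.card (Torus d L) : ℝ) = (2 * L + 1 : ℝ) ^ d := by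
    rw [card_torus]; push_cast; ring
  have hpow : 1 ≤ (1 + (N : ℝ)) ^ ((p - d) / 2) :=
    Real.one_le_rpow hN (by linarith)
  rcases le_or_gt (N : ℝ) ((L : ℝ) ^ 2) with h | h
  · refine ⟨1 / Fintype.card (Torus d L), ?_, ?_, ?_⟩
    · have e1 : (Fintype.card (Torus d L) : ℝ) * (1 / Fintype.card (Torus d L)) ^ 2 =
          ((2 * L + 1 : ℝ) ^ d)⁻¹ := by
        rw [hcard]; field_simp
      rw [e1, Real.rpow_neg (by linarith)]
      refine inv_anti₀ (by positivity) ?_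
      calc (1 + (N : ℝ)) ^ (d / 2 : ℝ) ≤ ((2 * L + 1 : ℝ) ^ 2) ^ (d / 2 : ℝ) :=
            Real.rpow_le_rpow (by linarith) (by nlinarith) (by positivity)
        _ = (2 * L + 1 : ℝ) ^ d := by
            rw [← Real.rpow_natCast _ 2, ← Real.rpow_mul (by positivity), ← Real.rpow_natCast]
            congr 1
            push_cast
            ring
    · have e1 : ∀ x, starNorm x ^ p * (pointMass d L x + 1 / Fintype.card (Torus d L)) ^ 2 =
          if x = 0 then 1 else 0 := by
        intro x
        unfold pointMass
        split_ifs with hx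
        · rw [hx, starNorm_zero]; simp
        · simp
      simp only [e1]
      rw [Finset.sum_ite_eq' Finset.univ (0 : Torus d L), if_pos (Finset.mem_univ _)]
      calc (1 : ℝ) = 1 * 1 := by norm_num
        _ ≤ _ := mul_le_mul (by linarith) hpow zero_le_one (by linarith)
    · have e1 : ∀ x, (pointMass d L x + 1 / Fintype.card (Torus d L)) ^ 2 =
          if x = 0 then 1 else 0 := by
        intro x
        unfold pointMass
        split_ifs with hx <;> simp
      simp only [e1]
      rw [Finset.sum_ite_eq' Finset.univ (0 : Torus d L), if_pos (Finset.mem_univ _)]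
  · refine ⟨0, by simp; positivity, ?_, by simpa using sum_sq_pointMass_le⟩
    simp only [add_zero]
    calc ∑ x, starNorm x ^ p * pointMass d L x ^ 2
        ≤ ∑ x : Torus d L, ((if x = 0 then 1 else 0) +
            (d * L + 1 : ℝ) ^ p * (1 / (Fintype.card (Torus d L) : ℝ) ^ 2)) := by
          refine Finset.sum_le_sum fun x _ => ?_
          have h1 := mul_le_mul_of_nonneg_left (sq_pointMass_le x)
            (Real.rpow_nonneg (starNorm_pos x).le p)
          refine h1.trans ?_
          rw [mul_add]
          refine add_le_add (le_of_eq ?_) (mul_le_mul_of_nonneg_right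
            (Real.rpow_le_rpow (starNorm_pos x).le (starNorm_le x) hp0.le) (by positivity))
          split_ifs with hx
          · rw [hx, starNorm_zero]; simp
          · simp
      _ = 1 + (d * L + 1 : ℝ) ^ p / Fintype.card (Torus d L) := by
          rw [Finset.sum_add_distrib, Finset.sum_ite_eq' Finset.univ (0 : Torus d L),
            if_pos (Finset.mem_univ _), Finset.sum_const, Finset.card_univ, nsmul_eq_mul]
          field_simp
      _ ≤ 1 + (d + 1 : ℝ) ^ p * (1 + (N : ℝ)) ^ ((p - d) / 2) := by
          have h2 : (d * L + 1 : ℝ) ^ p ≤ (d + 1 : ℝ) ^ p * (L : ℝ) ^ p := by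
            rw [← Real.mul_rpow (by positivity) (by positivity)]
            exact Real.rpow_le_rpow (by positivity) (by linarith) hp0.le
          have h3 : (L : ℝ) ^ d ≤ Fintype.card (Torus d L) := by
            rw [hcard]
            exact pow_le_pow_left₀ (by positivity) (by linarith) d
          have h4 : (L : ℝ) ^ p = (L : ℝ) ^ (p - d) * (L : ℝ) ^ d := by
            rw [← Real.rpow_natCast, ← Real.rpow_add (by linarith)]
            congr 1; ring
          have h5 : (L : ℝ) ^ (p - d) ≤ (1 + (N : ℝ)) ^ ((p - d) / 2) := by
            calc (L : ℝ) ^ (p - d) = ((L : ℝ) ^ 2) ^ ((p - d) / 2) := by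
                  rw [← Real.rpow_natCast _ 2, ← Real.rpow_mul (by positivity)]
                  congr 1
                  push_cast
                  ring
              _ ≤ _ := Real.rpow_le_rpow (by positivity) (by linarith) (by linarith)
          refine add_le_add le_rfl ?_
          rw [div_le_iff₀ h0]
          calc (d * L + 1 : ℝ) ^ p ≤ (d + 1 : ℝ) ^ p * ((L : ℝ) ^ (p - d) * (L : ℝ) ^ d) := by
                rw [← h4]; exact h2
            _ ≤ (d + 1 : ℝ) ^ p * ((1 + (N : ℝ)) ^ ((p - d) / 2) * Fintype.card (Torus d L)) := by
                gcongr
            _ = _ := by ring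
      _ ≤ _ := by
          rw [add_mul, one_mul]
          exact add_le_add hpow le_rfl

theorem lintegral_Ioc_nat (f : ℝ → ℝ≥0∞) (n : ℕ) :
    ∫⁻ r in Ioc 0 (n : ℝ), f r =
      ∑ k ∈ Finset.range n, ∫⁻ r in Ioc (k : ℝ) (k + 1 : ℝ), f r := by
  induction n with
  | zero => simp
  | succ n ih =>
    rw [Finset.sum_range_succ, ← ih, ← lintegral_union measurableSet_Ioc, Ioc_union_Ioc_eq_Ioc
      (Nat.cast_nonneg n) (by linarith)]
    · push_cast; rfl
    · exact Ioc_disjoint_Ioc_of_le le_rfl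

theorem lintegral_Ioc_nat_le_iSup_timeAvg (f : ℝ → ℝ≥0∞) (n : ℕ) :
    ∫⁻ r in Ioc 0 (n : ℝ), f r ≤ n * ⨆ r ∈ Ici (1 : ℝ), timeAvg f r := by
  rcases Nat.eq_zero_or_pos n with rfl | hn
  · simp
  have hn1 : (1 : ℝ) ≤ n := by exact_mod_cast hn
  have h := le_iSup₂ (f := fun r (_ : r ∈ Ici (1 : ℝ)) => timeAvg f r) (n : ℝ) hn1
  unfold timeAvg at h ⊢
  rw [ENNReal.ofReal_natCast, ENNReal.div_le_iff (by exact_mod_cast hn.ne') (by simp), mul_comm] at h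
  exact h

theorem lintegral_mul_rpow_neg_le {f : ℝ → ℝ≥0∞} {q : ℝ} (hq0 : 0 < q) (hq1 : q < 1)
    (hS : (⨆ r ∈ Ici (1 : ℝ), timeAvg f r) ≠ ∞) (N : ℕ) :
    ∫⁻ r in Ioc 0 (N : ℝ), f r * ENNReal.ofReal ((1 + r) ^ (-q)) ≤
      (⨆ r ∈ Ici (1 : ℝ), timeAvg f r) * ENNReal.ofReal ((1 / (1 - q)) * (N : ℝ) ^ (1 - q)) := by
  set S := ⨆ r ∈ Ici (1 : ℝ), timeAvg f r
  set F : ℕ → ℝ≥0∞ := fun k => ∫⁻ r in Ioc (k : ℝ) (k + 1 : ℝ), f r with hF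
  have hsum : ∀ n : ℕ, ∑ k ∈ Finset.range n, F k ≤ n * S := fun n => by
    rw [hF, ← lintegral_Ioc_nat]
    exact lintegral_Ioc_nat_le_iSup_timeAvg f n
  have hFt : ∀ k, F k ≠ ∞ := fun k => by
    refine ne_top_of_le_ne_top (ENNReal.mul_ne_top (ENNReal.natCast_ne_top (k + 1)) hS)
      (le_trans ?_ (hsum (k + 1)))
    exact Finset.single_le_sum (f := F) (fun _ _ => zero_le) (Finset.self_mem_range_succ k)
  set w : ℕ → ℝ := fun k => (1 + (k : ℝ)) ^ (-q) with hw
  have hw0 : ∀ k, 0 ≤ w k := fun k => by positivity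
  have hwa : Antitone w := fun m n hmn => Real.rpow_le_rpow_of_nonpos (by positivity)
    (by have : (m : ℝ) ≤ n := by exact_mod_cast hmn
        linarith) (by linarith)
  have habel := sum_mul_le_of_antitone (f := fun k => (F k).toReal) (S := S.toReal) hwa hw0
    (fun n => by
      rw [← ENNReal.toReal_sum fun k _ => hFt k]
      have := ENNReal.toReal_mono (ENNReal.mul_ne_top (ENNReal.natCast_ne_top n) hS) (hsum n)
      rw [ENNReal.toReal_mul, ENNReal.toReal_natCast] at this
      linarith) N
  calc ∫⁻ r in Ioc 0 (N : ℝ), f r * ENNReal.ofReal ((1 + r) ^ (-q))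
      = ∑ k ∈ Finset.range N, ∫⁻ r in Ioc (k : ℝ) (k + 1 : ℝ),
          f r * ENNReal.ofReal ((1 + r) ^ (-q)) := lintegral_Ioc_nat _ _
    _ ≤ ∑ k ∈ Finset.range N, ENNReal.ofReal ((F k).toReal * w k) := by
        refine Finset.sum_le_sum fun k _ => ?_
        rw [ENNReal.ofReal_mul ENNReal.toReal_nonneg, ENNReal.ofReal_toReal (hFt k),
          ← lintegral_mul_const' _ _ ENNReal.ofReal_ne_top]
        refine setLIntegral_mono' measurableSet_Ioc fun r hr => mul_le_mul' le_rfl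
          (ENNReal.ofReal_le_ofReal ?_)
        exact Real.rpow_le_rpow_of_nonpos (by positivity) (by linarith [hr.1]) (by linarith)
    _ = ENNReal.ofReal (∑ k ∈ Finset.range N, (F k).toReal * w k) :=
        (ENNReal.ofReal_sum_of_nonneg fun k _ => mul_nonneg ENNReal.toReal_nonneg (hw0 k)).symm
    _ ≤ ENNReal.ofReal (S.toReal * ((1 / (1 - q)) * (N : ℝ) ^ (1 - q))) :=
        ENNReal.ofReal_le_ofReal (habel.trans (mul_le_mul_of_nonneg_left (sum_rpow_neg_le hq0 hq1 N)
          ENNReal.toReal_nonneg))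
    _ = _ := by rw [ENNReal.ofReal_mul ENNReal.toReal_nonneg, ENNReal.ofReal_toReal hS]

variable {a : ℝ → Edge d L → ℝ} {u : ℝ → Torus d L → ℝ}

theorem moment_zero_add_const {t : ℝ} (hs : ∑ x, u t x = 0) (η : ℝ) :
    moment 0 (fun t x => u t x + η) t =
      moment 0 u t + ENNReal.ofReal (Fintype.card (Torus d L) * η ^ 2) := by
  rw [moment_zero_eq, moment_zero_eq, ← ENNReal.ofReal_add
    (Finset.sum_nonneg fun x _ => sq_nonneg _) (by positivity)]
  congr 1
  have : ∀ x, (u t x + η) ^ 2 = u t x ^ 2 + 2 * η * u t x + η ^ 2 := fun x => by ring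
  simp only [this, Finset.sum_add_distrib, ← Finset.mul_sum, hs, Finset.sum_const,
    Finset.card_univ, nsmul_eq_mul]
  ring

theorem measurable_calM1 (hp : 0 < p) (hδ : 0 ≤ δ) (ha : ∀ e, Continuous fun t => a t e) :
    Measurable (calM1 p δ a) := by
  have : calM1 p δ a = fun t =>
      1 + bar p δ (fun s => calM0 p δ a s ^ (p / (2 * (1 - thetaExp d)))) t :=
    funext fun t => calM1_eq hp hδ ha t
  rw [this]
  exact measurable_const.add (measurable_bar ((measurable_calM0 ha).pow_const _))

theorem one_le_timeAvg {f : ℝ → ℝ≥0∞} (hf : ∀ s, 1 ≤ f s) {t : ℝ} (ht : 0 < t) :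
    1 ≤ timeAvg f t := by
  unfold timeAvg
  rw [ENNReal.le_div_iff_mul_le (Or.inl (by simpa using ht)) (Or.inl ENNReal.ofReal_ne_top),
    one_mul]
  calc ENNReal.ofReal t = ∫⁻ _ in Ioc 0 t, 1 := by simp
    _ ≤ _ := lintegral_mono fun s => hf s

theorem one_le_scrM2 (hp : 1 < p) : 1 ≤ scrM2 p a := by
  unfold scrM2
  refine ENNReal.one_le_rpow ?_ (by linarith)
  exact (one_le_timeAvg (fun s => le_self_add) one_pos).trans
    (le_iSup₂ (f := fun t (_ : t ∈ Ici (1 : ℝ)) => timeAvg (calM2 p a) t) 1 (mem_Ici.2 le_rfl))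

/-- Growth of the averaged weighted norm when the energy decays at the heat-kernel rate. -/
theorem exists_bar_moment_le_of_decay (d : ℕ) (hd : 2 ≤ d) {p δ : ℝ} (hp : (d : ℝ) < p)
    (hδ : IsAdmissibleDelta p δ) :
    ∃ C : ℝ≥0∞, 1 ≤ C ∧ C ≠ ∞ ∧ ∀ (L : ℕ), 1 ≤ L → ∀ (a : ℝ → Edge d L → ℝ)
      (u : ℝ → Torus d L → ℝ), IsFlow a u → (∀ x, u 0 x = pointMass d L x) → scrM1 p δ a ≠ ∞ →
      scrM2 p a ≠ ∞ → ∀ (N : ℕ) (Λ : ℝ), 1 ≤ Λ →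
      (∀ s ∈ Icc 0 (N : ℝ), ∑ x, u s x ^ 2 ≤ Λ * (1 + s) ^ (-(d / 2 : ℝ))) →
      ∃ η : ℝ, Fintype.card (Torus d L) * η ^ 2 ≤ (1 + (N : ℝ)) ^ (-(d / 2 : ℝ)) ∧
        ∀ s ∈ Icc 0 (N : ℝ), bar p δ (moment p fun t x => u t x + η) s ≤
          C * ((scrM1 p δ a + scrM2 p a) * ENNReal.ofReal (Λ * (1 + (N : ℝ)) ^ ((p - d) / 2))) := by
  have hd2 : (2 : ℝ) ≤ d := by exact_mod_cast hd
  have hp2 : 2 < p := by linarith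
  have hp0 : 0 < p := by linarith
  obtain ⟨C1, hC11, hC1⟩ := exists_anchor d hp
  obtain ⟨C2, hC21, hC2t, hC2⟩ := exists_bar_moment_le d hd hp2 hδ
  obtain ⟨C3, hC31, hC3t, hC3⟩ := exists_bar_apriori hp2 hδ
  set q := (d : ℝ) / p with hq
  have hq0 : 0 < q := by positivity
  have hq1 : q < 1 := (div_lt_one hp0).2 hp
  set C4 : ℝ≥0∞ := ENNReal.ofReal (2 * (1 / (1 - q)) ^ (p / 2)) with hC4
  set C5 : ℝ≥0∞ := C3 * (ENNReal.ofReal C1 + 1) with hC5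
  refine ⟨C2 * (C5 + C4), one_le_mul hC21 (le_add_right (one_le_mul hC31 le_add_self)),
    ENNReal.mul_ne_top hC2t (ENNReal.add_ne_top.2 ⟨ENNReal.mul_ne_top hC3t (ENNReal.add_ne_top.2
      ⟨ENNReal.ofReal_ne_top, ENNReal.one_ne_top⟩), ENNReal.ofReal_ne_top⟩), ?_⟩
  intro L hL a u h hu0 hM1 hM2 N Λ hΛ hdec
  obtain ⟨η, hη1, hη2, hη3⟩ := hC1 L hL N
  refine ⟨η, hη1, ?_⟩
  set U : ℝ → Torus d L → ℝ := fun t x => u t x + η with hU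
  have hUf : IsFlow a U := h.add_const η
  have hUE : moment 0 U 0 ≤ 1 := by
    rw [moment_zero_eq]
    simp only [hU, hu0]
    exact ENNReal.ofReal_le_one.2 hη3
  have hUN : moment p U 0 ≤ ENNReal.ofReal (C1 * (1 + (N : ℝ)) ^ ((p - d) / 2)) := by
    rw [moment_eq]
    simp only [hU, hu0]
    exact ENNReal.ofReal_le_ofReal hη2
  set S1 := ⨆ t ∈ Ici (1 : ℝ), timeAvg (fun s => calM1 p δ a s ^ (2 / p)) t with hS1
  have hS1e : S1 ^ (p / 2) = scrM1 p δ a := rfl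
  have hS1t : S1 ≠ ∞ := by
    intro htop
    apply hM1
    rw [← hS1e, htop, ENNReal.top_rpow_of_pos (by positivity)]
  have hM1m := measurable_calM1 (d := d) (L := L) hp0 hδ.1.le h.env_continuous
  have hae : ∀ᵐ s ∂volume.restrict (Ioc 0 (N : ℝ)), calM1 p δ a s ≠ ∞ := by
    have h1 : ∫⁻ s in Ioc 0 (N : ℝ), calM1 p δ a s ^ (2 / p) ≠ ∞ :=
      ne_top_of_le_ne_top (ENNReal.mul_ne_top (ENNReal.natCast_ne_top N) hS1t)
        (lintegral_Ioc_nat_le_iSup_timeAvg _ N)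
    filter_upwards [ae_lt_top (hM1m.pow_const _) h1] with s hs htop
    rw [htop, ENNReal.top_rpow_of_pos (by positivity)] at hs
    exact lt_irrefl _ hs
  have hN1 : (1 : ℝ) ≤ 1 + N := by linarith [(Nat.cast_nonneg N : (0 : ℝ) ≤ N)]
  set P := (1 + (N : ℝ)) ^ ((p - d) / 2) with hP
  have hP1 : 1 ≤ P := Real.one_le_rpow hN1 (by linarith)
  have hEU : ∀ s ∈ Icc 0 (N : ℝ), moment 0 U s ≤
      ENNReal.ofReal (2 * Λ * (1 + s) ^ (-(d / 2 : ℝ))) := by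
    intro s hs
    have hsum : ∑ x, u s x = 0 := by
      rw [h.sum_eq hs.1]
      simp only [hu0, sum_pointMass]
    rw [hU, moment_zero_add_const hsum, moment_zero_eq, ← ENNReal.ofReal_add
      (Finset.sum_nonneg fun x _ => sq_nonneg _) (by positivity)]
    refine ENNReal.ofReal_le_ofReal ?_
    have h1 : (1 + (N : ℝ)) ^ (-(d / 2 : ℝ)) ≤ (1 + s) ^ (-(d / 2 : ℝ)) :=
      Real.rpow_le_rpow_of_nonpos (by linarith [hs.1]) (by linarith [hs.2]) (by linarith)
    have h2 : 0 ≤ (1 + s) ^ (-(d / 2 : ℝ)) := Real.rpow_nonneg (by linarith [hs.1]) _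
    nlinarith [hdec s hs]
  have hJ : (∫⁻ r in Ioc 0 (N : ℝ), calM1 p δ a r ^ (2 / p) * moment 0 U r ^ (2 / p)) ^ (p / 2) ≤
      C4 * (scrM1 p δ a * ENNReal.ofReal (Λ * P)) := by
    have h1 : ∫⁻ r in Ioc 0 (N : ℝ), calM1 p δ a r ^ (2 / p) * moment 0 U r ^ (2 / p) ≤
        ENNReal.ofReal ((2 * Λ) ^ (2 / p)) * (S1 * ENNReal.ofReal ((1 / (1 - q)) *
          (N : ℝ) ^ (1 - q))) := by
      refine le_trans ?_ (mul_le_mul' le_rfl (lintegral_mul_rpow_neg_le hq0 hq1 hS1t N))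
      rw [← lintegral_const_mul' _ _ ENNReal.ofReal_ne_top]
      refine setLIntegral_mono' measurableSet_Ioc fun r hr => ?_
      have hr0 : 0 ≤ 1 + r := by linarith [hr.1]
      have h2 := ENNReal.rpow_le_rpow (hEU r ⟨hr.1.le, hr.2⟩) (z := 2 / p) (by positivity)
      rw [ENNReal.ofReal_rpow_of_nonneg (by positivity) (by positivity),
        Real.mul_rpow (by positivity) (by positivity), ← Real.rpow_mul hr0,
        ENNReal.ofReal_mul (by positivity)] at h2
      have e1 : -(d / 2 : ℝ) * (2 / p) = -q := by rw [hq]; field_simp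
      rw [e1] at h2
      calc _ ≤ _ := mul_le_mul' le_rfl h2
        _ = _ := by ring
    have hp2' : 0 ≤ p / 2 := by positivity
    refine (ENNReal.rpow_le_rpow h1 hp2').trans ?_
    have hq' : 0 < 1 - q := by linarith
    have k1 : ((2 * Λ) ^ (2 / p)) ^ (p / 2) = 2 * Λ := by
      have e2 : 2 / p * (p / 2) = 1 := by field_simp
      rw [← Real.rpow_mul (by linarith), e2, Real.rpow_one]
    have k2 : ((1 / (1 - q)) * (N : ℝ) ^ (1 - q)) ^ (p / 2) =
        (1 / (1 - q)) ^ (p / 2) * (N : ℝ) ^ ((p - d) / 2) := by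
      have e3 : (1 - q) * (p / 2) = (p - d) / 2 := by rw [hq]; field_simp
      rw [Real.mul_rpow (by positivity) (by positivity), ← Real.rpow_mul (Nat.cast_nonneg N), e3]
    rw [ENNReal.mul_rpow_of_nonneg _ _ hp2', ENNReal.mul_rpow_of_nonneg _ _ hp2', hS1e,
      ENNReal.ofReal_rpow_of_nonneg (by positivity) hp2', ENNReal.ofReal_rpow_of_nonneg
      (by positivity) hp2', k1, k2, hC4]
    have h3 : (N : ℝ) ^ ((p - d) / 2) ≤ P :=
      Real.rpow_le_rpow (Nat.cast_nonneg N) (by linarith) (by linarith)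
    calc ENNReal.ofReal (2 * Λ) * (scrM1 p δ a * ENNReal.ofReal ((1 / (1 - q)) ^ (p / 2) *
          (N : ℝ) ^ ((p - d) / 2)))
        = scrM1 p δ a * ENNReal.ofReal ((2 * Λ) * ((1 / (1 - q)) ^ (p / 2) *
          (N : ℝ) ^ ((p - d) / 2))) := by
          rw [ENNReal.ofReal_mul (p := 2 * Λ) (by positivity)]; ring
      _ ≤ scrM1 p δ a * ENNReal.ofReal ((2 * Λ) * ((1 / (1 - q)) ^ (p / 2) * P)) := by
          gcongr
      _ = scrM1 p δ a * ENNReal.ofReal ((2 * (1 / (1 - q)) ^ (p / 2)) * (Λ * P)) := by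
          congr 2; ring
      _ = _ := by rw [ENNReal.ofReal_mul (by positivity)]; ring
  have hN0 : bar p δ (moment p U) 0 ≤ C5 * (scrM2 p a * ENNReal.ofReal (Λ * P)) := by
    have h1 := hC3 d L a U hUf hUE hM2 0 le_rfl
    rw [add_zero, Real.one_rpow, ENNReal.ofReal_one, one_mul] at h1
    refine (le_self_add.trans h1).trans ?_
    rw [hC5, mul_assoc]
    refine mul_le_mul' le_rfl ?_
    have hM21 : 1 ≤ scrM2 p a := one_le_scrM2 (by linarith)
    have hΛP : P ≤ Λ * P := le_mul_of_one_le_left (by linarith) hΛ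
    have hΛP1 : 1 ≤ ENNReal.ofReal (Λ * P) := ENNReal.one_le_ofReal.2 (hP1.trans hΛP)
    rw [add_mul, one_mul]
    refine add_le_add ?_ (le_mul_of_one_le_right zero_le hΛP1)
    refine hUN.trans ?_
    rw [ENNReal.ofReal_mul (by linarith)]
    refine mul_le_mul' le_rfl ((ENNReal.ofReal_le_ofReal hΛP).trans ?_)
    exact le_mul_of_one_le_left zero_le hM21
  intro s hs
  refine (hC2 L a U hUf hUE hM2 N (Nat.cast_nonneg N) hae s hs).trans ?_
  rw [mul_assoc]
  refine mul_le_mul' le_rfl ((add_le_add hN0 hJ).trans ?_)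
  calc C5 * (scrM2 p a * ENNReal.ofReal (Λ * P)) + C4 * (scrM1 p δ a * ENNReal.ofReal (Λ * P))
      ≤ C5 * ((scrM1 p δ a + scrM2 p a) * ENNReal.ofReal (Λ * P)) +
        C4 * ((scrM1 p δ a + scrM2 p a) * ENNReal.ofReal (Λ * P)) := by
        gcongr
        · exact le_add_self
        · exact le_self_add
    _ = _ := by ring

end Anchor

end GradPhi

namespace GradPhi

section Decay

variable {d L : ℕ} {p p' δ : ℝ} {a : ℝ → Edge d L → ℝ} {u : ℝ → Torus d L → ℝ}

theorem IsFlow.bar_moment_zero_antitone (h : IsFlow a u) {t1 t2 : ℝ} (h1 : 0 ≤ t1)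
    (h12 : t1 ≤ t2) : bar p δ (moment 0 u) t2 ≤ bar p δ (moment 0 u) t1 := by
  rw [h.bar_energy_eq h1 h12]
  exact le_self_add

theorem IsFlow.bar_moment_zero_le (h : IsFlow a u) (hp : 0 < p) (hδ : IsAdmissibleDelta p δ) {t : ℝ}
    (ht : 0 ≤ t) : bar p δ (moment 0 u) t ≤ moment 0 u t :=
  (bar_mono_of_pos fun _ hs => h.moment_zero_antitone ht hs.le).trans
    (bar_const_le hp hδ (moment 0 u t) t)

theorem IsFlow.moment_zero_le_bar (h : IsFlow a u) (hp : 0 < p) (hδ : 0 < δ) {t : ℝ}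
    (ht : 0 ≤ t) : moment 0 u (t + 1) ≤
      (ENNReal.ofReal (δ / 2 ^ (p + 3)))⁻¹ * bar p δ (moment 0 u) t := by
  have hpos : 0 < δ / 2 ^ (p + 3) := by positivity
  have hb := bar_ge (F := moment 0 u) hp hδ.le (h.measurable_moment 0) (c := moment 0 u (t + 1))
    (t := t) fun s hs hs1 => h.moment_zero_antitone (by linarith) hs1
  have h0 : ENNReal.ofReal (δ / 2 ^ (p + 3)) ≠ 0 := by
    rw [Ne, ENNReal.ofReal_eq_zero, not_le]
    exact hpos
  calc moment 0 u (t + 1) = (ENNReal.ofReal (δ / 2 ^ (p + 3)))⁻¹ *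
        (ENNReal.ofReal (δ / 2 ^ (p + 3)) * moment 0 u (t + 1)) := by
        rw [← mul_assoc, ENNReal.inv_mul_cancel h0 ENNReal.ofReal_ne_top, one_mul]
    _ ≤ _ := mul_le_mul' le_rfl hb

/-- The time average over the future, along integer times. -/
noncomputable def stepEnergy (p δ : ℝ) (u : ℝ → Torus d L → ℝ) (n : ℕ) : ℝ :=
  (bar p δ (moment 0 u) n).toReal

/-- The integral of `𝓜₃^{-1/α}` over a unit interval. -/
noncomputable def stepRate (p p' δ : ℝ) (a : ℝ → Edge d L → ℝ) (n : ℕ) : ℝ :=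
  (∫⁻ s in Ioc (n : ℝ) (n + 1), calM3 p p' δ a s ^ (-(1 / alphaExp d p p'))).toReal

/-- The smallest time average of `𝓜₃^{-1/α}`. -/
noncomputable def minRate (p p' δ : ℝ) (a : ℝ → Edge d L → ℝ) : ℝ≥0∞ :=
  ⨅ t ∈ Ici (1 : ℝ), timeAvg (fun s => calM3 p p' δ a s ^ (-(1 / alphaExp d p p'))) t

theorem scrM3_eq : scrM3 p p' δ a = minRate p p' δ a ^ (-(alphaExp d p p' / gammaExp d p p')) := rfl

theorem one_le_calM3 (t : ℝ) : 1 ≤ calM3 p p' δ a t := by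
  unfold calM3
  exact le_self_add

theorem calM3_rpow_neg_le_one (hα : 0 < alphaExp d p p') (t : ℝ) :
    calM3 p p' δ a t ^ (-(1 / alphaExp d p p')) ≤ 1 := by
  rw [ENNReal.rpow_neg]
  exact ENNReal.inv_le_one.2 (ENNReal.one_le_rpow (one_le_calM3 t) (by positivity))

theorem lintegral_rate_le_one (hα : 0 < alphaExp d p p') (n : ℕ) :
    ∫⁻ s in Ioc (n : ℝ) (n + 1), calM3 p p' δ a s ^ (-(1 / alphaExp d p p')) ≤ 1 := by
  calc _ ≤ ∫⁻ _ in Ioc (n : ℝ) (n + 1), 1 := lintegral_mono fun s => calM3_rpow_neg_le_one hα s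
    _ = 1 := by simp

theorem lintegral_rate_ne_top (hα : 0 < alphaExp d p p') (n : ℕ) :
    ∫⁻ s in Ioc (n : ℝ) (n + 1), calM3 p p' δ a s ^ (-(1 / alphaExp d p p')) ≠ ∞ :=
  ne_top_of_le_ne_top ENNReal.one_ne_top (lintegral_rate_le_one hα n)

theorem stepRate_nonneg (n : ℕ) : 0 ≤ stepRate p p' δ a n := ENNReal.toReal_nonneg

theorem stepRate_le_one (hα : 0 < alphaExp d p p') (n : ℕ) : stepRate p p' δ a n ≤ 1 :=
  ENNReal.toReal_le_of_le_ofReal zero_le_one (by simpa using lintegral_rate_le_one hα n)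

theorem minRate_le_one (hα : 0 < alphaExp d p p') : minRate p p' δ a ≤ 1 := by
  unfold minRate
  refine (iInf₂_le (1 : ℝ) (mem_Ici.2 le_rfl)).trans ?_
  unfold timeAvg
  have := lintegral_rate_le_one (δ := δ) (a := a) hα 0
  simpa using this

theorem minRate_mul_le_sum (hα : 0 < alphaExp d p p') (n : ℕ) :
    (minRate p p' δ a).toReal * n ≤ ∑ k ∈ Finset.range n, stepRate p p' δ a k := by
  have hκt : minRate p p' δ a ≠ ∞ := ne_top_of_le_ne_top ENNReal.one_ne_top (minRate_le_one hα)
  rcases Nat.eq_zero_or_pos n with rfl | hn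
  · simp
  unfold stepRate
  rw [← ENNReal.toReal_sum fun k _ => lintegral_rate_ne_top hα k, ← lintegral_Ioc_nat]
  have hn1 : (1 : ℝ) ≤ n := by exact_mod_cast hn
  have h := iInf₂_le (f := fun t (_ : t ∈ Ici (1 : ℝ)) =>
    timeAvg (fun s => calM3 p p' δ a s ^ (-(1 / alphaExp d p p'))) t) (n : ℝ) hn1
  change minRate p p' δ a ≤ _ at h
  unfold timeAvg at h
  rw [ENNReal.ofReal_natCast, ENNReal.le_div_iff_mul_le (Or.inl (by exact_mod_cast hn.ne'))
    (Or.inl (ENNReal.natCast_ne_top n))] at h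
  have h2 := ENNReal.toReal_mono (by
    rw [lintegral_Ioc_nat]
    exact ENNReal.sum_ne_top.2 fun k _ => lintegral_rate_ne_top hα k) h
  rwa [ENNReal.toReal_mul, ENNReal.toReal_natCast] at h2

theorem minRate_pos (hα : 0 < alphaExp d p p') (hγ : 0 < gammaExp d p p')
    (h : scrM3 p p' δ a ≠ ∞) : 0 < (minRate p p' δ a).toReal := by
  refine ENNReal.toReal_pos ?_ (ne_top_of_le_ne_top ENNReal.one_ne_top (minRate_le_one hα))
  intro h0
  apply h
  have : 0 < alphaExp d p p' / gammaExp d p p' := by positivity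
  rw [scrM3_eq, h0, ENNReal.zero_rpow_of_neg (by linarith)]

theorem minRate_toReal_le_one (hα : 0 < alphaExp d p p') : (minRate p p' δ a).toReal ≤ 1 :=
  ENNReal.toReal_le_of_le_ofReal zero_le_one (by simpa using minRate_le_one hα)

theorem IsFlow.bar_moment_zero_ne_top (h : IsFlow a u) (hp : 0 < p) (hδ : IsAdmissibleDelta p δ)
    {t : ℝ} (ht : 0 ≤ t) : bar p δ (moment 0 u) t ≠ ∞ :=
  ne_top_of_le_ne_top (moment_ne_top 0 u t) (h.bar_moment_zero_le hp hδ ht)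

theorem IsFlow.stepEnergy_le (h : IsFlow a u) (hp : 0 < p) (hδ : IsAdmissibleDelta p δ) (n : ℕ) :
    stepEnergy p δ u n ≤ ∑ x, u n x ^ 2 := by
  have := h.bar_moment_zero_le hp hδ (Nat.cast_nonneg n)
  rw [moment_zero_eq] at this
  exact ENNReal.toReal_le_of_le_ofReal (Finset.sum_nonneg fun x _ => sq_nonneg _) this

theorem IsFlow.stepEnergy_antitone (h : IsFlow a u) (hp : 0 < p) (hδ : IsAdmissibleDelta p δ) :
    Antitone (stepEnergy p δ u) := fun m n hmn =>
  ENNReal.toReal_mono (h.bar_moment_zero_ne_top hp hδ (Nat.cast_nonneg m))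
    (h.bar_moment_zero_antitone (Nat.cast_nonneg m) (by exact_mod_cast hmn))

theorem IsFlow.sum_sq_antitone (h : IsFlow a u) {t1 t2 : ℝ} (h1 : 0 ≤ t1) (h12 : t1 ≤ t2) :
    ∑ x, u t2 x ^ 2 ≤ ∑ x, u t1 x ^ 2 := by
  have := h.moment_zero_antitone h1 h12
  rwa [moment_zero_eq, moment_zero_eq, ENNReal.ofReal_le_ofReal_iff
    (Finset.sum_nonneg fun x _ => sq_nonneg _)] at this

theorem IsFlow.sum_sq_le_stepEnergy (h : IsFlow a u) (hp : 0 < p) (hδ : IsAdmissibleDelta p δ)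
    (n : ℕ) : ∑ x, u (n + 1) x ^ 2 ≤ (δ / 2 ^ (p + 3))⁻¹ * stepEnergy p δ u n := by
  have hpos : 0 < δ / 2 ^ (p + 3) := div_pos hδ.1 (by positivity)
  have h1 := h.moment_zero_le_bar hp hδ.1 (Nat.cast_nonneg n)
  rw [moment_zero_eq, ← ENNReal.ofReal_inv_of_pos hpos] at h1
  have h2 := ENNReal.toReal_mono (ENNReal.mul_ne_top ENNReal.ofReal_ne_top
    (h.bar_moment_zero_ne_top hp hδ (Nat.cast_nonneg n))) h1
  rwa [ENNReal.toReal_mul, ENNReal.toReal_ofReal (Finset.sum_nonneg fun x _ => sq_nonneg _),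
    ENNReal.toReal_ofReal (by positivity)] at h2

/-- One step of the discrete differential inequality for the averaged energy. -/
theorem IsFlow.stepEnergy_step (h : IsFlow a u) (hp : 0 < p) (hδ : IsAdmissibleDelta p δ)
    (hα : 0 < alphaExp d p p') (n : ℕ) {c : ℝ≥0∞} (hc0 : c ≠ 0) (hct : c ≠ ∞)
    (hineq : ∀ t ∈ Ioc (n : ℝ) (n + 1), calM3 p p' δ a t ≠ ∞ → bar p δ (moment 0 u) t ≤
      c * (calM3 p p' δ a t * bar p δ (dissip 0 a u) t ^ alphaExp d p p')) :
    stepEnergy p δ u (n + 1) + (stepEnergy p δ u (n + 1) / c.toReal) ^ (1 / alphaExp d p p') *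
      stepRate p p' δ a n ≤ stepEnergy p δ u n := by
  have hn0 : (0 : ℝ) ≤ n := Nat.cast_nonneg n
  set α := alphaExp d p p'
  have hα' : 0 < 1 / α := by positivity
  have he := h.bar_energy_eq (p := p) (δ := δ) hn0 (by linarith : (n : ℝ) ≤ n + 1)
  set E := bar p δ (moment 0 u)
  set D := bar p δ (dissip 0 a u)
  have hEt : ∀ t, 0 ≤ t → E t ≠ ∞ := fun t ht => h.bar_moment_zero_ne_top hp hδ ht
  have hqt : (E (n + 1) / c) ^ (1 / α) ≠ ∞ := ENNReal.rpow_ne_top_of_nonneg hα'.le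
    (ENNReal.div_ne_top (hEt _ (by linarith)) hc0)
  have h1 : (E (n + 1) / c) ^ (1 / α) * ∫⁻ s in Ioc (n : ℝ) (n + 1), calM3 p p' δ a s ^ (-(1 / α)) ≤
      ∫⁻ t in Ioc (n : ℝ) (n + 1), D t := by
    rw [← lintegral_const_mul' _ _ hqt]
    refine setLIntegral_mono' measurableSet_Ioc fun t ht => ?_
    refine le_trans (mul_le_mul' (ENNReal.rpow_le_rpow (ENNReal.div_le_div_right ?_ c) hα'.le)
      le_rfl) (le_of_le_mul_mul_rpow hα hc0 hct
        (one_pos.trans_le (one_le_calM3 t)).ne' (hineq t ht))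
    exact h.bar_moment_zero_antitone (by linarith [ht.1]) ht.2
  have h2 : E (n + 1) + (E (n + 1) / c) ^ (1 / α) *
      ∫⁻ s in Ioc (n : ℝ) (n + 1), calM3 p p' δ a s ^ (-(1 / α)) ≤ E n := by
    rw [he]
    refine add_le_add le_rfl (h1.trans ?_)
    exact le_mul_of_one_le_left zero_le (by norm_num)
  have h3 := ENNReal.toReal_mono (hEt n hn0) h2
  rw [ENNReal.toReal_add (hEt _ (by linarith)) (ENNReal.mul_ne_top hqt
    (lintegral_rate_ne_top hα n)), ENNReal.toReal_mul, ← ENNReal.toReal_rpow,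
    ENNReal.toReal_div] at h3
  unfold stepEnergy stepRate
  push_cast
  exact h3

theorem rpow_algebra {α γ d p : ℝ} (hα : 0 < α) (hα1 : α < 1)
    (hscale : (p - d) * γ - 2 * α = -(d * (1 - α))) {c0 X T κ : ℝ} (hc0 : 0 < c0)
    (hX : 0 < X) (hT : 0 < T) (hκ : 0 < κ) {k : ℝ} (hk : 0 < k) :
    ((c0 * (X * T ^ ((p - d) / 2)) ^ γ) ^ (-(1 / α)) * k * (κ * T)) ^ (-(α / (1 - α))) =
      (c0 ^ (1 / (1 - α)) * k ^ (-(α / (1 - α)))) *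
        (X ^ (γ / (1 - α)) * κ ^ (-(α / (1 - α)))) * T ^ (-(d / 2)) := by
  have h1α : 0 < 1 - α := by linarith
  rw [Real.mul_rpow (by positivity) (by positivity), Real.mul_rpow (by positivity) (by positivity),
    Real.mul_rpow hκ.le hT.le, ← Real.rpow_mul (by positivity)]
  have e1 : -(1 / α) * -(α / (1 - α)) = 1 / (1 - α) := by field_simp
  rw [e1, Real.mul_rpow hc0.le (by positivity), Real.mul_rpow hX.le (by positivity),
    Real.mul_rpow (by positivity) (by positivity), ← Real.rpow_mul hX.le, ← Real.rpow_mul hT.le,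
    ← Real.rpow_mul hT.le]
  have e2 : γ * (1 / (1 - α)) = γ / (1 - α) := by ring
  have e3 : T ^ ((p - d) / 2 * γ * (1 / (1 - α))) * T ^ (-(α / (1 - α))) = T ^ (-(d / 2)) := by
    rw [← Real.rpow_add hT]
    congr 1
    field_simp
    linarith
  rw [e2, ← e3]
  ring

set_option maxHeartbeats 800000 in
/-- Decay of the averaged energy at an integer time, given the decay up to that time. -/
theorem exists_stepEnergy_le (d : ℕ) (hd : 2 ≤ d) {p p' δ : ℝ} (hp : (d : ℝ) < p)
    (hp' : (d : ℝ) < p') (hδ : IsAdmissibleDelta p δ) :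
    ∃ C : ℝ, 1 ≤ C ∧ ∀ (L : ℕ), 1 ≤ L → ∀ (a : ℝ → Edge d L → ℝ)
      (u : ℝ → Torus d L → ℝ), IsFlow a u → (∀ x, u 0 x = pointMass d L x) → scrM1 p δ a ≠ ∞ →
      scrM2 p a ≠ ∞ → scrM3 p p' δ a ≠ ∞ → ∀ N : ℕ, 1 ≤ N → ∀ Λ : ℝ, 1 ≤ Λ →
      (∀ s ∈ Icc 0 (N : ℝ), ∑ x, u s x ^ 2 ≤ Λ * (1 + s) ^ (-(d / 2 : ℝ))) →
      stepEnergy p δ u N ≤ C * (((scrM1 p δ a + scrM2 p a).toReal * Λ) ^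
        (gammaExp d p p' / (1 - alphaExp d p p')) *
        (minRate p p' δ a).toReal ^ (-(alphaExp d p p' / (1 - alphaExp d p p')))) *
        (1 + (N : ℝ)) ^ (-(d / 2 : ℝ)) := by
  have hd2 : (2 : ℝ) ≤ d := by exact_mod_cast hd
  have hp0 : 0 < p := by linarith
  have hα := alphaExp_pos hd hp hp'
  have hβ := betaExp_pos hd hp hp'
  have hγ := gammaExp_pos hd hp hp'
  have habc := exponents_add hd hp hp'
  have hsc := exponents_scaling hd hp hp'
  obtain ⟨Cn, hCn1, hCnt, hCn⟩ := exists_bar_nash d hd hp hp' hδ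
  obtain ⟨C6, hC61, hC6t, hC6⟩ := exists_bar_moment_le_of_decay d hd hp hδ
  set α := alphaExp d p p' with hαdef
  set β := betaExp d p p'
  set γ := gammaExp d p p' with hγdef
  have hα1 : α < 1 := by linarith
  have h1α : 0 < 1 - α := by linarith
  have hscale : (p - d) * γ - 2 * α = -(d * (1 - α)) := by
    linear_combination hsc - (d : ℝ) * habc
  set h := (1 - α) / α with hh
  have hh0 : 0 < h := by positivity
  have hh1 : 1 + h = 1 / α := by rw [hh]; field_simp; ring
  have hhinv : -(1 / h) = -(α / (1 - α)) := by rw [hh, one_div_div]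
  set c0 : ℝ := 2 * Cn.toReal * C6.toReal ^ γ with hc0
  have hCnr : 1 ≤ Cn.toReal := by
    have := ENNReal.toReal_mono hCnt hCn1; simpa using this
  have hC6r : 1 ≤ C6.toReal := by
    have := ENNReal.toReal_mono hC6t hC61; simpa using this
  have hC6γ : 1 ≤ C6.toReal ^ γ := Real.one_le_rpow hC6r hγ.le
  have hc01 : 2 ≤ c0 := by nlinarith
  set k : ℝ := h / (2 + h) / 2 with hk
  have hk0 : 0 < k := by positivity
  set C7 : ℝ := c0 ^ (1 / (1 - α)) * k ^ (-(α / (1 - α))) with hC7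
  have hC70 : 0 < C7 := by positivity
  refine ⟨2 * Cn.toReal + C7, by linarith, ?_⟩
  intro L hL a u hf hu0 hM1 hM2 hM3 N hN Λ hΛ hdec
  obtain ⟨η, hη, hB⟩ := hC6 L hL a u hf hu0 hM1 hM2 N Λ hΛ hdec
  have hsum0 : ∑ x, u 0 x = 0 := by simp only [hu0, sum_pointMass]
  have habs0 : ∑ x, |u 0 x| ≤ 2 := by simp only [hu0]; exact sum_abs_pointMass_le
  set κ := (minRate p p' δ a).toReal with hκ
  have hκ0 : 0 < κ := minRate_pos hα hγ hM3
  have hκ1 : κ ≤ 1 := minRate_toReal_le_one hα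
  set S := (scrM1 p δ a + scrM2 p a).toReal with hS
  have hSt : scrM1 p δ a + scrM2 p a ≠ ∞ := ENNReal.add_ne_top.2 ⟨hM1, hM2⟩
  have hS1 : 1 ≤ S := by
    have := ENNReal.toReal_mono hSt ((one_le_scrM2 (p := p) (a := a) (by linarith)).trans le_add_self)
    simpa using this
  have hNr : (1 : ℝ) ≤ N := by exact_mod_cast hN
  set T := 1 + (N : ℝ) with hT
  have hT1 : 1 ≤ T := by linarith
  have hX1 : 1 ≤ S * Λ := one_le_mul_of_one_le_of_one_le hS1 hΛ
  have hF1 : 1 ≤ (S * Λ) ^ (γ / (1 - α)) * κ ^ (-(α / (1 - α))) := by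
    refine one_le_mul_of_one_le_of_one_le (Real.one_le_rpow hX1 (by positivity)) ?_
    exact Real.one_le_rpow_of_pos_of_le_one_of_nonpos hκ0 hκ1 (by
      have : 0 < α / (1 - α) := by positivity
      linarith)
  set F := (S * Λ) ^ (γ / (1 - α)) * κ ^ (-(α / (1 - α))) with hF
  have hTd : 0 < T ^ (-(d / 2 : ℝ)) := by positivity
  set e := stepEnergy p δ u with he
  have hanti : Antitone e := hf.stepEnergy_antitone hp0 hδ
  rcases le_or_gt (e N) (2 * Cn.toReal * T ^ (-(d / 2 : ℝ))) with hsmall | hbig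
  · refine hsmall.trans (mul_le_mul_of_nonneg_right ?_ hTd.le)
    calc 2 * Cn.toReal ≤ (2 * Cn.toReal + C7) * 1 := by linarith
      _ ≤ _ := mul_le_mul_of_nonneg_left hF1 (by positivity)
  -- the bound for the averaged weighted norm
  set B : ℝ≥0∞ := C6 * ((scrM1 p δ a + scrM2 p a) * ENNReal.ofReal (Λ * T ^ ((p - d) / 2))) with hBdef
  have hP1 : 1 ≤ T ^ ((p - d) / 2) := Real.one_le_rpow hT1 (by linarith)
  have hBt : B ≠ ∞ := ENNReal.mul_ne_top hC6t (ENNReal.mul_ne_top hSt ENNReal.ofReal_ne_top)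
  have hBr : B.toReal = C6.toReal * (S * Λ * T ^ ((p - d) / 2)) := by
    rw [hBdef, ENNReal.toReal_mul, ENNReal.toReal_mul, ENNReal.toReal_ofReal (by positivity)]
    ring
  have hBr1 : 1 ≤ B.toReal := by
    rw [hBr]
    exact one_le_mul_of_one_le_of_one_le hC6r (one_le_mul_of_one_le_of_one_le hX1 hP1)
  have hB0 : B ≠ 0 := by
    intro h0
    rw [h0] at hBr1
    norm_num at hBr1
  set c : ℝ≥0∞ := 2 * Cn * B ^ γ with hc
  have hct : c ≠ ∞ := ENNReal.mul_ne_top (ENNReal.mul_ne_top (by norm_num) hCnt)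
    (ENNReal.rpow_ne_top_of_nonneg hγ.le hBt)
  have hCn0 : Cn ≠ 0 := (one_pos.trans_le hCn1).ne'
  have hc0' : c ≠ 0 := by
    refine mul_ne_zero (mul_ne_zero (by norm_num) hCn0) ?_
    rw [Ne, ENNReal.rpow_eq_zero_iff_of_pos hγ]
    exact hB0
  have hcr : c.toReal = c0 * (S * Λ * T ^ ((p - d) / 2)) ^ γ := by
    rw [hc, ENNReal.toReal_mul, ENNReal.toReal_mul, ← ENNReal.toReal_rpow, hBr,
      Real.mul_rpow (by positivity) (by positivity), hc0]
    simp
    ring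
  have hcr1 : 1 ≤ c.toReal := by
    rw [hcr]
    exact one_le_mul_of_one_le_of_one_le (by linarith)
      (Real.one_le_rpow (one_le_mul_of_one_le_of_one_le hX1 hP1) hγ.le)
  have hineq : ∀ t ∈ Icc 0 (N : ℝ), calM3 p p' δ a t ≠ ∞ → bar p δ (moment 0 u) t ≤
      c * (calM3 p p' δ a t * bar p δ (dissip 0 a u) t ^ α) := by
    intro t ht hM3t
    have h1 := hCn L hL a u hf hsum0 habs0 η t ht.1 hM3t
    have h2 : bar p δ (moment p fun t x => u t x + η) t ^ γ ≤ B ^ γ :=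
      ENNReal.rpow_le_rpow (hB t ht) hγ.le
    set Et := bar p δ (moment 0 u) t with hEt
    have hEtt : Et ≠ ∞ := hf.bar_moment_zero_ne_top hp0 hδ ht.1
    set R := ENNReal.ofReal (Fintype.card (Torus d L) * η ^ 2)
    have h3 : 2 * (Cn * R) ≤ Et := by
      have h4 : e N ≤ Et.toReal := ENNReal.toReal_mono hEtt
        (hf.bar_moment_zero_antitone ht.1 ht.2)
      have h5 : (2 * (Cn * R)).toReal ≤ Et.toReal := by
        rw [ENNReal.toReal_mul, ENNReal.toReal_mul, ENNReal.toReal_ofReal (by positivity)]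
        simp only [ENNReal.toReal_ofNat]
        have h6 := mul_le_mul_of_nonneg_left hη (by linarith : 0 ≤ 2 * Cn.toReal)
        linarith
      exact (ENNReal.toReal_le_toReal (ENNReal.mul_ne_top (by norm_num)
        (ENNReal.mul_ne_top hCnt ENNReal.ofReal_ne_top)) hEtt).1 h5
    set Y := calM3 p p' δ a t * bar p δ (dissip 0 a u) t ^ α with hY
    have h7 : Et ≤ Cn * (Y * B ^ γ) + Cn * R := h1.trans (add_le_add (mul_le_mul' le_rfl
      (mul_le_mul' le_rfl h2)) le_rfl)
    have h8 : Et + Et ≤ 2 * (Cn * (Y * B ^ γ)) + Et := by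
      calc Et + Et = 2 * Et := (two_mul _).symm
        _ ≤ 2 * (Cn * (Y * B ^ γ) + Cn * R) := mul_le_mul' le_rfl h7
        _ = 2 * (Cn * (Y * B ^ γ)) + 2 * (Cn * R) := by ring
        _ ≤ _ := add_le_add le_rfl h3
    have h9 := (ENNReal.add_le_add_iff_right hEtt).1 h8
    refine h9.trans_eq ?_
    rw [hc]
    ring
  set b := c.toReal ^ (-(1 / α)) with hb
  have hb0 : 0 < b := by positivity
  have hb1 : b ≤ 1 := Real.rpow_le_one_of_one_le_of_nonpos hcr1 (by
    have : 0 < 1 / α := by positivity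
    linarith)
  have hpos : ∀ n ≤ N, 0 < e n := fun n hn => by
    have h1 := hanti hn
    have h2 : 0 < 2 * Cn.toReal * T ^ (-(d / 2 : ℝ)) := by positivity
    linarith
  have hle1 : ∀ n ≤ N, e n ≤ 1 := fun n _ => by
    refine (hf.stepEnergy_le hp0 hδ n).trans ((hf.sum_sq_antitone le_rfl (Nat.cast_nonneg n)).trans ?_)
    simp only [hu0]
    exact sum_sq_pointMass_le
  have hrec : ∀ n < N, e (n + 1) + b * e (n + 1) ^ (1 + h) * stepRate p p' δ a n ≤ e n := by
    intro n hn
    have hnN : (n : ℝ) + 1 ≤ N := by exact_mod_cast hn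
    have h1 := hf.stepEnergy_step hp0 hδ hα n hc0' hct (p' := p') fun t ht => hineq t
      ⟨(Nat.cast_nonneg n).trans ht.1.le, ht.2.trans hnN⟩
    rw [← hαdef, Real.div_rpow (hpos _ (by omega)).le (by linarith), ← hh1] at h1
    rw [hb, ← hh1, Real.rpow_neg (by linarith)]
    refine le_trans (le_of_eq ?_) h1
    rw [div_eq_mul_inv]
    ring
  have hfin := rpow_neg_ge_of_recursion hb0 hb1 hh0 hpos hle1 (fun n => stepRate_nonneg n)
    (fun n => stepRate_le_one hα n) hrec
  have hQ : b * k * (κ * T) ≤ e N ^ (-h) := by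
    refine le_trans ?_ hfin
    have h1 := minRate_mul_le_sum (p := p) (p' := p') (δ := δ) (a := a) hα N
    rw [← hκ] at h1
    have h2 : κ * T / 2 ≤ κ * N := by rw [hT]; nlinarith
    calc b * k * (κ * T) = b * (h / (2 + h)) * (κ * T / 2) := by rw [hk]; ring
      _ ≤ _ := mul_le_mul_of_nonneg_left (h2.trans h1) (by positivity)
  have hlast := Real.rpow_le_rpow_of_nonpos (by positivity) hQ
    (by have : 0 < 1 / h := by positivity
        linarith : -(1 / h) ≤ 0)
  rw [← Real.rpow_mul (hpos N le_rfl).le, neg_mul_neg, mul_one_div_cancel hh0.ne', Real.rpow_one,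
    hhinv, hb, hcr, rpow_algebra hα hα1 hscale (by linarith) (by linarith)
      (by linarith) hκ0 hk0] at hlast
  refine hlast.trans (mul_le_mul_of_nonneg_right (mul_le_mul_of_nonneg_right ?_ (by positivity))
    hTd.le)
  linarith

end Decay

end GradPhi

namespace GradPhi

section MainEstimate

variable {d L : ℕ} {p p' δ : ℝ} {a : ℝ → Edge d L → ℝ} {u : ℝ → Torus d L → ℝ}

theorem one_le_scrM3 (hα : 0 < alphaExp d p p') (hγ : 0 < gammaExp d p p') :
    1 ≤ scrM3 p p' δ a := by
  rw [scrM3_eq, ENNReal.rpow_neg]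
  exact ENNReal.one_le_inv.2 (ENNReal.rpow_le_one (minRate_le_one hα) (by positivity))

theorem scrM_factors_ne_top (hα : 0 < alphaExp d p p') (hγ : 0 < gammaExp d p p')
    (hαγ : alphaExp d p p' + gammaExp d p p' < 1) (hp : 1 < p) (h : scrM p p' δ a ≠ ∞) :
    scrM1 p δ a ≠ ∞ ∧ scrM2 p a ≠ ∞ ∧ scrM3 p p' δ a ≠ ∞ := by
  have hexp : 0 < gammaExp d p p' / (1 - alphaExp d p p' - gammaExp d p p') :=
    div_pos hγ (by linarith)
  have h1 : (scrM1 p δ a + scrM2 p a) * scrM3 p p' δ a ≠ ∞ := by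
    intro htop
    apply h
    unfold scrM
    rw [htop, ENNReal.top_rpow_of_pos hexp]
  have h30 : scrM3 p p' δ a ≠ 0 := (one_pos.trans_le (one_le_scrM3 hα hγ)).ne'
  have h120 : scrM1 p δ a + scrM2 p a ≠ 0 :=
    (one_pos.trans_le ((one_le_scrM2 hp).trans le_add_self)).ne'
  have h12 : scrM1 p δ a + scrM2 p a ≠ ∞ := by
    intro htop
    exact h1 (by rw [htop, ENNReal.top_mul h30])
  have h3 : scrM3 p p' δ a ≠ ∞ := by
    intro htop
    exact h1 (by rw [htop, ENNReal.mul_top h120])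
  exact ⟨(ENNReal.add_ne_top.1 h12).1, (ENNReal.add_ne_top.1 h12).2, h3⟩

theorem scrM_toReal (hα : 0 < alphaExp d p p') (hγ : 0 < gammaExp d p p')
    (hαγ : alphaExp d p p' + gammaExp d p p' < 1) :
    (scrM p p' δ a).toReal = ((scrM1 p δ a + scrM2 p a).toReal ^
        (gammaExp d p p' / (1 - alphaExp d p p')) *
      (minRate p p' δ a).toReal ^ (-(alphaExp d p p' / (1 - alphaExp d p p')))) ^
        (1 / (1 - gammaExp d p p' / (1 - alphaExp d p p'))) := by
  unfold scrM
  set α := alphaExp d p p'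
  set γ := gammaExp d p p'
  have h1 : 0 < 1 - α := by linarith
  have h2 : 0 < 1 - α - γ := by linarith
  rw [← ENNReal.toReal_rpow, ENNReal.toReal_mul, scrM3_eq, ← ENNReal.toReal_rpow]
  have hS : 0 ≤ (scrM1 p δ a + scrM2 p a).toReal := ENNReal.toReal_nonneg
  have hκ : 0 ≤ (minRate p p' δ a).toReal := ENNReal.toReal_nonneg
  rw [Real.mul_rpow hS (Real.rpow_nonneg hκ _), Real.mul_rpow (Real.rpow_nonneg hS _)
    (Real.rpow_nonneg hκ _), ← Real.rpow_mul hS, ← Real.rpow_mul hκ, ← Real.rpow_mul hκ]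
  have e0 : 1 - γ / (1 - α) = (1 - α - γ) / (1 - α) := by field_simp
  congr 2
  · rw [e0]; field_simp
  · rw [e0]
    change -(α / γ) * (γ / (1 - α - γ)) = -(α / (1 - α)) * (1 / ((1 - α - γ) / (1 - α)))
    field_simp

theorem one_le_scrM_toReal (hα : 0 < alphaExp d p p') (hγ : 0 < gammaExp d p p')
    (hαγ : alphaExp d p p' + gammaExp d p p' < 1) (hp : 1 < p) (h : scrM p p' δ a ≠ ∞) :
    1 ≤ (scrM p p' δ a).toReal := by
  have h1 : 1 ≤ scrM p p' δ a := by
    unfold scrM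
    refine ENNReal.one_le_rpow (one_le_mul ((one_le_scrM2 hp).trans le_add_self)
      (one_le_scrM3 hα hγ)) (div_pos hγ (by linarith))
  have := ENNReal.toReal_mono h h1
  simpa using this

/-- Decay of the energy at the heat-kernel rate. -/
theorem exists_sum_sq_le (d : ℕ) (hd : 2 ≤ d) {p p' δ : ℝ} (hp : (d : ℝ) < p)
    (hp' : (d : ℝ) < p') (hδ : IsAdmissibleDelta p δ) :
    ∃ C : ℝ, 1 ≤ C ∧ ∀ (L : ℕ), 1 ≤ L → ∀ (a : ℝ → Edge d L → ℝ)
      (u : ℝ → Torus d L → ℝ), IsFlow a u → (∀ x, u 0 x = pointMass d L x) →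
      scrM p p' δ a ≠ ∞ → ∀ t : ℝ, 0 ≤ t →
      ∑ x, u t x ^ 2 ≤ C * (scrM p p' δ a).toReal * (1 + t) ^ (-(d / 2 : ℝ)) := by
  have hd2 : (2 : ℝ) ≤ d := by exact_mod_cast hd
  have hp0 : 0 < p := by linarith
  have hα := alphaExp_pos hd hp hp'
  have hβ := betaExp_pos hd hp hp'
  have hγ := gammaExp_pos hd hp hp'
  have habc := exponents_add hd hp hp'
  have hαγ : alphaExp d p p' + gammaExp d p p' < 1 := by linarith
  obtain ⟨C0, hC01, hC0⟩ := exists_stepEnergy_le d hd hp hp' hδ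
  set g := gammaExp d p p' / (1 - alphaExp d p p') with hg
  have h1α : 0 < 1 - alphaExp d p p' := by linarith
  have hg0 : 0 < g := by positivity
  have hg1 : g < 1 := by rw [hg, div_lt_one h1α]; linarith
  have hδ' : 0 < δ / 2 ^ (p + 3) := div_pos hδ.1 (by positivity)
  set Cδ := (δ / 2 ^ (p + 3))⁻¹ with hCδ
  have hCδ0 : 0 < Cδ := by positivity
  set C1 : ℝ := 3 ^ (d / 2 : ℝ) * (1 + Cδ * C0) with hC1
  have h3d : (1 : ℝ) ≤ 3 ^ (d / 2 : ℝ) := Real.one_le_rpow (by norm_num) (by positivity)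
  have hC11 : 1 ≤ C1 := one_le_mul_of_one_le_of_one_le h3d (by nlinarith)
  have hexp : 0 < 1 / (1 - g) := by
    have : 0 < 1 - g := by linarith
    positivity
  refine ⟨C1 ^ (1 / (1 - g)), Real.one_le_rpow hC11 hexp.le, ?_⟩
  intro L hL a u hf hu0 hM t ht
  obtain ⟨hM1, hM2, hM3⟩ := scrM_factors_ne_top hα hγ hαγ (by linarith) hM
  set κ := (minRate p p' δ a).toReal with hκ
  have hκ0 : 0 < κ := minRate_pos hα hγ hM3
  have hκ1 : κ ≤ 1 := minRate_toReal_le_one hα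
  set S := (scrM1 p δ a + scrM2 p a).toReal with hS
  have hS1 : 1 ≤ S := by
    have := ENNReal.toReal_mono (ENNReal.add_ne_top.2 ⟨hM1, hM2⟩)
      ((one_le_scrM2 (p := p) (a := a) (by linarith)).trans le_add_self)
    simpa using this
  set F := S ^ g * κ ^ (-(alphaExp d p p' / (1 - alphaExp d p p'))) with hF
  have hF1 : 1 ≤ F := by
    refine one_le_mul_of_one_le_of_one_le (Real.one_le_rpow hS1 hg0.le) ?_
    exact Real.one_le_rpow_of_pos_of_le_one_of_nonpos hκ0 hκ1 (by
      have : 0 < alphaExp d p p' / (1 - alphaExp d p p') := by positivity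
      linarith)
  set φ : ℝ → ℝ := fun s => (∑ x, u s x ^ 2) * (1 + s) ^ (d / 2 : ℝ) with hφ
  have hE1 : ∀ s, 0 ≤ s → ∑ x, u s x ^ 2 ≤ 1 := fun s hs => by
    refine (hf.sum_sq_antitone le_rfl hs).trans ?_
    simp only [hu0]
    exact sum_sq_pointMass_le
  have hφc : ContinuousOn φ (Icc 0 t) := by
    refine ContinuousOn.mul (continuous_finsetSum _ fun x _ => (hf.continuous x).pow 2).continuousOn ?_
    exact (continuous_const.add continuous_id).continuousOn.rpow_const fun s hs =>
      Or.inr (by positivity)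
  obtain ⟨s0, hs0, hmax⟩ := isCompact_Icc.exists_isMaxOn (nonempty_Icc.2 ht) hφc
  set Λ := max 1 (φ s0) with hΛ
  have hΛ1 : 1 ≤ Λ := le_max_left _ _
  have hΛ0 : 0 < Λ := by linarith
  have hΛg : 1 ≤ Λ ^ g := Real.one_le_rpow hΛ1 hg0.le
  have hdec : ∀ s ∈ Icc 0 t, ∑ x, u s x ^ 2 ≤ Λ * (1 + s) ^ (-(d / 2 : ℝ)) := by
    intro s hs
    have h1 : φ s ≤ Λ := (hmax hs).trans (le_max_right _ _)
    have h2 : 0 < (1 + s) ^ (d / 2 : ℝ) := Real.rpow_pos_of_pos (by linarith [hs.1]) _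
    rw [Real.rpow_neg (by linarith [hs.1]), ← div_eq_mul_inv, le_div_iff₀ h2]
    exact h1
  have hΛle : Λ ≤ C1 * F * Λ ^ g := by
    have hCF : 1 ≤ C1 * F * Λ ^ g :=
      one_le_mul_of_one_le_of_one_le (one_le_mul_of_one_le_of_one_le hC11 hF1) hΛg
    refine max_le hCF ?_
    rcases lt_or_ge s0 2 with h2 | h2
    · calc φ s0 ≤ 1 * 3 ^ (d / 2 : ℝ) := by
            refine mul_le_mul (hE1 s0 hs0.1) (Real.rpow_le_rpow (by linarith [hs0.1])
              (by linarith) (by positivity)) (Real.rpow_nonneg (by linarith [hs0.1]) _) zero_le_one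
        _ ≤ C1 * F * Λ ^ g := by
            rw [one_mul]
            calc (3 : ℝ) ^ (d / 2 : ℝ) ≤ C1 := by
                  rw [hC1]; exact le_mul_of_one_le_right (by linarith) (by nlinarith)
              _ = C1 * 1 * 1 := by ring
              _ ≤ _ := mul_le_mul (mul_le_mul_of_nonneg_left hF1 (by linarith)) hΛg zero_le_one
                  (mul_nonneg (by linarith) (by linarith))
    · obtain ⟨N, hN⟩ : ∃ N : ℕ, ⌊s0⌋₊ = N + 1 := by
        have h3 : 2 ≤ ⌊s0⌋₊ := Nat.le_floor (by exact_mod_cast h2)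
        exact ⟨⌊s0⌋₊ - 1, by omega⟩
      have hN1 : 1 ≤ N := by
        have h3 : 2 ≤ ⌊s0⌋₊ := Nat.le_floor (by exact_mod_cast h2)
        omega
      have hfl : ((N : ℝ) + 1) ≤ s0 := by
        have := Nat.floor_le hs0.1
        rw [hN] at this
        exact_mod_cast this
      have hfl2 : s0 < (N : ℝ) + 2 := by
        have := Nat.lt_floor_add_one s0
        rw [hN] at this
        push_cast at this
        linarith
      have h4 := hC0 L hL a u hf hu0 hM1 hM2 hM3 N hN1 Λ hΛ1 fun s hs =>
        hdec s ⟨hs.1, hs.2.trans (by linarith [hs0.2])⟩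
      have h5 := (hf.sum_sq_antitone (by positivity) hfl).trans (hf.sum_sq_le_stepEnergy hp0 hδ N)
      have hN1r : (1 : ℝ) ≤ N := by exact_mod_cast hN1
      have e1 : (S * Λ) ^ g = S ^ g * Λ ^ g := Real.mul_rpow (by linarith) hΛ0.le
      rw [e1] at h4
      have h6 : (1 + s0) ^ (d / 2 : ℝ) ≤ 3 ^ (d / 2 : ℝ) * (1 + (N : ℝ)) ^ (d / 2 : ℝ) := by
        rw [← Real.mul_rpow (by norm_num) (by positivity)]
        exact Real.rpow_le_rpow (by linarith [hs0.1]) (by linarith) (by positivity)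
      have hTpos : 0 < (1 + (N : ℝ)) ^ (d / 2 : ℝ) := by positivity
      rw [Real.rpow_neg (by positivity : (0 : ℝ) ≤ 1 + (N : ℝ))] at h4
      calc φ s0 ≤ (Cδ * (C0 * (S ^ g * Λ ^ g * κ ^ (-(alphaExp d p p' / (1 - alphaExp d p p')))) *
              ((1 + (N : ℝ)) ^ (d / 2 : ℝ))⁻¹)) * (3 ^ (d / 2 : ℝ) * (1 + (N : ℝ)) ^ (d / 2 : ℝ)) :=
            mul_le_mul (h5.trans (mul_le_mul_of_nonneg_left h4 hCδ0.le)) h6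
              (Real.rpow_nonneg (by linarith [hs0.1]) _) (by positivity)
        _ = 3 ^ (d / 2 : ℝ) * (Cδ * C0) * F * Λ ^ g := by rw [hF]; field_simp
        _ ≤ C1 * F * Λ ^ g := by
            refine mul_le_mul_of_nonneg_right (mul_le_mul_of_nonneg_right ?_ (by linarith))
              (by linarith)
            rw [hC1]
            exact mul_le_mul_of_nonneg_left (by linarith) (by linarith)
  have hΛfin := le_rpow_of_le_mul_rpow hΛ0 hg1 hΛle
  rw [Real.mul_rpow (by linarith) (by linarith)] at hΛfin
  rw [scrM_toReal hα hγ hαγ]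
  exact (hdec t ⟨ht, le_rfl⟩).trans (mul_le_mul_of_nonneg_right hΛfin
    (Real.rpow_nonneg (by linarith) _))

/-- Exponential decay of the averaged energy on the diffusive time scale. -/
theorem exists_stepEnergy_exp_le (d : ℕ) (hd : 2 ≤ d) {p p' δ : ℝ} (hp : (d : ℝ) < p)
    (hp' : (d : ℝ) < p') (hδ : IsAdmissibleDelta p δ) :
    ∃ c : ℝ, 0 < c ∧ ∀ (L : ℕ), 1 ≤ L → ∀ (a : ℝ → Edge d L → ℝ)
      (u : ℝ → Torus d L → ℝ), IsFlow a u → (∀ x, u 0 x = pointMass d L x) →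
      ∀ k N : ℕ, k ≤ N → stepEnergy p δ u (N + 1) ≤ stepEnergy p δ u k *
        Real.exp (-(c / (L : ℝ) ^ 2 * ∑ n ∈ Finset.Ioc k N, stepRate p p' δ a n)) := by
  have hd2 : (2 : ℝ) ≤ d := by exact_mod_cast hd
  have hp0 : 0 < p := by linarith
  have hα := alphaExp_pos hd hp hp'
  have hβ := betaExp_pos hd hp hp'
  have hγ := gammaExp_pos hd hp hp'
  have habc := exponents_add hd hp hp'
  obtain ⟨Cp, hCp1, hCpt, hCp⟩ := exists_bar_poincare d hd hp hp' hδ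
  set α := alphaExp d p p' with hαdef
  have h1α : 0 < 1 - α := by linarith
  set h := (1 - α) / α with hh
  have hh0 : 0 < h := by positivity
  have hh1 : 1 / α = 1 + h := by rw [hh]; field_simp; ring
  have hδ' : 0 < δ / 2 ^ (p + 3) := div_pos hδ.1 (by positivity)
  set Cδ := (δ / 2 ^ (p + 3))⁻¹ + 1 with hCδ
  have hCδ1 : 1 ≤ Cδ := by
    have : 0 < (δ / 2 ^ (p + 3))⁻¹ := by positivity
    linarith
  have hCpr : 1 ≤ Cp.toReal := by
    have := ENNReal.toReal_mono hCpt hCp1; simpa using this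
  set c2 : ℝ := (Cp.toReal ^ (1 / α) * Cδ ^ h)⁻¹ with hc2
  have hc20 : 0 < c2 := by positivity
  have hc21 : c2 ≤ 1 := inv_le_one_of_one_le₀ (one_le_mul_of_one_le_of_one_le
    (Real.one_le_rpow hCpr (by positivity)) (Real.one_le_rpow hCδ1 hh0.le))
  refine ⟨(2 : ℝ) ^ (-h) / 4 * c2, by positivity, ?_⟩
  intro L hL a u hf hu0 k N hkN
  have hL1 : (1 : ℝ) ≤ L := by exact_mod_cast hL
  have hsum0 : ∑ x, u 0 x = 0 := by simp only [hu0, sum_pointMass]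
  set e := stepEnergy p δ u with he
  have hanti : Antitone e := hf.stepEnergy_antitone hp0 hδ
  have he0 : ∀ n, 0 ≤ e n := fun n => ENNReal.toReal_nonneg
  set x : ℕ → ℝ := fun n => c2 / (L : ℝ) ^ 2 * stepRate p p' δ a n with hx
  have hcL : c2 / (L : ℝ) ^ 2 ≤ 1 := by
    rw [div_le_one (by positivity)]
    nlinarith
  have hmain := le_exp_of_delayed_recursion (x := x) hh0 hanti he0
    (fun n => mul_nonneg (by positivity) (stepRate_nonneg n))
    (fun n => mul_le_one₀ hcL (stepRate_nonneg n) (stepRate_le_one hα n)) (fun n hn => ?_) hkN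
  · refine hmain.trans_eq ?_
    rw [hx, ← Finset.mul_sum]
    congr 2
    ring
  -- the one-step inequality
  have hen : 0 < e n := hn.trans_le (hanti (by omega))
  set c : ℝ≥0∞ := Cp * ((L : ℝ≥0∞) ^ 2) ^ α * ENNReal.ofReal (Cδ * e n) ^ (1 - α) with hc
  have hct : c ≠ ∞ := ENNReal.mul_ne_top (ENNReal.mul_ne_top hCpt
    (ENNReal.rpow_ne_top_of_nonneg hα.le (ENNReal.pow_ne_top (ENNReal.natCast_ne_top L))))
    (ENNReal.rpow_ne_top_of_nonneg h1α.le ENNReal.ofReal_ne_top)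
  have hcr : c.toReal = Cp.toReal * ((L : ℝ) ^ 2) ^ α * (Cδ * e n) ^ (1 - α) := by
    rw [hc, ENNReal.toReal_mul, ENNReal.toReal_mul, ← ENNReal.toReal_rpow, ← ENNReal.toReal_rpow,
      ENNReal.toReal_ofReal (by positivity), ENNReal.toReal_pow, ENNReal.toReal_natCast]
  have hcr0 : 0 < c.toReal := by rw [hcr]; positivity
  have hc0 : c ≠ 0 := by
    intro h0
    rw [h0] at hcr0
    simp at hcr0
  have hstep := hf.stepEnergy_step hp0 hδ hα (n + 1) hc0 hct (p' := p') fun t ht hM3t => by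
    have ht0 : 0 ≤ t := le_trans (by positivity) ht.1.le
    have h1 := hCp L hL a u hf hsum0 t ht0 hM3t
    have h2 : moment 0 u t ≤ ENNReal.ofReal (Cδ * e n) := by
      rw [moment_zero_eq]
      refine ENNReal.ofReal_le_ofReal ?_
      have h3 := ht.1.le
      push_cast at h3
      refine ((hf.sum_sq_antitone (by positivity) h3).trans
        (hf.sum_sq_le_stepEnergy hp0 hδ n)).trans ?_
      exact mul_le_mul_of_nonneg_right (by linarith) (he0 n)
    refine h1.trans ?_
    rw [hc, ENNReal.mul_rpow_of_nonneg _ _ hα.le]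
    calc _ ≤ Cp * (calM3 p p' δ a t * (((L : ℝ≥0∞) ^ 2) ^ α *
          bar p δ (dissip 0 a u) t ^ α) * ENNReal.ofReal (Cδ * e n) ^ (1 - α)) :=
          mul_le_mul' le_rfl (mul_le_mul' le_rfl (ENNReal.rpow_le_rpow h2 h1α.le))
      _ = _ := by ring
  refine le_trans (le_of_eq ?_) hstep
  change e (n + 2) * (1 + x (n + 1) * (e (n + 2) / e n) ^ h) =
    e (n + 2) + (e (n + 2) / c.toReal) ^ (1 / α) * stepRate p p' δ a (n + 1)
  have key : (e (n + 2) / c.toReal) ^ (1 / α) =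
      e (n + 2) * (c2 / (L : ℝ) ^ 2 * (e (n + 2) / e n) ^ h) := by
    have k1 : c.toReal ^ (1 / α) = Cp.toReal ^ (1 / α) * (L : ℝ) ^ 2 * (Cδ ^ h * e n ^ h) := by
      rw [hcr, Real.mul_rpow (by positivity) (by positivity), Real.mul_rpow (by positivity)
        (by positivity), ← Real.rpow_mul (by positivity), ← Real.rpow_mul (by positivity),
        mul_one_div_cancel hα.ne', Real.rpow_one, mul_one_div, ← hh,
        Real.mul_rpow (by linarith) hen.le]
    rw [Real.div_rpow hn.le hcr0.le, k1, hh1, Real.rpow_add hn, Real.rpow_one,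
      Real.div_rpow hn.le hen.le, hc2, hh1]
    have : 0 < e n ^ h := Real.rpow_pos_of_pos hen _
    have : 0 < Cδ ^ h := by positivity
    have : 0 < Cp.toReal ^ (1 + h) := by positivity
    field_simp
  rw [key, hx]
  ring

set_option maxHeartbeats 1600000 in
/-- The energy upper bound for a flow, with the exponential cut-off. -/
theorem exists_sum_sq_exp_le (d : ℕ) (hd : 2 ≤ d) {p p' δ : ℝ} (hp : (d : ℝ) < p)
    (hp' : (d : ℝ) < p') (hδ : IsAdmissibleDelta p δ) :
    ∃ C : ℝ, 1 ≤ C ∧ ∀ (L : ℕ), 1 ≤ L → ∀ (a : ℝ → Edge d L → ℝ)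
      (u : ℝ → Torus d L → ℝ), IsFlow a u → (∀ x, u 0 x = pointMass d L x) →
      scrM p p' δ a ≠ ∞ → ∀ t : ℝ, 0 ≤ t →
      ∑ x, u t x ^ 2 ≤ C * (scrM p p' δ a).toReal * (1 + t) ^ (-(d / 2 : ℝ)) *
        Real.exp (-(t * (minRate p p' δ a).toReal ^ 2 / (C * (L : ℝ) ^ 2))) := by
  have hd2 : (2 : ℝ) ≤ d := by exact_mod_cast hd
  have hp0 : 0 < p := by linarith
  have hα := alphaExp_pos hd hp hp'
  have hβ := betaExp_pos hd hp hp'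
  have hγ := gammaExp_pos hd hp hp'
  have habc := exponents_add hd hp hp'
  have hαγ : alphaExp d p p' + gammaExp d p p' < 1 := by linarith
  obtain ⟨C1, hC11, hC1⟩ := exists_sum_sq_le d hd hp hp' hδ
  obtain ⟨c, hc0, hc⟩ := exists_stepEnergy_exp_le d hd hp hp' hδ
  obtain ⟨C7, hC71, hC7⟩ := exists_rpow_le_exp (q := (d / 2 : ℝ)) (c := c / 4) (by positivity)
    (by positivity)
  have hδ' : 0 < δ / 2 ^ (p + 3) := div_pos hδ.1 (by positivity)
  set Cδ := (δ / 2 ^ (p + 3))⁻¹ with hCδ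
  have hCδ0 : 0 < Cδ := by positivity
  set C8 : ℝ := Cδ * C1 * 16 ^ (d / 2 : ℝ) * C7 with hC8
  have hC80 : 0 < C8 := by positivity
  set C : ℝ := 8 + C1 * Real.exp 1 + C8 + 4 / c with hC
  have he1 : 0 < Real.exp 1 := Real.exp_pos 1
  have h4c : 0 < 4 / c := by positivity
  have hCC8 : C8 ≤ C := by
    have : 0 < C1 * Real.exp 1 := by positivity
    linarith
  have hCC1 : C1 * Real.exp 1 ≤ C := by linarith
  have hCc : 4 / c ≤ C := by
    have : 0 < C1 * Real.exp 1 := by positivity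
    linarith
  have hC8' : 8 ≤ C := by
    have : 0 < C1 * Real.exp 1 := by positivity
    linarith
  refine ⟨C, by linarith, ?_⟩
  intro L hL a u hf hu0 hM t ht
  obtain ⟨hM1, hM2, hM3⟩ := scrM_factors_ne_top hα hγ hαγ (by linarith) hM
  have hL1 : (1 : ℝ) ≤ L := by exact_mod_cast hL
  have hK1 := one_le_scrM_toReal hα hγ hαγ (by linarith : 1 < p) hM
  set K := (scrM p p' δ a).toReal with hK
  set κ := (minRate p p' δ a).toReal with hκ
  have hκ0 : 0 < κ := minRate_pos hα hγ hM3
  have hκ1 : κ ≤ 1 := minRate_toReal_le_one hα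
  have ht1 : 0 < 1 + t := by linarith
  have hTd : 0 < (1 + t) ^ (-(d / 2 : ℝ)) := Real.rpow_pos_of_pos ht1 _
  have hL2 : (1 : ℝ) ≤ (L : ℝ) ^ 2 := one_le_pow₀ hL1
  rcases le_or_gt (t * κ ^ 2) (8 * (L : ℝ) ^ 2) with hsmall | hbig
  · have h1 : t * κ ^ 2 / (C * (L : ℝ) ^ 2) ≤ 1 := by
      rw [div_le_one (by positivity)]
      exact hsmall.trans (mul_le_mul_of_nonneg_right hC8' (by positivity))
    have h2 : Real.exp (-1) ≤ Real.exp (-(t * κ ^ 2 / (C * (L : ℝ) ^ 2))) :=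
      Real.exp_le_exp.2 (by linarith)
    calc ∑ x, u t x ^ 2 ≤ C1 * K * (1 + t) ^ (-(d / 2 : ℝ)) := hC1 L hL a u hf hu0 hM t ht
      _ = C1 * Real.exp 1 * K * (1 + t) ^ (-(d / 2 : ℝ)) * Real.exp (-1) := by
          rw [Real.exp_neg]; field_simp
      _ ≤ _ := by gcongr
  · have hκtt : κ * t ≤ t := mul_le_of_le_one_left ht hκ1
    have hκsq : t * κ ^ 2 ≤ κ * t := by
      rw [mul_comm κ t]
      exact mul_le_mul_of_nonneg_left (pow_le_of_le_one hκ0.le hκ1 two_ne_zero) ht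
    have hκt : 8 ≤ κ * t := by
      have h1 : 8 ≤ t * κ ^ 2 := by linarith
      exact h1.trans hκsq
    have ht8 : 8 ≤ t := hκt.trans hκtt
    -- integer times
    obtain ⟨N, hN⟩ : ∃ N : ℕ, ⌊t⌋₊ = N + 2 := by
      have h3 : 8 ≤ ⌊t⌋₊ := Nat.le_floor (by exact_mod_cast ht8)
      exact ⟨⌊t⌋₊ - 2, by omega⟩
    have hfl : (N : ℝ) + 2 ≤ t := by
      have := Nat.floor_le ht
      rw [hN] at this
      exact_mod_cast this
    have hfl2 : t < (N : ℝ) + 3 := by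
      have := Nat.lt_floor_add_one t
      rw [hN] at this
      push_cast at this
      linarith
    obtain ⟨k, hk⟩ : ∃ k : ℕ, ⌊κ * t / 4⌋₊ = k + 1 := by
      have h3 : 2 ≤ ⌊κ * t / 4⌋₊ := Nat.le_floor (by push_cast; linarith)
      exact ⟨⌊κ * t / 4⌋₊ - 1, by omega⟩
    have hkf : (k : ℝ) + 1 ≤ κ * t / 4 := by
      have := Nat.floor_le (by positivity : 0 ≤ κ * t / 4)
      rw [hk] at this
      exact_mod_cast this
    have hkf2 : κ * t / 4 < (k : ℝ) + 2 := by
      have := Nat.lt_floor_add_one (κ * t / 4)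
      rw [hk] at this
      push_cast at this
      linarith
    have hkN : k ≤ N := by
      have : (k : ℝ) ≤ N := by linarith
      exact_mod_cast this
    have hsumrate : κ * t / 2 ≤ ∑ n ∈ Finset.Ioc k N, stepRate p p' δ a n := by
      have h1 := minRate_mul_le_sum (p := p) (p' := p') (δ := δ) (a := a) hα (N + 1)
      rw [← hκ] at h1
      have h2 : ∑ n ∈ Finset.range (N + 1), stepRate p p' δ a n =
          ∑ n ∈ Finset.range (k + 1), stepRate p p' δ a n +
            ∑ n ∈ Finset.Ioc k N, stepRate p p' δ a n := by
        rw [← Finset.sum_union]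
        · congr 1
          ext n
          simp only [Finset.mem_range, Finset.mem_union, Finset.mem_Ioc]
          omega
        · rw [Finset.disjoint_left]
          intro n
          simp only [Finset.mem_range, Finset.mem_Ioc]
          omega
      have h3 : ∑ n ∈ Finset.range (k + 1), stepRate p p' δ a n ≤ (k : ℝ) + 1 := by
        calc _ ≤ ∑ _n ∈ Finset.range (k + 1), (1 : ℝ) :=
              Finset.sum_le_sum fun n _ => stepRate_le_one hα n
          _ = _ := by simp
      push_cast at h1
      have h4 : κ * (t * (3 / 4)) ≤ κ * (N + 1) := mul_le_mul_of_nonneg_left (by linarith) hκ0.le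
      linarith
    have hek : stepEnergy p δ u k ≤ C1 * K * (16 ^ (d / 2 : ℝ) * κ ^ (-(d / 2 : ℝ)) *
        (1 + t) ^ (-(d / 2 : ℝ))) := by
      refine ((hf.stepEnergy_le hp0 hδ k).trans (hC1 L hL a u hf hu0 hM k
        (Nat.cast_nonneg k))).trans (mul_le_mul_of_nonneg_left ?_ (by positivity))
      have h1 : κ * (1 + t) / 16 ≤ 1 + k := by
        rw [mul_add, mul_one]
        linarith [Nat.cast_nonneg (α := ℝ) k]
      refine (Real.rpow_le_rpow_of_nonpos (by positivity) h1 (by linarith)).trans_eq ?_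
      rw [Real.div_rpow (by positivity) (by norm_num), Real.mul_rpow hκ0.le ht1.le,
        Real.rpow_neg (by norm_num : (0 : ℝ) ≤ 16), div_inv_eq_mul]
      ring
    set y := κ * t / (L : ℝ) ^ 2 with hy
    have hy0 : 0 ≤ y := by positivity
    have hyκ : κ⁻¹ ≤ y := by
      rw [hy, le_div_iff₀ (by positivity), inv_mul_le_iff₀ hκ0]
      have : κ * (κ * t) = t * κ ^ 2 := by ring
      linarith
    have hκy : κ ^ (-(d / 2 : ℝ)) ≤ C7 * Real.exp (c / 4 * y) := by
      rw [Real.rpow_neg hκ0.le, ← Real.inv_rpow hκ0.le]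
      exact (Real.rpow_le_rpow (by positivity) hyκ (by positivity)).trans (hC7 y hy0)
    have hexp1 : Real.exp (-(c / (L : ℝ) ^ 2 * ∑ n ∈ Finset.Ioc k N, stepRate p p' δ a n)) ≤
        Real.exp (-(c / 2 * y)) := by
      refine Real.exp_le_exp.2 (neg_le_neg ?_)
      calc c / 2 * y = c / (L : ℝ) ^ 2 * (κ * t / 2) := by rw [hy]; ring
        _ ≤ _ := mul_le_mul_of_nonneg_left hsumrate (by positivity)
    have hexp2 : Real.exp (c / 4 * y) * Real.exp (-(c / 2 * y)) ≤
        Real.exp (-(t * κ ^ 2 / (C * (L : ℝ) ^ 2))) := by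
      rw [← Real.exp_add]
      refine Real.exp_le_exp.2 ?_
      have h1 : t * κ ^ 2 / (C * (L : ℝ) ^ 2) ≤ c / 4 * y := by
        have h2 : 1 / C ≤ c / 4 := by
          rw [div_le_iff₀ (by linarith)]
          rw [div_le_iff₀ hc0] at hCc
          linarith
        have h3 : t * κ ^ 2 / (L : ℝ) ^ 2 ≤ y := by
          rw [hy]
          exact div_le_div_of_nonneg_right hκsq (by positivity)
        calc t * κ ^ 2 / (C * (L : ℝ) ^ 2) = 1 / C * (t * κ ^ 2 / (L : ℝ) ^ 2) := by
              field_simp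
          _ ≤ c / 4 * y := mul_le_mul h2 h3 (by positivity) (by positivity)
      linarith
    have hNt : ((N + 1 : ℕ) : ℝ) + 1 ≤ t := by push_cast; linarith
    have hfin := (hf.sum_sq_antitone (by positivity : (0 : ℝ) ≤ ((N + 1 : ℕ) : ℝ) + 1)
      hNt).trans (hf.sum_sq_le_stepEnergy hp0 hδ (N + 1))
    have hstep := hc L hL a u hf hu0 k N hkN
    calc ∑ x, u t x ^ 2 ≤ Cδ * (stepEnergy p δ u k *
          Real.exp (-(c / (L : ℝ) ^ 2 * ∑ n ∈ Finset.Ioc k N, stepRate p p' δ a n))) :=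
          hfin.trans (mul_le_mul_of_nonneg_left hstep hCδ0.le)
      _ ≤ Cδ * ((C1 * K * (16 ^ (d / 2 : ℝ) * (C7 * Real.exp (c / 4 * y)) *
            (1 + t) ^ (-(d / 2 : ℝ)))) * Real.exp (-(c / 2 * y))) := by
          refine mul_le_mul_of_nonneg_left (mul_le_mul (hek.trans ?_) hexp1 (Real.exp_pos _).le
            (by positivity)) hCδ0.le
          gcongr
      _ = C8 * K * (1 + t) ^ (-(d / 2 : ℝ)) *
            (Real.exp (c / 4 * y) * Real.exp (-(c / 2 * y))) := by rw [hC8]; ring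
      _ ≤ _ := by gcongr

end MainEstimate

end GradPhi

namespace GradPhi

variable {d L : ℕ} {p p' δ : ℝ} {a b : ℝ → Edge d L → ℝ}

section Congruence

/-! ### The maximal functionals depend on the environment at nonnegative times only -/

theorem moderated_congr (h : EqOn a b (Ici 0)) {t : ℝ} (ht : 0 ≤ t) :
    moderated p δ a t = moderated p δ b t := by
  funext e
  unfold moderated
  congr 1
  refine setIntegral_congr_fun measurableSet_Ioi fun s hs => ?_
  have hts : t < s := hs
  have hsum : ∀ e' : Edge d L, ∫ s' in t..s, max (a s' e') 1 = ∫ s' in t..s, max (b s' e') 1 := by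
    intro e'
    refine intervalIntegral.integral_congr fun s' hs' => ?_
    rw [uIcc_of_le hts.le] at hs'
    have hab : a s' = b s' := h (mem_Ici.2 (ht.trans hs'.1))
    simp only [hab]
  have hab : a s = b s := h (mem_Ici.2 (ht.trans hts.le))
  simp only [hsum, hab]

theorem wE_congr (h : EqOn a b (Ici 0)) {t : ℝ} (ht : 0 ≤ t) : wE p δ a t = wE p δ b t := by
  funext e
  unfold wE
  rw [moderated_congr h ht]

theorem wInv_congr (h : EqOn a b (Ici 0)) {t : ℝ} (ht : 0 ≤ t) :
    wInv p δ a t = wInv p δ b t := by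
  funext e
  unfold wInv
  rw [wE_congr h ht]

theorem calMp'_congr (h : EqOn a b (Ici 0)) {t : ℝ} (ht : 0 ≤ t) :
    calMp' p p' δ a t = calMp' p p' δ b t := by
  unfold calMp'
  rw [wInv_congr h ht, wE_congr h ht]

theorem calM0_congr (h : EqOn a b (Ici 0)) {t : ℝ} (ht : 0 ≤ t) :
    calM0 p δ a t = calM0 p δ b t := by
  unfold calM0
  rw [wInv_congr h ht, h (mem_Ici.2 ht)]

theorem calM1_congr (h : EqOn a b (Ici 0)) {t : ℝ} (ht : 0 ≤ t) :
    calM1 p δ a t = calM1 p δ b t := by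
  unfold calM1
  congr 1
  refine setLIntegral_congr_fun measurableSet_Ioi fun s hs => ?_
  simp only [calM0_congr h (ht.trans (le_of_lt hs))]

theorem calM2_congr (h : EqOn a b (Ici 0)) {t : ℝ} (ht : 0 ≤ t) :
    calM2 p a t = calM2 p b t := by
  unfold calM2
  rw [h (mem_Ici.2 ht)]

theorem calM3_congr (h : EqOn a b (Ici 0)) {t : ℝ} (ht : 0 ≤ t) :
    calM3 p p' δ a t = calM3 p p' δ b t := by
  unfold calM3
  rw [setLIntegral_congr_fun measurableSet_Ioi fun s (hs : t < s) => by
    rw [calMp'_congr h (ht.trans hs.le)]]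

theorem timeAvg_congr {f g : ℝ → ℝ≥0∞} (h : ∀ s, 0 ≤ s → f s = g s) : timeAvg f = timeAvg g := by
  funext t
  unfold timeAvg
  congr 1
  exact setLIntegral_congr_fun measurableSet_Ioc fun s hs => h s hs.1.le

theorem minRate_congr (h : EqOn a b (Ici 0)) : minRate p p' δ a = minRate p p' δ b := by
  unfold minRate
  rw [timeAvg_congr fun s hs => by rw [calM3_congr h hs]]

theorem scrM_congr (h : EqOn a b (Ici 0)) : scrM p p' δ a = scrM p p' δ b := by
  unfold scrM
  rw [scrM3_eq, scrM3_eq, minRate_congr h]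
  unfold scrM1 scrM2
  rw [timeAvg_congr fun s hs => by rw [calM1_congr h hs],
    timeAvg_congr fun s hs => calM2_congr h hs]

end Congruence

section Potential

theorem IsAdmissiblePotential.continuous_deriv_deriv {V : ℝ → ℝ} (hV : IsAdmissiblePotential V) :
    Continuous (deriv (deriv V)) := by
  have h1 : ContDiff ℝ (1 + 1) V := by
    have := hV.1
    norm_num
    exact this
  exact ((contDiff_succ_iff_deriv.1 h1).2.2).continuous_deriv le_rfl

theorem IsAdmissiblePotential.deriv_deriv_nonneg {V : ℝ → ℝ} (hV : IsAdmissiblePotential V)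
    (x : ℝ) : 0 ≤ deriv (deriv V) x := by
  have hdiff : Differentiable ℝ V := hV.1.differentiable (by norm_num)
  have hm : Monotone (deriv V) :=
    monotoneOn_univ.1 (hV.2.1.monotoneOn_deriv fun x _ => hdiff x)
  exact hm.deriv_nonneg

/-- A heat kernel in the environment of a continuous trajectory is a flow, once both are frozen
at their initial value for negative times. -/
theorem isFlow_of_isHeatKernel {o : Orientation d L} {V : ℝ → ℝ} (hV : IsAdmissiblePotential V)
    {φ : ℝ → Torus d L → ℝ} (hφ : ContinuousOn φ (Ici 0)) {y : Torus d L}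
    {P : ℝ → Torus d L → ℝ} (hP : IsHeatKernel o (environment o V φ) 0 y P) :
    IsFlow (fun t => environment o V φ (max t 0)) fun t => P (max t 0) where
  env_continuous e := by
    have hφ' : Continuous fun t : ℝ => φ (max t 0) :=
      hφ.comp_continuous (by fun_prop) fun t => le_max_right t 0
    unfold environment grad
    exact hV.continuous_deriv_deriv.comp
      (((continuous_apply _).comp hφ').sub ((continuous_apply _).comp hφ'))
  env_nonneg t e := hV.deriv_deriv_nonneg _
  continuous x := (hP.continuousOn x).comp_continuous (by fun_prop) fun t => le_max_right t 0
  hasDerivAt t ht x := by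
    have h1 := hP.equation t ht x
    rw [dvg_mul_grad] at h1
    simp only [max_eq_left ht.le]
    refine h1.congr_of_eventuallyEq ?_
    filter_upwards [lt_mem_nhds ht] with s hs
    rw [max_eq_left hs.le]

end Potential

section Conclusion

theorem one_le_scrM4 : 1 ≤ scrM4 p δ a := by
  unfold scrM4
  refine ENNReal.one_le_inv.2 ((iInf₂_le (1 : ℝ) (mem_Ici.2 le_rfl)).trans ?_)
  unfold timeAvg
  rw [ENNReal.ofReal_one, div_one]
  calc ∫⁻ s in Ioc (0 : ℝ) 1, (calM4 p δ a s)⁻¹ ≤ ∫⁻ _ in Ioc (0 : ℝ) 1, 1 :=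
        lintegral_mono fun s => ENNReal.inv_le_one.2 le_self_add
    _ = 1 := by simp

theorem inv_minRate_sq_le_scrM' (hd : 2 ≤ d) (hp : (d : ℝ) < p) (hp' : (d : ℝ) < p')
    (hα : 0 < alphaExp d p p') (hγ : 0 < gammaExp d p p') :
    (minRate p p' δ a ^ 2)⁻¹ ≤ scrM' p p' δ a := by
  unfold scrM'
  refine le_trans (le_of_eq ?_) (le_mul_of_one_le_right' one_le_scrM4)
  rw [exponents_scaling hd hp hp', scrM3_eq, ← ENNReal.rpow_mul]
  have : -(alphaExp d p p' / gammaExp d p p') * (2 * gammaExp d p p' / (2 * alphaExp d p p') +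
      gammaExp d p p' / alphaExp d p p') = -2 := by
    field_simp
    norm_num
  rw [this, ENNReal.rpow_neg]
  norm_num

/-- Conversion of a real heat-kernel bound to extended nonnegative real functionals. -/
theorem ofReal_le_of_sum_sq_exp_le {C E t q κ l : ℝ} {M M' : ℝ≥0∞} (hC : 1 ≤ C) (ht : 0 ≤ t)
    (hκ : 0 < κ) (hl : 0 < l) (hM : M ≠ ∞)
    (hM' : (ENNReal.ofReal κ ^ 2)⁻¹ ≤ M')
    (h : E ≤ C * M.toReal * (1 + t) ^ (-q) * Real.exp (-(t * κ ^ 2 / (C * l ^ 2)))) :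
    ENNReal.ofReal E ≤ ENNReal.ofReal C * M / ENNReal.ofReal ((1 + t) ^ q) *
      ENNReal.ofReal (Real.exp
        (-(ENNReal.ofReal t / (ENNReal.ofReal C * M' * ENNReal.ofReal l ^ 2)).toReal)) := by
  have hC0 : 0 < C := by linarith
  have ht1 : 0 < 1 + t := by linarith
  have hrate : (ENNReal.ofReal t / (ENNReal.ofReal C * M' * ENNReal.ofReal l ^ 2)).toReal ≤
      t * κ ^ 2 / (C * l ^ 2) := by
    refine ENNReal.toReal_le_of_le_ofReal (by positivity) ?_
    calc ENNReal.ofReal t / (ENNReal.ofReal C * M' * ENNReal.ofReal l ^ 2) ≤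
          ENNReal.ofReal t / (ENNReal.ofReal C * (ENNReal.ofReal κ ^ 2)⁻¹ *
            ENNReal.ofReal l ^ 2) := by gcongr
      _ = ENNReal.ofReal (t / (C * (κ ^ 2)⁻¹ * l ^ 2)) := by
          rw [ENNReal.ofReal_div_of_pos (by positivity), ENNReal.ofReal_mul (by positivity),
            ENNReal.ofReal_mul hC0.le, ENNReal.ofReal_inv_of_pos (by positivity),
            ENNReal.ofReal_pow hκ.le, ENNReal.ofReal_pow hl.le]
      _ = ENNReal.ofReal (t * κ ^ 2 / (C * l ^ 2)) := by
          congr 1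
          field_simp
  calc ENNReal.ofReal E ≤ ENNReal.ofReal (C * M.toReal / (1 + t) ^ q * Real.exp
        (-(ENNReal.ofReal t / (ENNReal.ofReal C * M' * ENNReal.ofReal l ^ 2)).toReal)) := by
        refine ENNReal.ofReal_le_ofReal (h.trans ?_)
        rw [Real.rpow_neg ht1.le, ← div_eq_mul_inv]
        refine mul_le_mul_of_nonneg_left (Real.exp_le_exp.2 (neg_le_neg hrate)) ?_
        have := ENNReal.toReal_nonneg (a := M)
        positivity
    _ = _ := by
        have hM0 := ENNReal.toReal_nonneg (a := M)
        rw [ENNReal.ofReal_mul (by positivity), ENNReal.ofReal_div_of_pos (by positivity),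
          ENNReal.ofReal_mul hC0.le, ENNReal.ofReal_toReal hM]

end Conclusion

end GradPhi

theorem theorem4p1 (d : ℕ) (hd : 2 ≤ d) (p p' δ : ℝ) (hp : (d : ℝ) < p) (hp' : (d : ℝ) < p')
    (hδ : GradPhi.IsAdmissibleDelta p δ) :
    ∃ C : ℝ≥0, 1 ≤ C ∧
      ∀ (L : ℕ), 1 ≤ L → ∀ (o : GradPhi.Orientation d L) (V : ℝ → ℝ),
        GradPhi.IsAdmissiblePotential V →
        ∀ (Ω : Type*) [MeasurableSpace Ω] (μ : Measure Ω) [IsProbabilityMeasure μ]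
          (B : GradPhi.Torus d L → ℝ≥0 → Ω → ℝ) (φ₀ : Ω → GradPhi.meanZero d L)
          (φ : ℝ → Ω → GradPhi.Torus d L → ℝ),
          GradPhi.IsLangevinDynamic μ o V B φ₀ φ →
          ∀ᵐ ω ∂μ, ∀ (a : ℝ → GradPhi.Edge d L → ℝ),
            a = GradPhi.environment o V (fun t => φ t ω) →
            ∀ P : ℝ → GradPhi.Torus d L → ℝ, GradPhi.IsHeatKernel o a 0 0 P →
              ∀ t : ℝ, 1 ≤ t →
                ENNReal.ofReal (∑ x, P t x ^ 2) ≤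
                  C * GradPhi.scrM p p' δ a / ENNReal.ofReal ((1 + t) ^ ((d : ℝ) / 2))
                    * ENNReal.ofReal (Real.exp
                        (-(ENNReal.ofReal t
                            / (C * GradPhi.scrM' p p' δ a * (L : ℝ≥0∞) ^ 2)).toReal)) := by
  have hα := GradPhi.alphaExp_pos hd hp hp'
  have hγ := GradPhi.gammaExp_pos hd hp hp'
  have hαγ : GradPhi.alphaExp d p p' + GradPhi.gammaExp d p p' < 1 := by
    linarith [GradPhi.exponents_add hd hp hp', GradPhi.betaExp_pos hd hp hp']
  have hd2 : (2 : ℝ) ≤ d := by exact_mod_cast hd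
  obtain ⟨C, hC1, hC⟩ := GradPhi.exists_sum_sq_exp_le d hd hp hp' hδ
  refine ⟨C.toNNReal, by simpa using hC1, ?_⟩
  intro L hL o V hV Ω _ μ _ B φ₀ φ hφ
  filter_upwards [hφ.continuous] with ω hω
  rintro a rfl P hP t ht
  set a := GradPhi.environment o V (fun t => φ t ω)
  change _ ≤ ENNReal.ofReal C * _ / _ * ENNReal.ofReal (Real.exp
    (-(_ / (ENNReal.ofReal C * _ * _)).toReal))
  rw [← ENNReal.ofReal_natCast L]
  have ht0 : 0 ≤ t := by linarith
  by_cases hM : GradPhi.scrM p p' δ a = ∞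
  · rw [hM, ENNReal.mul_top (by simpa using by linarith), ENNReal.top_div_of_ne_top
      ENNReal.ofReal_ne_top, ENNReal.top_mul (by simpa using Real.exp_pos _)]
    exact le_top
  · have hκ := GradPhi.minRate_pos hα hγ
      (GradPhi.scrM_factors_ne_top hα hγ hαγ (by linarith) hM).2.2
    have hκt : GradPhi.minRate p p' δ a ≠ ∞ :=
      ne_top_of_le_ne_top ENNReal.one_ne_top (GradPhi.minRate_le_one hα)
    refine GradPhi.ofReal_le_of_sum_sq_exp_le hC1 ht0 hκ (by exact_mod_cast hL) hM ?_ ?_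
    · rw [ENNReal.ofReal_toReal hκt]
      exact GradPhi.inv_minRate_sq_le_scrM' hd hp hp' hα hγ
    · have hab : EqOn a (fun t => a (max t 0)) (Ici 0) := fun s hs => by
        simp only [max_eq_left (mem_Ici.1 hs)]
      rw [GradPhi.scrM_congr hab, GradPhi.minRate_congr hab]
      have hbound := hC L hL (fun t => a (max t 0)) (fun t => P (max t 0))
        (GradPhi.isFlow_of_isHeatKernel hV hω hP)
        (fun x => by simpa [GradPhi.pointMass] using hP.init x)
        (by rwa [← GradPhi.scrM_congr hab]) t ht0
      simpa only [max_eq_left ht0] using hbound
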